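/- Let $d,M\ge 1$ be integers, and let $T,\kappa,\alpha>0$ be finite. Put $\langle v\rangle=\sqrt{1+|v|^2}$, $c(m)=\alpha m^{(1-d)/d}$ and $s(n,m)=(n^{1/d}+m^{1/d})^{d-1}$. Let $L^p_k$ be the space of $f:\mathbb R^d\to\mathbb R$ with $f\langle v\rangle^k\in L^p(\mathbb R^d)$, let $H^1_1$ be the space of $f\in L^2_1$ whose weak gradient lies in $L^2_1$, and let $C_b^\infty$ be the space of smooth functions on $\mathbb R^d$ all of whose derivatives (of order $0$ included) are bounded. Consider the spatially homogeneous system $$\partial_t f_m=c(m)\,\mathrm{div}_v(vf_m)+\kappa c(m)^2\Delta_v f_m+Q_m(f,f),\qquad f_m|_{t=0}=f_m^0,\qquad m=1,\dots,M,$$ on $[0,T]\times\mathbb R^d$, where $$Q_m(f,f)(v)=\sum_{n=1}^{m-1}s(n,m-n)\iint_{\{nw'+(m-n)w=mv\}}f_n(w')f_{m-n}(w)|w-w'|\,dw\,dw'-2\sum_{n=1}^M s(n,m)\int f_m(v)f_n(w)|v-w|\,dw .$$ Here the constrained double integral denotes the density in $v$ of the image of the measure $f_n(w')f_{m-n}(w)|w-w'|\,dw\,dw'$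 under $(w',w)\mapsto (nw'+(m-n)w)/m$, that is, $\int f_n(w')f_{m-n}(w)|w-w'|\,(m/n)^d\,dw$ with $w'=(mv-(m-n)w)/n$. A weak solution is a family $f_m\in L^\infty(0,T;L^1_2)$, $m=1,\dots,M$, with $Q_m(f,f)\in L^\infty(0,T;L^1)$ for every $m$, such that for almost every $t\in[0,T]$, all $m=1,\dots,M$ and all $\varphi\in C_c^\infty(\mathbb R^d)$, $$\langle f_m(t),\varphi\rangle-\langle f_m^0,\varphi\rangle=\kappa c(m)^2\int_0^t\langle f_m(s),\Delta\varphi\rangle ds-c(m)\int_0^t\langle f_m(s),v\cdot\nabla\varphi\rangle ds+\int_0^t\langle Q_m(f(s),f(s)),\varphi\rangle ds .\qquad(*)$$ Let the initial data $f_m^0$, $m=1,\dots,M$, be nonnegative almost everywhere. (1) If $f_m^0\in L^2\cap L^1_2$ for every $m=1,\dots,M$, then there is at least one nonnegative weak solution. (2) If $f_m^0\in H^1_1\cap L^1_2$ for every $m=1,\dots,M$, then there is a nonnegative weak solution, and it is unique: any two nonnegative weak solutions agree for almost every $t\in[0,T]$ and almost every $v\in\mathbb R^d$. Moreover, choosing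 the representative of this solution suitably, the identity $(*)$ holds for every $t\in[0,T]$ and $f_m(t)\in C_b^\infty$ for every $t\in(0,T]$ and every $m=1,\dots,M$. -/

import Mathlib

open MeasureTheory Set
open scoped ContDiff NNReal ENNReal

noncomputable section

namespace KineticSmoluchowski

/-- Velocity space `ℝ^d` with the Euclidean norm and Lebesgue measure. -/
abbrev Vel (d : ℕ) : Type := EuclideanSpace ℝ (Fin d)

/-- The Japanese bracket `⟨v⟩ = √(1 + |v|²)`. -/
def bracket {d : ℕ} (v : Vel d) : ℝ := Real.sqrt (1 + ‖v‖ ^ 2)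

/-- The weighted Lebesgue space `L^p_k(ℝ^d)`: `f ⟨v⟩^k ∈ L^p(ℝ^d)`. -/
def MemWeightedLp {d : ℕ} (p : ℝ≥0∞) (k : ℕ) (f : Vel d → ℝ) : Prop :=
  MemLp (fun v => f v * bracket v ^ k) p volume

/-- Test functions: `C_c^∞(ℝ^d)`. -/
def IsTestFunction {d : ℕ} (φ : Vel d → ℝ) : Prop :=
  ContDiff ℝ ∞ φ ∧ HasCompactSupport φ

/-- `g` is the weak partial derivative `∂f/∂v_i` on `ℝ^d`. -/
def HasWeakPartialDeriv {d : ℕ} (i : Fin d) (f g : Vel d → ℝ) : Prop :=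
  LocallyIntegrable f volume ∧ LocallyIntegrable g volume ∧
    ∀ φ : Vel d → ℝ, IsTestFunction φ →
      ∫ v, f v * fderiv ℝ φ v (EuclideanSpace.single i 1) = -∫ v, g v * φ v

/-- The weighted Sobolev space `H^n_k(ℝ^d)`: all weak derivatives of order at most `n` exist and
lie in `L²_k(ℝ^d)`. -/
def MemWeightedSobolev {d : ℕ} : ℕ → ℕ → (Vel d → ℝ) → Prop
  | 0, k, f => MemWeightedLp 2 k f
  | n + 1, k, f => MemWeightedLp 2 k f ∧
      ∀ i : Fin d, ∃ g : Vel d → ℝ, HasWeakPartialDeriv i f g ∧ MemWeightedSobolev n k g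

/-- `C_b^∞(ℝ^d)`: smooth functions all of whose derivatives (order `0` included) are bounded. -/
def IsCbInfty {d : ℕ} (f : Vel d → ℝ) : Prop :=
  ContDiff ℝ ∞ f ∧ ∀ n : ℕ, ∃ C : ℝ, ∀ v, ‖iteratedFDeriv ℝ n f v‖ ≤ C

/-- `L^∞(0,T; L^1_k(ℝ^d))`. -/
def MemLinftyL1 {d : ℕ} (T : ℝ) (k : ℕ) (f : ℝ → Vel d → ℝ) : Prop :=
  AEStronglyMeasurable (Function.uncurry f) ((volume.restrict (Icc 0 T)).prod volume) ∧
    ∃ C : ℝ≥0, ∀ᵐ t ∂(volume.restrict (Icc 0 T)),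
      eLpNorm (fun v => f t v * bracket v ^ k) 1 volume ≤ C

/-- The friction coefficient `c(m) = α m^{(1-d)/d}`. -/
def massCoeff (d : ℕ) (α : ℝ) (m : ℕ) : ℝ := α * (m : ℝ) ^ ((1 - (d : ℝ)) / (d : ℝ))

/-- The collision cross section `s(n,m) = (n^{1/d} + m^{1/d})^{d-1}`. -/
def crossSection (d : ℕ) (n m : ℕ) : ℝ :=
  ((n : ℝ) ^ (1 / (d : ℝ)) + (m : ℝ) ^ (1 / (d : ℝ))) ^ ((d : ℝ) - 1)

/-- The velocity `w' = (m v - (m-n) w) / n`, i.e. the solution of `n w' + (m-n) w = m v`. -/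
def preVel {d : ℕ} (m n : ℕ) (v w : Vel d) : Vel d :=
  (n : ℝ)⁻¹ • ((m : ℝ) • v - ((m : ℝ) - (n : ℝ)) • w)

/-- The gain density `∬_{n w' + (m-n) w = m v} g(w') h(w) |w - w'| dw dw'`, i.e. the density in `v`
of the image of the measure `g(w') h(w) |w - w'| dw' dw` under `(w', w) ↦ (n w' + (m-n) w) / m`;
for fixed `w` one has `dw' = (m/n)^d dv`. -/
def gain {d : ℕ} (m n : ℕ) (g h : Vel d → ℝ) (v : Vel d) : ℝ :=
  ∫ w, g (preVel m n v w) * h w * ‖w - preVel m n v w‖ * ((m : ℝ) / (n : ℝ)) ^ d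

/-- The collision operator `Q_m(f,f)` for the mass levels `1, …, M`. -/
def collision {d : ℕ} (M m : ℕ) (f : ℕ → Vel d → ℝ) (v : Vel d) : ℝ :=
  (∑ n ∈ Finset.Ico 1 m, crossSection d n (m - n) * gain m n (f n) (f (m - n)) v)
    - 2 * ∑ n ∈ Finset.Icc 1 M, crossSection d n m * ∫ w, f m v * f n w * ‖v - w‖

/-- The weak (time-integrated) form at time `t` of
`∂_t f_m = c(m) div(v f_m) + κ c(m)² Δ f_m + Q_m(f,f)`, `f_m(0) = f⁰_m`, for `m = 1, …, M`. -/
def WeakFormAt {d : ℕ} (M : ℕ) (α κ : ℝ) (f₀ : ℕ → Vel d → ℝ) (f : ℕ → ℝ → Vel d → ℝ)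
    (t : ℝ) : Prop :=
  ∀ m ∈ Finset.Icc 1 M, ∀ φ : Vel d → ℝ, IsTestFunction φ →
    (∫ v, f m t v * φ v) - ∫ v, f₀ m v * φ v =
      κ * massCoeff d α m ^ 2 * (∫ s in (0 : ℝ)..t, ∫ v, f m s v * Laplacian.laplacian φ v)
        - massCoeff d α m * (∫ s in (0 : ℝ)..t, ∫ v, f m s v * fderiv ℝ φ v v)
        + ∫ s in (0 : ℝ)..t, ∫ v, collision M m (fun n => f n s) v * φ v

/-- Weak solutions on `[0,T]`, in the class `L^∞(0,T; L^1_2)`, with initial data `f₀`. Only the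
components with index `m = 1, …, M` matter. -/
structure IsWeakSolution {d : ℕ} (M : ℕ) (α κ T : ℝ) (f₀ : ℕ → Vel d → ℝ)
    (f : ℕ → ℝ → Vel d → ℝ) : Prop where
  mem_class : ∀ m ∈ Finset.Icc 1 M, MemLinftyL1 T 2 (f m)
  collision_mem : ∀ m ∈ Finset.Icc 1 M,
    MemLinftyL1 T 0 (fun t => collision M m (fun n => f n t))
  weak_form : ∀ᵐ t ∂(volume.restrict (Icc 0 T)), WeakFormAt M α κ f₀ f t

/-- Nonnegativity of the components `m = 1, …, M` for almost every `(t,v) ∈ [0,T] × ℝ^d`. -/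
def IsNonneg {d : ℕ} (M : ℕ) (T : ℝ) (f : ℕ → ℝ → Vel d → ℝ) : Prop :=
  ∀ m ∈ Finset.Icc 1 M, ∀ᵐ t ∂(volume.restrict (Icc 0 T)), ∀ᵐ v, 0 ≤ f m t v

end KineticSmoluchowski

end

open MeasureTheory Set Filter Topology
open scoped ContDiff NNReal ENNReal

noncomputable section

namespace KineticSmoluchowski

open Real (sqrt_le_sqrt norm_of_nonneg exp exp_add exp_pos exp_le_one_iff norm_eq_abs sqrt enorm_of_nonneg enorm_eq_ofReal_abs)
open Function (uncurry)
open intervalIntegral (integral_of_le integral_congr integral_eq_sub_of_hasDerivAt continuousOn_primitive_interval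
  integral_comp_sub_left)
open ENNReal (ofReal toReal_ofReal ofReal_mul mul_lt_top ofReal_lt_top ofReal_le_ofReal ofReal_ne_top coe_lt_top
  ofReal_le_ofReal_iff coe_toNNReal ofReal_add sum_lt_top one_ne_top add_ne_top mul_ne_top toReal_mul toReal_add coe_ne_top
  toReal_nonneg ofReal_toReal mul_top ofReal_zero ofNat_ne_top)
open Laplacian (laplacian)
open EuclideanSpace (single basisFun basisFun_apply inner_single_right proj)
open Finset (sum_congr mul_sum sum_add_distrib sum_le_sum sum_mul single_le_sum measurable_sum sum_nonneg sum_sub_distrib)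
open ContinuousLinearMap (opNorm_le_bound)
open Eventually (of_forall)

local notation "Lev" => Finset.Icc 1
local notation:max "ouI" c:max r:max σ:max v:max z:max => exp (c * r) • (v - σ • z)
local notation:max "mfr" n:max m:max => ((m : ℝ) - n) / m
local notation "volR" => Measure.restrict (volume : Measure ℝ)

variable {d : ℕ}

local notation:max "Fn" d:max => Vel d → ℝ
local notation:max "FnL" d:max => Vel d → ℝ≥0∞
local notation:max "Fam" d:max => ℕ → ℝ → Vel d → ℝ

variable {X : Type*} [MeasurableSpace X] {v : X → Vel d} {F L h u w ρ : ℝ → Fn d}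
  {A C D R T a c g₀ lam r s t x α θ κ μ ν σ : ℝ} {η η' : ℝ → ℝ} {M i j k m n : ℕ}
  {b b' g u₀ w₀ φ ψ : Fn d} {f : Fam d} {B G H Φ : FnL d} {I S : Set ℝ} {K : ℝ≥0∞}
  {E Y : ℝ → ℝ≥0∞} {f₀ : ℕ → Fn d} {ε : ℕ → ℝ≥0∞}

/-! The linear part of the equation is an Ornstein–Uhlenbeck operator, whose semigroup is an
explicit Gaussian average (Mehler's formula: `ou`, with adjoint `ouDual`). Testing the weak form
with the backward evolution turns a weak solution into a mild one (`mild_of_weak`), and the converse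
also holds (`weak_of_mild`). All estimates are then made on Duhamel's formula, in `L¹` spaces with
weights `⟨v⟩^j`.

The structural fact about collisions is that merging masses `n` and `k` puts the mass `n + k` at the
mean velocity, so for a convex weight `Φ` the merged contribution `(n + k) Φ` is at most `n Φ(x) + k
Φ(y)`. Hence the mass-weighted `Φ`-moment of the gain is at most that of the loss (`wmom_gainL_le`,
`wmom_rateL`), and moments grow only through diffusion. For two solutions with difference `u` and
mean `S`, the difference of the collision terms is the symmetrized bilinear form at `(u, S)`. The
part of its gain that puts the extra weight on `u` is absorbed by the loss `u A(S)`; the remainder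
is at most a second moment of `S` times a first moment of `u` (`wmom_collB_sub_le`). Since `A(S)`
grows linearly in `v`, the absorption uses an artificial damping `N`, and `N → ∞` at the end; the
Gronwall rate does not depend on `N` (`wmom_sub_le`). This gives uniqueness, and the same estimate,
with an error term, is the Cauchy estimate for existence.

Existence starts from bounded kernels, where a Picard iteration converges and keeps nonnegativity
and moments (`exists_solution_of_bounded`). The data are then cut off at `⟨v⟩ ≤ N` and the relative
speed at `N^5`: fourth moments are `O(N^2)`, the kernel error carries a factor `N^{-5}`, and so the
approximations differ by `O(N^{-1})` (`exists_solution`).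

For smoothness, a component with nonzero data keeps a positive mass (`exists_mass_lower`), so every
loss rate is at least `α ⟨v⟩ - β`. The moment lost by collisions is integrable in time, so each
finite moment creates the next one at positive times (`unifL1_of_rate_lower`). The gain of a level
involves smaller masses only, so induction on the mass and the Gaussian kernel give pointwise rapid
decay (`IsSolution.ae_le`). Finally `(t - a) f` has zero initial value and is a pure Duhamel term.
That term gains one derivative, because differentiating the Gaussian costs only `r^{-1/2}`
(`Reg.duhamel`), while collisions, written in the relative velocity, lose none (`Reg.collB`).
Iterating gives all derivatives (`IsSolution.exists_reg`), and a single Duhamel formula provides the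
smooth representative. -/

/-- All coefficients at the mass levels are positive. -/
def PosOn (M : ℕ) (c : ℕ → ℝ) : Prop := ∀ m ∈ Lev M, 0 < c m

lemma measurable_time_vel : Measurable fun q : (ℝ × Vel d) × Vel d => (q.1.1, q.2) := by fun_prop

/-- Every member of the family is measurable. -/
abbrev Meas {ι Y β : Type*} [MeasurableSpace Y] [MeasurableSpace β] (f : ι → Y → β) : Prop := ∀ n, Measurable (f n)

/-- Every member of the family is jointly measurable. -/
abbrev UMeas {ι Y Z β : Type*} [MeasurableSpace Y] [MeasurableSpace Z] [MeasurableSpace β] (f : ι → Y → Z → β) : Prop := ∀ n, Measurable (uncurry (f n))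

/-- The family is nonnegative. -/
abbrev Pos2 {ι Y : Type*} (f : ι → Y → ℝ) : Prop := ∀ n v, 0 ≤ f n v

/-- The family is nonnegative. -/
abbrev Pos3 {ι Y Z : Type*} (f : ι → Y → Z → ℝ) : Prop := ∀ n t v, 0 ≤ f n t v

lemma Ioc_sub (ht : t ∈ Icc a T) : Ioc a t ⊆ Icc a T := fun _ hs => ⟨hs.1.le, hs.2.trans ht.2⟩

lemma integral_ext {μ : Measure X} {f g : X → ℝ} (h : ∀ x, f x = g x) : ∫ x, f x ∂μ = ∫ x, g x ∂μ := integral_congr_ae (of_forall h)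

lemma ae_mem_Ioc : ∀ᵐ s ∂volR (Ioc a t), s ∈ Ioc a t := ae_restrict_mem measurableSet_Ioc

/-! ### The Japanese bracket -/

section Bracket

lemma bracket_sq (v : Vel d) : bracket v ^ 2 = 1 + ‖v‖ ^ 2 := Real.sq_sqrt (by positivity)

lemma one_le_bracket (v : Vel d) : 1 ≤ bracket v := Real.one_le_sqrt.2 (by nlinarith [sq_nonneg ‖v‖])

lemma bracket_pos (v : Vel d) : 0 < bracket v := lt_of_lt_of_le one_pos (one_le_bracket v)

lemma norm_le_bracket (v : Vel d) : ‖v‖ ≤ bracket v := Real.le_sqrt_of_sq_le (by linarith)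

lemma bracket_le (v : Vel d) : bracket v ≤ 1 + ‖v‖ := Real.sqrt_le_iff.2 ⟨by positivity, by nlinarith [norm_nonneg v]⟩

@[fun_prop]
lemma continuous_bracket : Continuous (bracket : Fn d) := by
  unfold bracket; fun_prop

@[fun_prop]
lemma measurable_bracket : Measurable (bracket : Fn d) := continuous_bracket.measurable

lemma bracket_mono {v w : Vel d} (h : ‖v‖ ≤ ‖w‖) : bracket v ≤ bracket w := sqrt_le_sqrt (by gcongr)

lemma bracket_neg (v : Vel d) : bracket (-v) = bracket v := by simp [bracket]

/-- Cauchy–Schwarz: `(|v| + |w|)² ≤ (1 + |v|²)(1 + |w|²)`, the gap being `(1 - |v||w|)²`. The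
relative speed thus costs one weight on each collision partner. -/
lemma norm_sub_le_bracket_mul (v w : Vel d) : ‖v - w‖ ≤ bracket v * bracket w := by
  refine (norm_sub_le v w).trans ?_
  rw [← Real.sqrt_sq (by positivity : 0 ≤ ‖v‖ + ‖w‖), bracket, bracket, ← Real.sqrt_mul (by positivity)]
  apply sqrt_le_sqrt
  nlinarith [sq_nonneg (1 - ‖v‖ * ‖w‖)]

lemma bracket_add_le (v w : Vel d) : bracket (v + w) ≤ 2 * (bracket v * bracket w) := by
  have h1 := bracket_le (v + w)
  have h2 := norm_add_le v w
  have h3 := norm_le_bracket v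
  have h4 := norm_le_bracket w
  have h5 := one_le_bracket v
  have h6 := one_le_bracket w
  have h7 : 1 + (‖v‖ + ‖w‖) ≤ 2 * (bracket v * bracket w) := by
    have h8 := norm_sub_le_bracket_mul v (-(‖w‖ / (‖v‖ + 1)) • v)
    have : ‖v‖ + ‖w‖ ≤ bracket v * bracket w := by
      rw [← Real.sqrt_sq (by positivity : 0 ≤ ‖v‖ + ‖w‖), bracket, bracket, ← Real.sqrt_mul (by positivity)]
      apply sqrt_le_sqrt
      nlinarith [sq_nonneg (1 - ‖v‖ * ‖w‖)]
    nlinarith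
  linarith

lemma bracket_smul_le (hr : 0 ≤ r) (v : Vel d) : bracket (r • v) ≤ (1 + r) * bracket v := by
  have h1 := bracket_le (r • v)
  rw [norm_smul, norm_of_nonneg hr] at h1
  nlinarith [norm_le_bracket v, one_le_bracket v]

/-- The bracket is the Euclidean norm of `(1, v)`, hence convex. After squaring, the cross term is
controlled by `1 + |x||y| ≤ ⟨x⟩⟨y⟩`. -/
lemma convexOn_bracket : ConvexOn ℝ univ (bracket : Fn d) := by
  refine ⟨convex_univ, fun x _ y _ a b ha hb hab => ?_⟩
  have hx := bracket_sq x
  have hy := bracket_sq y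
  have h0x := bracket_pos x
  have h0y := bracket_pos y
  simp only [smul_eq_mul]
  refine Real.sqrt_le_iff.2 ⟨by positivity, ?_⟩
  have h1 : ‖a • x + b • y‖ ≤ a * ‖x‖ + b * ‖y‖ := by
    refine (norm_add_le _ _).trans ?_
    rw [norm_smul, norm_smul, norm_of_nonneg ha, norm_of_nonneg hb]
  have h2 : 1 + ‖x‖ * ‖y‖ ≤ bracket x * bracket y := by
    refine abs_le_of_sq_le_sq' ?_ (by positivity) |>.2
    rw [mul_pow, hx, hy]
    nlinarith [sq_nonneg (‖x‖ - ‖y‖)]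
  have h3 : ‖a • x + b • y‖ ^ 2 ≤ (a * ‖x‖ + b * ‖y‖) ^ 2 := by gcongr
  have h4 : (1 : ℝ) = (a + b) ^ 2 := by rw [hab]; norm_num
  have h5 := mul_le_mul_of_nonneg_left h2 (mul_nonneg ha hb)
  have e1 : (a * bracket x + b * bracket y) ^ 2 = a ^ 2 * bracket x ^ 2 + b ^ 2 * bracket y ^ 2 + 2 * (a * b * (bracket x * bracket y)) := by ring
  rw [e1, hx, hy]
  nlinarith

lemma convexOn_bracket_pow (j : ℕ) : ConvexOn ℝ univ (fun v : Vel d => bracket v ^ j) := convexOn_bracket.pow (fun _ _ => (bracket_pos _).le) j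

end Bracket

/-! ### Iterated integrals over a triangle and Gronwall's inequality -/

section Primitive

variable {g k : ℝ → ℝ}

/-- Fubini on the square for the integrand extended by zero off the triangle `q ≤ s`. -/
lemma integral_triangle (hat : a ≤ t) {F : ℝ → ℝ → ℝ} (hF : IntegrableOn (uncurry F) (Ioc a t ×ˢ Ioc a t) (volume.prod volume)) :
    ∫ s in a..t, ∫ q in a..s, F s q = ∫ q in a..t, ∫ s in q..t, F s q := by
  set G : ℝ × ℝ → ℝ := {p : ℝ × ℝ | p.2 ≤ p.1}.indicator (uncurry F)
  have hm : MeasurableSet {p : ℝ × ℝ | p.2 ≤ p.1} := measurableSet_le measurable_snd measurable_fst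
  have hG : IntegrableOn G (Ioc a t ×ˢ Ioc a t) (volume.prod volume) := hF.indicator hm
  have h1 : ∫ s in a..t, ∫ q in a..s, F s q = ∫ s in Ioc a t, ∫ q in Ioc a t, G (s, q) := by
    rw [integral_of_le hat]
    refine setIntegral_congr_fun measurableSet_Ioc fun s hs => ?_
    rw [integral_of_le hs.1.le]
    have : (fun q => G (s, q)) = (Iic s).indicator (F s) := by
      ext q; simp [G, indicator, uncurry]
    rw [this, integral_indicator measurableSet_Iic, Measure.restrict_restrict measurableSet_Iic]
    congr 2
    ext q; simp only [mem_Ioc, mem_inter_iff, mem_Iic]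
    exact ⟨fun h => ⟨h.2, h.1, h.2.trans hs.2⟩, fun h => ⟨h.2.1, h.1⟩⟩
  have h2 : ∫ q in a..t, ∫ s in q..t, F s q = ∫ q in Ioc a t, ∫ s in Ioc a t, G (s, q) := by
    rw [integral_of_le hat]
    refine setIntegral_congr_fun measurableSet_Ioc fun q hq => ?_
    rw [integral_of_le hq.2, ← integral_Icc_eq_integral_Ioc]
    have : (fun s => G (s, q)) = (Ici q).indicator (fun s => F s q) := by
      ext s; simp [G, indicator, uncurry]
    rw [this, integral_indicator measurableSet_Ici, Measure.restrict_restrict measurableSet_Ici]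
    congr 2
    ext s; simp only [mem_Ioc, mem_inter_iff, mem_Ici, mem_Icc]
    exact ⟨fun h => ⟨h.1, hq.1.trans_le h.1, h.2⟩, fun h => ⟨h.1, h.2.2⟩⟩
  rw [h1, h2]
  apply integral_integral_swap
  rw [IntegrableOn, ← Measure.prod_restrict] at hG
  exact hG

lemma integral_deriv_mul_primitive {a t : ℝ} (hat : a ≤ t) {η η' k : ℝ → ℝ} (hη : ∀ s, HasDerivAt η (η' s) s) (hη' : Continuous η')
    (hk : IntegrableOn k (Ioc a t)) :
    ∫ s in a..t, η' s * ∫ q in a..s, k q = ∫ q in a..t, (η t - η q) * k q := by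
  have h := integral_triangle (F := fun s q => η' s * k q) hat ?_
  · calc _ = ∫ s in a..t, ∫ q in a..s, η' s * k q := by simp
      _ = _ := h
      _ = _ := by
        refine integral_congr fun q _ => ?_
        rw [intervalIntegral.integral_mul_const, integral_eq_sub_of_hasDerivAt (fun x _ => hη x) (hη'.intervalIntegrable _ _)]
  · rw [IntegrableOn, ← Measure.prod_restrict]
    exact Integrable.mul_prod (hη'.integrableOn_Ioc) hk

/-- Product rule for a `C¹` weight and a function known to be a primitive only for almost every
time, as an almost-everywhere weak form provides. The end point needs its own hypothesis. -/
lemma integral_mul_primitive (hat : a ≤ t) {g : ℝ → ℝ} (hη : ∀ s, HasDerivAt η (η' s) s) (hη' : Continuous η')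
    (hk : IntegrableOn k (Ioc a t)) (hg : ∀ᵐ s ∂volR (Ioc a t), g s = g₀ + ∫ q in a..s, k q) (hgt : g t = g₀ + ∫ q in a..t, k q) :
    η t * g t = η a * g₀ + ∫ s in a..t, (η s * k s + η' s * g s) := by
  have hηc : Continuous η := continuous_iff_continuousAt.2 fun s => (hη s).continuousAt
  have hk' : IntervalIntegrable k volume a t := (intervalIntegrable_iff_integrableOn_Ioc_of_le hat).2 hk
  have hp : ContinuousOn (fun s => ∫ q in a..s, k q) (uIcc a t) :=
    continuousOn_primitive_interval (by rw [uIcc_of_le hat, integrableOn_Icc_iff_integrableOn_Ioc]; exact hk)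
  have i1 : IntervalIntegrable (fun s => η' s * ∫ q in a..s, k q) volume a t := ContinuousOn.intervalIntegrable (hη'.continuousOn.mul hp)
  have i2 : IntervalIntegrable (fun s => η s * k s) volume a t := hk'.continuousOn_mul hηc.continuousOn
  have i3 : IntervalIntegrable (fun s => η' s * g₀) volume a t := (hη'.mul continuous_const).intervalIntegrable _ _
  have h1 : ∫ s in a..t, (η s * k s + η' s * g s) = ∫ s in a..t, (η s * k s + (η' s * g₀ + η' s * ∫ q in a..s, k q)) := by
    rw [integral_of_le hat, integral_of_le hat]
    refine integral_congr_ae ?_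
    filter_upwards [hg] with s hs
    rw [hs]; ring
  rw [h1, intervalIntegral.integral_add i2 (i3.add i1), intervalIntegral.integral_add i3 i1,
    integral_deriv_mul_primitive hat hη hη' hk, intervalIntegral.integral_mul_const,
    integral_eq_sub_of_hasDerivAt (fun x _ => hη x) (hη'.intervalIntegrable _ _), hgt]
  simp only [sub_mul]
  rw [intervalIntegral.integral_sub (hk'.const_mul _) i2, intervalIntegral.integral_const_mul]
  ring

/-- Gronwall's inequality in the damped form `y ≤ e^{-μt}A + ∫ e^{-μ(t-s)}(ν y + δ)`. -/
lemma gronwall_damped (hν : 0 ≤ ν) (hμν : μ ≤ ν) {y δ : ℝ → ℝ} (hy : IntegrableOn y (Ioc 0 T)) (hδ : IntegrableOn δ (Ioc 0 T)) (hδ0 : ∀ s, 0 ≤ δ s)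
    (h : ∀ᵐ t ∂volR (Ioc 0 T), y t ≤ exp (-(μ * t)) * A + ∫ s in (0)..t, exp (-(μ * (t - s))) * (ν * y s + δ s))
    (htm : t ∈ Ioc 0 T) (ht : y t ≤ exp (-(μ * t)) * A + ∫ s in (0)..t, exp (-(μ * (t - s))) * (ν * y s + δ s)) :
    y t ≤ exp ((ν - μ) * t) * (A + ∫ s in (0)..t, δ s) := by
  -- Multiplication by `e^{μs}` removes the damping: `z` satisfies the ordinary integral inequality
  -- with rate `ν`.
  set z : ℝ → ℝ := fun s => exp (μ * s) * y s
  set δ' : ℝ → ℝ := fun s => exp (μ * s) * δ s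
  set a : ℝ → ℝ := fun t => A + ∫ s in (0)..t, δ' s
  have hc : ∀ c : ℝ, Continuous fun s : ℝ => exp (c * s) := fun c => by fun_prop
  have bdd : ∀ {f : ℝ → ℝ} (c : ℝ), IntegrableOn f (Ioc 0 T) → IntegrableOn (fun s => exp (c * s) * f s) (Ioc 0 T) := fun c hf =>
    IntegrableOn.continuousOn_mul_of_subset (hc c).continuousOn hf isCompact_Icc measurableSet_Ioc Ioc_subset_Icc_self
  have hz : IntegrableOn z (Ioc 0 T) := bdd μ hy
  have hδ' : IntegrableOn δ' (Ioc 0 T) := bdd μ hδ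
  have hsub : ∀ {t}, t ∈ Ioc 0 T → Ioc 0 t ⊆ Ioc 0 T := fun ht => Ioc_subset_Ioc_right ht.2
  have hii : ∀ {f : ℝ → ℝ} {t}, t ∈ Ioc 0 T → IntegrableOn f (Ioc 0 T) → IntervalIntegrable f volume 0 t := fun ht hf =>
    (intervalIntegrable_iff_integrableOn_Ioc_of_le ht.1.le).2 (hf.mono_set (hsub ht))
  have hzt : ∀ t ∈ Ioc 0 T, y t ≤ exp (-(μ * t)) * A + (∫ s in (0)..t, exp (-(μ * (t - s))) * (ν * y s + δ s)) →
      z t ≤ a t + ν * ∫ s in (0)..t, z s := by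
    intro t htm ht
    have e1 : ∫ s in (0)..t, exp (-(μ * (t - s))) * (ν * y s + δ s) = exp (-(μ * t)) * (ν * (∫ s in (0)..t, z s) + ∫ s in (0)..t, δ' s) := by
      rw [← intervalIntegral.integral_const_mul, ← intervalIntegral.integral_add
        ((hii htm hz).const_mul ν) (hii htm hδ'), ← intervalIntegral.integral_const_mul]
      refine integral_congr fun s _ => ?_
      simp only [z, δ']
      rw [show -(μ * (t - s)) = -(μ * t) + μ * s by ring, exp_add]; ring
    rw [e1, ← mul_add] at ht
    have e2 : exp (μ * t) * exp (-(μ * t)) = 1 := by rw [← exp_add]; simp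
    calc z t ≤ exp (μ * t) * (exp (-(μ * t)) *
          (A + (ν * (∫ s in (0)..t, z s) + ∫ s in (0)..t, δ' s))) := by
          simp only [z]; gcongr
      _ = _ := by rw [← mul_assoc, e2]; simp only [a]; ring
  have hz1 : ∀ᵐ t ∂volR (Ioc 0 T), z t ≤ a t + ν * ∫ s in (0)..t, z s := by
    filter_upwards [h, ae_mem_Ioc] with t ht htm
    exact hzt t htm ht
  have ha : ContinuousOn a (Icc 0 T) := by
    by_cases hT : 0 ≤ T
    · have := continuousOn_primitive_interval (f := δ') (μ := volume) (a := 0) (b := T)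
        (by rw [uIcc_of_le hT, integrableOn_Icc_iff_integrableOn_Ioc]; exact hδ')
      rw [uIcc_of_le hT] at this
      exact continuousOn_const.add this
    · rw [Icc_eq_empty hT]; exact continuousOn_empty _
  have hexp : ∀ (c s : ℝ), HasDerivAt (fun s => exp (c * s)) (c * exp (c * s)) s := by
    intro c s
    have := ((hasDerivAt_id s).const_mul c).exp
    simpa [mul_comm] using this
  replace ht := hzt t htm ht
  have hX := integral_mul_primitive (g₀ := 0) (g := fun s => ∫ q in (0)..s, z q) (k := z) htm.1.le (hexp (-ν))
    (by fun_prop) (hz.mono_set (hsub htm)) (by simp) (by simp)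
  have hA := integral_mul_primitive (g₀ := A) (g := a) (k := δ') htm.1.le (hexp (-ν))
    (by fun_prop) (hδ'.mono_set (hsub htm)) (by simp [a]) (by simp [a])
  have hXz : ContinuousOn (fun s => ∫ q in (0)..s, z q) (Icc 0 T) := by
    have hT : 0 ≤ T := htm.1.le.trans htm.2
    have := continuousOn_primitive_interval (f := z) (μ := volume) (a := 0) (b := T)
        (by rw [uIcc_of_le hT, integrableOn_Icc_iff_integrableOn_Ioc]; exact hz)
    rwa [uIcc_of_le hT] at this
  have hcz : IntervalIntegrable (fun s => (-ν) * exp (-ν * s) * ∫ q in (0)..s, z q) volume 0 t := by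
    apply ContinuousOn.intervalIntegrable
    rw [uIcc_of_le htm.1.le]
    exact ContinuousOn.mul (by fun_prop) (hXz.mono (Icc_subset_Icc_right htm.2))
  have hca : IntervalIntegrable (fun s => (-ν) * exp (-ν * s) * a s) volume 0 t := by
    apply ContinuousOn.intervalIntegrable
    rw [uIcc_of_le htm.1.le]
    exact ContinuousOn.mul (by fun_prop) (ha.mono (Icc_subset_Icc_right htm.2))
  have hzz : IntervalIntegrable (fun s => exp (-ν * s) * z s) volume 0 t := hii htm (bdd (-ν) hz)
  have hdd : IntervalIntegrable (fun s => exp (-ν * s) * δ' s) volume 0 t := hii htm (bdd (-ν) hδ')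
  -- The derivative of `e^{-νs} ∫₀ˢ z` is `e^{-νs}(z - ν ∫₀ˢ z)`, which is at most `e^{-νs} a(s)`;
  -- integrate and multiply by `ν`.
  have key : exp (-ν * t) * ∫ q in (0)..t, ν * z q ≤ -∫ s in (0)..t, (-ν) * exp (-ν * s) * a s := by
    rw [intervalIntegral.integral_const_mul, mul_left_comm, hX, ← intervalIntegral.integral_neg, mul_zero, zero_add,
      ← intervalIntegral.integral_const_mul]
    rw [integral_of_le htm.1.le, integral_of_le htm.1.le]
    refine integral_mono_ae ?_ ?_ ?_
    · exact ((intervalIntegrable_iff_integrableOn_Ioc_of_le htm.1.le).1 ((hzz.add hcz).const_mul ν))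
    · exact ((intervalIntegrable_iff_integrableOn_Ioc_of_le htm.1.le).1 hca.neg)
    · have := ae_mono (Measure.restrict_mono (hsub htm) (le_refl volume)) hz1
      filter_upwards [this] with s hs
      have h0 := mul_le_mul_of_nonneg_left hs (mul_nonneg hν (exp_pos (-ν * s)).le)
      linarith
  rw [intervalIntegral.integral_add hdd hca] at hA
  -- The total factor on `δ` is `e^{(μ-ν)s}`, at most one because `μ ≤ ν`.
  have hd1 : ∫ s in (0)..t, exp (-ν * s) * δ' s ≤ ∫ s in (0)..t, δ s := by
    refine intervalIntegral.integral_mono_on htm.1.le hdd (hii htm hδ) fun s hs => ?_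
    simp only [δ']
    rw [← mul_assoc, ← exp_add]
    have : exp (-ν * s + μ * s) ≤ 1 := exp_le_one_iff.2 (by nlinarith [hs.1])
    nlinarith [hδ0 s]
  have hf : exp (-ν * t) * z t ≤ A + ∫ s in (0)..t, δ s := by
    have := mul_le_mul_of_nonneg_left ht (exp_pos (-ν * t)).le
    rw [← intervalIntegral.integral_const_mul] at this
    rw [mul_zero, Real.exp_zero, one_mul] at hA
    rw [mul_add] at this
    linarith
  have e3 : y t = exp ((ν - μ) * t) * (exp (-ν * t) * z t) := by
    simp only [z]
    rw [← mul_assoc, ← mul_assoc, ← exp_add, ← exp_add]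
    rw [show (ν - μ) * t + -ν * t + μ * t = 0 by ring]; simp
  rw [e3]
  gcongr

/-! ### Completeness of time-uniform weighted `L¹` convergence -/

/-- A subsequence with geometrically small gaps converges almost everywhere at every time in `S`, by
summability. Taking the limit pointwise in `(t, v)` yields one jointly measurable function valid at
all these times, and Fatou's lemma returns the bound for the full sequence. -/
lemma exists_uniform_limit (ρ : Measure X) {φ : X → ℝ≥0∞} (hφ : Measurable φ) (hφ0 : ∀ v, φ v ≠ 0) (hφt : ∀ v, φ v ≠ ⊤)
    (u : ℕ → ℝ → X → ℝ) (hu : UMeas u) (S : Set ℝ) (ε : ℕ → ℝ≥0∞) (hε : Tendsto ε atTop (𝓝 0))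
    (h : ∀ n k, n ≤ k → ∀ t ∈ S, ∫⁻ v, ‖u n t v - u k t v‖ₑ * φ v ∂ρ ≤ ε n) :
    ∃ w : ℝ → X → ℝ, Measurable (uncurry w) ∧ (Pos3 u → Pos2 w) ∧ ∀ n, ∀ t ∈ S, ∫⁻ v, ‖u n t v - w t v‖ₑ * φ v ∂ρ ≤ ε n := by
  obtain ⟨ψ, hψ, hψε⟩ := extraction_forall_of_eventually' (P := fun i n => ε n ≤ (2⁻¹ : ℝ≥0∞) ^ i) (fun i => by
      have : ∀ᶠ n in atTop, ε n < (2⁻¹ : ℝ≥0∞) ^ i := hε.eventually (gt_mem_nhds (ENNReal.pow_pos (by simp) i))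
      obtain ⟨N, hN⟩ := eventually_atTop.1 this
      exact ⟨N, fun n hn => (hN n hn).le⟩)
  -- The convergence set is measurable; putting the limit equal to zero outside it preserves both
  -- measurability and nonnegativity.
  set A : Set (ℝ × X) := {p | ∃ c, Tendsto (fun i => u (ψ i) p.1 p.2) atTop (𝓝 c)}
  have hA : MeasurableSet A := measurableSet_exists_tendsto (f := fun i (p : ℝ × X) => u (ψ i) p.1 p.2) (fun i => hu (ψ i))
  set w : ℝ → X → ℝ := fun t v => A.indicator (fun p => limUnder atTop fun i => u (ψ i) p.1 p.2) (t, v)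
  have hwm : Measurable (uncurry w) := by
    have : StronglyMeasurable (fun p : ℝ × X => limUnder atTop fun i => u (ψ i) p.1 p.2) :=
      StronglyMeasurable.limUnder (f := fun i (p : ℝ × X) => u (ψ i) p.1 p.2) (fun i => (hu (ψ i)).stronglyMeasurable)
    exact this.measurable.indicator hA
  have hlim : ∀ t v, (t, v) ∈ A → Tendsto (fun i => u (ψ i) t v) atTop (𝓝 (w t v)) := by
    intro t v hv
    simp only [w, indicator_of_mem hv]
    exact tendsto_nhds_limUnder hv
  refine ⟨w, hwm, ?_, ?_⟩
  · intro h0 t v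
    by_cases hv : (t, v) ∈ A
    · exact ge_of_tendsto' (hlim t v hv) fun i => h0 _ _ _
    · simp [w, hv]
  intro n t ht
  have hut : ∀ n, Measurable (u n t) := fun n => (hu n).comp measurable_prodMk_left
  have hconv : ∀ᵐ v ∂ρ, (t, v) ∈ A := by
    have hm : ∀ i, Measurable fun v => ‖u (ψ i) t v - u (ψ (i + 1)) t v‖ₑ * φ v := fun i =>
      ((hut _).sub (hut _)).enorm.mul hφ
    have hsum : ∫⁻ v, ∑' i, ‖u (ψ i) t v - u (ψ (i + 1)) t v‖ₑ * φ v ∂ρ ≠ ⊤ := by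
      rw [lintegral_tsum fun i => (hm i).aemeasurable]
      refine ne_top_of_le_ne_top ?_ (ENNReal.tsum_le_tsum fun i =>
        (h (ψ i) (ψ (i + 1)) (hψ.monotone (Nat.le_succ i)) t ht).trans (hψε i))
      rw [ENNReal.tsum_geometric]
      simp
    filter_upwards [ae_lt_top (Measurable.tsum hm) hsum] with v hv
    rw [ENNReal.tsum_mul_right] at hv
    have hv' : ∑' i, ‖u (ψ i) t v - u (ψ (i + 1)) t v‖ₑ ≠ ⊤ := by
      intro htop
      rw [htop, ENNReal.top_mul (hφ0 v)] at hv
      exact lt_irrefl _ hv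
    have hs : Summable fun i => dist (u (ψ i) t v) (u (ψ (i + 1)) t v) := by
      have := ENNReal.summable_toReal hv'
      simpa [dist_eq_norm] using this
    exact cauchySeq_tendsto_of_complete (cauchySeq_of_summable_dist hs)
  calc ∫⁻ v, ‖u n t v - w t v‖ₑ * φ v ∂ρ
      = ∫⁻ v, liminf (fun i => ‖u n t v - u (ψ i) t v‖ₑ * φ v) atTop ∂ρ := by
        refine lintegral_congr_ae ?_
        filter_upwards [hconv] with v hv
        refine (Tendsto.liminf_eq ?_).symm
        refine ENNReal.Tendsto.mul_const ?_ (Or.inr (hφt v))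
        exact (tendsto_const_nhds.sub (hlim t v hv)).enorm
    _ ≤ liminf (fun i => ∫⁻ v, ‖u n t v - u (ψ i) t v‖ₑ * φ v ∂ρ) atTop := lintegral_liminf_le fun i => ((hut _).sub (hut _)).enorm.mul hφ
    _ ≤ ε n := by
        refine liminf_le_of_frequently_le' ?_
        refine Eventually.frequently ?_
        filter_upwards [eventually_ge_atTop n] with i hi
        exact h n (ψ i) (hi.trans (hψ.id_le i)) t ht

end Primitive

/-! ### The standard Gaussian measure -/

section Gauss

variable {f : Fn d}

/-- The density of the standard Gaussian measure. -/
def gaussPdf (z : Vel d) : ℝ := (2 * Real.pi) ^ (-(d : ℝ) / 2) * exp (-(1 / 2) * ‖z‖ ^ 2)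

variable (d) in
/-- The standard Gaussian measure on `ℝ^d`. -/
def gauss : Measure (Vel d) := volume.withDensity fun z => ofReal (gaussPdf z)

lemma gaussPdf_pos (z : Vel d) : 0 < gaussPdf z := by
  unfold gaussPdf; positivity

@[fun_prop]
lemma continuous_gaussPdf : Continuous (gaussPdf : Fn d) := by
  unfold gaussPdf; fun_prop

@[fun_prop]
lemma measurable_gaussPdf : Measurable (gaussPdf : Fn d) := continuous_gaussPdf.measurable

lemma integrable_exp_neg_mul_norm_sq {b : ℝ} (hb : 0 < b) : Integrable fun v : Vel d => exp (-b * ‖v‖ ^ 2) := by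
  by_contra h
  have h1 := GaussianFourier.integral_rexp_neg_mul_sq_norm (V := Vel d) hb
  rw [integral_undef h] at h1
  have : 0 < (Real.pi / b) ^ ((Module.finrank ℝ (Vel d) : ℝ) / 2) := by positivity
  linarith

lemma integral_gaussPdf : ∫ z : Vel d, gaussPdf z = 1 := by
  unfold gaussPdf
  rw [integral_const_mul, GaussianFourier.integral_rexp_neg_mul_sq_norm (by norm_num),
    finrank_euclideanSpace, Fintype.card_fin, show Real.pi / (1 / 2) = 2 * Real.pi by ring,
    ← Real.rpow_add (by positivity)]
  rw [show -(d : ℝ) / 2 + d / 2 = 0 by ring, Real.rpow_zero]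

lemma integrable_gaussPdf : Integrable (gaussPdf : Fn d) := (integrable_exp_neg_mul_norm_sq (by norm_num)).const_mul _

instance : IsProbabilityMeasure (gauss d) := ⟨by
  rw [gauss, withDensity_apply _ MeasurableSet.univ, Measure.restrict_univ, ← ofReal_integral_eq_lintegral_ofReal integrable_gaussPdf
      (of_forall fun z => (gaussPdf_pos z).le), integral_gaussPdf]
  simp⟩

lemma integral_gauss (f : Fn d) : ∫ z, f z ∂gauss d = ∫ z, gaussPdf z * f z := by
  rw [gauss, integral_withDensity_eq_integral_toReal_smul (by fun_prop) (by simp)]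
  refine integral_ext fun z => ?_
  simp [toReal_ofReal (gaussPdf_pos z).le]

lemma lintegral_gauss {f : FnL d} (hf : Measurable f) : ∫⁻ z, f z ∂gauss d = ∫⁻ z, ofReal (gaussPdf z) * f z := by
  rw [gauss, lintegral_withDensity_eq_lintegral_mul _ (by fun_prop) hf]
  rfl

lemma integrable_gauss_iff : Integrable f (gauss d) ↔ Integrable fun z => gaussPdf z * f z := by
  rw [gauss, integrable_withDensity_iff_integrable_smul' (by fun_prop) (by simp)]
  simp [toReal_ofReal (gaussPdf_pos _).le]

/-- Uses `s^j ≤ j! e^s` and `⟨z⟩ ≤ 2 + |z|²/4`. Only half of the Gaussian exponent is spent, and the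
other half keeps the product integrable. -/
lemma bracket_pow_mul_exp_le (j : ℕ) (z : Vel d) : bracket z ^ j ≤ j.factorial * exp 2 * exp ((1 / 4) * ‖z‖ ^ 2) := by
  have h1 := Real.pow_div_factorial_le_exp (bracket z) (bracket_pos z).le j
  rw [div_le_iff₀ (by positivity)] at h1
  have h2 : bracket z ≤ 2 + (1 / 4) * ‖z‖ ^ 2 := by
    nlinarith [bracket_le z, sq_nonneg (‖z‖ - 2)]
  calc _ ≤ exp (bracket z) * j.factorial := h1
    _ ≤ exp (2 + (1 / 4) * ‖z‖ ^ 2) * j.factorial := by gcongr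
    _ = _ := by rw [exp_add]; ring

lemma gaussPdf_mul_bracket_pow_le (j : ℕ) (z : Vel d) : gaussPdf z * bracket z ^ j ≤ (2 * Real.pi) ^ (-(d : ℝ) / 2) * (j.factorial * exp 2) *
      exp (-(1 / 4) * ‖z‖ ^ 2) := by
  have e : exp (-(1 / 2) * ‖z‖ ^ 2) * exp ((1 / 4) * ‖z‖ ^ 2) = exp (-(1 / 4) * ‖z‖ ^ 2) := by rw [← exp_add]; ring_nf
  calc _ ≤ gaussPdf z * (j.factorial * exp 2 * exp ((1 / 4) * ‖z‖ ^ 2)) := by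
        gcongr
        · exact (gaussPdf_pos z).le
        · exact bracket_pow_mul_exp_le j z
    _ = (2 * Real.pi) ^ (-(d : ℝ) / 2) * (j.factorial * exp 2) * (exp (-(1 / 2) * ‖z‖ ^ 2) * exp ((1 / 4) * ‖z‖ ^ 2)) := by
        unfold gaussPdf; ring
    _ = _ := by rw [e]

lemma exists_gaussPdf_mul_bracket_pow_le (j : ℕ) : ∃ C, 0 ≤ C ∧ ∀ z : Vel d, gaussPdf z * bracket z ^ j ≤ C := by
  refine ⟨(2 * Real.pi) ^ (-(d : ℝ) / 2) * (j.factorial * exp 2), by positivity, fun z => ?_⟩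
  refine (gaussPdf_mul_bracket_pow_le j z).trans ?_
  refine mul_le_of_le_one_right (by positivity) (exp_le_one_iff.2 ?_)
  nlinarith [sq_nonneg ‖z‖]

lemma integrable_gaussPdf_mul_bracket_pow (j : ℕ) : Integrable fun z : Vel d => gaussPdf z * bracket z ^ j := by
  refine ((integrable_exp_neg_mul_norm_sq (d := d) (b := 1 / 4) (by norm_num)).const_mul
    ((2 * Real.pi) ^ (-(d : ℝ) / 2) * (j.factorial * exp 2))).mono' (by fun_prop : Continuous _).aestronglyMeasurable (of_forall fun z => ?_)
  rw [norm_of_nonneg (mul_nonneg (gaussPdf_pos z).le (pow_nonneg (bracket_pos z).le j))]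
  exact gaussPdf_mul_bracket_pow_le j z

lemma integrable_gauss_bracket_pow (j : ℕ) : Integrable (fun z => bracket z ^ j) (gauss d) :=
  integrable_gauss_iff.2 (integrable_gaussPdf_mul_bracket_pow j)

lemma integrable_gauss_of_le (hf : Measurable f) (C : ℝ) (j : ℕ) (h : ∀ z, |f z| ≤ C * bracket z ^ j) : Integrable f (gauss d) :=
  ((integrable_gauss_bracket_pow j).const_mul C).mono' hf.aestronglyMeasurable (of_forall h)

lemma integral_gauss_neg (f : Fn d) : ∫ z, f (-z) ∂gauss d = ∫ z, f z ∂gauss d := by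
  rw [integral_gauss, integral_gauss, ← integral_neg_eq_self]
  simp [gaussPdf]

lemma hasFDerivAt_gaussPdf (z : Vel d) : HasFDerivAt gaussPdf (-(gaussPdf z) • innerSL ℝ z) z := by
  have h1 := ((hasStrictFDerivAt_norm_sq z).hasFDerivAt.const_mul (-(1 / 2) : ℝ)).exp.const_mul ((2 * Real.pi) ^ (-(d : ℝ) / 2))
  refine h1.congr_fderiv ?_
  ext w
  simp [gaussPdf]
  ring

/-- Gaussian integration by parts. -/
lemma gauss_integration_by_parts {G : Fn d} (hG : ContDiff ℝ 1 G) (hb : ∀ z, |G z| ≤ C) (hb' : ∀ z, ‖fderiv ℝ G z‖ ≤ C) (e : Vel d) :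
    ∫ z, inner ℝ z e * G z ∂gauss d = ∫ z, fderiv ℝ G z e ∂gauss d := by
  have hC : 0 ≤ C := (abs_nonneg _).trans (hb 0)
  have hfd : Continuous (fun z => fderiv ℝ G z e) := (hG.continuous_fderiv one_ne_zero).clm_apply continuous_const
  have i1 : Integrable (fun z => gaussPdf z * fderiv ℝ G z e) := by
    rw [← integrable_gauss_iff]
    refine integrable_gauss_of_le hfd.measurable (C * ‖e‖) 0 fun z => ?_
    rw [pow_zero, mul_one]
    exact ((fderiv ℝ G z).le_opNorm e).trans (by gcongr; exact hb' z)
  have i2 : Integrable (fun z => gaussPdf z * (inner ℝ z e * G z)) := by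
    rw [← integrable_gauss_iff]
    refine integrable_gauss_of_le ((by fun_prop : Continuous fun z : Vel d => inner ℝ z e).mul hG.continuous).measurable (‖e‖ * C) 1 fun z => ?_
    rw [pow_one, abs_mul]
    calc _ ≤ (‖z‖ * ‖e‖) * C := by gcongr; exact abs_real_inner_le_norm z e; exact hb z
      _ ≤ (bracket z * ‖e‖) * C := by gcongr; exact norm_le_bracket z
      _ = _ := by ring
  have i3 : Integrable (fun z => gaussPdf z * G z) := by
    rw [← integrable_gauss_iff]
    refine integrable_gauss_of_le hG.continuous.measurable C 0 fun z => by simpa using hb z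
  have hd : ∀ z : Vel d, fderiv ℝ gaussPdf z e = -(gaussPdf z * inner ℝ z e) := fun z => by
    rw [(hasFDerivAt_gaussPdf z).fderiv]; simp
  have := integral_mul_fderiv_eq_neg_fderiv_mul_of_integrable (μ := volume) (f := gaussPdf)
    (g := G) (v := e) ?_ i1 i3 (fun z _ => (hasFDerivAt_gaussPdf z).differentiableAt) (fun z _ => (hG.differentiable one_ne_zero) z)
  · rw [integral_gauss, integral_gauss, this, ← integral_neg]
    refine integral_ext fun z => ?_
    simp only [hd]; ring
  · refine i2.neg.congr (of_forall fun z => ?_)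
    simp only [hd, Pi.neg_apply]; ring

/-! ### Moments of Gaussian translates -/

lemma bracket_add_smul_le (hσ : 0 ≤ σ) (x z : Vel d) : bracket (x + σ • z) ≤ 2 * (1 + σ) * bracket x * bracket z := by
  calc _ ≤ 2 * (bracket x * bracket (σ • z)) := bracket_add_le _ _
    _ ≤ 2 * (bracket x * ((1 + σ) * bracket z)) := by
      gcongr
      · exact (bracket_pos x).le
      · exact bracket_smul_le hσ z
    _ = _ := by ring

lemma integrable_gauss_add_pow (hσ : 0 ≤ σ) (x : Vel d) (j : ℕ) : Integrable (fun z => bracket (x + σ • z) ^ j) (gauss d) := by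
  refine integrable_gauss_of_le (by fun_prop) ((2 * (1 + σ) * bracket x) ^ j) j fun z => ?_
  have := bracket_pos (x + σ • z)
  rw [abs_of_pos (by positivity), ← mul_pow]
  gcongr
  exact bracket_add_smul_le hσ x z

/-- Averaging over `z` and `-z` removes the first-order term, so a weight changes only by a factor
`1 + O(σ²)`. -/
lemma integral_gauss_le_of_symmetric {x : Vel d} {ρ : Fn d} (hφ : Integrable (fun z => φ (x + σ • z)) (gauss d)) (hρ : Integrable ρ (gauss d))
    (hφ' : Integrable (fun z => φ (x + σ • -z)) (gauss d)) (h : ∀ z, φ (x + σ • z) + φ (x + σ • -z) ≤ 2 * (φ x * (1 + σ ^ 2 * ρ z))) :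
    ∫ z, φ (x + σ • z) ∂gauss d ≤ (1 + (∫ z, ρ z ∂gauss d) * σ ^ 2) * φ x := by
  have h1 := integral_gauss_neg (d := d) (fun z => φ (x + σ • z))
  have h2 : ∫ z, (φ (x + σ • z) + φ (x + σ • -z)) ∂gauss d ≤ ∫ z, 2 * (φ x * (1 + σ ^ 2 * ρ z)) ∂gauss d := by
    refine integral_mono (hφ.add hφ') ?_ h
    exact (((integrable_const 1).add (hρ.const_mul _)).const_mul _).const_mul _
  rw [integral_add hφ hφ', h1, integral_const_mul, integral_const_mul, integral_add (integrable_const 1) (hρ.const_mul _), integral_const_mul] at h2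
  simp at h2
  nlinarith

/-- The factor must tend to one quadratically in `σ`: since `σ²` is of the order of the elapsed
time, such a bound becomes an exponential growth rate that is compatible with Gronwall's inequality.
-/
lemma exists_gauss_bracket_growth (σm : ℝ) (hj : j = 0 ∨ j = 1 ∨ j = 2 ∨ j = 4) : ∃ C, 0 ≤ C ∧ ∀ σ, 0 ≤ σ → σ ≤ σm → ∀ x : Vel d,
      ∫ z, bracket (x + σ • z) ^ j ∂gauss d ≤ (1 + C * σ ^ 2) * bracket x ^ j := by
  have int : ∀ {σ : ℝ}, 0 ≤ σ → ∀ (x : Vel d) (j : ℕ), Integrable (fun z => bracket (x + σ • -z) ^ j) (gauss d) := by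
    intro σ hσ x j
    refine integrable_gauss_of_le (by fun_prop) ((2 * (1 + σ) * bracket x) ^ j) j fun z => ?_
    have := bracket_pos (x + σ • -z)
    rw [abs_of_pos (by positivity), ← mul_pow]
    gcongr
    simpa [bracket_neg] using bracket_add_smul_le hσ x (-z)
  have hsq : Integrable (fun z : Vel d => ‖z‖ ^ 2) (gauss d) := by
    refine integrable_gauss_of_le (by fun_prop) 1 2 fun z => ?_
    rw [abs_of_nonneg (by positivity), bracket_sq]; linarith
  have two : ∀ σ, 0 ≤ σ → ∀ x : Vel d, ∫ z, bracket (x + σ • z) ^ 2 ∂gauss d ≤ (1 + (∫ z, ‖z‖ ^ 2 ∂gauss d) * σ ^ 2) * bracket x ^ 2 := by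
    intro σ hσ x
    refine integral_gauss_le_of_symmetric (φ := fun y => bracket y ^ 2) (integrable_gauss_add_pow hσ x 2) hsq (int hσ x 2) fun z => ?_
    rw [bracket_sq, bracket_sq, bracket_sq, smul_neg, norm_add_sq_real, norm_add_sq_real, norm_neg,
      inner_neg_right, norm_smul, mul_pow, norm_eq_abs, sq_abs]
    nlinarith [mul_nonneg (mul_nonneg (sq_nonneg σ) (sq_nonneg ‖z‖)) (sq_nonneg ‖x‖)]
  have hE : 0 ≤ ∫ z, ‖z‖ ^ 2 ∂gauss d := integral_nonneg fun z => by positivity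
  rcases hj with rfl | rfl | rfl | rfl
  · exact ⟨0, le_rfl, fun σ _ _ x => by simp⟩
  · refine ⟨(∫ z, ‖z‖ ^ 2 ∂gauss d) / 2, by positivity, fun σ hσ _ x => ?_⟩
    have hx := bracket_pos x
    -- The first moment follows from the second through `2ab ≤ a² + b²` with `b = ⟨x⟩`.
    have h1 : ∫ z, bracket (x + σ • z) ^ 1 ∂gauss d ≤ ∫ z, (2 * bracket x)⁻¹ * (bracket (x + σ • z) ^ 2 + bracket x ^ 2) ∂gauss d := by
      refine integral_mono (integrable_gauss_add_pow hσ x 1)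
        (((integrable_gauss_add_pow hσ x 2).add (integrable_const _)).const_mul _) fun z => ?_
      simp only [pow_one]
      rw [inv_mul_eq_div, le_div_iff₀ (by positivity)]
      nlinarith [sq_nonneg (bracket (x + σ • z) - bracket x)]
    refine h1.trans ?_
    rw [integral_const_mul, integral_add (integrable_gauss_add_pow hσ x 2) (integrable_const _), inv_mul_eq_div, div_le_iff₀ (by positivity)]
    have := two σ hσ x
    simp
    nlinarith
  · exact ⟨_, hE, fun σ hσ _ x => two σ hσ x⟩
  · have h4 : Integrable (fun z : Vel d => ‖z‖ ^ 4) (gauss d) := by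
      refine integrable_gauss_of_le (by fun_prop) 1 4 fun z => ?_
      rw [abs_of_nonneg (by positivity), one_mul]
      gcongr; exact norm_le_bracket z
    refine ⟨∫ z, (6 * ‖z‖ ^ 2 + σm ^ 2 * ‖z‖ ^ 4) ∂gauss d, integral_nonneg fun z => by positivity, fun σ hσ hσm x => ?_⟩
    refine integral_gauss_le_of_symmetric (φ := fun y => bracket y ^ 4)
      (integrable_gauss_add_pow hσ x 4) ((hsq.const_mul _).add (h4.const_mul _)) (int hσ x 4) fun z => ?_
    have e4 : ∀ y : Vel d, bracket y ^ 4 = (1 + ‖y‖ ^ 2) ^ 2 := fun y => by rw [← bracket_sq]; ring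
    rw [e4, e4, e4, smul_neg, norm_add_sq_real, norm_add_sq_real, norm_neg, inner_neg_right]
    have hin : inner ℝ x (σ • z) ^ 2 ≤ ‖x‖ ^ 2 * ‖σ • z‖ ^ 2 := by
      rw [← mul_pow, ← sq_abs]; gcongr; exact abs_real_inner_le_norm _ _
    have hn : ‖σ • z‖ ^ 2 = σ ^ 2 * ‖z‖ ^ 2 := by
      rw [norm_smul, mul_pow, norm_eq_abs, sq_abs]
    set q := inner ℝ x (σ • z)
    set X := ‖x‖ ^ 2
    set Y := ‖σ • z‖ ^ 2
    have hX : 0 ≤ X := by positivity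
    have hY : 0 ≤ Y := by positivity
    -- The quartic term in `σ` is brought to order `σ²` here; this is the only place where the upper
    -- bound on `σ` is needed.
    have hY2 : Y ^ 2 ≤ σ ^ 2 * (σm ^ 2 * ‖z‖ ^ 4) := by
      rw [hn]
      have : σ ^ 2 ≤ σm ^ 2 := by gcongr
      have h5 : (σ ^ 2 * ‖z‖ ^ 2) ^ 2 = σ ^ 2 * (σ ^ 2 * ‖z‖ ^ 4) := by ring
      rw [h5]; gcongr
    have e5 : 1 + σ ^ 2 * (6 * ‖z‖ ^ 2 + σm ^ 2 * ‖z‖ ^ 4) = 1 + (6 * Y + σ ^ 2 * (σm ^ 2 * ‖z‖ ^ 4)) := by rw [hn]; ring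
    rw [e5]
    have h6 : (1 + X) ^ 2 * (1 + (6 * Y + Y ^ 2)) ≤ (1 + X) ^ 2 * (1 + (6 * Y + σ ^ 2 * (σm ^ 2 * ‖z‖ ^ 4))) := by gcongr
    have h7 : (1 + (X + 2 * q + Y)) ^ 2 + (1 + (X + 2 * -q + Y)) ^ 2 ≤ 2 * ((1 + X) ^ 2 * (1 + (6 * Y + Y ^ 2))) := by
      have : (1 + (X + 2 * q + Y)) ^ 2 + (1 + (X + 2 * -q + Y)) ^ 2 = 2 * (1 + X + Y) ^ 2 + 8 * q ^ 2 := by ring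
      rw [this]
      nlinarith [mul_nonneg hX hY, mul_nonneg (mul_nonneg hX hX) hY, mul_nonneg hX (mul_nonneg hY hY), mul_nonneg (mul_nonneg hX hX) (mul_nonneg hY hY)]
    linarith

end Gauss

/-! ### The Ornstein–Uhlenbeck semigroup -/

section OU

/-- The variance at time `r` of the Ornstein–Uhlenbeck process. -/
def ouVar (c D r : ℝ) : ℝ := D / c * (1 - exp (-(2 * c * r)))

/-- The standard deviation at time `r` of the Ornstein–Uhlenbeck process. -/
def ouSd (c D r : ℝ) : ℝ := sqrt (ouVar c D r)

scoped notation:max "ouM" c:max D:max r:max w:max z:max => exp (-(c * r)) • w + ouSd c D r • z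

/-- The semigroup generated by `φ ↦ D Δφ - c v·∇φ - lam φ`. -/
def ouDual (c D lam r : ℝ) (φ : Fn d) (w : Vel d) : ℝ := exp (-(lam * r)) * ∫ z, φ (ouM c D r w z) ∂gauss d

/-- The semigroup generated by `g ↦ c div(v g) + D Δg - lam g`. -/
def ou (c D lam r : ℝ) (g : Fn d) (v : Vel d) : ℝ := exp ((c * d - lam) * r) * ∫ z, g (exp (c * r) • (v - ouSd c D r • z)) ∂gauss d

/-- `ouDual` with `lam = 0` on nonnegative extended functions. -/
def ouDualL (c D r : ℝ) (Φ : FnL d) (w : Vel d) : ℝ≥0∞ := ∫⁻ z, Φ (ouM c D r w z) ∂gauss d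

/-- `ou` with `lam = 0` on nonnegative extended functions. -/
def ouL (c D r : ℝ) (G : FnL d) (v : Vel d) : ℝ≥0∞ := ofReal (exp (c * d * r)) * ∫⁻ z, G (exp (c * r) • (v - ouSd c D r • z)) ∂gauss d

/-- The Duhamel integral from time `a`. -/
def duhamel (c D lam a : ℝ) (h : ℝ → Fn d) (t : ℝ) (v : Vel d) : ℝ := ∫ s in Ioc a t, ou c D lam (t - s) (h s) v

@[fun_prop]
lemma continuous_ouVar (c D : ℝ) : Continuous (ouVar c D) := by unfold ouVar; fun_prop

@[fun_prop]
lemma continuous_ouSd (c D : ℝ) : Continuous (ouSd c D) := by unfold ouSd; fun_prop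

lemma ouSd_nonneg (c D r : ℝ) : 0 ≤ ouSd c D r := Real.sqrt_nonneg _

@[simp] lemma ouVar_zero (c D : ℝ) : ouVar c D 0 = 0 := by simp [ouVar]

@[simp] lemma ouSd_zero (c D : ℝ) : ouSd c D 0 = 0 := by simp [ouSd]

lemma ouVar_pos (hc : 0 < c) (hD : 0 < D) (hr : 0 < r) : 0 < ouVar c D r := by
  have : exp (-(2 * c * r)) < 1 := by
    rw [← Real.exp_zero]; exact Real.exp_lt_exp.2 (by nlinarith)
  unfold ouVar
  have := div_pos hD hc
  nlinarith

lemma ouVar_nonneg (hc : 0 < c) (hD : 0 < D) (hr : 0 ≤ r) : 0 ≤ ouVar c D r := by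
  rcases hr.eq_or_lt with rfl | h
  · simp
  · exact (ouVar_pos hc hD h).le

lemma ouSd_sq (hc : 0 < c) (hD : 0 < D) (hr : 0 ≤ r) : ouSd c D r ^ 2 = ouVar c D r := Real.sq_sqrt (ouVar_nonneg hc hD hr)

lemma ouVar_le (hc : 0 < c) (hD : 0 < D) : ouVar c D r ≤ 2 * D * r := by
  have h1 := Real.add_one_le_exp (-(2 * c * r))
  have h2 := div_pos hD hc
  calc ouVar c D r ≤ D / c * (2 * c * r) := by unfold ouVar; gcongr; linarith
    _ = _ := by field_simp

/-- A lower bound linear in `r` makes `1/σ` of order `r^{-1/2}`, the integrable singularity behind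
the gain of a derivative. -/
lemma le_ouVar (hc : 0 < c) (hD : 0 < D) (hr : 0 ≤ r) (hT : r ≤ T) : 2 * D * exp (-(2 * c * T)) * r ≤ ouVar c D r := by
  have h1 := Real.add_one_le_exp (2 * c * r)
  have h2 := div_pos hD hc
  have h3 : exp (2 * c * r) * exp (-(2 * c * r)) = 1 := by rw [← exp_add]; simp
  have h4 : exp (-(2 * c * T)) ≤ exp (-(2 * c * r)) := by gcongr
  have h5 := exp_pos (-(2 * c * r))
  calc _ ≤ 2 * D * exp (-(2 * c * r)) * r := by gcongr
    _ = D / c * (2 * c * r * exp (-(2 * c * r))) := by field_simp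
    _ ≤ ouVar c D r := by unfold ouVar; gcongr; nlinarith

lemma ouVar_mono (hc : 0 < c) (hD : 0 < D) : Monotone (ouVar c D) := fun r s h => by
  unfold ouVar
  have := div_pos hD hc
  gcongr

lemma ouSd_mono (hc : 0 < c) (hD : 0 < D) : Monotone (ouSd c D) := fun _ _ h =>
  sqrt_le_sqrt (ouVar_mono hc hD h)

lemma ouSd_pos (hc : 0 < c) (hD : 0 < D) (hr : 0 < r) : 0 < ouSd c D r := Real.sqrt_pos.2 (ouVar_pos hc hD hr)

/-! #### Measurability -/

/-- Time, density and velocity all depend on a parameter, so that the later joint measurability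
questions in time and velocity reduce to this one. -/
lemma measurable_ou_comp (c D lam : ℝ) {H : X → Fn d}
    (hH : Measurable (uncurry H)) {r : X → ℝ} (hr : Measurable r) (hv : Measurable v) : Measurable fun x => ou c D lam (r x) (H x) (v x) := by
  unfold ou
  refine Measurable.mul (by fun_prop) ?_
  have : Measurable fun p : X × Vel d =>
      H p.1 (exp (c * r p.1) • (v p.1 - ouSd c D (r p.1) • p.2)) :=
    hH.comp (g := uncurry H) (f := fun p : X × Vel d =>
      (p.1, exp (c * r p.1) • (v p.1 - ouSd c D (r p.1) • p.2))) (by fun_prop)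
  exact this.stronglyMeasurable.integral_prod_right'.measurable

lemma measurable_ou (hg : Measurable g) : Measurable (ou c D lam r g) :=
  measurable_ou_comp (H := fun _ => g) c D lam (by exact hg.comp measurable_snd) measurable_const measurable_id

lemma measurable_ouL_comp (c D : ℝ) {H : X → FnL d}
    (hH : Measurable (uncurry H)) {r : X → ℝ} (hr : Measurable r) (hv : Measurable v) : Measurable fun x => ouL c D (r x) (H x) (v x) := by
  unfold ouL
  refine Measurable.mul (by fun_prop) ?_
  have : Measurable fun p : X × Vel d =>
      H p.1 (exp (c * r p.1) • (v p.1 - ouSd c D (r p.1) • p.2)) :=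
    hH.comp (g := uncurry H) (f := fun p : X × Vel d =>
      (p.1, exp (c * r p.1) • (v p.1 - ouSd c D (r p.1) • p.2))) (by fun_prop)
  exact this.lintegral_prod_right'

lemma measurable_ouL {g : FnL d} (hg : Measurable g) : Measurable (ouL c D r g) :=
  measurable_ouL_comp (H := fun _ => g) c D (by exact hg.comp measurable_snd) measurable_const measurable_id

lemma measurable_ouDual_comp (c D lam : ℝ) (hφ : Measurable φ) {r : X → ℝ} (hr : Measurable r) (hv : Measurable v) : Measurable fun x => ouDual c D lam (r x) φ (v x) := by
  unfold ouDual
  refine Measurable.mul (by fun_prop) ?_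
  have : Measurable fun p : X × Vel d =>
      φ (exp (-(c * r p.1)) • v p.1 + ouSd c D (r p.1) • p.2) :=
    hφ.comp (by fun_prop)
  exact this.stronglyMeasurable.integral_prod_right'.measurable

lemma measurable_duhamel (c D lam a : ℝ) (hh : Measurable (uncurry h)) : Measurable (uncurry (duhamel c D lam a h)) := by
  have h1 : Measurable fun p : (ℝ × Vel d) × ℝ =>
      (Ioc a p.1.1).indicator (fun s => ou c D lam (p.1.1 - s) (h s) p.1.2) p.2 := by
    have h2 : Measurable fun p : (ℝ × Vel d) × ℝ => ou c D lam (p.1.1 - p.2) (h p.2) p.1.2 :=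
      measurable_ou_comp (H := fun p : (ℝ × Vel d) × ℝ => h p.2) c D lam
        (hh.comp ((by fun_prop : Measurable fun q : ((ℝ × Vel d) × ℝ) × Vel d => (q.1.2, q.2)))) (by fun_prop) (by fun_prop)
    have h3 : MeasurableSet {p : (ℝ × Vel d) × ℝ | a < p.2 ∧ p.2 ≤ p.1.1} := (measurableSet_lt measurable_const measurable_snd).inter
        (measurableSet_le measurable_snd (by fun_prop))
    exact h2.indicator h3
  have h4 := (h1.stronglyMeasurable.integral_prod_right' (ν := volume)).measurable
  convert h4 using 1
  ext p
  simp only [uncurry, duhamel]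
  rw [← integral_indicator measurableSet_Ioc]

/-! #### Duality -/

lemma lintegral_comp_smul_vel (hR : 0 < R) {F : FnL d} (hF : Measurable F) : ∫⁻ y, F (R • y) = ofReal ((R ^ d)⁻¹) * ∫⁻ y, F y := by
  have h := Measure.map_addHaar_smul (volume : Measure (Vel d)) hR.ne'
  rw [← lintegral_map (μ := volume) hF (measurable_const_smul R), h, lintegral_smul_measure,
    finrank_euclideanSpace, Fintype.card_fin, abs_of_pos (by positivity), smul_eq_mul]

/-- Tonelli and the substitution `w = e^{cr}(v - σz)`. Its Jacobian `e^{-cdr}` cancels the prefactor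
of `ouL`. -/
lemma lintegral_ouL_mul (c D r : ℝ) (hG : Measurable G) (hΦ : Measurable Φ) : ∫⁻ v, ouL c D r G v * Φ v = ∫⁻ w, G w * ouDualL c D r Φ w := by
  set σ := ouSd c D r
  have hm : Measurable fun p : Vel d × Vel d => G (exp (c * r) • (p.1 - σ • p.2)) * Φ p.1 := (hG.comp (by fun_prop)).mul (hΦ.comp measurable_fst)
  have hm' : Measurable fun p : Vel d × Vel d => G p.1 * Φ (exp (-(c * r)) • p.1 + σ • p.2) := (hG.comp measurable_fst).mul (hΦ.comp (by fun_prop))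
  have hexp : exp (-(c * r)) * exp (c * r) = 1 := by rw [← exp_add]; simp
  have inner : ∀ z, ∫⁻ v, G ouI c r σ v z * Φ v = ofReal ((exp (c * r) ^ d)⁻¹) * ∫⁻ w, G w * Φ (exp (-(c * r)) • w + σ • z) := by
    intro z
    rw [← lintegral_comp_smul_vel (F := fun w => G w * Φ (exp (-(c * r)) • w + σ • z)) (exp_pos _) (hm'.comp (measurable_prodMk_right (y := z))),
      ← lintegral_add_right_eq_self _ (σ • z)]
    refine lintegral_congr fun v => ?_
    simp only [smul_smul, hexp, one_smul, add_sub_cancel_right]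
  calc ∫⁻ v, ouL c D r G v * Φ v
      = ofReal (exp (c * d * r)) * ∫⁻ v, ∫⁻ z, G ouI c r σ v z * Φ v ∂gauss d := by
        rw [← lintegral_const_mul _ hm.lintegral_prod_right']
        refine lintegral_congr fun v => ?_
        have : Measurable fun z => G ouI c r σ v z := hG.comp (by fun_prop)
        dsimp only
        rw [ouL, lintegral_mul_const _ this, mul_assoc]
    _ = ofReal (exp (c * d * r)) * ∫⁻ z, (ofReal ((exp (c * r) ^ d)⁻¹) * ∫⁻ w, G w * Φ (exp (-(c * r)) • w + σ • z)) ∂gauss d := by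
        rw [lintegral_lintegral_swap hm.aemeasurable]
        simp only [inner]
    _ = ∫⁻ z, (∫⁻ w, G w * Φ (exp (-(c * r)) • w + σ • z)) ∂gauss d := by
        rw [lintegral_const_mul _ hm'.lintegral_prod_left', ← mul_assoc, ← ofReal_mul (exp_pos _).le, ← Real.exp_nat_mul]
        rw [show c * d * r = d * (c * r) by ring, mul_inv_cancel₀ (exp_pos _).ne']
        simp
    _ = _ := by
        rw [lintegral_lintegral_swap (f := fun z w => G w * Φ (exp (-(c * r)) • w + σ • z)) (by exact (hm'.comp measurable_swap).aemeasurable)]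
        refine lintegral_congr fun w => ?_
        have : Measurable fun z => Φ (exp (-(c * r)) • w + σ • z) := hΦ.comp (by fun_prop)
        rw [ouDualL, lintegral_const_mul _ this]

lemma enorm_ou_le (c D lam r : ℝ) (g : Fn d) (v : Vel d) : ‖ou c D lam r g v‖ₑ ≤ ofReal (exp (-(lam * r))) * ouL c D r (fun w => ‖g w‖ₑ) v := by
  unfold ou ouL
  rw [enorm_mul, ← mul_assoc, ← ofReal_mul (exp_pos _).le, ← exp_add,
    enorm_of_nonneg (exp_pos _).le, show (c * d - lam) * r = -(lam * r) + c * d * r by ring]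
  gcongr
  exact enorm_integral_le_lintegral_enorm _

lemma lintegral_enorm_ou_le (c D lam r : ℝ) (hg : Measurable g) (hΦ : Measurable Φ) : ∫⁻ v, ‖ou c D lam r g v‖ₑ * Φ v ≤
      ofReal (exp (-(lam * r))) * ∫⁻ w, ‖g w‖ₑ * ouDualL c D r Φ w := by
  have hm : Measurable fun v => ouL c D r (fun w => ‖g w‖ₑ) v * Φ v := (measurable_ouL hg.enorm).mul hΦ
  rw [← lintegral_ouL_mul c D r hg.enorm hΦ, ← lintegral_const_mul _ hm]
  refine lintegral_mono fun v => ?_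
  rw [← mul_assoc]
  gcongr
  exact enorm_ou_le c D lam r g v

lemma ouDualL_const (c D r : ℝ) (C : ℝ≥0∞) (w : Vel d) : ouDualL c D r (fun _ => C) w = C := by
  simp [ouDualL]

lemma integrable_ou (hg : Measurable g) (hi : Integrable g) : Integrable (ou c D lam r g) := by
  refine ⟨(measurable_ou hg).aestronglyMeasurable, ?_⟩
  have := lintegral_enorm_ou_le c D lam r hg (Φ := fun _ => 1) measurable_const
  simp only [mul_one, ouDualL_const] at this
  exact this.trans_lt (mul_lt_top ofReal_lt_top hi.2)

lemma integral_ou_mul (c D lam r : ℝ) (hg : Measurable g) (hi : Integrable g) (hφ : Measurable φ) (hC : ∀ v, |φ v| ≤ C) :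
    ∫ v, ou c D lam r g v * φ v = ∫ w, g w * ouDual c D lam r φ w := by
  set σ := ouSd c D r
  have hm : Measurable fun p : Vel d × Vel d => g (exp (c * r) • (p.1 - σ • p.2)) * φ p.1 := (hg.comp (by fun_prop)).mul (hφ.comp measurable_fst)
  have hm' : Measurable fun p : Vel d × Vel d => g p.1 * φ (exp (-(c * r)) • p.1 + σ • p.2) := (hg.comp measurable_fst).mul (hφ.comp (by fun_prop))
  have hexp : exp (-(c * r)) * exp (c * r) = 1 := by rw [← exp_add]; simp
  have hCe : ∀ v, ‖φ v‖ₑ ≤ ofReal C := fun v => by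
    rw [enorm_eq_ofReal_abs]; exact ofReal_le_ofReal (hC v)
  -- Integrability on the product follows from the nonnegative duality applied to absolute values.
  have i1 : Integrable (fun p : Vel d × Vel d => g (exp (c * r) • (p.1 - σ • p.2)) * φ p.1) (volume.prod (gauss d)) := by
    refine ⟨hm.aestronglyMeasurable, ?_⟩
    rw [HasFiniteIntegral, lintegral_prod _ hm.enorm.aemeasurable]
    have h1 := lintegral_ouL_mul c D r hg.enorm (Φ := fun v => ‖φ v‖ₑ) hφ.enorm
    have h2 : ∫⁻ w, ‖g w‖ₑ * ouDualL c D r (fun v => ‖φ v‖ₑ) w < ⊤ := by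
      calc _ ≤ ∫⁻ w, ‖g w‖ₑ * ofReal C := by
            gcongr with w
            calc _ ≤ ouDualL c D r (fun _ => ofReal C) w := lintegral_mono fun z => hCe _
              _ = _ := ouDualL_const _ _ _ _ _
        _ < ⊤ := by
            rw [lintegral_mul_const _ hg.enorm]
            exact mul_lt_top hi.2 ofReal_lt_top
    rw [← h1] at h2
    have h3 : ∀ v, ∫⁻ z, ‖g ouI c r σ v z * φ v‖ₑ ∂gauss d = ofReal (exp (-(c * d * r))) * (ouL c D r (fun w => ‖g w‖ₑ) v * ‖φ v‖ₑ) := by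
      intro v
      have : Measurable fun z => ‖g ouI c r σ v z‖ₑ := hg.enorm.comp (g := fun w => ‖g w‖ₑ) (f := fun z => exp (c * r) • (v - σ • z)) (by fun_prop)
      simp only [enorm_mul]
      rw [lintegral_mul_const _ this, ouL, ← mul_assoc, ← mul_assoc, ← ofReal_mul (exp_pos _).le, ← exp_add]
      simp [σ]
    simp only [h3]
    have hm2 : Measurable fun v => ouL c D r (fun w => ‖g w‖ₑ) v * ‖φ v‖ₑ := (measurable_ouL hg.enorm).mul hφ.enorm
    rw [lintegral_const_mul _ hm2]
    exact mul_lt_top ofReal_lt_top h2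
  have i2 : Integrable (fun p : Vel d × Vel d => g p.1 * φ (exp (-(c * r)) • p.1 + σ • p.2)) (volume.prod (gauss d)) := by
    have : Integrable (fun p : Vel d × Vel d => g p.1 * C) (volume.prod (gauss d)) := Integrable.mul_prod hi (integrable_const C)
    refine this.mono hm'.aestronglyMeasurable (of_forall fun p => ?_)
    simp only [norm_mul]
    gcongr
    exact (hC _).trans (le_abs_self C)
  have inner : ∀ z, ∫ v, g ouI c r σ v z * φ v = (exp (c * r) ^ d)⁻¹ * ∫ w, g w * φ (exp (-(c * r)) • w + σ • z) := by
    intro z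
    have := Measure.integral_comp_smul (μ := (volume : Measure (Vel d))) (fun w => g w * φ (exp (-(c * r)) • w + σ • z)) (exp (c * r))
    rw [finrank_euclideanSpace, Fintype.card_fin, abs_of_pos (by positivity), smul_eq_mul] at this
    rw [← this, ← integral_add_right_eq_self _ (σ • z)]
    refine integral_ext fun v => ?_
    simp only [smul_smul, hexp, one_smul, add_sub_cancel_right]
  calc ∫ v, ou c D lam r g v * φ v
      = exp ((c * d - lam) * r) * ∫ v, ∫ z, g ouI c r σ v z * φ v ∂gauss d := by
        rw [← integral_const_mul]
        refine integral_ext fun v => ?_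
        rw [ou, integral_mul_const, mul_assoc]
    _ = exp ((c * d - lam) * r) * ∫ z, ((exp (c * r) ^ d)⁻¹ * ∫ w, g w * φ (exp (-(c * r)) • w + σ • z)) ∂gauss d := by
        rw [integral_integral_swap i1]
        simp only [inner]
    _ = exp (-(lam * r)) * ∫ z, (∫ w, g w * φ (exp (-(c * r)) • w + σ • z)) ∂gauss d := by
        rw [integral_const_mul, ← mul_assoc, ← Real.exp_nat_mul, ← Real.exp_neg, ← exp_add]
        ring_nf
    _ = _ := by
        rw [integral_integral_swap (f := fun z w => g w * φ (exp (-(c * r)) • w + σ • z)) (by exact i2.swap), ← integral_const_mul]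
        refine integral_ext fun w => ?_
        rw [ouDual, integral_const_mul]; ring

lemma abs_ouDual_le (c D lam r : ℝ) (hC : ∀ v, |φ v| ≤ C) (w : Vel d) :
    |ouDual c D lam r φ w| ≤ exp (-(lam * r)) * C := by
  rw [ouDual, abs_mul, abs_of_pos (exp_pos _)]
  gcongr
  have := norm_integral_le_of_norm_le_const (μ := gauss d) (C := C) (f := fun z => φ (ouM c D r w z)) (of_forall fun z => hC _)
  simpa using this

/-! #### Growth of weights -/

/-- The weight `Φ` grows at most at rate `C` under the semigroup, up to time `T`. -/
def OUGrowth (c D T C : ℝ) (Φ : FnL d) : Prop := ∀ r ∈ Icc 0 T, ∀ w, ouDualL c D r Φ w ≤ ofReal (exp (C * r)) * Φ w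

variable (d) in
/-- The weight `⟨v⟩^j`. -/
def wt (j : ℕ) (v : Vel d) : ℝ≥0∞ := ofReal (bracket v ^ j)

scoped notation:max "nrm" k:max f:max => ∫⁻ v, ‖f v‖ₑ * wt _ k v

/-- The moments of order `k` are finite. -/
abbrev HMom (k : ℕ) (f : ℕ → Fn d) : Prop := ∀ n, nrm k (f n) ≠ ⊤

variable (d) in
/-- Growth bounds for the weight of order `j` at all mass levels. -/
abbrev Grow (M : ℕ) (c D : ℕ → ℝ) (T C : ℝ) (j : ℕ) : Prop := ∀ m ∈ Lev M, OUGrowth (c m) (D m) T C (wt d j)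

@[fun_prop]
lemma measurable_wt (j : ℕ) : Measurable (wt d j) := by unfold wt; fun_prop

lemma one_le_wt (j : ℕ) (v : Vel d) : 1 ≤ wt d j v := by
  rw [wt, ← ENNReal.ofReal_one]
  exact ofReal_le_ofReal (one_le_pow₀ (one_le_bracket v))

lemma wt_ne_top (j : ℕ) (v : Vel d) : wt d j v ≠ ⊤ := ofReal_ne_top

lemma wt_ne_zero (j : ℕ) (v : Vel d) : wt d j v ≠ 0 := (one_pos.trans_le (one_le_wt j v)).ne'

lemma wt_mono (h : i ≤ j) (v : Vel d) : wt d i v ≤ wt d j v := ofReal_le_ofReal (pow_le_pow_right₀ (one_le_bracket v) h)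

@[simp] lemma wt_zero : wt d 0 = fun _ => 1 := by ext v; simp [wt]

lemma wt_mul (i j : ℕ) (v : Vel d) : wt d i v * wt d j v = wt d (i + j) v := by
  rw [wt, wt, wt, ← ofReal_mul (pow_nonneg (bracket_pos v).le _), pow_add]

lemma OUGrowth.mono {C' : ℝ} (h : OUGrowth c D T C Φ) (hC : C ≤ C') : OUGrowth c D T C' Φ := fun r hr w => (h r hr w).trans (by
  have := hr.1
  gcongr)

/-- The drift contracts velocities and cannot increase the weight; diffusion contributes `1 + Cσ²`,
at most `e^{2DCr}` because `σ² ≤ 2Dr`. -/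
lemma exists_ouGrowth (hc : 0 < c) (hD : 0 < D) (T : ℝ) (hj : j = 0 ∨ j = 1 ∨ j = 2 ∨ j = 4) : ∃ C, 0 ≤ C ∧ OUGrowth c D T C (wt d j) := by
  obtain ⟨C, hC, h⟩ := exists_gauss_bracket_growth (d := d) (ouSd c D T) hj
  refine ⟨C * (2 * D), by positivity, fun r hr w => ?_⟩
  have hσ := ouSd_nonneg c D r
  have h1 := h _ hσ (ouSd_mono hc hD hr.2) (exp (-(c * r)) • w)
  have h2 : bracket (exp (-(c * r)) • w) ≤ bracket w := by
    refine bracket_mono ?_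
    rw [norm_smul, norm_of_nonneg (exp_pos _).le]
    exact mul_le_of_le_one_left (norm_nonneg _) (exp_le_one_iff.2 (by nlinarith [hr.1]))
  unfold ouDualL wt
  rw [← ofReal_integral_eq_lintegral_ofReal (integrable_gauss_add_pow hσ _ j) (of_forall fun z => pow_nonneg (bracket_pos _).le j),
    ← ofReal_mul (exp_pos _).le]
  refine ofReal_le_ofReal (h1.trans ?_)
  have h3 : 1 + C * ouSd c D r ^ 2 ≤ exp (C * (2 * D) * r) := by
    rw [ouSd_sq hc hD hr.1]
    have := ouVar_le (r := r) hc hD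
    have h4 := Real.add_one_le_exp (C * (2 * D) * r)
    nlinarith
  have := bracket_pos (exp (-(c * r)) • w)
  gcongr

/-- Valid for every exponent, but with a constant that does not tend to one as `r → 0`. This is
enough for moment propagation, where no iteration in time takes place. -/
lemma exists_ouDualL_wt_le (hc : 0 < c) (hD : 0 < D) (T : ℝ) (j : ℕ) :
    ∃ C : ℝ, 0 < C ∧ ∀ r ∈ Icc 0 T, ∀ w : Vel d, ouDualL c D r (wt d j) w ≤ ofReal C * wt d j w := by
  have hI : 0 < ∫ z, bracket z ^ j ∂gauss d := by
    have : ∫ _z : Vel d, (1 : ℝ) ∂gauss d ≤ ∫ z, bracket z ^ j ∂gauss d := integral_mono (integrable_const _) (integrable_gauss_bracket_pow j)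
        fun z => one_le_pow₀ (one_le_bracket z)
    simp at this
    linarith
  refine ⟨(2 * (1 + ouSd c D T)) ^ j * ∫ z, bracket z ^ j ∂gauss d, mul_pos (pow_pos (by linarith [ouSd_nonneg c D T]) j) hI, fun r hr w => ?_⟩
  have hσ := ouSd_nonneg c D r
  unfold ouDualL wt
  rw [← ofReal_integral_eq_lintegral_ofReal (integrable_gauss_add_pow hσ _ j) (of_forall fun z => pow_nonneg (bracket_pos _).le j),
    ← ofReal_mul (by have := ouSd_nonneg c D T; positivity)]
  refine ofReal_le_ofReal ?_
  have h2 : bracket (exp (-(c * r)) • w) ≤ bracket w := by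
    refine bracket_mono ?_
    rw [norm_smul, norm_of_nonneg (exp_pos _).le]
    exact mul_le_of_le_one_left (norm_nonneg _) (exp_le_one_iff.2 (by nlinarith [hr.1]))
  calc ∫ z, bracket (ouM c D r w z) ^ j ∂gauss d
      ≤ ∫ z, (2 * (1 + ouSd c D T) * bracket w) ^ j * bracket z ^ j ∂gauss d := by
        refine integral_mono (integrable_gauss_add_pow hσ _ j) ((integrable_gauss_bracket_pow j).const_mul _) fun z => ?_
        have h0 := bracket_pos (ouM c D r w z)
        have h0' := bracket_pos z
        have h0'' := bracket_pos w
        have hm := ouSd_mono hc hD hr.2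
        have hT := ouSd_nonneg c D T
        have h1 := bracket_pos (exp (-(c * r)) • w)
        simp only [← mul_pow]
        gcongr
        refine (bracket_add_smul_le hσ _ _).trans ?_
        gcongr
    _ = _ := by rw [integral_const_mul, mul_pow]; ring

lemma lintegral_enorm_duhamel_le (c D lam a t : ℝ) (hh : Measurable (uncurry h)) (hΦ : Measurable Φ) :
    ∫⁻ v, ‖duhamel c D lam a h t v‖ₑ * Φ v ≤ ∫⁻ s in Ioc a t, ofReal (exp (-(lam * (t - s)))) * ∫⁻ w, ‖h s w‖ₑ * ouDualL c D (t - s) Φ w := by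
  have hm : Measurable fun p : Vel d × ℝ => ‖ou c D lam (t - p.2) (h p.2) p.1‖ₑ * Φ p.1 := by
    refine (Measurable.enorm ?_).mul (hΦ.comp measurable_fst)
    exact measurable_ou_comp (H := fun p : Vel d × ℝ => h p.2) c D lam
        (hh.comp ((by fun_prop : Measurable fun q : (Vel d × ℝ) × Vel d => (q.1.2, q.2)))) (by fun_prop) (by fun_prop)
  calc ∫⁻ v, ‖duhamel c D lam a h t v‖ₑ * Φ v
      ≤ ∫⁻ v, ∫⁻ s in Ioc a t, ‖ou c D lam (t - s) (h s) v‖ₑ * Φ v := by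
        refine lintegral_mono fun v => ?_
        rw [lintegral_mul_const _ ((measurable_ou_comp (H := fun s => h s) c D lam hh (by fun_prop) measurable_const).enorm)]
        gcongr
        exact enorm_integral_le_lintegral_enorm _
    _ = ∫⁻ s in Ioc a t, ∫⁻ v, ‖ou c D lam (t - s) (h s) v‖ₑ * Φ v := lintegral_lintegral_swap hm.aemeasurable
    _ ≤ _ := lintegral_mono fun s => lintegral_enorm_ou_le c D lam (t - s) (hh.comp measurable_prodMk_left) hΦ

end OU

/-! ### The semigroup on test functions -/

section TestFunctions

lemma two_le_infty : (2 : WithTop ℕ∞) ≤ ((⊤ : ℕ∞) : WithTop ℕ∞) := by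
  exact ENat.LEInfty.out

lemma IsTestFunction.exists_bound (hφ : IsTestFunction φ) : ∃ C, ∀ v, |φ v| ≤ C := hφ.2.exists_bound_of_continuous hφ.1.continuous

lemma IsTestFunction.fderiv_apply (hφ : IsTestFunction φ) (e : Vel d) : IsTestFunction fun v => fderiv ℝ φ v e :=
  ⟨(hφ.1.fderiv_right (m := ∞) (by simp)).clm_apply contDiff_const, (hφ.2.fderiv ℝ).mono fun v hv => by
      intro h; apply hv; simp [h]⟩

lemma IsTestFunction.fderiv_apply_self (hφ : IsTestFunction φ) : IsTestFunction fun v => fderiv ℝ φ v v :=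
  ⟨(hφ.1.fderiv_right (m := ∞) (by simp)).clm_apply contDiff_id, (hφ.2.fderiv ℝ).mono fun v hv => by
      intro h; apply hv; simp [h]⟩

lemma IsTestFunction.add (hφ : IsTestFunction φ) (hψ : IsTestFunction ψ) : IsTestFunction fun v => φ v + ψ v := ⟨hφ.1.add hψ.1, hφ.2.add hψ.2⟩

lemma IsTestFunction.const_mul (hφ : IsTestFunction φ) (c : ℝ) : IsTestFunction fun v => c * φ v := ⟨contDiff_const.mul hφ.1, hφ.2.mul_left⟩

lemma IsTestFunction.sum {ι : Type*} (s : Finset ι) {φ : ι → Fn d} (h : ∀ i ∈ s, IsTestFunction (φ i)) : IsTestFunction fun v => ∑ i ∈ s, φ i v := by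
  classical
  induction s using Finset.induction_on with
  | empty => exact ⟨by simpa using contDiff_const, (HasCompactSupport.zero : HasCompactSupport (0 : Fn d))⟩
  | insert i s hi ih =>
    simp only [Finset.sum_insert hi]
    exact (h i (by simp)).add (ih fun j hj => h j (by simp [hj]))

lemma laplacian_eq_sum (hφ : ContDiff ℝ 2 φ) (v : Vel d) : laplacian φ v = ∑ i : Fin d,
      fderiv ℝ (fun x => fderiv ℝ φ x (single i 1)) v (single i 1) := by
  rw [InnerProductSpace.laplacian_eq_iteratedFDeriv_orthonormalBasis φ (basisFun (Fin d) ℝ)]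
  refine sum_congr rfl fun i _ => ?_
  rw [iteratedFDeriv_two_apply, basisFun_apply]
  rw [fderiv_clm_apply ((hφ.fderiv_right (m := 1) (by norm_num)).differentiable one_ne_zero v) (differentiableAt_const _)]
  simp

lemma IsTestFunction.laplacian (hφ : IsTestFunction φ) : IsTestFunction (Laplacian.laplacian φ) := by
  have : Laplacian.laplacian φ = fun v => ∑ i : Fin d, fderiv ℝ (fun x => fderiv ℝ φ x (single i 1)) v (single i 1) :=
    funext fun v => laplacian_eq_sum (hφ.1.of_le two_le_infty) v
  rw [this]
  exact IsTestFunction.sum _ fun i _ => (hφ.fderiv_apply _).fderiv_apply _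

/-- The adjoint generator `D Δφ - c v·∇φ - lam φ`. -/
def genAdj (c D lam : ℝ) (φ : Fn d) (v : Vel d) : ℝ := D * laplacian φ v - c * fderiv ℝ φ v v - lam * φ v

lemma IsTestFunction.genAdj (hφ : IsTestFunction φ) (c D lam : ℝ) : IsTestFunction (genAdj c D lam φ) := by
  have := ((hφ.laplacian.const_mul D).add (hφ.fderiv_apply_self.const_mul (-c))).add (hφ.const_mul (-lam))
  convert this using 1
  ext v; simp only [KineticSmoluchowski.genAdj]; ring

lemma IsTestFunction.fderiv_bound (hφ : IsTestFunction φ) : ∃ C, 0 ≤ C ∧ ∀ v, ‖fderiv ℝ φ v‖ ≤ C := by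
  obtain ⟨C, hC⟩ := (hφ.2.fderiv ℝ).exists_bound_of_continuous (hφ.1.continuous_fderiv (by simp))
  exact ⟨C, (norm_nonneg _).trans (hC 0), hC⟩

/-- Gaussian integration by parts in each coordinate (Stein's identity). It converts a change of the
standard deviation into a Laplacian. -/
lemma gauss_fderiv_self (hφ : IsTestFunction φ) (x : Vel d) (σ : ℝ) : ∫ z, fderiv ℝ φ (x + σ • z) z ∂gauss d =
      σ * ∫ z, laplacian φ (x + σ • z) ∂gauss d := by
  set e : Fin d → Vel d := fun i => single i 1
  have hz : ∀ z : Vel d, z = ∑ i, inner ℝ z (e i) • e i := fun z => by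
    have := (basisFun (Fin d) ℝ).sum_repr' z
    simp only [basisFun_apply] at this
    conv_lhs => rw [← this]
    simp only [real_inner_comm, e]
  have hcd : ∀ i, ContDiff ℝ ∞ (fun z => fderiv ℝ φ (x + σ • z) (e i)) := fun i =>
    (hφ.fderiv_apply (e i)).1.comp (by fun_prop)
  have hd : ∀ i z, fderiv ℝ (fun z => fderiv ℝ φ (x + σ • z) (e i)) z (e i) = σ * fderiv ℝ (fun y => fderiv ℝ φ y (e i)) (x + σ • z) (e i) := by
    intro i z
    have h1 : HasFDerivAt (fun z : Vel d => x + σ • z) (σ • ContinuousLinearMap.id ℝ (Vel d)) z := ((hasFDerivAt_id z).const_smul σ).const_add x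
    have h2 := (((hφ.fderiv_apply (e i)).1.differentiable (by simp)) (x + σ • z)).hasFDerivAt.comp z h1
    have h3 : fderiv ℝ (fun z => fderiv ℝ φ (x + σ • z) (e i)) z = _ := h2.fderiv
    rw [h3]
    simp
  obtain ⟨C, hC0, hC⟩ := hφ.fderiv_bound
  have hCi : ∀ i z, |fderiv ℝ φ (x + σ • z) (e i)| ≤ C := fun i z => by
    refine ((fderiv ℝ φ (x + σ • z)).le_opNorm (e i)).trans ?_
    simpa [e] using hC (x + σ • z)
  have parts : ∀ i, ∫ z, inner ℝ z (e i) * fderiv ℝ φ (x + σ • z) (e i) ∂gauss d =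
      ∫ z, σ * fderiv ℝ (fun y => fderiv ℝ φ y (e i)) (x + σ • z) (e i) ∂gauss d := by
    intro i
    obtain ⟨C', hC'0, hC'⟩ := (hφ.fderiv_apply (e i)).fderiv_bound
    have hb : ∀ z, ‖fderiv ℝ (fun z => fderiv ℝ φ (x + σ • z) (e i)) z‖ ≤ C' * |σ| := by
      intro z
      have h1 : HasFDerivAt (fun z : Vel d => x + σ • z) (σ • ContinuousLinearMap.id ℝ (Vel d)) z := ((hasFDerivAt_id z).const_smul σ).const_add x
      have h2 := (((hφ.fderiv_apply (e i)).1.differentiable (by simp)) (x + σ • z)).hasFDerivAt.comp z h1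
      have h3 : fderiv ℝ (fun z => fderiv ℝ φ (x + σ • z) (e i)) z = _ := h2.fderiv
      rw [h3]
      refine (ContinuousLinearMap.opNorm_comp_le _ _).trans ?_
      gcongr
      · exact hC' _
      · refine (norm_smul_le _ _).trans ?_
        rw [norm_eq_abs]
        exact mul_le_of_le_one_right (abs_nonneg _) ContinuousLinearMap.norm_id_le
    have := gauss_integration_by_parts (C := max C (C' * |σ|)) ((hcd i).of_le (by exact_mod_cast le_top))
      (fun z => (hCi i z).trans (le_max_left _ _)) (fun z => (hb z).trans (le_max_right _ _)) (e i)
    rw [this]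
    simp only [hd]
  have ii1 : ∀ i, Integrable (fun z => inner ℝ z (e i) * fderiv ℝ φ (x + σ • z) (e i)) (gauss d) := by
    intro i
    refine integrable_gauss_of_le ((by fun_prop : Continuous fun z : Vel d => inner ℝ z (e i)).mul
      (hcd i).continuous).measurable C 1 fun z => ?_
    rw [abs_mul, mul_comm, pow_one]
    gcongr
    · exact hCi i z
    · refine (abs_real_inner_le_norm _ _).trans ?_
      simpa [e] using norm_le_bracket z
  have ii2 : ∀ i, Integrable (fun z => fderiv ℝ (fun y => fderiv ℝ φ y (e i)) (x + σ • z) (e i)) (gauss d) := by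
    intro i
    obtain ⟨C', hC'⟩ := ((hφ.fderiv_apply (e i)).fderiv_apply (e i)).exists_bound
    refine integrable_gauss_of_le ?_ C' 0 fun z => by simpa using hC' _
    exact (((hφ.fderiv_apply (e i)).fderiv_apply (e i)).1.continuous.comp (by fun_prop)).measurable
  calc ∫ z, fderiv ℝ φ (x + σ • z) z ∂gauss d
      = ∫ z, ∑ i, inner ℝ z (e i) * fderiv ℝ φ (x + σ • z) (e i) ∂gauss d := by
        refine integral_ext fun z => ?_
        conv_lhs => rw [hz z]
        rw [map_sum, ← hz z]
        simp
    _ = ∑ i, ∫ z, σ * fderiv ℝ (fun y => fderiv ℝ φ y (e i)) (x + σ • z) (e i) ∂gauss d := by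
        rw [integral_finsetSum _ fun i _ => ii1 i]
        exact sum_congr rfl fun i _ => parts i
    _ = σ * ∫ z, laplacian φ (x + σ • z) ∂gauss d := by
        simp only [laplacian_eq_sum (hφ.1.of_le two_le_infty)]
        rw [integral_finsetSum _ fun i _ => ii2 i, mul_sum]
        simp only [integral_const_mul, e]

lemma integrable_gauss_test (hφ : IsTestFunction φ) (x : Vel d) (σ : ℝ) : Integrable (fun z => φ (x + σ • z)) (gauss d) := by
  obtain ⟨C, hC⟩ := hφ.exists_bound
  exact integrable_gauss_of_le (hφ.1.continuous.comp (by fun_prop)).measurable C 0 fun z => by simpa using hC _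

/-- Up to scalings this is the convolution of `φ` with the law of `-σz`. Smoothness comes from `φ`
alone, so the degenerate case `σ = 0` is included. -/
lemma contDiff_ouDual (hφ : IsTestFunction φ) (c D lam r : ℝ) : ContDiff ℝ ∞ (ouDual c D lam r φ) := by
  set σ := ouSd c D r
  set ν : Measure (Vel d) := (gauss d).map (fun z => -(σ • z))
  have hm : Measurable fun z : Vel d => -(σ • z) := by fun_prop
  have : IsProbabilityMeasure ν := Measure.isProbabilityMeasure_map hm.aemeasurable
  have h1 := hφ.2.contDiff_convolution_right (μ := ν) (f := fun _ => (1 : ℝ)) (n := ⊤) (ContinuousLinearMap.mul ℝ ℝ) (locallyIntegrable_const 1) hφ.1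
  have h2 : ouDual c D lam r φ = fun w => exp (-(lam * r)) *
      (convolution (fun _ => (1 : ℝ)) φ (ContinuousLinearMap.mul ℝ ℝ) ν) (exp (-(c * r)) • w) := by
    ext w
    rw [ouDual, convolution_def, integral_map hm.aemeasurable]
    · simp [σ]
    · exact (by have := hφ.1.continuous; fun_prop : Continuous _).aestronglyMeasurable
  rw [h2]
  exact contDiff_const.mul (h1.comp (contDiff_const_smul _))

lemma fderiv_ouDual (hφ : IsTestFunction φ) (c D lam r : ℝ) (w e : Vel d) : fderiv ℝ (ouDual c D lam r φ) w e =
      exp (-(c * r)) * ouDual c D lam r (fun v => fderiv ℝ φ v e) w := by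
  set σ := ouSd c D r
  set ε := exp (-(c * r))
  obtain ⟨C, hC0, hC⟩ := hφ.fderiv_bound
  have hf : ∀ w z, HasFDerivAt (fun w => φ (ε • w + σ • z)) (ε • fderiv ℝ φ (ε • w + σ • z)) w := by
    intro w z
    have h1 : HasFDerivAt (fun w : Vel d => ε • w + σ • z) (ε • ContinuousLinearMap.id ℝ (Vel d)) w := ((hasFDerivAt_id w).const_smul ε).add_const _
    have h2 := ((hφ.1.differentiable (by simp)) (ε • w + σ • z)).hasFDerivAt.comp w h1
    refine h2.congr_fderiv ?_
    ext y; simp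
  have hfc : Continuous (fderiv ℝ φ) := hφ.1.continuous_fderiv (by simp)
  have hint : Integrable (fun z => ε • fderiv ℝ φ (ε • w + σ • z)) (gauss d) := by
    refine (integrable_const (ε * C)).mono' (by fun_prop : Continuous _).aestronglyMeasurable (of_forall fun z => ?_)
    rw [norm_smul, norm_of_nonneg (exp_pos _).le]
    exact mul_le_mul_of_nonneg_left (hC _) (exp_pos _).le
  have h := hasFDerivAt_integral_of_dominated_of_fderiv_le (μ := gauss d) (s := univ) (x₀ := w)
    (F := fun w z => φ (ε • w + σ • z)) (F' := fun w z => ε • fderiv ℝ φ (ε • w + σ • z)) (bound := fun _ => ε * C) univ_mem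
    (of_forall fun w => (integrable_gauss_test hφ _ _).aestronglyMeasurable) (integrable_gauss_test hφ _ _) hint.aestronglyMeasurable
    (of_forall fun z w _ => by
      rw [norm_smul, norm_of_nonneg (exp_pos _).le]
      exact mul_le_mul_of_nonneg_left (hC _) (exp_pos _).le)
    (integrable_const _) (of_forall fun z w _ => hf w z)
  have h2 := (h.const_mul (exp (-(lam * r)))).fderiv
  change fderiv ℝ (fun w => exp (-(lam * r)) * ∫ z, φ (ε • w + σ • z) ∂gauss d) w e = _
  rw [h2]
  simp only [smul_apply, smul_eq_mul]
  rw [ContinuousLinearMap.integral_apply hint]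
  simp only [smul_apply, smul_eq_mul, ouDual]
  rw [integral_const_mul]
  ring

lemma laplacian_ouDual (hφ : IsTestFunction φ) (c D lam r : ℝ) (w : Vel d) : laplacian (ouDual c D lam r φ) w =
      exp (-(2 * c * r)) * ouDual c D lam r (laplacian φ) w := by
  have hsm := contDiff_ouDual hφ c D lam r
  rw [laplacian_eq_sum (hsm.of_le two_le_infty)]
  have h1 : ∀ i : Fin d, fderiv ℝ (fun x => fderiv ℝ (ouDual c D lam r φ) x (single i 1)) w
      (single i 1) = exp (-(2 * c * r)) * ouDual c D lam r (fun v =>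
        fderiv ℝ (fun x => fderiv ℝ φ x (single i 1)) v (single i 1)) w := by
    intro i
    simp only [fderiv_ouDual hφ]
    have hs2 := contDiff_ouDual (hφ.fderiv_apply (single i 1)) c D lam r
    rw [fderiv_const_mul (hs2.differentiable (by simp) w)]
    simp only [smul_apply, smul_eq_mul]
    rw [fderiv_ouDual (hφ.fderiv_apply _), ← mul_assoc, ← exp_add]
    ring_nf
  simp only [h1, ← mul_sum]
  congr 1
  simp only [ouDual, laplacian_eq_sum (hφ.1.of_le two_le_infty)]
  rw [integral_finsetSum _ fun i _ => integrable_gauss_test ((hφ.fderiv_apply _).fderiv_apply _) _ _, mul_sum]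

/-- The drift at `e^{-cr}w + σz` splits into a `w`-part and a `z`-part. Stein's identity turns the
latter into `cσ²` times a Laplacian, and `D - cσ² = D e^{-2cr}`. -/
lemma ouDual_genAdj (hφ : IsTestFunction φ) (hc : 0 < c) (hD : 0 < D) (hr : 0 ≤ r) (lam : ℝ) (w : Vel d) :
    ouDual c D lam r (genAdj c D lam φ) w = exp (-(lam * r)) * (D * exp (-(2 * c * r)) * (∫ z, laplacian φ (ouM c D r w z) ∂gauss d)
       - c * exp (-(c * r)) * (∫ z, fderiv ℝ φ (ouM c D r w z) w ∂gauss d)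
       - lam * ∫ z, φ (ouM c D r w z) ∂gauss d) := by
  set σ := ouSd c D r with hσ
  set ε := exp (-(c * r))
  have i1 := integrable_gauss_test hφ.laplacian (ε • w) σ
  have i2 := integrable_gauss_test hφ.fderiv_apply_self (ε • w) σ
  have i3 := integrable_gauss_test hφ (ε • w) σ
  have i4 := integrable_gauss_test (hφ.fderiv_apply w) (ε • w) σ
  have i5 : Integrable (fun z => fderiv ℝ φ (ε • w + σ • z) z) (gauss d) := by
    obtain ⟨C, hC0, hC⟩ := hφ.fderiv_bound
    have hfc : Continuous (fderiv ℝ φ) := hφ.1.continuous_fderiv (by simp)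
    refine integrable_gauss_of_le (by fun_prop : Continuous _).measurable C 1 fun z => ?_
    refine ((fderiv ℝ φ (ε • w + σ • z)).le_opNorm z).trans ?_
    rw [pow_one]
    gcongr
    · exact hC _
    · exact norm_le_bracket z
  have e1 : ∫ z, fderiv ℝ φ (ε • w + σ • z) (ε • w + σ • z) ∂gauss d = ε * (∫ z, fderiv ℝ φ (ε • w + σ • z) w ∂gauss d) +
        σ * (σ * ∫ z, laplacian φ (ε • w + σ • z) ∂gauss d) := by
    rw [← gauss_fderiv_self hφ, ← integral_const_mul, ← integral_const_mul, ← integral_add (i4.const_mul ε) (i5.const_mul σ)]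
    simp
  have e2 : σ * σ = D / c * (1 - exp (-(2 * c * r))) := by
    rw [← sq, hσ, ouSd_sq hc hD hr, ouVar]
  simp only [ouDual, genAdj]
  have i12 : Integrable (fun z => D * laplacian φ (ε • w + σ • z) -
      c * fderiv ℝ φ (ε • w + σ • z) (ε • w + σ • z)) (gauss d) := (i1.const_mul D).sub (i2.const_mul c)
  rw [integral_sub i12 (i3.const_mul lam), integral_sub (i1.const_mul D) (i2.const_mul c), integral_const_mul, integral_const_mul,
    integral_const_mul, e1, ← mul_assoc σ, e2]
  congr 1
  field_simp
  ring

lemma genAdj_ouDual (hφ : IsTestFunction φ) (hc : 0 < c) (hD : 0 < D) (hr : 0 ≤ r) (lam : ℝ) (w : Vel d) :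
    genAdj c D lam (ouDual c D lam r φ) w = ouDual c D lam r (genAdj c D lam φ) w := by
  rw [ouDual_genAdj hφ hc hD hr, genAdj, laplacian_ouDual hφ, fderiv_ouDual hφ]
  simp only [ouDual]
  ring

/-- Restricted to `r > 0`, because `σ` behaves like a square root at zero. From `σ'σ = D e^{-2cr}`
and Stein's identity the derivative matches the expansion in `ouDual_genAdj`. -/
lemma hasDerivAt_ouDual (hφ : IsTestFunction φ) (hc : 0 < c) (hD : 0 < D) (hr : 0 < r) (lam : ℝ) (w : Vel d) :
    HasDerivAt (fun r => ouDual c D lam r φ w) (ouDual c D lam r (genAdj c D lam φ) w) r := by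
  set σ' : ℝ → ℝ := fun r => D * exp (-(2 * c * r)) / ouSd c D r
  have hV : ∀ r, HasDerivAt (ouVar c D) (2 * D * exp (-(2 * c * r))) r := by
    intro r
    have h1 : HasDerivAt (fun r : ℝ => -(2 * c * r)) (-(2 * c)) r := by
      convert! (hasDerivAt_mul_const (x := r) (-(2 * c))) using 1; ext; ring
    have h2 := (h1.exp.const_sub 1).const_mul (D / c)
    refine h2.congr_deriv ?_
    field_simp
  have hσ : ∀ r, 0 < r → HasDerivAt (ouSd c D) (σ' r) r := by
    intro r hr
    have := (hV r).sqrt (ouVar_pos hc hD hr).ne'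
    refine this.congr_deriv ?_
    simp only [σ', ouSd]
    field_simp
  have hε : ∀ r, HasDerivAt (fun r => exp (-(c * r))) (-c * exp (-(c * r))) r := by
    intro r
    have h1 : HasDerivAt (fun r : ℝ => -(c * r)) (-c) r := by
      convert! (hasDerivAt_mul_const (x := r) (-c)) using 1; ext; ring
    refine h1.exp.congr_deriv (by ring)
  obtain ⟨C, hC0, hC⟩ := hφ.fderiv_bound
  have hfc : Continuous (fderiv ℝ φ) := hφ.1.continuous_fderiv (by simp)
  set F' : ℝ → Fn d := fun r z => fderiv ℝ φ (ouM c D r w z) ((-c * exp (-(c * r))) • w + σ' r • z)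
  have hs0 : 0 < ouSd c D (r / 2) := ouSd_pos hc hD (half_pos hr)
  -- On times above `r/2` the derivative of `σ` is bounded, so a multiple of `⟨z⟩` dominates.
  have hbd : ∀ z, ∀ x ∈ Ioi (r / 2), ‖F' x z‖ ≤ C * (c * ‖w‖ + D / ouSd c D (r / 2)) * bracket z ^ 1 := by
    intro z x hx
    have hx0 : 0 < x := (half_pos hr).trans hx
    refine ((fderiv ℝ φ _).le_opNorm _).trans ?_
    rw [mul_assoc]
    refine mul_le_mul (hC _) ?_ (norm_nonneg _) hC0
    have hx1 : exp (-(c * x)) ≤ 1 := exp_le_one_iff.2 (by nlinarith)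
    have hx2 : exp (-(2 * c * x)) ≤ 1 := exp_le_one_iff.2 (by nlinarith)
    have hσ'0 : 0 ≤ σ' x := by
      have := ouSd_nonneg c D x
      simp only [σ']; positivity
    have hσ'1 : σ' x ≤ D / ouSd c D (r / 2) := by
      simp only [σ']
      have := ouSd_mono hc hD (le_of_lt hx)
      gcongr
      nlinarith
    have hz := norm_le_bracket z
    have hz1 := one_le_bracket z
    calc ‖(-c * exp (-(c * x))) • w + σ' x • z‖
        ≤ (c * exp (-(c * x))) * ‖w‖ + σ' x * ‖z‖ := by
          refine (norm_add_le _ _).trans ?_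
          rw [norm_smul, norm_smul, norm_of_nonneg hσ'0, norm_mul, norm_neg, norm_of_nonneg hc.le, norm_of_nonneg (exp_pos _).le]
      _ ≤ (c * 1) * ‖w‖ + D / ouSd c D (r / 2) * bracket z := by gcongr
      _ ≤ _ := by nlinarith [mul_nonneg hc.le (norm_nonneg w)]
  have h := (hasDerivAt_integral_of_dominated_loc_of_deriv_le (μ := gauss d) (x₀ := r) (s := Ioi (r / 2))
    (F := fun r z => φ (ouM c D r w z)) (F' := F') (bound := fun z => C * (c * ‖w‖ + D / ouSd c D (r / 2)) * bracket z ^ 1)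
    (Ioi_mem_nhds (by linarith)) (of_forall fun r => (integrable_gauss_test hφ _ _).aestronglyMeasurable) (integrable_gauss_test hφ _ _)
    (by fun_prop : Continuous _).aestronglyMeasurable (of_forall fun z x hx => hbd z x hx) ((integrable_gauss_bracket_pow 1).const_mul _)
    (of_forall fun z x hx => by
      have hx0 : 0 < x := (half_pos hr).trans hx
      have h1 := ((hε x).smul_const w).add ((hσ x hx0).smul_const z)
      exact ((hφ.1.differentiable (by simp)) _).hasFDerivAt.comp_hasDerivAt x h1)).2
  have hl : HasDerivAt (fun r : ℝ => exp (-(lam * r))) (-lam * exp (-(lam * r))) r := by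
    have h1 : HasDerivAt (fun r : ℝ => -(lam * r)) (-lam) r := by
      convert! (hasDerivAt_mul_const (x := r) (-lam)) using 1; ext; ring
    refine h1.exp.congr_deriv (by ring)
  refine (hl.mul h).congr_deriv ?_
  have i4 := integrable_gauss_test (hφ.fderiv_apply w) (exp (-(c * r)) • w) (ouSd c D r)
  have i5 : Integrable (fun z => fderiv ℝ φ (ouM c D r w z) z) (gauss d) := by
    refine integrable_gauss_of_le (by fun_prop : Continuous _).measurable C 1 fun z => ?_
    refine ((fderiv ℝ φ _).le_opNorm z).trans ?_
    rw [pow_one]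
    gcongr
    · exact hC _
    · exact norm_le_bracket z
  have e1 : ∫ z, F' r z ∂gauss d = -c * exp (-(c * r)) * (∫ z, fderiv ℝ φ (ouM c D r w z) w ∂gauss d) +
      σ' r * (ouSd c D r * ∫ z, laplacian φ (ouM c D r w z) ∂gauss d) := by
    rw [← gauss_fderiv_self hφ, ← integral_const_mul, ← integral_const_mul, ← integral_add (i4.const_mul _) (i5.const_mul _)]
    simp [F']
  have hsr := ouSd_pos hc hD hr
  have e2 : σ' r * ouSd c D r = D * exp (-(2 * c * r)) := by
    simp only [σ']; field_simp
  rw [ouDual_genAdj hφ hc hD hr.le, e1, ← mul_assoc (σ' r), e2]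
  ring

lemma continuous_ouDual_time (hφ : IsTestFunction φ) (c D lam : ℝ) (w : Vel d) : Continuous fun r => ouDual c D lam r φ w := by
  unfold ouDual
  refine (by fun_prop : Continuous fun r : ℝ => exp (-(lam * r))).mul ?_
  obtain ⟨C, hC⟩ := hφ.exists_bound
  have := hφ.1.continuous
  exact continuous_of_dominated (bound := fun _ => C) (fun r => (integrable_gauss_test hφ _ _).aestronglyMeasurable)
    (fun r => of_forall fun z => hC _) (integrable_const _) (of_forall fun z => by fun_prop)

@[simp] lemma ouDual_zero (c D lam : ℝ) (φ : Fn d) (w : Vel d) : ouDual c D lam 0 φ w = φ w := by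
  simp [ouDual]

/-- Differentiability is available only for positive times; continuity up to zero suffices for the
fundamental theorem of calculus. -/
lemma integral_ouDual_genAdj (hφ : IsTestFunction φ) (hc : 0 < c) (hD : 0 < D) (hr : 0 ≤ r) (lam : ℝ) (w : Vel d) :
    ∫ s in (0)..r, ouDual c D lam s (genAdj c D lam φ) w = ouDual c D lam r φ w - φ w := by
  have := intervalIntegral.integral_eq_sub_of_hasDerivAt_of_le hr (continuous_ouDual_time hφ c D lam w).continuousOn
    (fun s hs => hasDerivAt_ouDual hφ hc hD hs.1 lam w) ((continuous_ouDual_time (hφ.genAdj c D lam) c D lam w).intervalIntegrable _ _)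
  rw [this, ouDual_zero]

end TestFunctions

/-! ### Weak and mild solutions of the linear equation -/

section Linear

variable {f : Fn d}

/-- The `L²` pairing. -/
def pair (g ψ : Fn d) : ℝ := ∫ v, g v * ψ v

/-- `u` is jointly measurable and bounded in `L¹_j` uniformly over the times in `S`. -/
def UnifL1 (S : Set ℝ) (j : ℕ) (u : ℝ → Fn d) : Prop := Measurable (uncurry u) ∧ ∃ C : ℝ≥0, ∀ s ∈ S, nrm j (u s) ≤ C

scoped notation:max "UL" a:max T:max => UnifL1 (Icc a T)

/-- Uniform bounds on `[0, T]` for all members of the family. -/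
abbrev Unif (T : ℝ) (j : ℕ) (f : Fam d) : Prop := ∀ m, UnifL1 (Icc 0 T) j (f m)

/-- The weak form of `∂_t u = c div(v u) + D Δu - lam u + h`, `u(a) = u₀`, integrated from `a` to `t`. -/
def LinWeakAt (c D lam a : ℝ) (u₀ : Fn d) (u h : ℝ → Fn d) (t : ℝ) : Prop := ∀ φ, IsTestFunction φ → pair (u t) φ =
    pair u₀ φ + ∫ s in a..t, (pair (u s) (genAdj c D lam φ) + pair (h s) φ)

lemma UnifL1.measurable_apply (hu : UnifL1 S j u) (s : ℝ) : Measurable (u s) := hu.1.comp measurable_prodMk_left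

lemma UnifL1.mono_weight (hu : UnifL1 S j u) (h : i ≤ j := by norm_num) : UnifL1 S i u := by
  obtain ⟨hm, C, hC⟩ := hu
  refine ⟨hm, C, fun s hs => (lintegral_mono fun v => ?_).trans (hC s hs)⟩
  gcongr
  exact wt_mono h v

lemma UnifL1.mono_set {S' : Set ℝ} (hu : UnifL1 S j u) (h : S' ⊆ S) : UnifL1 S' j u := ⟨hu.1, hu.2.imp fun _ hC s hs => hC s (h hs)⟩

lemma integrable_of_wt (hg : Measurable g) (h : nrm j g < ⊤) : Integrable fun v => g v * bracket v ^ j := by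
  refine ⟨(hg.mul (by fun_prop)).aestronglyMeasurable, ?_⟩
  refine lt_of_le_of_lt (lintegral_mono fun v => ?_) h
  rw [enorm_mul, enorm_of_nonneg (pow_nonneg (bracket_pos v).le j)]
  rfl

lemma UnifL1.integrable_mul (hu : UnifL1 S j u) (hs : s ∈ S) : Integrable fun v => u s v * bracket v ^ j := by
  obtain ⟨C, hC⟩ := hu.2
  exact integrable_of_wt (hu.measurable_apply s) ((hC s hs).trans_lt coe_lt_top)

lemma UnifL1.integrable (hu : UnifL1 S j u) (hs : s ∈ S) : Integrable (u s) := by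
  simpa using (hu.mono_weight (Nat.zero_le j)).integrable_mul hs

lemma UnifL1.nrm_ne_top (hu : UnifL1 S j u) (ht : t ∈ S) (h : i ≤ j := by norm_num) : nrm i (u t) ≠ ⊤ := by
  obtain ⟨-, C, hC⟩ := hu.mono_weight h
  exact ((hC t ht).trans_lt coe_lt_top).ne

lemma UnifL1.exists_pair_bound (hu : UnifL1 S j u) : ∃ C : ℝ, 0 ≤ C ∧ ∀ s ∈ S, ∀ (ψ : Fn d) (K : ℝ), (∀ v, |ψ v| ≤ K * bracket v ^ j) →
      |pair (u s) ψ| ≤ C * K := by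
  obtain ⟨C, hC⟩ := hu.2
  refine ⟨C, C.2, fun s hs ψ K hK => ?_⟩
  have hK0 : 0 ≤ K := by
    have h1 := (abs_nonneg _).trans (hK 0)
    have h2 := pow_pos (bracket_pos (0 : Vel d)) j
    exact nonneg_of_mul_nonneg_left h1 h2
  have h1 : ‖pair (u s) ψ‖ₑ ≤ ofReal (C * K) := by
    calc ‖pair (u s) ψ‖ₑ ≤ ∫⁻ v, ‖u s v * ψ v‖ₑ := enorm_integral_le_lintegral_enorm _
      _ ≤ ∫⁻ v, ofReal K * (‖u s v‖ₑ * wt d j v) := by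
          refine lintegral_mono fun v => ?_
          rw [enorm_mul, mul_left_comm]
          gcongr
          rw [enorm_eq_ofReal_abs, wt, ← ofReal_mul hK0]
          exact ofReal_le_ofReal (hK v)
      _ ≤ ofReal K * C := by
          have hm : Measurable fun v => ‖u s v‖ₑ * wt d j v := (hu.measurable_apply s).enorm.mul (measurable_wt j)
          rw [lintegral_const_mul _ hm]
          gcongr
          exact hC s hs
      _ = ofReal (C * K) := by
          rw [ofReal_mul (NNReal.coe_nonneg C), mul_comm, ENNReal.ofReal_coe_nnreal]
  rw [enorm_eq_ofReal_abs] at h1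
  exact (ofReal_le_ofReal_iff (mul_nonneg C.2 hK0)).1 h1

lemma measurable_pair_comp (hu : Measurable (uncurry u)) {s : X → ℝ} (hs : Measurable s) {ψ : X → Fn d}
    (hψ : Measurable (uncurry ψ)) : Measurable fun x => pair (u (s x)) (ψ x) := by
  have : Measurable fun p : X × Vel d => u (s p.1) p.2 * ψ p.1 p.2 :=
    (hu.comp (g := uncurry u) (f := fun p : X × Vel d => (s p.1, p.2)) (by fun_prop)).mul hψ
  exact this.stronglyMeasurable.integral_prod_right'.measurable

/-- The parameter space is general so that the lemma serves for single times and for the pairs of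
times in the triangle argument. -/
lemma integrableOn_pair_ouDual {μ : Measure X} {A : Set X} (hA : MeasurableSet A) (hμ : μ A < ⊤) (hu : UnifL1 S 0 u)
    (hφ : IsTestFunction φ) (c D lam : ℝ) {q r : X → ℝ} (hq : Measurable q) (hr : Measurable r) (hqS : ∀ x ∈ A, q x ∈ S) (hR : ∀ x ∈ A, |r x| ≤ R) :
    IntegrableOn (fun x => pair (u (q x)) (ouDual c D lam (r x) φ)) A μ := by
  obtain ⟨C, hC0, hC⟩ := hu.exists_pair_bound
  obtain ⟨K, hK⟩ := hφ.exists_bound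
  have hK0 : 0 ≤ K := (abs_nonneg _).trans (hK 0)
  refine Measure.integrableOn_of_bounded (M := C * (exp (|lam| * R) * K)) hμ.ne ?_ ?_
  · have hψ : Measurable (uncurry fun x => ouDual c D lam (r x) φ) :=
      measurable_ouDual_comp (r := fun p : X × Vel d => r p.1) c D lam hφ.1.continuous.measurable (hr.comp measurable_fst) measurable_snd
    exact (measurable_pair_comp hu.1 hq hψ).aestronglyMeasurable
  · filter_upwards [ae_restrict_mem hA] with x hx
    refine hC _ (hqS x hx) _ _ fun v => ?_
    rw [pow_zero, mul_one]
    refine (abs_ouDual_le c D lam _ hK v).trans ?_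
    gcongr
    calc -(lam * r x) ≤ |lam * r x| := neg_le_abs _
      _ = |lam| * |r x| := abs_mul _ _
      _ ≤ _ := by gcongr; exact hR x hx

lemma integral_pair_ouDual (hg : Measurable g) (hi : Integrable g) (hφ : IsTestFunction φ) (hc : 0 < c) (hD : 0 < D) (hr : 0 ≤ r) (lam : ℝ) :
    ∫ s in (0)..r, pair g (ouDual c D lam s (genAdj c D lam φ)) = pair g (ouDual c D lam r φ) - pair g φ := by
  obtain ⟨K, hK⟩ := (hφ.genAdj c D lam).exists_bound
  obtain ⟨K', hK'⟩ := hφ.exists_bound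
  have hm : Measurable fun p : ℝ × Vel d => g p.2 * ouDual c D lam p.1 (genAdj c D lam φ) p.2 :=
    (hg.comp measurable_snd).mul (measurable_ouDual_comp c D lam (hφ.genAdj c D lam).1.continuous.measurable measurable_fst measurable_snd)
  have hint : Integrable (fun p : ℝ × Vel d => g p.2 * ouDual c D lam p.1 (genAdj c D lam φ) p.2) ((volume.restrict (Ioc 0 r)).prod volume) := by
    have h1 : Integrable (fun p : ℝ × Vel d => (exp (|lam| * r) * K) * g p.2)
      ((volume.restrict (Ioc 0 r)).prod volume) := Integrable.mul_prod (integrable_const _) hi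
    have hK0 : 0 ≤ K := (abs_nonneg _).trans (hK 0)
    refine h1.mono hm.aestronglyMeasurable ?_
    have : ∀ᵐ s ∂(volume.restrict (Ioc 0 r)), ∀ᵐ v ∂(volume : Measure (Vel d)),
        ‖g v * ouDual c D lam s (genAdj c D lam φ) v‖ ≤ ‖exp (|lam| * r) * K * g v‖ := by
      filter_upwards [ae_mem_Ioc] with s hs
      refine of_forall fun v => ?_
      rw [norm_mul, norm_mul, mul_comm]
      gcongr
      have hp : 0 ≤ exp (|lam| * r) * K := by positivity
      refine le_trans ?_ (norm_of_nonneg hp).ge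
      rw [norm_eq_abs]
      refine (abs_ouDual_le c D lam _ hK v).trans ?_
      gcongr
      calc -(lam * s) ≤ |lam * s| := neg_le_abs _
        _ = |lam| * |s| := abs_mul _ _
        _ ≤ _ := by gcongr; rw [abs_of_pos hs.1]; exact hs.2
    exact (Measure.ae_prod_iff_ae_ae (measurableSet_le hm.norm (((hg.comp measurable_snd).const_mul _).norm))).2 this
  have i1 : Integrable fun v => g v * ouDual c D lam r φ v := hi.mul_bdd (c := exp (-(lam * r)) * K')
      ((contDiff_ouDual hφ c D lam r).continuous.aestronglyMeasurable) (of_forall fun v => abs_ouDual_le c D lam r hK' v)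
  have i2 : Integrable fun v => g v * φ v := hi.mul_bdd (c := K') hφ.1.continuous.aestronglyMeasurable (of_forall hK')
  unfold pair
  rw [integral_of_le hr, integral_integral_swap hint, ← integral_sub i1 i2]
  refine integral_ext fun v => ?_
  rw [integral_const_mul, ← integral_of_le hr, integral_ouDual_genAdj hφ hc hD hr]
  ring

/-! #### Extension of the weak form beyond compact support -/

lemma fderiv_comp_smul_const (hf : Differentiable ℝ f) (ε : ℝ) (v : Vel d) : fderiv ℝ (fun x => f (ε • x)) v = ε • fderiv ℝ f (ε • v) := by
  have h1 : HasFDerivAt (fun w : Vel d => ε • w) (ε • ContinuousLinearMap.id ℝ (Vel d)) v := (hasFDerivAt_id v).const_smul ε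
  have h2 := (hf (ε • v)).hasFDerivAt.comp v h1
  have h3 : fderiv ℝ (fun x => f (ε • x)) v = _ := h2.fderiv
  rw [h3]
  ext y; simp

lemma laplacian_comp_smul_const (hf : ContDiff ℝ ∞ f) (ε : ℝ) (v : Vel d) : laplacian (fun x => f (ε • x)) v = ε ^ 2 * laplacian f (ε • v) := by
  have hfs : ContDiff ℝ ∞ fun x => f (ε • x) := hf.comp (contDiff_const_smul _)
  rw [laplacian_eq_sum (hfs.of_le two_le_infty), laplacian_eq_sum (hf.of_le two_le_infty), mul_sum]
  refine sum_congr rfl fun i _ => ?_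
  have hd : Differentiable ℝ (fun x => fderiv ℝ f x (single i 1)) :=
    ((hf.fderiv_right (m := ∞) (by simp)).clm_apply contDiff_const).differentiable (by simp)
  simp only [fderiv_comp_smul_const (hf.differentiable (by simp)), smul_apply, smul_eq_mul]
  have hd' : Differentiable ℝ (fun x => fderiv ℝ f (ε • x) (single i 1)) := hd.comp (differentiable_id.const_smul ε)
  rw [fderiv_const_mul (hd' v), fderiv_comp_smul_const hd]
  simp only [smul_apply, smul_eq_mul]
  ring

lemma laplacian_mul (hf : ContDiff ℝ ∞ f) (hg : ContDiff ℝ ∞ g) (v : Vel d) : laplacian (fun x => f x * g x) v = f v * laplacian g v +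
      g v * laplacian f v + 2 * ∑ i : Fin d, fderiv ℝ f v (single i 1) * fderiv ℝ g v (single i 1) := by
  rw [laplacian_eq_sum ((hf.mul hg).of_le two_le_infty), laplacian_eq_sum (hf.of_le two_le_infty),
    laplacian_eq_sum (hg.of_le two_le_infty), mul_sum, mul_sum, mul_sum,
    ← sum_add_distrib, ← sum_add_distrib]
  refine sum_congr rfl fun i _ => ?_
  set e : Vel d := single i 1
  have hf1 : Differentiable ℝ f := hf.differentiable (by simp)
  have hg1 : Differentiable ℝ g := hg.differentiable (by simp)
  have hf2 : Differentiable ℝ (fun x => fderiv ℝ f x e) := ((hf.fderiv_right (m := ∞) (by simp)).clm_apply contDiff_const).differentiable (by simp)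
  have hg2 : Differentiable ℝ (fun x => fderiv ℝ g x e) := ((hg.fderiv_right (m := ∞) (by simp)).clm_apply contDiff_const).differentiable (by simp)
  have h1 : (fun x => fderiv ℝ (fun x => f x * g x) x e) = fun x => f x * fderiv ℝ g x e + g x * fderiv ℝ f x e := by
    ext x
    rw [fderiv_fun_mul (hf1 x) (hg1 x)]
    simp
  have a1 : DifferentiableAt ℝ (fun x => f x * fderiv ℝ g x e) v := (hf1 v).mul (hg2 v)
  have a2 : DifferentiableAt ℝ (fun x => g x * fderiv ℝ f x e) v := (hg1 v).mul (hf2 v)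
  rw [h1, fderiv_fun_add a1 a2, fderiv_fun_mul (hf1 v) (hg2 v), fderiv_fun_mul (hg1 v) (hf2 v)]
  simp
  ring

/-- The backward evolution of a test function need not have compact support, hence this extension.
Multiply by cut-offs `χ(εv)` and let `ε → 0`: the drift term grows linearly and is dominated by
means of the first moment of `u`. -/
lemma LinWeakAt.extend (hu : UL a T 1 u) (hh : UL a T 0 h) (hi₀ : Integrable u₀) (ht : t ∈ Icc a T) (hw : LinWeakAt c D lam a u₀ u h t)
    (hψ : ContDiff ℝ ∞ ψ) (h0 : ∀ v, |ψ v| ≤ C) (h1 : ∀ v, ‖fderiv ℝ ψ v‖ ≤ C) (h2 : ∀ v, |laplacian ψ v| ≤ C) :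
    pair (u t) ψ = pair u₀ ψ + ∫ s in a..t, (pair (u s) (genAdj c D lam ψ) + pair (h s) ψ) := by
  have hC0 : 0 ≤ C := (abs_nonneg _).trans (h0 0)
  let χ : ContDiffBump (0 : Vel d) := ⟨1, 2, one_pos, one_lt_two⟩
  have hχ : IsTestFunction (χ : Fn d) := ⟨χ.contDiff, χ.hasCompactSupport⟩
  obtain ⟨K1, hK10, hK1⟩ := hχ.fderiv_bound
  -- Bounding `x·∇χ(x)` controls the drift of `χ(εv)` uniformly in `ε`, since `v·∇(χ(εv))` is this
  -- function at `εv`.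
  obtain ⟨K2, hK2⟩ := hχ.fderiv_apply_self.exists_bound
  obtain ⟨K3, hK3⟩ := hχ.laplacian.exists_bound
  have hK20 : 0 ≤ K2 := (abs_nonneg _).trans (hK2 0)
  have hK30 : 0 ≤ K3 := (abs_nonneg _).trans (hK3 0)
  set ε : ℕ → ℝ := fun n => 1 / ((n : ℝ) + 1)
  have hε0 : ∀ n, 0 < ε n := fun n => by positivity
  have hε1 : ∀ n, ε n ≤ 1 := fun n => by
    rw [div_le_one (by positivity)]; linarith [(Nat.cast_nonneg n : (0 : ℝ) ≤ n)]
  have hεt : Tendsto ε atTop (𝓝 0) := tendsto_one_div_add_atTop_nhds_zero_nat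
  set χn : ℕ → Fn d := fun n v => χ (ε n • v)
  have hχn : ∀ n, ContDiff ℝ ∞ (χn n) := fun n => hχ.1.comp (contDiff_const_smul _)
  set ψn : ℕ → Fn d := fun n v => χn n v * ψ v
  have hψn : ∀ n, IsTestFunction (ψn n) := fun n =>
    ⟨(hχn n).mul hψ, (hχ.2.comp_smul (hε0 n).ne').mul_right⟩
  have hχ1 : ∀ v, |χ v| ≤ 1 := fun v => by rw [abs_of_nonneg χ.nonneg]; exact χ.le_one
  have bψn : ∀ n v, |ψn n v| ≤ C := fun n v => by
    simp only [ψn, abs_mul]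
    exact (mul_le_of_le_one_left (abs_nonneg _) (hχ1 _)).trans (h0 v)
  -- Near each fixed point the cut-off is eventually identically one, so all derivatives agree and
  -- the generator converges pointwise.
  have hev : ∀ v, ∀ᶠ n in atTop, ψn n =ᶠ[𝓝 v] ψ := by
    intro v
    have hlim : Tendsto (fun n => ε n * (‖v‖ + 1)) atTop (𝓝 0) := by
      simpa using hεt.mul_const (‖v‖ + 1)
    filter_upwards [hlim.eventually (gt_mem_nhds one_pos)] with n hn
    filter_upwards [Metric.ball_mem_nhds v one_pos] with x hx
    simp only [ψn, χn]
    rw [χ.one_of_mem_closedBall, one_mul]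
    rw [mem_closedBall_zero_iff, norm_smul, norm_of_nonneg (hε0 n).le]
    rw [Metric.mem_ball, dist_eq_norm] at hx
    have : ‖x‖ ≤ ‖v‖ + 1 := by
      have := norm_le_norm_add_norm_sub' x v
      linarith
    change ε n * ‖x‖ ≤ 1
    nlinarith [hε0 n]
  have lim0 : ∀ v, Tendsto (fun n => ψn n v) atTop (𝓝 (ψ v)) := fun v =>
    tendsto_const_nhds.congr' ((hev v).mono fun n hn => hn.eq_of_nhds.symm)
  have limG : ∀ v, Tendsto (fun n => genAdj c D lam (ψn n) v) atTop (𝓝 (genAdj c D lam ψ v)) := fun v =>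
    tendsto_const_nhds.congr' ((hev v).mono fun n hn => by
      simp only [genAdj, hn.fderiv_eq, hn.eq_of_nhds, (InnerProductSpace.laplacian_congr_nhds hn).eq_of_nhds])
  set Q : ℝ := C + C * K3 + 2 * (d * (K1 * C))
  obtain ⟨K, hK⟩ : ∃ K, ∀ n v, |genAdj c D lam (ψn n) v| ≤ K * bracket v ^ 1 := by
    refine ⟨|D| * Q + |c| * (C + C * K2) + |lam| * C, fun n v => ?_⟩
    have hb1 := one_le_bracket v
    have hLχ : |laplacian (χn n) v| ≤ K3 := by
      simp only [χn]
      rw [laplacian_comp_smul_const hχ.1, abs_mul, abs_of_nonneg (sq_nonneg _)]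
      exact (mul_le_of_le_one_left (abs_nonneg _) (pow_le_one₀ (hε0 n).le (hε1 n))).trans (hK3 _)
    have hFχ : ∀ i : Fin d, |fderiv ℝ (χn n) v (single i 1)| ≤ K1 := fun i => by
      refine ((fderiv ℝ (χn n) v).le_opNorm _).trans ?_
      simp only [χn]
      rw [fderiv_comp_smul_const (hχ.1.differentiable (by simp)), norm_smul, norm_of_nonneg (hε0 n).le]
      simp only [PiLp.norm_single, norm_one, mul_one]
      exact (mul_le_of_le_one_left (norm_nonneg _) (hε1 n)).trans (hK1 _)
    have hFψ : ∀ i : Fin d, |fderiv ℝ ψ v (single i 1)| ≤ C := fun i => by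
      refine ((fderiv ℝ ψ v).le_opNorm _).trans ?_
      simpa using h1 v
    have hL : |laplacian (ψn n) v| ≤ Q := by
      simp only [ψn]
      rw [laplacian_mul (hχn n) hψ]
      refine (abs_add_le _ _).trans (add_le_add ((abs_add_le _ _).trans (add_le_add ?_ ?_)) ?_)
      · rw [abs_mul]; exact (mul_le_of_le_one_left (abs_nonneg _) (hχ1 _)).trans (h2 v)
      · rw [abs_mul]; gcongr; exact h0 v
      · rw [abs_mul, abs_two]
        gcongr
        refine (Finset.abs_sum_le_sum_abs _ _).trans ?_
        calc _ ≤ ∑ _i : Fin d, K1 * C := by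
              refine sum_le_sum fun i _ => ?_
              rw [abs_mul]; gcongr; exact hFχ i; exact hFψ i
          _ = _ := by simp
    have hF : |fderiv ℝ (ψn n) v v| ≤ (C + C * K2) * bracket v := by
      simp only [ψn]
      rw [fderiv_fun_mul ((hχn n).differentiable (by simp) v) (hψ.differentiable (by simp) v)]
      simp only [add_apply, smul_apply, smul_eq_mul]
      refine (abs_add_le _ _).trans ?_
      have e1 : |χn n v * fderiv ℝ ψ v v| ≤ C * bracket v := by
        rw [abs_mul]
        refine (mul_le_of_le_one_left (abs_nonneg _) (hχ1 _)).trans (((fderiv ℝ ψ v).le_opNorm v).trans ?_)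
        gcongr; exact h1 v; exact norm_le_bracket v
      have e2 : |ψ v * fderiv ℝ (χn n) v v| ≤ C * K2 * bracket v := by
        rw [abs_mul]
        have : fderiv ℝ (χn n) v v = fderiv ℝ χ (ε n • v) (ε n • v) := by
          simp only [χn]
          rw [fderiv_comp_smul_const (hχ.1.differentiable (by simp))]
          simp
        rw [this]
        calc _ ≤ C * K2 := by gcongr; exact h0 v; exact hK2 _
          _ ≤ C * K2 * bracket v := le_mul_of_one_le_right (by positivity) hb1
      linarith
    have hF2 : |ψn n v| ≤ C := bψn n v
    unfold genAdj
    rw [pow_one]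
    refine (abs_sub _ _).trans ?_
    refine (add_le_add ((abs_sub _ _)) le_rfl).trans ?_
    rw [abs_mul, abs_mul, abs_mul]
    calc _ ≤ |D| * Q + |c| * ((C + C * K2) * bracket v) + |lam| * C := by gcongr
      _ ≤ |D| * Q * bracket v + |c| * ((C + C * K2) * bracket v) +
            |lam| * C * bracket v := by
          have p1 : 0 ≤ |D| * Q := by positivity
          have p2 : 0 ≤ |lam| * C := by positivity
          have := le_mul_of_one_le_right p1 hb1
          have := le_mul_of_one_le_right p2 hb1
          linarith
      _ = _ := by ring
  have lim_pair : ∀ (g : Fn d), Integrable g → Tendsto (fun n => pair g (ψn n)) atTop (𝓝 (pair g ψ)) := by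
    intro g hg
    refine tendsto_integral_of_dominated_convergence (fun v => ‖g v‖ * C)
      (fun n => hg.1.mul (hψn n).1.continuous.aestronglyMeasurable) (hg.norm.mul_const C)
      (fun n => of_forall fun v => ?_) (of_forall fun v => (lim0 v).const_mul _)
    rw [norm_mul]; gcongr; exact bψn n v
  have lim_pairG : ∀ s ∈ Icc a T, Tendsto (fun n => pair (u s) (genAdj c D lam (ψn n))) atTop (𝓝 (pair (u s) (genAdj c D lam ψ))) := by
    intro s hs
    refine tendsto_integral_of_dominated_convergence (fun v => ‖u s v * bracket v ^ 1‖ * K)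
      (fun n => (hu.integrable hs).1.mul ((hψn n).genAdj c D lam).1.continuous.aestronglyMeasurable) ((hu.integrable_mul hs).norm.mul_const K)
      (fun n => of_forall fun v => ?_) (of_forall fun v => (limG v).const_mul _)
    rw [norm_mul, norm_mul, mul_assoc, norm_of_nonneg (pow_nonneg (bracket_pos v).le 1), mul_comm _ K]
    gcongr; exact hK n v
  obtain ⟨Cu, hCu0, hCu⟩ := hu.exists_pair_bound
  obtain ⟨Ch, hCh0, hCh⟩ := hh.exists_pair_bound
  have hsub : Ioc a t ⊆ Icc a T := Ioc_sub ht
  have lim_time : Tendsto (fun n => ∫ s in a..t, (pair (u s) (genAdj c D lam (ψn n)) + pair (h s) (ψn n)))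
      atTop (𝓝 (∫ s in a..t, (pair (u s) (genAdj c D lam ψ) + pair (h s) ψ))) := by
    simp only [integral_of_le ht.1]
    refine tendsto_integral_of_dominated_convergence (fun _ => Cu * K + Ch * C) (fun n => ?_) (integrable_const _) (fun n => ?_) ?_
    · refine Measurable.aestronglyMeasurable (Measurable.add ?_ ?_)
      · exact measurable_pair_comp hu.1 measurable_id (((hψn n).genAdj c D lam).1.continuous.measurable.comp measurable_snd)
      · exact measurable_pair_comp hh.1 measurable_id ((hψn n).1.continuous.measurable.comp measurable_snd)
    · filter_upwards [ae_mem_Ioc] with s hs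
      refine (norm_add_le _ _).trans (add_le_add ?_ ?_)
      · exact hCu s (hsub hs) _ _ (hK n)
      · exact hCh s (hsub hs) _ _ fun v => by simpa using bψn n v
    · filter_upwards [ae_mem_Ioc] with s hs
      exact (lim_pairG s (hsub hs)).add (lim_pair (h s) (hh.integrable (hsub hs)))
  refine tendsto_nhds_unique (lim_pair (u t) (hu.integrable ht)) ?_
  simp only [hw _ (hψn _)]
  exact (lim_pair u₀ hi₀).add lim_time

/-! #### Equivalence of the weak and the mild formulation -/

lemma integrable_duhamel_prod (hh : UL a T 0 h) (ht : t ≤ T) : Integrable (fun p : Vel d × ℝ => ou c D lam (t - p.2) (h p.2) p.1)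
      (volume.prod (volume.restrict (Ioc a t))) := by
  have hm : Measurable fun p : Vel d × ℝ => ou c D lam (t - p.2) (h p.2) p.1 := measurable_ou_comp (H := fun p : Vel d × ℝ => h p.2) c D lam
      (hh.1.comp ((by fun_prop : Measurable fun q : (Vel d × ℝ) × Vel d => (q.1.2, q.2)))) (by fun_prop) (by fun_prop)
  refine ⟨hm.aestronglyMeasurable, ?_⟩
  obtain ⟨C, hC⟩ := hh.2
  rw [HasFiniteIntegral, lintegral_prod_symm _ hm.enorm.aemeasurable]
  calc ∫⁻ s in Ioc a t, ∫⁻ v, ‖ou c D lam (t - s) (h s) v‖ₑ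
      ≤ ∫⁻ s in Ioc a t, ofReal (exp (|lam| * (t - a))) * C := by
        refine setLIntegral_mono measurable_const fun s hs => ?_
        have h1 := lintegral_enorm_ou_le c D lam (t - s) (hh.measurable_apply s) (Φ := fun _ => 1) measurable_const
        have h2 := hC s ⟨hs.1.le, hs.2.trans ht⟩
        simp only [mul_one, ouDualL_const, wt_zero] at h1 h2
        refine h1.trans ?_
        gcongr
        calc -(lam * (t - s)) ≤ |lam * (t - s)| := neg_le_abs _
          _ = |lam| * (t - s) := by rw [abs_mul, abs_of_nonneg (show 0 ≤ t - s by linarith [hs.2])]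
          _ ≤ _ := by gcongr; exact hs.1.le
    _ < ⊤ := by
        rw [lintegral_const]
        exact mul_lt_top (mul_lt_top ofReal_lt_top coe_lt_top) (by simp)

lemma integrable_duhamel (hh : UL a T 0 h) (ht : t ≤ T) : Integrable (duhamel c D lam a h t) := (integrable_duhamel_prod hh ht).integral_prod_left

/-- Duality moves the semigroup onto the test function, both in the initial term and under the time
integral. -/
lemma pair_mild (hm₀ : Measurable u₀) (hi₀ : Integrable u₀) (hh : UL a T 0 h) (ht : t ∈ Icc a T) (hφ : Measurable φ) (hC : ∀ v, |φ v| ≤ C) :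
    pair (fun v => ou c D lam (t - a) u₀ v + duhamel c D lam a h t v) φ =
      pair u₀ (ouDual c D lam (t - a) φ) + ∫ q in a..t, pair (h q) (ouDual c D lam (t - q) φ) := by
  have i1 := (integrable_ou (c := c) (D := D) (lam := lam) (r := t - a) hm₀ hi₀)
  have i2 := integrable_duhamel (c := c) (D := D) (lam := lam) hh ht.2
  have b1 : ∀ {g : Fn d}, Integrable g → Integrable fun v => g v * φ v := fun hg =>
    hg.mul_bdd hφ.aestronglyMeasurable (of_forall hC)
  have e1 : ∫ v, duhamel c D lam a h t v * φ v = ∫ q in a..t, pair (h q) (ouDual c D lam (t - q) φ) := by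
    have h1 : ∀ v, duhamel c D lam a h t v * φ v = ∫ s in Ioc a t, ou c D lam (t - s) (h s) v * φ v := fun v => by rw [integral_mul_const]; rfl
    simp only [h1]
    rw [integral_integral_swap, integral_of_le ht.1]
    · refine setIntegral_congr_fun measurableSet_Ioc fun s hs => ?_
      exact integral_ou_mul c D lam _ (hh.measurable_apply s) (hh.integrable (Ioc_sub ht hs)) hφ hC
    · exact (integrable_duhamel_prod hh ht.2).mul_bdd (c := C) (hφ.comp measurable_fst).aestronglyMeasurable (of_forall fun p => hC p.1)
  unfold pair
  simp only [add_mul]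
  rw [integral_add (b1 i1) (b1 i2), integral_ou_mul c D lam _ hm₀ hi₀ hφ hC, e1]
  rfl

lemma ouDual_bounds (hφ : IsTestFunction φ) (c D lam r : ℝ) : ∃ C, (∀ v, |ouDual c D lam r φ v| ≤ C) ∧ (∀ v, ‖fderiv ℝ (ouDual c D lam r φ) v‖ ≤ C) ∧
      ∀ v, |laplacian (ouDual c D lam r φ) v| ≤ C := by
  obtain ⟨K0, hK0⟩ := hφ.exists_bound
  obtain ⟨K1, hK10, hK1⟩ := hφ.fderiv_bound
  obtain ⟨K2, hK2⟩ := hφ.laplacian.exists_bound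
  refine ⟨max (exp (-(lam * r)) * K0) (max (exp (-(c * r)) * (exp (-(lam * r)) * K1))
    (exp (-(2 * c * r)) * (exp (-(lam * r)) * K2))), fun v => ?_, fun v => ?_, fun v => ?_⟩
  · exact (abs_ouDual_le c D lam r hK0 v).trans (le_max_left _ _)
  · refine le_trans ?_ ((le_max_left _ _).trans (le_max_right _ _))
    refine opNorm_le_bound _ (by positivity) fun e => ?_
    rw [fderiv_ouDual hφ, norm_mul, norm_of_nonneg (exp_pos _).le]
    have := abs_ouDual_le c D lam r (φ := fun v => fderiv ℝ φ v e) (C := K1 * ‖e‖)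
      (fun v => ((fderiv ℝ φ v).le_opNorm e).trans (by gcongr; exact hK1 v)) v
    rw [norm_eq_abs]
    calc _ ≤ exp (-(c * r)) * (exp (-(lam * r)) * (K1 * ‖e‖)) := by gcongr
      _ = _ := by ring
  · refine le_trans ?_ ((le_max_right _ _).trans (le_max_right _ _))
    rw [laplacian_ouDual hφ, abs_mul, abs_of_pos (exp_pos _)]
    gcongr
    exact abs_ouDual_le c D lam r hK2 v

lemma intervalIntegrable_of_Ioc {f : ℝ → ℝ} (hat : a ≤ t) (hf : IntegrableOn f (Ioc a t)) : IntervalIntegrable f volume a t :=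
  (intervalIntegrable_iff_integrableOn_Ioc_of_le hat).2 hf

lemma UnifL1.integrableOn_pair (hu : UnifL1 S 0 u) (hφ : IsTestFunction φ) (hS : Ioc a t ⊆ S) : IntegrableOn (fun s => pair (u s) φ) (Ioc a t) := by
  obtain ⟨C, hC0, hC⟩ := hu.exists_pair_bound
  obtain ⟨K, hK⟩ := hφ.exists_bound
  refine Measure.integrableOn_of_bounded (M := C * K) (by simp) ?_ (ae_mem_Ioc.mono fun s hs => hC s (hS hs) φ K fun v => by simpa using hK v)
  exact (measurable_pair_comp (ψ := fun _ => φ) hu.1 measurable_id (hφ.1.continuous.measurable.comp measurable_snd)).aestronglyMeasurable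

lemma UnifL1.intervalIntegrable_pair (hu : UnifL1 S 0 u) (hφ : IsTestFunction φ) (hat : a ≤ t) (hS : Ioc a t ⊆ S) :
    IntervalIntegrable (fun s => pair (u s) φ) volume a t := intervalIntegrable_of_Ioc hat (hu.integrableOn_pair hφ hS)

lemma unifL1_const (hm₀ : Measurable u₀) (hi₀ : Integrable u₀) : UnifL1 univ 0 (fun _ : ℝ => u₀) := by
  refine ⟨hm₀.comp measurable_snd, (∫⁻ v, ‖u₀ v‖ₑ).toNNReal, fun _ _ => ?_⟩
  rw [coe_toNNReal hi₀.2.ne]; simp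

/-- Write `P_r` for `ouDual` and `A` for `genAdj`. The weak form at time `s` is tested with `P_{t-s}
Aφ` and integrated over `s`. After exchanging the integrals on the triangle, the inner integral
telescopes through `d/dr P_r = P_r A`; comparison with the weak form at `t` tested by `φ` leaves the
dual of Duhamel's formula. No time regularity of `u` enters, and the weak form is needed only at
almost every time and at `t`. -/
lemma mild_of_weak (hc : 0 < c) (hD : 0 < D) (hm₀ : Measurable u₀) (hi₀ : Integrable u₀) (hu : UL a T 1 u) (hh : UL a T 0 h)
    (ht : t ∈ Icc a T) (hw : ∀ᵐ s ∂volR (Ioc a T), LinWeakAt c D lam a u₀ u h s) (hwt : LinWeakAt c D lam a u₀ u h t) :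
    u t =ᵐ[volume] fun v => ou c D lam (t - a) u₀ v + duhamel c D lam a h t v := by
  have hu0 := hu.mono_weight (Nat.zero_le 1)
  have key : ∀ φ, IsTestFunction φ → pair (u t) φ = pair u₀ (ouDual c D lam (t - a) φ) + ∫ q in a..t, pair (h q) (ouDual c D lam (t - q) φ) := by
    intro φ hφ
    set φ₁ := genAdj c D lam φ
    set φ₂ := genAdj c D lam φ₁
    have hφ₁ : IsTestFunction φ₁ := hφ.genAdj c D lam
    have hφ₂ : IsTestFunction φ₂ := hφ₁.genAdj c D lam
    have hsub : Ioc a t ⊆ Ioc a T := Ioc_subset_Ioc_right ht.2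
    have hmem : ∀ s ∈ Ioc a t, s ∈ Icc a T := Ioc_sub ht
    have hr : ∀ s ∈ Ioc a t, |t - s| ≤ t - a := fun s hs => by
      rw [abs_of_nonneg (by linarith [hs.2])]; linarith [hs.1]
    have hfin : (volume : Measure ℝ) (Ioc a t) < ⊤ := by simp
    -- integrability in time
    have I : ∀ {g : ℝ → Fn d} {ψ : Fn d}, UL a T 0 g → IsTestFunction ψ →
        IntegrableOn (fun s => pair (g s) (ouDual c D lam (t - s) ψ)) (Ioc a t) := fun hg hψ =>
      integrableOn_pair_ouDual measurableSet_Ioc hfin hg hψ c D lam measurable_id (by fun_prop) hmem hr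
    have Iu₀ : IntegrableOn (fun s => pair u₀ (ouDual c D lam (t - s) φ₁)) (Ioc a t) :=
      integrableOn_pair_ouDual measurableSet_Ioc hfin (unifL1_const hm₀ hi₀) hφ₁ c D lam measurable_id (by fun_prop) (fun _ _ => mem_univ _) hr
    have I2 : ∀ {g : ℝ → Fn d} {ψ : Fn d}, UL a T 0 g → IsTestFunction ψ →
        IntegrableOn (fun p : ℝ × ℝ => pair (g p.2) (ouDual c D lam (t - p.1) ψ)) (Ioc a t ×ˢ Ioc a t) (volume.prod volume) := fun hg hψ =>
      integrableOn_pair_ouDual (measurableSet_Ioc.prod measurableSet_Ioc)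
        (by rw [Measure.prod_prod]; exact mul_lt_top hfin hfin) hg hψ c D lam measurable_snd
        (by fun_prop) (fun p hp => hmem _ hp.2) (fun p hp => hr _ hp.1)
    -- The integrated semigroup identity, read backwards from time `t`.
    have shift : ∀ {g ψ : Fn d} {q : ℝ}, Measurable g → Integrable g → IsTestFunction ψ → q ≤ t →
        ∫ s in q..t, pair g (ouDual c D lam (t - s) (genAdj c D lam ψ)) = pair g (ouDual c D lam (t - q) ψ) - pair g ψ := by
      intro g ψ q hg hgi hψ hq
      rw [integral_comp_sub_left (fun r => pair g (ouDual c D lam r (genAdj c D lam ψ))) t, sub_self]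
      exact integral_pair_ouDual hg hgi hψ hc hD (by linarith) lam
    set F : ℝ → ℝ → ℝ := fun s q => pair (u q) (ouDual c D lam (t - s) φ₂) + pair (h q) (ouDual c D lam (t - s) φ₁)
    -- The extended weak form applies at time `s`; the generator commutes with the semigroup, so `φ₂
    -- = Aφ₁` appears under it.
    have step : ∀ᵐ s ∂volR (Ioc a t), pair (u s) (ouDual c D lam (t - s) φ₁) = pair u₀ (ouDual c D lam (t - s) φ₁) + ∫ q in a..s, F s q := by
      filter_upwards [ae_mono (Measure.restrict_mono hsub le_rfl) hw, ae_mem_Ioc] with s hs hsm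
      obtain ⟨K, hK0, hK1, hK2⟩ := ouDual_bounds hφ₁ c D lam (t - s)
      have := hs.extend hu hh hi₀ (hmem s hsm) (contDiff_ouDual hφ₁ c D lam (t - s)) hK0 hK1 hK2
      rw [this]
      have e : genAdj c D lam (ouDual c D lam (t - s) φ₁) = ouDual c D lam (t - s) φ₂ :=
        funext fun v => genAdj_ouDual hφ₁ hc hD (by linarith [hsm.2]) lam v
      rw [e]
    have a1 := intervalIntegrable_of_Ioc ht.1 (I hu0 hφ₁)
    have a2 := intervalIntegrable_of_Ioc ht.1 (I hh hφ)
    have b1 := hu0.intervalIntegrable_pair hφ₁ ht.1 hmem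
    have b2 := hh.intervalIntegrable_pair hφ ht.1 hmem
    have hF := (I2 hu0 hφ₂).add (I2 hh hφ₁)
    have Q1 : ∫ s in a..t, pair (u s) (ouDual c D lam (t - s) φ₁) = (pair u₀ (ouDual c D lam (t - a) φ) - pair u₀ φ) +
        ((∫ q in a..t, pair (u q) (ouDual c D lam (t - q) φ₁)) - (∫ q in a..t, pair (u q) φ₁) +
         ((∫ q in a..t, pair (h q) (ouDual c D lam (t - q) φ)) - ∫ q in a..t, pair (h q) φ)) := by
      have tri := integral_triangle ht.1 (F := F) hF
      have hInner : IntegrableOn (fun s => ∫ q in a..s, F s q) (Ioc a t) := by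
        refine (((I hu0 hφ₁).sub Iu₀)).congr ?_
        filter_upwards [step] with s hs
        simp only [Pi.sub_apply]
        rw [hs]; ring
      have L : ∫ s in a..t, pair (u s) (ouDual c D lam (t - s) φ₁) = (∫ s in a..t, pair u₀ (ouDual c D lam (t - s) φ₁)) + ∫ s in a..t, ∫ q in a..s,
            F s q := by
        rw [integral_of_le ht.1, integral_of_le ht.1, integral_of_le ht.1, integral_congr_ae step, integral_add Iu₀ hInner]
      have R : ∫ q in a..t, ∫ s in q..t, F s q = (∫ q in a..t, pair (u q) (ouDual c D lam (t - q) φ₁)) - (∫ q in a..t, pair (u q) φ₁) +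
          ((∫ q in a..t, pair (h q) (ouDual c D lam (t - q) φ)) - ∫ q in a..t, pair (h q) φ) := by
        rw [← intervalIntegral.integral_sub a1 b1, ← intervalIntegral.integral_sub a2 b2, ← intervalIntegral.integral_add (a1.sub b1) (a2.sub b2),
          integral_of_le ht.1, integral_of_le ht.1]
        refine setIntegral_congr_fun measurableSet_Ioc fun q hq => ?_
        have hqT := hmem q hq
        have j1 : ∀ {g : ℝ → Fn d} {ψ : Fn d}, UL a T 0 g → IsTestFunction ψ →
          IntervalIntegrable (fun s => pair (g q) (ouDual c D lam (t - s) ψ)) volume q t := fun hg hψ =>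
            (intervalIntegrable_iff_integrableOn_Ioc_of_le hq.2).2
            (integrableOn_pair_ouDual (R := t - q) measurableSet_Ioc (by simp) hg hψ c D lam measurable_const
              (by fun_prop) (fun _ _ => hqT) (fun s hs => by
                rw [abs_of_nonneg (by linarith [hs.2])]; linarith [hs.1]))
        simp only [F]
        rw [intervalIntegral.integral_add (j1 hu0 hφ₂) (j1 hh hφ₁), shift (hu.measurable_apply q) (hu.integrable hqT) hφ₁ hq.2,
          shift (hh.measurable_apply q) (hh.integrable hqT) hφ hq.2]
      rw [tri, shift hm₀ hi₀ hφ ht.1, R] at L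
      exact L
    have W := hwt φ hφ
    rw [intervalIntegral.integral_add b1 b2] at W
    linarith
  have hmi : Integrable fun v => ou c D lam (t - a) u₀ v + duhamel c D lam a h t v := (integrable_ou hm₀ hi₀).add (integrable_duhamel hh ht.2)
  -- Two locally integrable functions with equal pairings against all test functions agree almost
  -- everywhere.
  refine ae_eq_of_integral_contDiff_smul_eq (hu.integrable ht).locallyIntegrable hmi.locallyIntegrable ?_
  intro φ h1 h2
  have hφ : IsTestFunction φ := ⟨h1, h2⟩
  obtain ⟨K, hK⟩ := hφ.exists_bound
  have e := (key φ hφ).trans (pair_mild (c := c) (D := D) (lam := lam) hm₀ hi₀ hh ht hφ.1.continuous.measurable hK).symm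
  unfold pair at e
  simpa [mul_comm] using e

/-- The same exchange on the triangle, run forwards: pair the mild formula with `Aφ`, integrate in
time, and let the semigroup identity telescope. -/
lemma weak_of_mild (hc : 0 < c) (hD : 0 < D) (hm₀ : Measurable u₀) (hi₀ : Integrable u₀) (hu : UL a T 0 u) (hh : UL a T 0 h)
    (ht : t ∈ Icc a T) (hw : ∀ s ∈ Icc a T, u s =ᵐ[volume] fun v => ou c D lam (s - a) u₀ v + duhamel c D lam a h s v) :
    LinWeakAt c D lam a u₀ u h t := by
  intro φ hφ
  set φ₁ := genAdj c D lam φ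
  have hφ₁ : IsTestFunction φ₁ := hφ.genAdj c D lam
  have hmem : ∀ s ∈ Ioc a t, s ∈ Icc a T := Ioc_sub ht
  have hfin : (volume : Measure ℝ) (Ioc a t) < ⊤ := by simp
  have dual : ∀ s ∈ Icc a T, ∀ ψ, IsTestFunction ψ → pair (u s) ψ =
      pair u₀ (ouDual c D lam (s - a) ψ) + ∫ q in a..s, pair (h q) (ouDual c D lam (s - q) ψ) := by
    intro s hs ψ hψ
    obtain ⟨K, hK⟩ := hψ.exists_bound
    rw [← pair_mild hm₀ hi₀ hh hs hψ.1.continuous.measurable hK]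
    refine integral_congr_ae ?_
    filter_upwards [hw s hs] with v hv
    simp only [hv]
  have Iu₀ : IntegrableOn (fun s => pair u₀ (ouDual c D lam (s - a) φ₁)) (Ioc a t) :=
    integrableOn_pair_ouDual (R := t - a) measurableSet_Ioc hfin (unifL1_const hm₀ hi₀) hφ₁ c D lam measurable_id (by fun_prop)
      (fun _ _ => mem_univ _) (fun s hs => by rw [abs_of_nonneg (by linarith [hs.1])]; linarith [hs.2])
  have Ih : IntegrableOn (fun s => pair (h s) (ouDual c D lam (t - s) φ)) (Ioc a t) :=
    integrableOn_pair_ouDual (R := t - a) measurableSet_Ioc hfin hh hφ c D lam measurable_id (by fun_prop)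
      hmem (fun s hs => by rw [abs_of_nonneg (by linarith [hs.2])]; linarith [hs.1])
  have I2 : IntegrableOn (fun p : ℝ × ℝ => pair (h p.2) (ouDual c D lam (p.1 - p.2) φ₁)) (Ioc a t ×ˢ Ioc a t) (volume.prod volume) :=
    integrableOn_pair_ouDual (R := t - a) (measurableSet_Ioc.prod measurableSet_Ioc)
      (by rw [Measure.prod_prod]; exact mul_lt_top hfin hfin) hh hφ₁ c D lam measurable_snd (by fun_prop) (fun p hp => hmem _ hp.2) (fun p hp => by
        rw [abs_le]; constructor <;> linarith [hp.1.1, hp.1.2, hp.2.1, hp.2.2])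
  have shift : ∀ {g : Fn d} {q : ℝ}, Measurable g → Integrable g → q ≤ t →
      ∫ s in q..t, pair g (ouDual c D lam (s - q) φ₁) = pair g (ouDual c D lam (t - q) φ) - pair g φ := by
    intro g q hg hgi hq
    rw [intervalIntegral.integral_comp_sub_right (fun r => pair g (ouDual c D lam r φ₁)) q, sub_self]
    exact integral_pair_ouDual hg hgi hφ hc hD (by linarith) lam
  have tri := integral_triangle ht.1 (F := fun s q => pair (h q) (ouDual c D lam (s - q) φ₁)) I2
  have hInner : IntegrableOn (fun s => ∫ q in a..s, pair (h q) (ouDual c D lam (s - q) φ₁)) (Ioc a t) := by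
    refine ((hu.integrableOn_pair hφ₁ hmem).sub Iu₀).congr ?_
    filter_upwards [ae_mem_Ioc] with s hs
    simp only [Pi.sub_apply]
    rw [dual s (hmem s hs) φ₁ hφ₁]; ring
  have Q1 : ∫ s in a..t, pair (u s) φ₁ = (pair u₀ (ouDual c D lam (t - a) φ) - pair u₀ φ) +
      ((∫ q in a..t, pair (h q) (ouDual c D lam (t - q) φ)) - ∫ q in a..t, pair (h q) φ) := by
    rw [integral_of_le ht.1, setIntegral_congr_fun measurableSet_Ioc (fun s hs => dual s (hmem s hs) φ₁ hφ₁), integral_add Iu₀ hInner,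
      ← integral_of_le ht.1, ← integral_of_le ht.1, tri,
      shift hm₀ hi₀ ht.1]
    congr 1
    rw [← intervalIntegral.integral_sub (intervalIntegrable_of_Ioc ht.1 Ih) (hh.intervalIntegrable_pair hφ ht.1 hmem), integral_of_le ht.1, integral_of_le ht.1]
    refine setIntegral_congr_fun measurableSet_Ioc fun q hq => ?_
    exact shift (hh.measurable_apply q) (hh.integrable (hmem q hq)) hq.2
  rw [intervalIntegral.integral_add (hu.intervalIntegrable_pair hφ₁ ht.1 hmem) (hh.intervalIntegrable_pair hφ ht.1 hmem), Q1, dual t ht φ hφ]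
  ring

end Linear

/-! ### The collision operator: estimates for nonnegative densities -/

section CollisionL

variable {F : ℕ → FnL d}

/-- The gain-type collision density of two nonnegative densities, for the kernel `B`: the density of
the image of `G(x) H(y) B(x-y) dx dy` under `(x, y) ↦ (1-θ) x + θ y`. -/
def collL (B : FnL d) (θ : ℝ) (G H : FnL d) (v : Vel d) : ℝ≥0∞ := ∫⁻ z, G (v + θ • z) * H (v - (1 - θ) • z) * B z

/-- The convolution `B * H`. -/
def convL (B : FnL d) (H : FnL d) (v : Vel d) : ℝ≥0∞ := ∫⁻ w, H w * B (v - w)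

/-- The collision frequency `∬ G(x) H(y) B(x-y) Φ(x) dx dy`, weighted in the first variable. -/
def crossL (B G H Φ : FnL d) : ℝ≥0∞ := ∫⁻ x, G x * convL B H x * Φ x

lemma measurable_collL_comp (hB : Measurable B) (θ : ℝ) {G H : X → FnL d} (hG : Measurable (uncurry G)) (hH : Measurable (uncurry H))
    (hv : Measurable v) : Measurable fun x => collL B θ (G x) (H x) (v x) := by
  unfold collL
  refine Measurable.lintegral_prod_right' (f := fun p : X × Vel d =>
    G p.1 (v p.1 + θ • p.2) * H p.1 (v p.1 - (1 - θ) • p.2) * B p.2) ?_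
  refine ((hG.comp (f := fun p : X × Vel d => (p.1, v p.1 + θ • p.2)) ?_).mul
    (hH.comp (f := fun p : X × Vel d => (p.1, v p.1 - (1 - θ) • p.2)) ?_)).mul (hB.comp measurable_snd)
  · exact measurable_fst.prodMk (by fun_prop)
  · exact measurable_fst.prodMk (by fun_prop)

lemma measurable_convL_comp (hB : Measurable B) {H : X → FnL d} (hH : Measurable (uncurry H))
    (hv : Measurable v) : Measurable fun x => convL B (H x) (v x) := by
  unfold convL
  exact Measurable.lintegral_prod_right' (f := fun p : X × Vel d => H p.1 p.2 * B (v p.1 - p.2)) (hH.mul (hB.comp (by fun_prop)))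

lemma measurable_collL (hB : Measurable B) (θ : ℝ) (hG : Measurable G) (hH : Measurable H) : Measurable (collL B θ G H) :=
  measurable_collL_comp (X := Vel d) hB θ (G := fun _ => G) (H := fun _ => H) (hG.comp measurable_snd) (hH.comp measurable_snd) measurable_id

lemma measurable_convL (hB : Measurable B) (hH : Measurable H) : Measurable (convL B H) :=
  measurable_convL_comp (X := Vel d) hB (H := fun _ => H) (hH.comp measurable_snd) measurable_id

/-- The map `(v, z) ↦ (v + θz, v - (1-θ)z) = (x, y)` preserves volume, with `z = x - y` and `v =
(1-θ)x + θy`. It is performed as two translations. -/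
lemma lintegral_collL_mul (hB : Measurable B) (θ : ℝ) (hG : Measurable G) (hH : Measurable H) (hΦ : Measurable Φ) : ∫⁻ v, collL B θ G H v * Φ v =
      ∫⁻ x, ∫⁻ y, G x * H y * B (x - y) * Φ ((1 - θ) • x + θ • y) := by
  have m1 : Measurable fun p : Vel d × Vel d => G (p.1 + θ • p.2) * H (p.1 - (1 - θ) • p.2) * B p.2 * Φ p.1 := by
    fun_prop
  have m2 : Measurable fun p : Vel d × Vel d => G p.2 * H (p.2 - p.1) * B p.1 * Φ (p.2 - θ • p.1) := by
    fun_prop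
  calc ∫⁻ v, collL B θ G H v * Φ v
      = ∫⁻ v, ∫⁻ z, G (v + θ • z) * H (v - (1 - θ) • z) * B z * Φ v := by
        refine lintegral_congr fun v => ?_
        rw [collL, ← lintegral_mul_const _ (by fun_prop)]
    _ = ∫⁻ z, ∫⁻ v, G (v + θ • z) * H (v - (1 - θ) • z) * B z * Φ v := lintegral_lintegral_swap m1.aemeasurable
    _ = ∫⁻ z, ∫⁻ x, G x * H (x - z) * B z * Φ (x - θ • z) := by
        refine lintegral_congr fun z => ?_
        rw [← lintegral_add_right_eq_self (fun x => G x * H (x - z) * B z * Φ (x - θ • z)) (θ • z)]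
        refine lintegral_congr fun v => ?_
        rw [add_sub_cancel_right, show v + θ • z - z = v - (1 - θ) • z by module]
    _ = ∫⁻ x, ∫⁻ z, G x * H (x - z) * B z * Φ (x - θ • z) := lintegral_lintegral_swap m2.aemeasurable
    _ = _ := by
        refine lintegral_congr fun x => ?_
        rw [← lintegral_sub_left_eq_self _ x]
        refine lintegral_congr fun y => ?_
        rw [sub_sub_cancel, show x - θ • (x - y) = (1 - θ) • x + θ • y by module]

lemma crossL_eq (hB : Measurable B) (hH : Measurable H) : crossL B G H Φ = ∫⁻ x, ∫⁻ y, G x * H y * B (x - y) * Φ x := by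
  refine lintegral_congr fun x => ?_
  rw [convL, ← lintegral_const_mul _ (by fun_prop), ← lintegral_mul_const _ (by fun_prop)]
  simp only [mul_assoc]

lemma crossL_eq_swap (hB : Measurable B) (hBe : ∀ z, B (-z) = B z) (hG : Measurable G) (hH : Measurable H) (hΦ : Measurable Φ) :
    crossL B H G Φ = ∫⁻ x, ∫⁻ y, G x * H y * B (x - y) * Φ y := by
  rw [crossL_eq hB hG, lintegral_lintegral_swap (by fun_prop)]
  refine lintegral_congr fun x => lintegral_congr fun y => ?_
  rw [← hBe (x - y), neg_sub, mul_comm (G x)]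

/-- The cross section as an extended nonnegative real. -/
def crossSectionL (d n m : ℕ) : ℝ≥0∞ := ofReal (crossSection d n m)

lemma crossSection_nonneg (d n m : ℕ) : 0 ≤ crossSection d n m := by unfold crossSection; positivity

lemma crossSection_comm (d n m : ℕ) : crossSection d n m = crossSection d m n := by
  unfold crossSection; rw [add_comm]

lemma crossSection_pos (d : ℕ) (hn : 1 ≤ n) : 0 < crossSection d n m := by
  have : (0 : ℝ) < n := by exact_mod_cast hn
  unfold crossSection; positivity

lemma crossSectionL_comm (d n m : ℕ) : crossSectionL d n m = crossSectionL d m n := by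
  unfold crossSectionL; rw [crossSection_comm]

lemma crossSectionL_ne_top (d n m : ℕ) : crossSectionL d n m ≠ ⊤ := ofReal_ne_top

/-- The total gain for the mass level `m`. -/
def gainL (B : FnL d) (m : ℕ) (G H : ℕ → FnL d) (v : Vel d) : ℝ≥0∞ :=
  ∑ n ∈ Finset.Ico 1 m, crossSectionL d n (m - n) * collL B mfr n m (G n) (H (m - n)) v

/-- The loss rate for the mass level `m`. -/
def rateL (B : FnL d) (M m : ℕ) (H : ℕ → FnL d) (v : Vel d) : ℝ≥0∞ := 2 * ∑ n ∈ Lev M, crossSectionL d n m * convL B (H n) v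

/-- The total `Φ`-moment `∑ₘ m ∫ Fₘ Φ`. -/
def wmom (M : ℕ) (F : ℕ → FnL d) (Φ : FnL d) : ℝ≥0∞ := ∑ m ∈ Lev M, (m : ℝ≥0∞) * ∫⁻ v, F m v * Φ v

/-- The total collision rate. -/
def etot (B : FnL d) (M : ℕ) (G H : ℕ → FnL d) (Φ : FnL d) : ℝ≥0∞ :=
  ∑ n ∈ Lev M, ∑ k ∈ Lev M, (n : ℝ≥0∞) * (crossSectionL d n k * crossL B (G n) (H k) Φ)

/-- The factor two of the loss term survives here; it balances the two summands in the bound for the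
gain. -/
lemma wmom_rateL (hB : Measurable B) (M : ℕ) {G H : ℕ → FnL d} (hG : ∀ n, Measurable (G n)) (hH : ∀ n, Measurable (H n)) (hΦ : Measurable Φ) :
    wmom M (fun m v => G m v * rateL B M m H v) Φ = 2 * etot B M G H Φ := by
  unfold wmom etot rateL
  rw [mul_sum]
  refine sum_congr rfl fun m _ => ?_
  have hc := fun n => measurable_convL hB (hH n)
  have e1 : ∀ v, G m v * (2 * ∑ n ∈ Lev M, crossSectionL d n m * convL B (H n) v) * Φ v =
      ∑ n ∈ Lev M, 2 * crossSectionL d n m * (G m v * convL B (H n) v * Φ v) := fun v => by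
    rw [mul_sum, mul_sum, sum_mul]
    refine sum_congr rfl fun n _ => by ring
  simp only [e1]
  rw [lintegral_finsetSum _ (fun n _ => by fun_prop), mul_sum, mul_sum]
  refine sum_congr rfl fun n _ => ?_
  rw [lintegral_const_mul _ (by fun_prop), crossSectionL_comm, crossL]
  ring

/-- The map `(m, n) ↦ (n, m - n)` is injective into the square. Pairs with `n + k > M` are missed,
since such mergers leave the system; hence only an inequality. -/
lemma sum_Ico_reindex_le (M : ℕ) (X : ℕ → ℕ → ℝ≥0∞) : ∑ m ∈ Lev M, ∑ n ∈ Finset.Ico 1 m, X n (m - n) ≤ ∑ n ∈ Lev M, ∑ k ∈ Lev M, X n k := by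
  rw [← Finset.sum_product', Finset.sum_sigma']
  refine (Finset.sum_le_sum_of_subset (s := ((Lev M).sigma fun m => Finset.Ico 1 m).image fun p => (p.2, p.1 - p.2)) ?_).trans' (le_of_eq ?_)
  · intro p hp
    simp only [Finset.mem_image, Finset.mem_sigma, Finset.mem_Icc, Finset.mem_Ico] at hp
    obtain ⟨⟨m, n⟩, h, rfl⟩ := hp
    simp only [Finset.mem_product, Finset.mem_Icc] at *
    omega
  · rw [Finset.sum_image]
    rintro ⟨m, n⟩ h ⟨m', n'⟩ h' e
    simp only [Finset.coe_sigma, Finset.mem_coe, Finset.mem_Icc, Finset.mem_Ico, Set.mem_sigma_iff, Prod.mk.injEq] at h h' e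
    obtain ⟨rfl, e⟩ := e
    obtain rfl : m = m' := by omega
    rfl

/-- A weight `Φ` that does not increase in a collision. -/
def ConvexWeight (Φ : FnL d) : Prop := ∀ n k : ℕ, 1 ≤ n → 1 ≤ k → ∀ x y : Vel d,
    ((n + k : ℕ) : ℝ≥0∞) * Φ ((1 - (k : ℝ) / ((n + k : ℕ) : ℝ)) • x + ((k : ℝ) / ((n + k : ℕ) : ℝ)) • y) ≤ n * Φ x + k * Φ y

lemma convexWeight_wt (j : ℕ) : ConvexWeight (wt d j) := by
  intro n k hn hk x y
  have hn' : (0 : ℝ) < n := by exact_mod_cast hn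
  have hk' : (0 : ℝ) < k := by exact_mod_cast hk
  have h0 : 0 ≤ 1 - (k : ℝ) / ((n + k : ℕ) : ℝ) := by
    rw [sub_nonneg, div_le_one (by positivity)]; push_cast; linarith
  have h1 : 0 ≤ (k : ℝ) / ((n + k : ℕ) : ℝ) := by positivity
  have h := (convexOn_bracket_pow (d := d) j).2 (mem_univ x) (mem_univ y) h0 h1 (by ring)
  simp only [smul_eq_mul] at h
  unfold wt
  rw [← ENNReal.ofReal_natCast, ← ENNReal.ofReal_natCast, ← ENNReal.ofReal_natCast,
    ← ofReal_mul (by positivity), ← ofReal_mul (by positivity), ← ofReal_mul (by positivity),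
    ← ofReal_add (by have := bracket_pos x; positivity) (by have := bracket_pos y; positivity)]
  refine ofReal_le_ofReal ?_
  calc ((n + k : ℕ) : ℝ) * _ ≤ ((n + k : ℕ) : ℝ) * _ := mul_le_mul_of_nonneg_left h (by positivity)
    _ = _ := by push_cast; field_simp; ring

/-- In each merger the convex weight of the product, multiplied by its mass, is shared by the two
partners. For `G = H` the bound is exactly the loss computed in `wmom_rateL`. -/
lemma wmom_gainL_le (hB : Measurable B) (hBe : ∀ z, B (-z) = B z) (M : ℕ) {G H : ℕ → FnL d} (hG : Meas G) (hH : Meas H)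
    (hΦ : Measurable Φ) (hc : ConvexWeight Φ) :
    wmom M (fun m => gainL B m G H) Φ ≤ etot B M G H Φ + etot B M H G Φ := by
  have key : ∀ n k, 1 ≤ n → 1 ≤ k → ((n + k : ℕ) : ℝ≥0∞) * ∫⁻ v, collL B ((k : ℝ) / ((n + k : ℕ) : ℝ)) (G n) (H k) v * Φ v ≤
      n * crossL B (G n) (H k) Φ + k * crossL B (H k) (G n) Φ := by
    intro n k hn hk
    have hGn := hG n
    have hHk := hH k
    rw [lintegral_collL_mul hB _ hGn hHk hΦ, crossL_eq hB hHk, crossL_eq_swap hB hBe hGn hHk hΦ,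
      ← lintegral_const_mul' _ _ (by simp), ← lintegral_const_mul' _ _ (by simp),
      ← lintegral_const_mul' _ _ (by simp), ← lintegral_add_left]
    · refine lintegral_mono fun x => ?_
      rw [← lintegral_const_mul' _ _ (by simp), ← lintegral_const_mul' _ _ (by simp),
        ← lintegral_const_mul' _ _ (by simp), ← lintegral_add_left (by fun_prop)]
      refine lintegral_mono fun y => ?_
      calc _ = G n x * H k y * B (x - y) * (((n + k : ℕ) : ℝ≥0∞) * Φ ((1 - (k : ℝ) / ((n + k : ℕ) : ℝ)) • x +
              ((k : ℝ) / ((n + k : ℕ) : ℝ)) • y)) := by ring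
        _ ≤ G n x * H k y * B (x - y) * (n * Φ x + k * Φ y) := by gcongr; exact hc n k hn hk x y
        _ = _ := by ring
    · refine Measurable.const_mul ?_ _
      exact Measurable.lintegral_prod_right' (f := fun p : Vel d × Vel d => G n p.1 * H k p.2 * B (p.1 - p.2) * Φ p.1) (by fun_prop)
  calc wmom M (fun m => gainL B m G H) Φ
      = ∑ m ∈ Lev M, ∑ n ∈ Finset.Ico 1 m, crossSectionL d n (m - n) *
          (((n + (m - n) : ℕ) : ℝ≥0∞) * ∫⁻ v, collL B (((m - n : ℕ) : ℝ) / ((n + (m - n) : ℕ) : ℝ)) (G n) (H (m - n)) v * Φ v) := by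
        refine sum_congr rfl fun m hm => ?_
        have e : ∀ v, gainL B m G H v * Φ v = ∑ n ∈ Finset.Ico 1 m, crossSectionL d n (m - n) *
            (collL B mfr n m (G n) (H (m - n)) v * Φ v) := fun v => by
          rw [gainL, sum_mul]; simp only [mul_assoc]
        have hm' : ∀ n k : ℕ, Measurable (collL B mfr n m (G n) (H k)) := fun n k =>
          measurable_collL hB _ (hG n) (hH k)
        simp only [e]
        rw [lintegral_finsetSum _ (fun n _ => by fun_prop), mul_sum]
        refine sum_congr rfl fun n hn => ?_
        rw [Finset.mem_Ico] at hn
        rw [lintegral_const_mul _ (by fun_prop), show n + (m - n) = m by omega, Nat.cast_sub hn.2.le]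
        ring
    _ ≤ ∑ m ∈ Lev M, ∑ n ∈ Finset.Ico 1 m, crossSectionL d n (m - n) *
          (n * crossL B (G n) (H (m - n)) Φ + (m - n : ℕ) * crossL B (H (m - n)) (G n) Φ) := by
        refine sum_le_sum fun m hm => sum_le_sum fun n hn => ?_
        rw [Finset.mem_Ico] at hn
        gcongr
        exact key n (m - n) hn.1 (by omega)
    _ ≤ _ := sum_Ico_reindex_le M fun n k => crossSectionL d n k * (n * crossL B (G n) (H k) Φ + k * crossL B (H k) (G n) Φ)
    _ = _ := by
        unfold etot
        rw [Finset.sum_comm (f := fun n k : ℕ => (n : ℝ≥0∞) * (crossSectionL d n k * crossL B (H n) (G k) Φ)), ← sum_add_distrib]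
        refine sum_congr rfl fun n _ => ?_
        rw [← sum_add_distrib]
        refine sum_congr rfl fun k _ => ?_
        rw [crossSectionL_comm d k n]; ring

lemma bracket_segment_le (h0 : 0 ≤ θ) (h1 : θ ≤ 1) (x y : Vel d) : bracket ((1 - θ) • x + θ • y) ≤ bracket x * bracket y := by
  have hx := one_le_bracket x
  have hy := one_le_bracket y
  have h := convexOn_bracket.2 (mem_univ x) (mem_univ y) (sub_nonneg.2 h1) h0 (by ring)
  simp only [smul_eq_mul] at h
  have a1 : bracket x ≤ bracket x * bracket y := le_mul_of_one_le_right (by linarith) hy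
  have a2 : bracket y ≤ bracket x * bracket y := le_mul_of_one_le_left (by linarith) hx
  calc _ ≤ _ := h
    _ ≤ (1 - θ) * (bracket x * bracket y) + θ * (bracket x * bracket y) := by
        have := sub_nonneg.2 h1
        gcongr
    _ = _ := by ring

lemma wt_segment_le (h0 : 0 ≤ θ) (h1 : θ ≤ 1) (j : ℕ) (x y : Vel d) : wt d j ((1 - θ) • x + θ • y) ≤ wt d j x * wt d j y := by
  unfold wt
  rw [← ofReal_mul (pow_nonneg (bracket_pos x).le j), ← mul_pow]
  exact ofReal_le_ofReal (pow_le_pow_left₀ (bracket_pos _).le (bracket_segment_le h0 h1 x y) j)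

lemma enorm_sub_le_wt (x y : Vel d) : ‖x - y‖ₑ ≤ wt d 1 x * wt d 1 y := by
  unfold wt
  rw [← ofReal_mul (pow_nonneg (bracket_pos x).le 1), ← ofReal_norm]
  refine ofReal_le_ofReal ?_
  simpa using norm_sub_le_bracket_mul x y

/-- In this estimate and the following ones the exponent `i` records the growth of the kernel: `0`
for bounded kernels, `1` for the relative speed, `2` for the difference between kernels cut off at
different heights. -/
lemma lintegral_collL_wt_le (hB : Measurable B) (i : ℕ) (hBl : ∀ x y : Vel d, B (x - y) ≤ K * (wt d i x * wt d i y))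
    (h0 : 0 ≤ θ) (h1 : θ ≤ 1) (j : ℕ) (hG : Measurable G) (hH : Measurable H) :
    ∫⁻ v, collL B θ G H v * wt d j v ≤ K * ((∫⁻ v, G v * wt d (j + i) v) * ∫⁻ v, H v * wt d (j + i) v) := by
  rw [lintegral_collL_mul hB θ hG hH (measurable_wt j), ← lintegral_mul_const _ (by fun_prop), ← lintegral_const_mul _ (by fun_prop)]
  refine lintegral_mono fun x => ?_
  rw [← lintegral_const_mul _ (by fun_prop), ← lintegral_const_mul _ (by fun_prop)]
  refine lintegral_mono fun y => ?_
  calc G x * H y * B (x - y) * wt d j _ ≤ G x * H y * (K * (wt d i x * wt d i y)) * (wt d j x * wt d j y) := by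
        gcongr
        · exact hBl x y
        · exact wt_segment_le h0 h1 j x y
    _ = K * (G x * (wt d j x * wt d i x) * (H y * (wt d j y * wt d i y))) := by ring
    _ = _ := by rw [wt_mul, wt_mul]

lemma convL_le (i : ℕ) (hBl : ∀ x y : Vel d, B (x - y) ≤ K * (wt d i x * wt d i y))
    (hH : Measurable H) (v : Vel d) : convL B H v ≤ K * (wt d i v * ∫⁻ w, H w * wt d i w) := by
  rw [← lintegral_const_mul _ (by fun_prop), ← lintegral_const_mul _ (by fun_prop)]
  refine lintegral_mono fun w => ?_
  calc H w * B (v - w) ≤ H w * (K * (wt d i v * wt d i w)) := by gcongr; exact hBl v w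
    _ = _ := by ring

lemma crossL_le (i : ℕ) (hBl : ∀ x y : Vel d, B (x - y) ≤ K * (wt d i x * wt d i y)) (j : ℕ) (hG : Measurable G) (hH : Measurable H) :
    crossL B G H (wt d j) ≤ K * ((∫⁻ v, G v * wt d (j + i) v) * ∫⁻ w, H w * wt d i w) := by
  rw [← lintegral_mul_const _ (by fun_prop), ← lintegral_const_mul _ (by fun_prop)]
  refine lintegral_mono fun x => ?_
  calc G x * convL B H x * wt d j x ≤ G x * (K * (wt d i x * ∫⁻ w, H w * wt d i w)) * wt d j x := by
        gcongr; exact convL_le i hBl hH x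
    _ = K * (G x * (wt d j x * wt d i x) * ∫⁻ w, H w * wt d i w) := by ring
    _ = _ := by rw [wt_mul]

lemma wmom_add (M : ℕ) {G : ℕ → FnL d} (hF : Meas F) (hΦ : Measurable Φ) : wmom M (fun m v => F m v + G m v) Φ = wmom M F Φ + wmom M G Φ := by
  unfold wmom
  rw [← sum_add_distrib]
  refine sum_congr rfl fun m _ => ?_
  have := hF m
  simp only [add_mul]
  rw [lintegral_add_left (by fun_prop), mul_add]

lemma wmom_mono (M : ℕ) {G : ℕ → FnL d} (h : ∀ m ∈ Lev M, ∀ᵐ v, F m v ≤ G m v) : wmom M F Φ ≤ wmom M G Φ := by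
  refine sum_le_sum fun m hm => ?_
  gcongr 1
  refine lintegral_mono_ae ?_
  filter_upwards [h m hm] with v hv
  gcongr

lemma wmom_const_mul (M : ℕ) (hF : Meas F) (hΦ : Measurable Φ) (c : ℝ≥0∞) : wmom M (fun m v => c * F m v) Φ = c * wmom M F Φ := by
  unfold wmom
  rw [mul_sum]
  refine sum_congr rfl fun m _ => ?_
  have := hF m
  simp only [mul_assoc]
  rw [lintegral_const_mul _ (by fun_prop)]
  ring

lemma le_wmom (hm : m ∈ Lev M) (F : ℕ → FnL d) (Φ : FnL d) : ∫⁻ v, F m v * Φ v ≤ wmom M F Φ := by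
  refine le_trans ?_ (single_le_sum (f := fun m : ℕ => (m : ℝ≥0∞) * ∫⁻ v, F m v * Φ v) (fun _ _ => zero_le) hm)
  refine le_mul_of_one_le_left zero_le ?_
  exact_mod_cast (Finset.mem_Icc.1 hm).1

/-- The largest collision rate constant. -/
def crossMax (d M : ℕ) : ℝ≥0∞ := ∑ n ∈ Lev M, ∑ k ∈ Lev M, crossSectionL d n k

lemma crossMax_ne_top (d M : ℕ) : crossMax d M ≠ ⊤ := (sum_lt_top.2 fun _ _ => sum_lt_top.2 fun _ _ => (crossSectionL_ne_top _ _ _).lt_top).ne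

lemma le_crossMax (hn : n ∈ Lev M) (hk : k ∈ Lev M) : crossSectionL d n k ≤ crossMax d M :=
  (single_le_sum (f := fun k => crossSectionL d n k) (fun _ _ => zero_le) hk).trans
    (single_le_sum (f := fun n => ∑ k ∈ Lev M, crossSectionL d n k) (fun _ _ => zero_le) hn)

/-- The weight `j` falls on the first density alone. Stability uses this asymmetry to place the high
moment on the known densities and the low one on their difference. -/
lemma etot_le (i : ℕ) (hBl : ∀ x y : Vel d, B (x - y) ≤ K * (wt d i x * wt d i y)) (M j : ℕ) {G H : ℕ → FnL d} (hG : Meas G) (hH : Meas H) :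
    etot B M G H (wt d j) ≤ crossMax d M * (K * (wmom M G (wt d (j + i)) * wmom M H (wt d i))) := by
  calc etot B M G H (wt d j) ≤ ∑ n ∈ Lev M, ∑ k ∈ Lev M,
        crossMax d M * (K * ((n * ∫⁻ v, G n v * wt d (j + i) v) * (k * ∫⁻ v, H k v * wt d i v))) := by
        refine sum_le_sum fun n hn => sum_le_sum fun k hk => ?_
        have hk1 : (1 : ℝ≥0∞) ≤ k := by exact_mod_cast (Finset.mem_Icc.1 hk).1
        calc _ ≤ (n : ℝ≥0∞) * (crossMax d M * (K * ((∫⁻ v, G n v * wt d (j + i) v) * (1 * ∫⁻ w, H k w * wt d i w)))) := by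
              rw [one_mul]
              gcongr
              · exact le_crossMax hn hk
              · exact crossL_le i hBl j (hG n) (hH k)
          _ ≤ (n : ℝ≥0∞) * (crossMax d M * (K * ((∫⁻ v, G n v * wt d (j + i) v) * (k * ∫⁻ w, H k w * wt d i w)))) := by
              gcongr
          _ = _ := by ring
    _ = _ := by
        unfold wmom
        rw [Finset.sum_mul_sum, mul_sum, mul_sum]
        simp only [mul_sum]

lemma rateL_le (i : ℕ) (hBl : ∀ x y : Vel d, B (x - y) ≤ K * (wt d i x * wt d i y)) (hm : m ∈ Lev M) {H : ℕ → FnL d} (hH : Meas H) (v : Vel d) :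
    rateL B M m H v ≤ 2 * crossMax d M * (K * wmom M H (wt d i)) * wt d i v := by
  calc rateL B M m H v ≤ 2 * ∑ n ∈ Lev M,
        crossMax d M * (K * (((n : ℝ≥0∞) * ∫⁻ w, H n w * wt d i w) * wt d i v)) := by
        unfold rateL
        gcongr with n hn
        · exact le_crossMax hn hm
        · have hn1 : (1 : ℝ≥0∞) ≤ n := by exact_mod_cast (Finset.mem_Icc.1 hn).1
          refine (convL_le i hBl (hH n) v).trans ?_
          rw [mul_comm (wt d i v)]
          gcongr
          exact le_mul_of_one_le_left zero_le hn1
    _ = _ := by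
        rw [wmom, ← mul_sum, ← mul_sum, ← sum_mul]
        ring

end CollisionL

/-! ### The collision operator for signed densities -/

section Collision

variable {h : Fn d} {S f : ℕ → Fn d} {H : ℕ → FnL d}

/-- The signed gain-type density; see `collL`. -/
def coll (b : Fn d) (θ : ℝ) (g h : Fn d) (v : Vel d) : ℝ := ∫ z, g (v + θ • z) * h (v - (1 - θ) • z) * b z

/-- The convolution `b * h`. -/
def conv (b h : Fn d) (v : Vel d) : ℝ := ∫ w, h w * b (v - w)

/-- The gain term for the mass level `m`. -/
def gainR (b : Fn d) (m : ℕ) (f : ℕ → Fn d) (v : Vel d) : ℝ := ∑ n ∈ Finset.Ico 1 m, crossSection d n (m - n) * coll b mfr n m (f n) (f (m - n)) v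

/-- The loss rate for the mass level `m`. -/
def rateR (b : Fn d) (M m : ℕ) (f : ℕ → Fn d) (v : Vel d) : ℝ := 2 * ∑ n ∈ Lev M, crossSection d n m * conv b (f n) v

/-- The collision operator with the kernel `b`. -/
def collB (b : Fn d) (M m : ℕ) (f : ℕ → Fn d) (v : Vel d) : ℝ := gainR b m f v - f m v * rateR b M m f v

scoped notation:max "cB" b:max M:max m:max f:max => fun s => collB b M m fun n => f n s
scoped notation:max "SolAt" b:max M:max c:max D:max u:max f:max m:max t:max =>
  LinWeakAt (c m) (D m) 0 0 (u m) (f m) cB b M m f t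

/-- The substitution `w = v - (n/m)z` makes `z` the relative velocity up to sign and cancels the
factor `(m/n)^d`. The kernel then no longer depends on `v`, so later derivatives fall on the
densities only. -/
lemma gain_eq_coll (hn : 1 ≤ n) (hm : 1 ≤ m) (g h : Fn d) (v : Vel d) : gain m n g h v = coll norm mfr n m g h v := by
  have hn' : (0 : ℝ) < n := by exact_mod_cast hn
  have hm' : (0 : ℝ) < m := by exact_mod_cast hm
  unfold gain coll
  set F : Fn d := fun w => g (preVel m n v w) * h w * ‖w - preVel m n v w‖ * ((m : ℝ) / (n : ℝ)) ^ d
  have h1 : ∫ w, F w = ∫ w, F (v - w) := (integral_sub_left_eq_self F volume v).symm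
  have h2 := Measure.integral_comp_smul (volume : Measure (Vel d)) (fun w => F (v - w)) ((n : ℝ) / m)
  have h3 : ∫ w, F (v - w) = ((n : ℝ) / m) ^ d * ∫ w, F (v - ((n : ℝ) / m) • w) := by
    rw [h2, finrank_euclideanSpace_fin, abs_of_pos (by positivity), smul_eq_mul, ← mul_assoc, mul_inv_cancel₀ (by positivity), one_mul]
  rw [h1, h3, ← integral_const_mul]
  refine integral_ext fun z => ?_
  have e1 : preVel m n v (v - ((n : ℝ) / m) • z) = v + mfr n m • z := by
    unfold preVel
    simp only [smul_sub, smul_smul]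
    have a1 : (n : ℝ)⁻¹ * (((m : ℝ) - n) * (n / m)) = mfr n m := by field_simp
    rw [a1]
    have a2 : ((n : ℝ)⁻¹ * m) • v = v + ((n : ℝ)⁻¹ * (m - n)) • v := by
      rw [show (n : ℝ)⁻¹ * m = 1 + (n : ℝ)⁻¹ * (m - n) by field_simp; ring, add_smul, one_smul]
    rw [a2]
    abel
  have e2 : (1 : ℝ) - mfr n m = n / m := by field_simp; ring
  have e3 : v - ((n : ℝ) / m) • z - (v + mfr n m • z) = -z := by
    have : z = ((n : ℝ) / m) • z + mfr n m • z := by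
      rw [← add_smul, show (n : ℝ) / m + mfr n m = 1 by field_simp; ring, one_smul]
    nth_rewrite 3 [this]
    abel
  simp only [F, e1, e2, e3, norm_neg]
  have e4 : ((n : ℝ) / m) ^ d * ((m : ℝ) / n) ^ d = 1 := by
    rw [← mul_pow, div_mul_div_cancel₀ hm'.ne', div_self hn'.ne', one_pow]
  linear_combination (g (v + mfr n m • z) * h (v - ((n : ℝ) / m) • z) * ‖z‖) * e4

lemma collision_eq (M m : ℕ) (f : ℕ → Fn d) (v : Vel d) : collision M m f v = collB norm M m f v := by
  unfold collision collB gainR rateR conv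
  congr 1
  · refine sum_congr rfl fun n hn => ?_
    rw [Finset.mem_Ico] at hn
    rw [gain_eq_coll hn.1 (hn.1.trans hn.2.le)]
  · refine Eq.trans ?_ (mul_left_comm 2 (f m v) _)
    rw [mul_sum (Lev M) _ (f m v)]
    congr 1
    refine sum_congr rfl fun n _ => ?_
    simp only [mul_assoc]
    rw [integral_const_mul]
    ring

/-- As for the semigroup, densities and velocity depend on a parameter, which covers joint
measurability in time and velocity. -/
lemma measurable_coll_comp (hb : Measurable b) (θ : ℝ) {g h : X → Fn d} (hg : Measurable (uncurry g)) (hh : Measurable (uncurry h))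
    (hv : Measurable v) : Measurable fun x => coll b θ (g x) (h x) (v x) := by
  have : Measurable fun p : X × Vel d => g p.1 (v p.1 + θ • p.2) * h p.1 (v p.1 - (1 - θ) • p.2) * b p.2 := by
    refine ((hg.comp (f := fun p : X × Vel d => (p.1, v p.1 + θ • p.2)) ?_).mul
      (hh.comp (f := fun p : X × Vel d => (p.1, v p.1 - (1 - θ) • p.2)) ?_)).mul (hb.comp measurable_snd)
    · exact measurable_fst.prodMk (by fun_prop)
    · exact measurable_fst.prodMk (by fun_prop)
  exact this.stronglyMeasurable.integral_prod_right'.measurable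

lemma measurable_conv_comp (hb : Measurable b) {h : X → Fn d} (hh : Measurable (uncurry h)) (hv : Measurable v) :
    Measurable fun x => conv b (h x) (v x) := by
  have : Measurable fun p : X × Vel d => h p.1 p.2 * b (v p.1 - p.2) := hh.mul (hb.comp (by fun_prop))
  exact this.stronglyMeasurable.integral_prod_right'.measurable

lemma measurable_gainR_comp (hb : Measurable b) (m : ℕ) {f : ℕ → X → Fn d} (hf : UMeas f) (hv : Measurable v) :
    Measurable fun x => gainR b m (fun n => f n x) (v x) := by
  unfold gainR
  exact measurable_sum _ fun n _ => (measurable_coll_comp hb _ (hf n) (hf _) hv).const_mul _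

lemma measurable_rateR_comp (hb : Measurable b) (M m : ℕ) {f : ℕ → X → Fn d} (hf : UMeas f) (hv : Measurable v) :
    Measurable fun x => rateR b M m (fun n => f n x) (v x) := by
  unfold rateR
  exact (measurable_sum _ fun n _ => (measurable_conv_comp hb (hf n) hv).const_mul _).const_mul _

lemma measurable_collB_comp (hb : Measurable b) (M m : ℕ) {f : ℕ → X → Fn d} (hf : UMeas f) (hv : Measurable v) :
    Measurable fun x => collB b M m (fun n => f n x) (v x) :=
  (measurable_gainR_comp hb m hf hv).sub (((hf m).comp (measurable_id.prodMk hv)).mul (measurable_rateR_comp hb M m hf hv))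

lemma measurable_collB (hb : Measurable b) (M m : ℕ) (hf : Meas f) : Measurable (collB b M m f) :=
  measurable_collB_comp (X := Vel d) hb M m (f := fun n _ => f n) (fun n => (hf n).comp measurable_snd) measurable_id

/-- The absolute value of a kernel or density as an extended nonnegative function. -/
def absL (b : Fn d) (z : Vel d) : ℝ≥0∞ := ‖b z‖ₑ

/-- The absolute values of a family of densities. -/
def famL (f : ℕ → Fn d) (m : ℕ) (v : Vel d) : ℝ≥0∞ := ‖f m v‖ₑ

scoped notation:max "mom" M:max f:max t:max => wmom M (famL fun m => f m t)
scoped notation:max "diffL" f:max g:max => famL fun m v => f m v - g m v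
scoped notation:max "avgL" f:max g:max => famL fun n v => (f n v + g n v) / 2
scoped notation:max "dmom" M:max f:max g:max => wmom M diffL f g

lemma measurable_absL (hb : Measurable b) : Measurable (absL b) := hb.enorm

lemma measurable_famL (hf : Meas f) (n : ℕ) : Measurable (famL f n) := (hf n).enorm

lemma enorm_coll_le (b : Fn d) (θ : ℝ) (g h : Fn d) (v : Vel d) : ‖coll b θ g h v‖ₑ ≤ collL (absL b) θ (absL g) (absL h) v := by
  refine (enorm_integral_le_lintegral_enorm _).trans (le_of_eq (lintegral_congr fun z => ?_))
  rw [enorm_mul, enorm_mul]; rfl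

lemma enorm_conv_le (b h : Fn d) (v : Vel d) : ‖conv b h v‖ₑ ≤ convL (absL b) (absL h) v := by
  refine (enorm_integral_le_lintegral_enorm _).trans (le_of_eq (lintegral_congr fun z => ?_))
  rw [enorm_mul]; rfl

lemma enorm_sum_le' {ι : Type*} (s : Finset ι) (f : ι → ℝ) : ‖∑ i ∈ s, f i‖ₑ ≤ ∑ i ∈ s, ‖f i‖ₑ := enorm_sum_le s f

lemma enorm_crossSection (d n m : ℕ) : ‖crossSection d n m‖ₑ = crossSectionL d n m := enorm_of_nonneg (crossSection_nonneg d n m)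

lemma enorm_gainR_le (b : Fn d) (m : ℕ) (f : ℕ → Fn d) (v : Vel d) : ‖gainR b m f v‖ₑ ≤ gainL (absL b) m (famL f) (famL f) v := by
  refine (enorm_sum_le' _ _).trans (sum_le_sum fun n _ => ?_)
  rw [enorm_mul, enorm_crossSection]
  gcongr
  exact enorm_coll_le _ _ _ _ _

lemma enorm_rateR_le (b : Fn d) (M m : ℕ) (f : ℕ → Fn d) (v : Vel d) : ‖rateR b M m f v‖ₑ ≤ rateL (absL b) M m (famL f) v := by
  unfold rateR rateL
  rw [enorm_mul, show ‖(2 : ℝ)‖ₑ = 2 by rw [enorm_of_nonneg (by norm_num)]; simp]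
  gcongr
  refine (enorm_sum_le' _ _).trans (sum_le_sum fun n _ => ?_)
  rw [enorm_mul, enorm_crossSection]
  gcongr
  exact enorm_conv_le _ _ _

/-- An admissible collision kernel: even, nonnegative and at most the relative speed. -/
structure IsKernel (b : Fn d) : Prop where
  meas : Measurable b
  even : ∀ z, b (-z) = b z
  nonneg : ∀ z, 0 ≤ b z
  le_norm : ∀ z, b z ≤ ‖z‖

lemma isKernel_norm : IsKernel (norm : Fn d) := ⟨measurable_norm, norm_neg, norm_nonneg, fun _ => le_rfl⟩

lemma isKernel_min (hR : 0 ≤ R) : IsKernel (fun z : Vel d => min ‖z‖ R) :=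
  ⟨by fun_prop, fun z => by rw [norm_neg], fun z => le_min (norm_nonneg z) hR, fun z => min_le_left _ _⟩

lemma IsKernel.absL_le (hb : IsKernel b) (x y : Vel d) : absL b (x - y) ≤ 1 * (wt d 1 x * wt d 1 y) := by
  rw [one_mul]
  refine le_trans ?_ (enorm_sub_le_wt x y)
  unfold absL
  rw [enorm_of_nonneg (hb.nonneg _), ← ofReal_norm]
  exact ofReal_le_ofReal (hb.le_norm _)

lemma absL_even (hb : ∀ z, b (-z) = b z) (z : Vel d) : absL b (-z) = absL b z := by
  unfold absL; rw [hb]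

lemma wmom_famL_collB_le (hb : Measurable b) (hbe : ∀ z, b (-z) = b z) (M : ℕ) (hf : Meas f) (j : ℕ) :
    wmom M (famL fun m => collB b M m f) (wt d j) ≤ 4 * etot (absL b) M (famL f) (famL f) (wt d j) := by
  have hB := measurable_absL hb
  have hF := measurable_famL hf
  have hgm : ∀ m, Measurable (gainL (absL b) m (famL f) (famL f)) := fun m =>
    measurable_sum _ fun n _ => (measurable_collL hB _ (hF n) (hF _)).const_mul _
  calc wmom M (famL fun m => collB b M m f) (wt d j)
      ≤ wmom M (fun m v => gainL (absL b) m (famL f) (famL f) v + famL f m v * rateL (absL b) M m (famL f) v) (wt d j) := by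
        refine wmom_mono M fun m _ => of_forall fun v => ?_
        refine (enorm_sub_le).trans ?_
        rw [enorm_mul]
        gcongr
        · exact enorm_gainR_le b m f v
        · exact le_rfl
        · exact enorm_rateR_le b M m f v
    _ ≤ _ := by
        rw [wmom_add M hgm (measurable_wt j), wmom_rateL hB M hF hF (measurable_wt j)]
        refine (add_le_add (wmom_gainL_le hB (absL_even hbe) M hF hF (measurable_wt j) (convexWeight_wt j)) le_rfl).trans (le_of_eq (by ring))

lemma integrable_conv (hb : Measurable b) (hh : Measurable h) (hK : K ≠ ⊤) (i : ℕ) (hbl : ∀ x y : Vel d, absL b (x - y) ≤ K * (wt d i x * wt d i y))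
    (hfin : nrm i h ≠ ⊤) (v : Vel d) : Integrable fun w => h w * b (v - w) := by
  refine ⟨(hh.mul (hb.comp (by fun_prop))).aestronglyMeasurable, ?_⟩
  have h1 := convL_le i hbl (H := absL h) (measurable_absL hh) v
  refine lt_of_le_of_lt (le_of_eq ?_) (h1.trans_lt (mul_lt_top hK.lt_top (mul_lt_top (wt_ne_top i v).lt_top hfin.lt_top)))
  refine lintegral_congr fun w => ?_
  rw [enorm_mul]; rfl

/-- The integral over all `v` of the absolute collision density is finite, so the inner integral is
finite for almost every `v`. -/
lemma ae_integrable_coll (hb : Measurable b) (hg : Measurable g) (hh : Measurable h)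
    (hK : K ≠ ⊤) (i : ℕ) (hbl : ∀ x y : Vel d, absL b (x - y) ≤ K * (wt d i x * wt d i y)) (hgf : nrm i g ≠ ⊤) (hhf : nrm i h ≠ ⊤)
    (h0 : 0 ≤ θ) (h1 : θ ≤ 1) :
    ∀ᵐ v, Integrable fun z => g (v + θ • z) * h (v - (1 - θ) • z) * b z := by
  have hl := lintegral_collL_wt_le (measurable_absL hb) i hbl h0 h1 0 (measurable_absL hg) (measurable_absL hh)
  simp only [wt_zero, mul_one, zero_add] at hl
  have hfin : ∫⁻ v, collL (absL b) θ (absL g) (absL h) v ≠ ⊤ := (hl.trans_lt (mul_lt_top hK.lt_top (mul_lt_top hgf.lt_top hhf.lt_top))).ne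
  filter_upwards [ae_lt_top (measurable_collL (measurable_absL hb) θ (measurable_absL hg) (measurable_absL hh)) hfin] with v hv
  refine ⟨Measurable.aestronglyMeasurable (by fun_prop), lt_of_le_of_lt (le_of_eq (lintegral_congr fun z => ?_)) hv⟩
  rw [enorm_mul, enorm_mul]; rfl

lemma theta_mem (hn : n ∈ Finset.Ico 1 m) : 0 ≤ mfr n m ∧ mfr n m ≤ 1 := by
  rw [Finset.mem_Ico] at hn
  have h1 : (n : ℝ) ≤ m := by exact_mod_cast hn.2.le
  have h2 : (0 : ℝ) < m := by exact_mod_cast (by omega : 0 < m)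
  have h3 : (0 : ℝ) ≤ n := Nat.cast_nonneg n
  constructor
  · exact div_nonneg (by linarith) h2.le
  · rw [div_le_one h2]; linarith

lemma mem_Icc_of_Ico (hm : m ∈ Lev M) (hn : n ∈ Finset.Ico 1 m) : n ∈ Lev M ∧ m - n ∈ Lev M := by
  simp only [Finset.mem_Icc, Finset.mem_Ico] at *; omega

lemma enorm_half_le {y : ℝ} (hx : ‖x‖ₑ ≤ K) (hy : ‖y‖ₑ ≤ K) : ‖(x + y) / 2‖ₑ ≤ K := by
  rw [enorm_eq_ofReal_abs] at *
  by_cases hK : K = ⊤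
  · simp [hK]
  · rw [ENNReal.ofReal_le_iff_le_toReal hK] at *
    rw [abs_div, abs_two]
    linarith [abs_add_le x y]

lemma rateL_famL_eq (hb : IsKernel b) (hS : Meas S) (hS0 : Pos2 S) (hSf : ∀ n ∈ Lev M, nrm 1 (S n) ≠ ⊤) (v : Vel d) :
    rateL (absL b) M m (famL S) v = ofReal (rateR b M m S v) := by
  unfold rateR rateL
  rw [ofReal_mul (by norm_num), ENNReal.ofReal_sum_of_nonneg]
  · congr 1
    · simp
    refine sum_congr rfl fun n hn => ?_
    rw [ofReal_mul (crossSection_nonneg _ _ _), crossSectionL]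
    congr 1
    unfold convL conv
    rw [ofReal_integral_eq_lintegral_ofReal (integrable_conv hb.meas (hS n) one_ne_top 1 hb.absL_le (hSf n hn) v)
      (of_forall fun w => mul_nonneg (hS0 n w) (hb.nonneg _))]
    refine lintegral_congr fun w => ?_
    unfold famL absL
    rw [enorm_of_nonneg (hS0 n w), enorm_of_nonneg (hb.nonneg _), ← ofReal_mul (hS0 n w)]
  · intro n _
    exact mul_nonneg (crossSection_nonneg _ _ _) (integral_nonneg fun w => mul_nonneg (hS0 n w) (hb.nonneg _))

lemma rateR_nonneg (hb : IsKernel b) (M m : ℕ) (hS0 : Pos2 S) (v : Vel d) : 0 ≤ rateR b M m S v :=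
  mul_nonneg (by norm_num) (sum_nonneg fun n _ => mul_nonneg (crossSection_nonneg _ _ _) (integral_nonneg fun w => mul_nonneg (hS0 n w) (hb.nonneg _)))

lemma gainR_nonneg (hb : IsKernel b) (m : ℕ) (hS0 : Pos2 S) (v : Vel d) : 0 ≤ gainR b m S v :=
  sum_nonneg fun n _ => mul_nonneg (crossSection_nonneg _ _ _) (integral_nonneg fun _ => mul_nonneg (mul_nonneg (hS0 n _) (hS0 _ _)) (hb.nonneg _))

/-- The pointwise estimate behind the stability of the collision operator. -/
lemma collB_sub_le (hb : IsKernel b) {g : ℕ → Fn d} (hf : Meas f) (hg : Meas g) (hf0 : Pos2 f) (hg0 : Pos2 g) (hff : ∀ n ∈ Lev M, nrm 1 (f n) ≠ ⊤)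
    (hgf : ∀ n ∈ Lev M, nrm 1 (g n) ≠ ⊤) (hl : 0 ≤ lam) (hm : m ∈ Lev M) :
    ∀ᵐ v, ‖lam * (f m v - g m v) + (collB b M m f v - collB b M m g v)‖ₑ + diffL f g m v * rateL (absL b) M m avgL f g v ≤ ofReal lam * diffL f g m v +
      2 * ((rateL (absL b) M m avgL f g v - ofReal lam) * diffL f g m v) +
      (gainL (absL b) m diffL f g avgL f g v + gainL (absL b) m avgL f g diffL f g v + avgL f g m v * rateL (absL b) M m diffL f g v) := by
  set u : ℕ → Fn d := fun n v => f n v - g n v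
  -- Polarization: with `f = S + u/2` and `g = S - u/2`, a bilinear expression changes by its values
  -- at `(u, S)` and `(S, u)`, without a quadratic remainder.
  set S : ℕ → Fn d := fun n v => (f n v + g n v) / 2
  have hu : Meas u := fun n => (hf n).sub (hg n)
  have hS : Meas S := fun n => ((hf n).add (hg n)).div_const 2
  have hS0 : Pos2 S := fun n v => by
    have := hf0 n v; have := hg0 n v; simp only [S]; positivity
  have hsum : ∀ n ∈ Lev M, ∫⁻ v, (‖f n v‖ₑ + ‖g n v‖ₑ) * wt d 1 v ≠ ⊤ := fun n hn => by
    simp only [add_mul]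
    have hm : Measurable fun v => ‖f n v‖ₑ * wt d 1 v := (hf n).enorm.mul (measurable_wt 1)
    rw [lintegral_add_left hm]
    exact add_ne_top.2 ⟨hff n hn, hgf n hn⟩
  have huf : ∀ n ∈ Lev M, nrm 1 (u n) ≠ ⊤ := fun n hn => by
    refine ne_top_of_le_ne_top (hsum n hn) (lintegral_mono fun v => ?_)
    gcongr
    exact enorm_sub_le
  have hSf : ∀ n ∈ Lev M, nrm 1 (S n) ≠ ⊤ := fun n hn => by
    refine ne_top_of_le_ne_top (hsum n hn) (lintegral_mono fun v => ?_)
    gcongr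
    exact enorm_half_le le_self_add le_add_self
  have one : (1 : ℝ≥0∞) ≠ ⊤ := one_ne_top
  have cI : ∀ {h : Fn d}, Measurable h → nrm 1 h ≠ ⊤ → ∀ v,
      Integrable fun w => h w * b (v - w) := fun hm hf v => integrable_conv hb.meas hm one 1 hb.absL_le hf v
  have rate : ∀ {h : ℕ → Fn d} (ε : ℝ), (∀ n v, h n v = S n v + ε * u n v) → ∀ v,
      rateR b M m h v = rateR b M m S v + ε * rateR b M m u v := fun {h} ε hh v => by
    unfold rateR
    rw [mul_left_comm, ← mul_add]
    congr 1
    rw [mul_sum, ← sum_add_distrib]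
    refine sum_congr rfl fun n hn => ?_
    have : conv b (h n) v = conv b (S n) v + ε * conv b (u n) v := by
      unfold conv
      rw [← integral_const_mul, ← integral_add (cI (hS n) (hSf n hn) v) ((cI (hu n) (huf n hn) v).const_mul ε)]
      refine integral_ext fun w => ?_
      rw [hh]; ring
    rw [this]; ring
  have rateS : ∀ v, rateL (absL b) M m (famL S) v = ofReal (rateR b M m S v) := rateL_famL_eq hb hS hS0 hSf
  have gainD : ∀ᵐ v, gainR b m f v - gainR b m g v = ∑ n ∈ Finset.Ico 1 m, crossSection d n (m - n) *
      (coll b mfr n m (u n) (S (m - n)) v + coll b mfr n m (S n) (u (m - n)) v) := by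
    have aI : ∀ {g h : Fn d}, Measurable g → Measurable h → nrm 1 g ≠ ⊤ → nrm 1 h ≠ ⊤ → ∀ n ∈ Finset.Ico 1 m, ∀ᵐ v, Integrable fun z =>
          g (v + mfr n m • z) * h (v - (1 - mfr n m) • z) * b z := fun hg hh h1 h2 n hn =>
      ae_integrable_coll hb.meas hg hh one 1 hb.absL_le h1 h2 (theta_mem hn).1 (theta_mem hn).2
    have all : ∀ᵐ v, ∀ n ∈ Finset.Ico 1 m, coll b mfr n m (f n) (f (m - n)) v - coll b mfr n m (g n) (g (m - n)) v =
        coll b mfr n m (u n) (S (m - n)) v + coll b mfr n m (S n) (u (m - n)) v := by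
      rw [Filter.eventually_all_finset]
      intro n hn
      obtain ⟨h1, h2⟩ := mem_Icc_of_Ico hm hn
      filter_upwards [aI (hf n) (hf (m - n)) (hff n h1) (hff _ h2) n hn, aI (hg n) (hg (m - n)) (hgf n h1) (hgf _ h2) n hn,
        aI (hu n) (hS (m - n)) (huf n h1) (hSf _ h2) n hn,
        aI (hS n) (hu (m - n)) (hSf n h1) (huf _ h2) n hn] with v i1 i2 i3 i4
      unfold coll
      rw [← integral_sub i1 i2, ← integral_add i3 i4]
      refine integral_ext fun z => ?_
      simp only [S, u]; ring
    filter_upwards [all] with v hv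
    unfold gainR
    rw [← sum_sub_distrib]
    refine sum_congr rfl fun n hn => ?_
    rw [← hv n hn]; ring
  filter_upwards [gainD] with v hv
  have hA0 : 0 ≤ rateR b M m S v := rateR_nonneg hb M m hS0 v
  set A := rateR b M m S v
  have e1 : lam * (f m v - g m v) + (collB b M m f v - collB b M m g v) =
      (lam - A) * u m v + ((gainR b m f v - gainR b m g v) - S m v * rateR b M m u v) := by
    unfold collB
    rw [rate (h := f) 2⁻¹ fun n v => by simp only [S, u]; ring, rate (h := g) (-2⁻¹) fun n v => by simp only [S, u]; ring]
    simp only [u, S, A]; ring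
  have e2 : ‖gainR b m f v - gainR b m g v‖ₑ ≤ gainL (absL b) m (famL u) (famL S) v + gainL (absL b) m (famL S) (famL u) v := by
    rw [hv]
    refine (enorm_sum_le' _ _).trans ?_
    unfold gainL
    rw [← sum_add_distrib]
    refine sum_le_sum fun n _ => ?_
    rw [enorm_mul, enorm_crossSection, ← mul_add]
    gcongr
    exact (enorm_add_le _ _).trans (add_le_add (enorm_coll_le _ _ _ _ _) (enorm_coll_le _ _ _ _ _))
  have e3 : ‖S m v * rateR b M m u v‖ₑ ≤ famL S m v * rateL (absL b) M m (famL u) v := by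
    rw [enorm_mul]
    exact mul_le_mul' le_rfl (enorm_rateR_le b M m u v)
  -- The identity `|λ - A| + A = λ + 2(A - λ)₊`; subtraction of extended nonnegative numbers is
  -- truncated and so gives the positive part.
  have e4 : ‖(lam - A) * u m v‖ₑ + famL u m v * ofReal A ≤ ofReal lam * famL u m v + 2 * ((ofReal A - ofReal lam) * famL u m v) := by
    rw [enorm_mul, show ‖u m v‖ₑ = famL u m v from rfl, enorm_eq_ofReal_abs, mul_comm (famL u m v), ← add_mul, ← mul_assoc, ← add_mul,
      ← ENNReal.ofReal_sub _ hl, ← ofReal_add (abs_nonneg _) hA0]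
    gcongr
    · rcases le_total A lam with h | h
      · rw [abs_of_nonneg (by linarith), ENNReal.ofReal_of_nonpos (p := A - lam) (by linarith)]
        simp
      · rw [abs_of_nonpos (by linarith), show (2 : ℝ≥0∞) = ofReal 2 by simp, ← ofReal_mul (by norm_num), ← ofReal_add hl (by linarith)]
        refine ofReal_le_ofReal (by linarith)
  rw [e1, rateS]
  calc _ ≤ (‖(lam - A) * u m v‖ₑ + (‖gainR b m f v - gainR b m g v‖ₑ + ‖S m v * rateR b M m u v‖ₑ)) +
        famL u m v * ofReal A := by
        gcongr
        exact (enorm_add_le _ _).trans (add_le_add le_rfl enorm_sub_le)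
    _ = (‖(lam - A) * u m v‖ₑ + famL u m v * ofReal A) + (‖gainR b m f v - gainR b m g v‖ₑ + ‖S m v * rateR b M m u v‖ₑ) := by ring
    _ ≤ _ := add_le_add e4 (add_le_add e2 e3)

lemma measurable_gainL (hB : Measurable B) (m : ℕ) {G : ℕ → FnL d} (hG : Meas G) (hH : Meas H) : Measurable (gainL B m G H) :=
  measurable_sum _ fun n _ => (measurable_collL hB _ (hG n) (hH _)).const_mul _

lemma measurable_rateL (hB : Measurable B) (M m : ℕ) (hH : Meas H) : Measurable (rateL B M m H) :=
  (measurable_sum _ fun n _ => (measurable_convL hB (hH n)).const_mul _).const_mul _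

/-- The weighted `L¹` estimate behind the stability of the collision operator. -/
lemma wmom_collB_sub_le (hb : IsKernel b) {g : ℕ → Fn d} (hf : Meas f) (hg : Meas g) (hf0 : Pos2 f) (hg0 : Pos2 g)
    (hff : ∀ n ∈ Lev M, nrm 1 (f n) ≠ ⊤) (hgf : ∀ n ∈ Lev M, nrm 1 (g n) ≠ ⊤) (hl : 0 ≤ lam) (hΦ : Measurable Φ) (hc : ConvexWeight Φ)
    (hfin : etot (absL b) M diffL f g avgL f g Φ ≠ ⊤) :
    wmom M (famL fun m v => lam * (f m v - g m v) + (collB b M m f v - collB b M m g v)) Φ ≤ ofReal lam * dmom M f g Φ +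
      2 * wmom M (fun m v => (rateL (absL b) M m avgL f g v - ofReal lam) * diffL f g m v) Φ +
      4 * etot (absL b) M avgL f g diffL f g Φ := by
  have key := fun m hm => collB_sub_le hb hf hg hf0 hg0 hff hgf hl (m := m) hm
  set u : ℕ → Fn d := fun n v => f n v - g n v
  set S : ℕ → Fn d := fun n v => (f n v + g n v) / 2
  have hu : Meas u := fun n => (hf n).sub (hg n)
  have hS : Meas S := fun n => ((hf n).add (hg n)).div_const 2
  have hB := measurable_absL hb.meas
  have hU := measurable_famL hu
  have hSS := measurable_famL hS
  have r1 := fun m => measurable_rateL hB M m hSS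
  have r2 := fun m => measurable_rateL hB M m hU
  have g1 := fun m => measurable_gainL hB m hU hSS
  have g2 := fun m => measurable_gainL hB m hSS hU
  have q1 := fun m => measurable_collB hb.meas M m hf
  have q2 := fun m => measurable_collB hb.meas M m hg
  have hL : ∀ m, Measurable (famL (fun m v => lam * (f m v - g m v) + (collB b M m f v - collB b M m g v)) m) :=
    fun m => (((hu m).const_mul lam).add ((q1 m).sub (q2 m))).enorm
  have tot := wmom_mono M (Φ := Φ) key
  have i1 : wmom M (fun m v => famL u m v * rateL (absL b) M m (famL S) v) Φ = 2 * etot (absL b) M (famL u) (famL S) Φ := wmom_rateL hB M hU hSS hΦ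
  have i2 : wmom M (fun m v => famL S m v * rateL (absL b) M m (famL u) v) Φ = 2 * etot (absL b) M (famL S) (famL u) Φ := wmom_rateL hB M hSS hU hΦ
  have j1 := wmom_gainL_le hB (absL_even hb.even) M hU hSS hΦ hc
  have j2 := wmom_gainL_le hB (absL_even hb.even) M hSS hU hΦ hc
  have lhs : wmom M (fun m v => ‖lam * (f m v - g m v) + (collB b M m f v - collB b M m g v)‖ₑ + famL u m v * rateL (absL b) M m (famL S) v) Φ =
      wmom M (famL fun m v => lam * (f m v - g m v) + (collB b M m f v - collB b M m g v)) Φ +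
      2 * etot (absL b) M (famL u) (famL S) Φ := by
    rw [← i1]; exact wmom_add M hL hΦ
  rw [lhs, wmom_add M (F := fun m v => ofReal lam * famL u m v + 2 * ((rateL (absL b) M m (famL S) v -
      ofReal lam) * famL u m v)) (fun m => by have := hU m; have := r1 m; fun_prop) hΦ,
    wmom_add M (F := fun m v => ofReal lam * famL u m v) (fun m => (hU m).const_mul _) hΦ,
    wmom_const_mul M hU hΦ,
    wmom_const_mul M (F := fun m v => (rateL (absL b) M m (famL S) v - ofReal lam) * famL u m v) (fun m => by have := hU m; have := r1 m; fun_prop) hΦ,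
    wmom_add M (F := fun m v => gainL (absL b) m (famL u) (famL S) v + gainL (absL b) m (famL S) (famL u) v)
      (fun m => (g1 m).add (g2 m)) hΦ, wmom_add M g1 hΦ, i2] at tot
  -- The gain bounds contribute `2 etot(u, S)`, exactly the loss of `u` kept on the left; being
  -- finite, it can be subtracted from both sides.
  have fin2 : 2 * etot (absL b) M (famL u) (famL S) Φ ≠ ⊤ := mul_ne_top (by simp) hfin
  refine (ENNReal.add_le_add_iff_right fin2).1 (tot.trans ?_)
  refine le_trans (add_le_add le_rfl (add_le_add (add_le_add j1 j2) le_rfl)) (le_of_eq ?_)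
  ring

end Collision

/-! ### Stability of mild solutions of the system -/

section Stability

/-- The mild solution of the linear equation. -/
def mild (c D lam a : ℝ) (u₀ : Fn d) (h : ℝ → Fn d) (t : ℝ) (v : Vel d) : ℝ := ou c D lam (t - a) u₀ v + duhamel c D lam a h t v

lemma toReal_setLIntegral_exp (hν : 0 ≤ ν) (ht : 0 ≤ t) (hY : Measurable Y) (hE : Measurable E)
    (hYf : ∀ s ∈ Ioc 0 t, Y s ≠ ⊤) (hEf : ∀ᵐ s ∂volR (Ioc 0 t), E s < ⊤) :
    (∫⁻ s in Ioc 0 t, ofReal (exp (-(μ * (t - s)))) * (ofReal ν * Y s + E s)).toReal =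
      ∫ s in (0)..t, exp (-(μ * (t - s))) * (ν * (Y s).toReal + (E s).toReal) := by
  rw [integral_of_le ht, ← integral_toReal (by fun_prop)]
  · refine integral_congr_ae ?_
    filter_upwards [hEf, ae_mem_Ioc] with s hs hsm
    rw [toReal_mul, toReal_add (mul_ne_top ofReal_ne_top (hYf s hsm)) hs.ne, toReal_mul, toReal_ofReal (exp_pos _).le, toReal_ofReal hν]
  · filter_upwards [hEf, ae_mem_Ioc] with s hs hsm
    exact mul_lt_top ofReal_lt_top (ENNReal.add_lt_top.2 ⟨mul_lt_top ofReal_lt_top (hYf s hsm).lt_top, hs⟩)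

/-- `gronwall_damped` for extended nonnegative functions. The bound on `Y` and the integrability of
`E` make the passage to real numbers lossless. -/
lemma gronwall_lintegral (hν : 0 ≤ ν) (hμν : μ ≤ ν) (hY : Measurable Y)
    (hE : Measurable E) {C : ℝ≥0} (hYb : ∀ s ∈ Icc 0 T, Y s ≤ C) {A : ℝ≥0∞} (hA : A ≠ ⊤) (hEf : ∫⁻ s in Ioc 0 T, E s ≠ ⊤)
    (h : ∀ᵐ t ∂volR (Ioc 0 T), Y t ≤ ofReal (exp (-(μ * t))) * A + ∫⁻ s in Ioc 0 t, ofReal (exp (-(μ * (t - s)))) * (ofReal ν * Y s + E s))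
    (htm : t ∈ Icc 0 T) (ht : Y t ≤ ofReal (exp (-(μ * t))) * A + ∫⁻ s in Ioc 0 t, ofReal (exp (-(μ * (t - s)))) * (ofReal ν * Y s + E s)) :
    Y t ≤ ofReal (exp ((ν - μ) * t)) * (A + ∫⁻ s in Ioc 0 t, E s) := by
  rcases htm.1.eq_or_lt with rfl | ht0
  · simpa using ht
  have htm' : t ∈ Ioc 0 T := ⟨ht0, htm.2⟩
  have hYt : ∀ s ∈ Icc 0 T, Y s ≠ ⊤ := fun s hs => ((hYb s hs).trans_lt coe_lt_top).ne
  have hEa : ∀ᵐ s ∂volR (Ioc 0 T), E s < ⊤ := ae_lt_top hE hEf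
  have hEi : IntegrableOn (fun s => (E s).toReal) (Ioc 0 T) := integrable_toReal_of_lintegral_ne_top hE.aemeasurable hEf
  have hYi : IntegrableOn (fun s => (Y s).toReal) (Ioc 0 T) := by
    refine integrable_toReal_of_lintegral_ne_top hY.aemeasurable (ne_top_of_le_ne_top ?_
      (setLIntegral_mono (g := fun _ => (C : ℝ≥0∞)) measurable_const fun s hs => hYb s ⟨hs.1.le, hs.2⟩))
    rw [lintegral_const]
    exact mul_ne_top coe_ne_top (by simp)
  have conv : ∀ s ∈ Ioc 0 T, (Y s ≤ ofReal (exp (-(μ * s))) * A + ∫⁻ q in Ioc 0 s, ofReal (exp (-(μ * (s - q)))) * (ofReal ν * Y q + E q)) →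
      (Y s).toReal ≤ exp (-(μ * s)) * A.toReal + ∫ q in (0)..s, exp (-(μ * (s - q))) * (ν * (Y q).toReal + (E q).toReal) := by
    intro s hs hle
    have hsub : Ioc 0 s ⊆ Ioc 0 T := Ioc_subset_Ioc_right hs.2
    have hEs : ∀ᵐ q ∂volR (Ioc 0 s), E q < ⊤ := ae_mono (Measure.restrict_mono hsub le_rfl) hEa
    have hfin : ∫⁻ q in Ioc 0 s, ofReal (exp (-(μ * (s - q)))) * (ofReal ν * Y q + E q) ≠ ⊤ := by
      refine ne_top_of_le_ne_top (b := ∫⁻ q in Ioc 0 s, ofReal (exp (|μ| * T)) *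
        (ofReal ν * C + E q)) ?_ (setLIntegral_mono (by fun_prop) fun q hq => ?_)
      · rw [lintegral_const_mul _ (by fun_prop), lintegral_add_left measurable_const, lintegral_const]
        refine mul_ne_top ofReal_ne_top (add_ne_top.2 ⟨?_, ?_⟩)
        · exact mul_ne_top (mul_ne_top ofReal_ne_top coe_ne_top) (by simp)
        · exact ne_top_of_le_ne_top hEf (lintegral_mono_set hsub)
      · gcongr
        · calc -(μ * (s - q)) ≤ |μ * (s - q)| := neg_le_abs _
            _ = |μ| * (s - q) := by rw [abs_mul, abs_of_nonneg (show 0 ≤ s - q by linarith [hq.2])]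
            _ ≤ _ := by gcongr; linarith [hq.1, hs.2]
        · exact hYb q (Ioc_sub (Ioc_subset_Icc_self hs) hq)
    have hfin1 : ofReal (exp (-(μ * s))) * A ≠ ⊤ := mul_ne_top ofReal_ne_top hA
    have := ENNReal.toReal_mono (add_ne_top.2 ⟨hfin1, hfin⟩) hle
    rwa [toReal_add hfin1 hfin, toReal_mul, toReal_ofReal (exp_pos _).le,
      toReal_setLIntegral_exp hν hs.1.le hY hE (fun q hq => hYt q (Ioc_sub (Ioc_subset_Icc_self hs) hq)) hEs] at this
  have res := gronwall_damped (A := A.toReal) hν hμν hYi hEi (fun s => toReal_nonneg)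
    (by filter_upwards [h, ae_mem_Ioc] with s hs hsm using conv s hsm hs) htm' (conv t htm' ht)
  have hsub : Ioc 0 t ⊆ Ioc 0 T := Ioc_subset_Ioc_right htm.2
  have hEt : ∫⁻ s in Ioc 0 t, E s ≠ ⊤ := ne_top_of_le_ne_top hEf (lintegral_mono_set hsub)
  rw [integral_of_le htm.1, integral_toReal hE.aemeasurable (ae_mono (Measure.restrict_mono hsub le_rfl) hEa), ← toReal_add hA hEt] at res
  rw [← ofReal_toReal (hYt t htm), ← ofReal_toReal (add_ne_top.2 ⟨hA, hEt⟩), ← ofReal_mul (exp_pos _).le]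
  exact ofReal_le_ofReal res

/-! #### Algebra of the linear weak form -/

lemma UnifL1.add (hu : UnifL1 S j u) (hw : UnifL1 S j w) : UnifL1 S j (fun s v => u s v + w s v) := by
  obtain ⟨hum, C, hC⟩ := hu
  obtain ⟨hwm, C', hC'⟩ := hw
  refine ⟨hum.add hwm, C + C', fun s hs => ?_⟩
  have hm : Measurable fun v => ‖u s v‖ₑ * wt d j v := (hum.comp measurable_prodMk_left).enorm.mul (measurable_wt j)
  calc _ ≤ ∫⁻ v, (‖u s v‖ₑ * wt d j v + ‖w s v‖ₑ * wt d j v) := by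
        refine lintegral_mono fun v => ?_
        rw [← add_mul]; gcongr; exact enorm_add_le _ _
    _ ≤ _ := by
        rw [lintegral_add_left hm]; push_cast
        exact add_le_add (hC s hs) (hC' s hs)

lemma UnifL1.time_mul (hu : UnifL1 S j u) (hη : Measurable η) {K : ℝ} (hK : ∀ s ∈ S, |η s| ≤ K) : UnifL1 S j (fun s v => η s * u s v) := by
  obtain ⟨hum, C, hC⟩ := hu
  refine ⟨(hη.comp measurable_fst).mul hum, K.toNNReal * C, fun s hs => ?_⟩
  have hm : Measurable fun v => ‖u s v‖ₑ * wt d j v := (hum.comp measurable_prodMk_left).enorm.mul (measurable_wt j)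
  simp only [enorm_mul, mul_assoc]
  rw [lintegral_const_mul _ hm, ENNReal.coe_mul, enorm_eq_ofReal_abs]
  exact mul_le_mul' (ofReal_le_ofReal (hK s hs)) (hC s hs)

lemma UnifL1.const_mul (hu : UnifL1 S j u) (k : ℝ) : UnifL1 S j (fun s v => k * u s v) := hu.time_mul measurable_const fun _ _ => le_rfl

lemma UnifL1.sub (hu : UnifL1 S j u) (hw : UnifL1 S j w) : UnifL1 S j (fun s v => u s v - w s v) := by
  simpa [sub_eq_add_neg] using hu.add (hw.const_mul (-1))

lemma IsTestFunction.integrable_mul (hφ : IsTestFunction φ) (hg : Integrable g) : Integrable fun v => g v * φ v := by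
  obtain ⟨K, hK⟩ := hφ.exists_bound
  exact hg.mul_bdd hφ.1.continuous.aestronglyMeasurable (of_forall hK)

lemma UnifL1.integrable_mul_test (hu : UnifL1 S 0 u) (hs : s ∈ S) (hφ : IsTestFunction φ) : Integrable fun v => u s v * φ v :=
  hφ.integrable_mul (hu.integrable hs)

/-- Damping can be added at will if the same multiple of `u` is returned to the source. -/
lemma LinWeakAt.shift (hw : LinWeakAt c D lam a u₀ u h t) (hu : UL a T 0 u) (hh : UL a T 0 h) (ht : t ∈ Icc a T) (μ : ℝ) :
    LinWeakAt c D (lam + μ) a u₀ u (fun s v => h s v + μ * u s v) t := by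
  intro φ hφ
  rw [hw φ hφ, integral_of_le ht.1, integral_of_le ht.1]
  congr 1
  refine setIntegral_congr_fun measurableSet_Ioc fun s hs => ?_
  have hsT : s ∈ Icc a T := Ioc_sub ht hs
  have i1 := hu.integrable_mul_test hsT (hφ.genAdj c D lam)
  have i2 := hh.integrable_mul_test hsT hφ
  have i3 := hu.integrable_mul_test hsT (hφ.genAdj c D (lam + μ))
  have i4 := (hh.add (hu.const_mul μ)).integrable_mul_test hsT hφ
  simp only [pair]
  rw [← integral_add i1 i2, ← integral_add i3 i4]
  refine integral_ext fun v => ?_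
  simp only [genAdj]
  ring

lemma pair_sub (hg : Integrable fun v => g v * φ v) (hb : Integrable fun v => b v * φ v) : pair (fun v => g v - b v) φ = pair g φ - pair b φ := by
  unfold pair; simp only [sub_mul]; exact integral_sub hg hb

lemma integral_pair_sub {k : ℝ → Fn d} (hu : UL a T 0 u) (hh : UL a T 0 h) (hw : UL a T 0 w) (hk : UL a T 0 k)
    (ht : t ∈ Icc a T) (hψ : IsTestFunction ψ) (hφ : IsTestFunction φ) :
    ∫ s in a..t, (pair (fun v => u s v - w s v) ψ + pair (fun v => h s v - k s v) φ) =
      (∫ s in a..t, (pair (u s) ψ + pair (h s) φ)) - ∫ s in a..t, (pair (w s) ψ + pair (k s) φ) := by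
  have hsub := Ioc_sub ht
  rw [← intervalIntegral.integral_sub ((hu.intervalIntegrable_pair hψ ht.1 hsub).add (hh.intervalIntegrable_pair hφ ht.1 hsub))
    ((hw.intervalIntegrable_pair hψ ht.1 hsub).add (hk.intervalIntegrable_pair hφ ht.1 hsub)), integral_of_le ht.1, integral_of_le ht.1]
  refine setIntegral_congr_fun measurableSet_Ioc fun s hs => ?_
  have hsT := hsub hs
  rw [pair_sub (hu.integrable_mul_test hsT hψ) (hw.integrable_mul_test hsT hψ),
    pair_sub (hh.integrable_mul_test hsT hφ) (hk.integrable_mul_test hsT hφ)]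
  ring

lemma LinWeakAt.sub {k : ℝ → Fn d} (hwu : LinWeakAt c D lam a u₀ u h t) (hww : LinWeakAt c D lam a w₀ w k t)
    (hu : UL a T 0 u) (hh : UL a T 0 h) (hw : UL a T 0 w) (hk : UL a T 0 k) (hi₀ : Integrable u₀) (hj₀ : Integrable w₀) (ht : t ∈ Icc a T) :
    LinWeakAt c D lam a (fun v => u₀ v - w₀ v) (fun s v => u s v - w s v) (fun s v => h s v - k s v) t := fun φ hφ => by
  rw [pair_sub (hu.integrable_mul_test ht hφ) (hw.integrable_mul_test ht hφ), pair_sub (hφ.integrable_mul hi₀) (hφ.integrable_mul hj₀),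
    hwu φ hφ, hww φ hφ, integral_pair_sub hu hh hw hk ht (hφ.genAdj c D lam) hφ]
  ring

/-! #### Weighted estimates for the system -/

lemma measurable_wmom (M : ℕ) {F : ℕ → X → FnL d} (hF : UMeas F) (hΦ : Measurable Φ) : Measurable fun x => wmom M (fun n => F n x) Φ := by
  unfold wmom
  refine measurable_sum _ fun m _ => Measurable.const_mul ?_ _
  exact Measurable.lintegral_prod_right' (f := fun p : X × Vel d => F m p.1 p.2 * Φ p.2) ((hF m).mul (hΦ.comp measurable_snd))

lemma measurable_mild (hu₀ : Measurable u₀) (hh : Measurable (uncurry h)) : Measurable (uncurry (mild c D lam a u₀ h)) :=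
  (measurable_ou_comp (H := fun _ : ℝ × Vel d => u₀) c D lam (hu₀.comp measurable_snd) (by fun_prop)
    measurable_snd).add (measurable_duhamel c D lam a hh)

/-- The damping `lam` competes with the growth rate `C` of the weight, leaving the net exponent `lam
- C`. -/
lemma wmom_mild_le {c D : ℕ → ℝ} (hΦ : Measurable Φ) (hgr : ∀ m ∈ Lev M, OUGrowth (c m) (D m) T C Φ) (lam : ℝ) {u₀ : ℕ → Fn d}
    (hu₀ : Meas u₀) {h : Fam d} (hh : UMeas h) (ht : t ∈ Icc 0 T) :
    wmom M (famL fun m => mild (c m) (D m) lam 0 (u₀ m) (h m) t) Φ ≤ ofReal (exp (-((lam - C) * t))) * wmom M (famL u₀) Φ +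
      ∫⁻ s in Ioc 0 t, ofReal (exp (-((lam - C) * (t - s)))) * mom M h s Φ := by
  have hexp : ∀ r : ℝ, ofReal (exp (-((lam - C) * r))) = ofReal (exp (-(lam * r))) * ofReal (exp (C * r)) := fun r => by
    rw [← ofReal_mul (exp_pos _).le, ← exp_add]; congr 2; ring
  have hhs : ∀ m s, Measurable (h m s) := fun m s => (hh m).comp measurable_prodMk_left
  have one : ∀ m ∈ Lev M, ∫⁻ v, ‖mild (c m) (D m) lam 0 (u₀ m) (h m) t v‖ₑ * Φ v ≤ ofReal (exp (-((lam - C) * t))) * (∫⁻ v, ‖u₀ m v‖ₑ * Φ v) +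
      ∫⁻ s in Ioc 0 t, ofReal (exp (-((lam - C) * (t - s)))) * ∫⁻ v, ‖h m s v‖ₑ * Φ v := by
    intro m hm
    have hm1 : Measurable fun v => ‖ou (c m) (D m) lam (t - 0) (u₀ m) v‖ₑ * Φ v := (measurable_ou (hu₀ m)).enorm.mul hΦ
    calc _ ≤ ∫⁻ v, (‖ou (c m) (D m) lam (t - 0) (u₀ m) v‖ₑ * Φ v + ‖duhamel (c m) (D m) lam 0 (h m) t v‖ₑ * Φ v) := by
          refine lintegral_mono fun v => ?_
          rw [← add_mul]; gcongr; exact enorm_add_le _ _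
      _ ≤ _ := by
          rw [lintegral_add_left hm1]
          refine add_le_add ?_ ?_
          · refine (lintegral_enorm_ou_le _ _ _ _ (hu₀ m) hΦ).trans ?_
            rw [sub_zero, hexp, mul_assoc]
            gcongr
            have hm2 : Measurable fun v => ‖u₀ m v‖ₑ * Φ v := (hu₀ m).enorm.mul hΦ
            rw [← lintegral_const_mul _ hm2]
            refine lintegral_mono fun v => ?_
            rw [mul_left_comm]
            gcongr
            exact hgr m hm t ht v
          · refine (lintegral_enorm_duhamel_le _ _ _ _ _ (hh m) hΦ).trans ?_
            refine setLIntegral_mono' measurableSet_Ioc fun s hs => ?_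
            rw [hexp, mul_assoc]
            gcongr
            have hm2 : Measurable fun v => ‖h m s v‖ₑ * Φ v := (hhs m s).enorm.mul hΦ
            rw [← lintegral_const_mul _ hm2]
            refine lintegral_mono fun v => ?_
            rw [mul_left_comm]
            gcongr
            exact hgr m hm (t - s) ⟨by linarith [hs.2], by linarith [hs.1, ht.2]⟩ v
  unfold wmom
  calc _ ≤ ∑ m ∈ Lev M, (m : ℝ≥0∞) * (ofReal (exp (-((lam - C) * t))) * (∫⁻ v, ‖u₀ m v‖ₑ * Φ v) +
      ∫⁻ s in Ioc 0 t, ofReal (exp (-((lam - C) * (t - s)))) * ∫⁻ v, ‖h m s v‖ₑ * Φ v) := by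
        refine sum_le_sum fun m hm => ?_
        gcongr
        exact one m hm
    _ = _ := by
        have hmi : ∀ m, Measurable fun s => ∫⁻ v, ‖h m s v‖ₑ * Φ v := fun m =>
          Measurable.lintegral_prod_right' (f := fun p : ℝ × Vel d => ‖h m p.1 p.2‖ₑ * Φ p.2) ((hh m).enorm.mul (hΦ.comp measurable_snd))
        simp only [mul_add, sum_add_distrib]
        congr 1
        · rw [mul_sum]
          exact sum_congr rfl fun m _ => mul_left_comm _ _ _
        · simp only [mul_sum]
          rw [lintegral_finsetSum _ (fun m _ => by
            have : Measurable fun s => ∫⁻ v, famL (fun m => h m s) m v * Φ v := hmi m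
            fun_prop)]
          refine sum_congr rfl fun m _ => ?_
          rw [← lintegral_const_mul _ (by have := hmi m; fun_prop)]
          refine lintegral_congr fun s => ?_
          rw [mul_left_comm]; rfl

lemma exists_wmom_bound (hf : ∀ m, UnifL1 S j (f m)) (M : ℕ) : ∃ ρ : ℝ≥0, ∀ s ∈ S, mom M f s (wt d j) ≤ ρ := by
  choose C hC using fun m => (hf m).2
  refine ⟨∑ m ∈ Lev M, (m : ℝ≥0) * C m, fun s hs => ?_⟩
  push_cast
  exact sum_le_sum fun m _ => mul_le_mul' le_rfl (hC m s hs)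

/-- The collision operator costs one moment, the one consumed by the relative speed. -/
lemma unifL1_collB (hb : IsKernel b) (hf : ∀ m, UnifL1 S (j + 1) (f m)) (hm : m ∈ Lev M) : UnifL1 S j cB b M m f := by
  obtain ⟨ρ, hρ⟩ := exists_wmom_bound hf M
  obtain ⟨ρ', hρ'⟩ := exists_wmom_bound (fun m => (hf m).mono_weight (Nat.le_add_left 1 j)) M
  refine ⟨measurable_collB_comp (f := fun n (p : ℝ × Vel d) => f n p.1) hb.meas M m (fun n => (hf n).1.comp measurable_time_vel) measurable_snd,
    (4 * (crossMax d M * (1 * (ρ * ρ')))).toNNReal, fun s hs => ?_⟩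
  have hfm : ∀ n, Measurable (f n s) := fun n => (hf n).measurable_apply s
  have fin : 4 * (crossMax d M * (1 * ((ρ : ℝ≥0∞) * ρ'))) ≠ ⊤ := mul_ne_top (by simp) (mul_ne_top (crossMax_ne_top d M)
      (mul_ne_top (by simp) (mul_ne_top coe_ne_top coe_ne_top)))
  rw [coe_toNNReal fin]
  calc _ ≤ wmom M (famL fun m => collB b M m fun n => f n s) (wt d j) :=
        le_wmom hm (famL fun m => collB b M m fun n => f n s) (wt d j)
    _ ≤ 4 * etot (absL b) M (famL fun n => f n s) (famL fun n => f n s) (wt d j) := wmom_famL_collB_le hb.meas hb.even M hfm j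
    _ ≤ _ := by
        gcongr
        refine (etot_le 1 hb.absL_le M j (measurable_famL hfm) (measurable_famL hfm)).trans ?_
        gcongr
        · exact hρ s hs
        · exact hρ' s hs

lemma measurable_rateL_comp (hB : Measurable B) (M m : ℕ) {H : ℕ → X → FnL d} (hH : UMeas H) (hv : Measurable v) :
    Measurable fun x => rateL B M m (fun n => H n x) (v x) :=
  (measurable_sum _ fun n _ => (measurable_convL_comp hB (hH n) hv).const_mul _).const_mul _

/-- The part of the loss with rate above `N` becomes negligible as `N → ∞`. -/
lemma tendsto_lintegral_excess (hB : Measurable B) (M : ℕ) {U S : ℕ → ℝ → FnL d} (hU : UMeas U) (hS : UMeas S) (hΦ : Measurable Φ)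
    (hr : ∀ s ∈ Ioc 0 t, ∀ m ∈ Lev M, ∀ v, rateL B M m (fun n => S n s) v ≠ ⊤) {K : ℝ≥0}
    (hK : ∀ s ∈ Ioc 0 t, wmom M (fun m v => U m s v * rateL B M m (fun n => S n s) v) Φ ≤ K) :
    Tendsto (fun N : ℕ => ∫⁻ s in Ioc 0 t, wmom M (fun m v => (rateL B M m (fun n => S n s) v - ofReal N) * U m s v) Φ) atTop (𝓝 0) := by
  have mR : ∀ m, Measurable fun p : ℝ × Vel d => rateL B M m (fun n => S n p.1) p.2 := fun m =>
    measurable_rateL_comp (H := fun n (p : ℝ × Vel d) => S n p.1) hB M m (fun n => (hS n).comp measurable_time_vel) measurable_snd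
  have mR' : ∀ m s, Measurable fun v => rateL B M m (fun n => S n s) v := fun m s =>
    (mR m).comp measurable_prodMk_left
  have mU' : ∀ m s, Measurable (U m s) := fun m s => (hU m).comp measurable_prodMk_left
  rw [← lintegral_zero (μ := volume.restrict (Ioc 0 t))]
  refine tendsto_lintegral_of_dominated_convergence (fun _ => K) (fun N => ?_) (fun N => ?_) ?_ ?_
  · exact measurable_wmom M (F := fun m s v => (rateL B M m (fun n => S n s) v - ofReal N) * U m s v) (fun m => ((mR m).sub_const _).mul (hU m)) hΦ
  · filter_upwards [ae_mem_Ioc] with s hs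
    refine le_trans (wmom_mono M fun m _ => of_forall fun v => ?_) (hK s hs)
    rw [mul_comm]
    gcongr
    exact tsub_le_self
  · rw [lintegral_const]
    exact mul_ne_top coe_ne_top (by simp)
  · filter_upwards [ae_mem_Ioc] with s hs
    rw [show (0 : ℝ≥0∞) = ∑ m ∈ Lev M, (m : ℝ≥0∞) * 0 by simp]
    refine tendsto_finsetSum _ fun m hm => ENNReal.Tendsto.const_mul ?_ (Or.inr (by simp))
    rw [← lintegral_zero (μ := (volume : Measure (Vel d)))]
    refine tendsto_lintegral_of_dominated_convergence (fun v => U m s v * rateL B M m (fun n => S n s) v * Φ v)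
      (fun N => ?_) (fun N => of_forall fun v => ?_) ?_ (of_forall fun v => ?_)
    · exact (((mR' m s).sub_const _).mul (mU' m s)).mul hΦ
    · simp only
      rw [mul_comm (U m s v)]
      gcongr
      exact tsub_le_self
    · exact ne_top_of_le_ne_top coe_ne_top ((le_wmom hm (fun m v => U m s v * rateL B M m (fun n => S n s) v) Φ).trans (hK s hs))
    · refine tendsto_const_nhds.congr' ?_
      obtain ⟨N₀, hN₀⟩ := exists_nat_ge (rateL B M m (fun n => S n s) v).toReal
      filter_upwards [eventually_ge_atTop N₀] with N hN
      rw [tsub_eq_zero_of_le, zero_mul, zero_mul]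
      rw [← ofReal_toReal (hr s hs m hm v)]
      exact ofReal_le_ofReal (hN₀.trans (by exact_mod_cast hN))

lemma integrable_of_wt_ne_top (hg : Measurable g) (h : nrm j g ≠ ⊤) : Integrable g := by
  refine ⟨hg.aestronglyMeasurable, lt_of_le_of_lt (lintegral_mono fun v => ?_) h.lt_top⟩
  exact le_mul_of_one_le_right zero_le (one_le_wt j v)

lemma wmom_mono_wt {F : ℕ → FnL d} (h : i ≤ j := by norm_num) : wmom M F (wt d i) ≤ wmom M F (wt d j) := by
  unfold wmom
  gcongr with m _ v
  exact wt_mono h v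

/-- Stability in `L¹_1` of nonnegative solutions with bounded second moments. -/
lemma wmom_sub_le {c D : ℕ → ℝ} (hc : PosOn M c) (hD : PosOn M D) (hC : 0 ≤ C) (hgr : Grow d M c D T C 1)
    (hb : IsKernel b) {g e : Fam d} (hf : Unif T 2 f) (hg : Unif T 2 g) (he : Unif T 1 e) (hf0 : Pos3 f) (hg0 : Pos3 g) {ρ : ℝ≥0} (hfρ : ∀ s ∈ Icc 0 T, mom M f s (wt d 2) ≤ ρ)
    (hgρ : ∀ s ∈ Icc 0 T, mom M g s (wt d 2) ≤ ρ) {g₀ : ℕ → Fn d} (hf₀ : Meas f₀) (hg₀ : Meas g₀) (hfi : HMom 1 f₀) (hgi : HMom 1 g₀)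
    (hw : ∀ᵐ t ∂volR (Ioc 0 T), ∀ m ∈ Lev M, SolAt b M c D f₀ f m t ∧
      LinWeakAt (c m) (D m) 0 0 (g₀ m) (g m) (fun s v => collB b M m (fun n => g n s) v + e m s v) t)
    (ht : t ∈ Icc 0 T) (hwt : ∀ m ∈ Lev M, SolAt b M c D f₀ f m t ∧
      LinWeakAt (c m) (D m) 0 0 (g₀ m) (g m) (fun s v => collB b M m (fun n => g n s) v + e m s v) t) :
    wmom M (famL fun m v => f m t v - g m t v) (wt d 1) ≤ ofReal (exp ((C + (8 * crossMax d M * ρ).toReal) * t)) * (dmom M f₀ g₀ (wt d 1) +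
          ∫⁻ s in Ioc 0 t, mom M e s (wt d 1)) := by
  have hB := measurable_absL hb.meas
  have h0t : Ioc 0 t ⊆ Icc 0 T := Ioc_sub ht
  set u : Fam d := fun m s v => f m s v - g m s v
  set src : Fam d := fun m s v => collB b M m (fun n => f n s) v - (collB b M m (fun n => g n s) v + e m s v)
  set A : ℝ≥0∞ := dmom M f₀ g₀ (wt d 1)
  set P : ℝ → Prop := fun s => ∀ m ∈ Lev M, LinWeakAt (c m) (D m) 0 0 (fun v => f₀ m v - g₀ m v) (u m) (src m) s
  set Z : ℝ≥0∞ := crossMax d M * (1 * ((ρ + ρ) * (ρ + ρ)))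
  set S : Fam d := fun m s v => (f m s v + g m s v) / 2
  have hu2 : Unif T 2 u := fun m => (hf m).sub (hg m)
  have hu1 : Unif T 1 u := fun m => (hu2 m).mono_weight
  have hu0 : Unif T 0 u := fun m => (hu2 m).mono_weight
  have hfm : ∀ s m, Measurable (f m s) := fun s m => (hf m).measurable_apply s
  have hgm : ∀ s m, Measurable (g m s) := fun s m => (hg m).measurable_apply s
  have hum : ∀ s m, Measurable (u m s) := fun s m => (hu2 m).measurable_apply s
  have hSm : ∀ s m, Measurable (S m s) := fun s m => ((hfm s m).add (hgm s m)).div_const 2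
  have hSmm : UMeas S := fun m => ((hf m).1.add (hg m).1).div_const 2
  have sum2 : ∀ s ∈ Icc 0 T, wmom M (fun m v => famL (fun m => f m s) m v + famL (fun m => g m s) m v) (wt d 2) ≤ ρ + ρ := fun s hs => by
      rw [wmom_add M (measurable_famL (hfm s)) (measurable_wt 2)]
      exact add_le_add (hfρ s hs) (hgρ s hs)
  have uρ : ∀ s ∈ Icc 0 T, mom M u s (wt d 2) ≤ ρ + ρ := fun s hs =>
    (wmom_mono M fun m _ => of_forall fun v => enorm_sub_le).trans (sum2 s hs)
  have Sρ : ∀ s ∈ Icc 0 T, mom M S s (wt d 2) ≤ ρ + ρ := fun s hs =>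
    (wmom_mono M fun m _ => of_forall fun v => enorm_half_le le_self_add le_add_self).trans (sum2 s hs)
  have hQf : ∀ m ∈ Lev M, UL 0 T 1 cB b M m f := fun m hm => unifL1_collB hb hf hm
  have hQg : ∀ m ∈ Lev M, UL 0 T 1 cB b M m g := fun m hm => unifL1_collB hb hg hm
  set Y : ℝ → ℝ≥0∞ := fun s => mom M u s (wt d 1)
  have mY : Measurable Y := measurable_wmom M (F := fun m s v => ‖u m s v‖ₑ) (fun m => (hu2 m).1.enorm) (measurable_wt 1)
  set E₁ : ℝ → ℝ≥0∞ := fun s => mom M e s (wt d 1)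
  have mE₁ : Measurable E₁ := measurable_wmom M (F := fun m s v => ‖e m s v‖ₑ) (fun m => (he m).1.enorm) (measurable_wt 1)
  -- The part of the loss that the damping `N` cannot absorb. It is finite because two moments
  -- control the relative speed with one extra weight.
  set X : ℕ → ℝ → ℝ≥0∞ := fun N s => wmom M (fun m v => (rateL (absL b) M m (famL fun n => S n s) v - ofReal N) * famL (fun n => u n s) m v) (wt d 1)
  have mR : ∀ m, Measurable fun p : ℝ × Vel d => rateL (absL b) M m (famL fun n => S n p.1) p.2 := fun m =>
    measurable_rateL_comp (H := fun n (p : ℝ × Vel d) v => ‖S n p.1 v‖ₑ) hB M m (fun n => ((hSmm n).comp measurable_time_vel).enorm) measurable_snd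
  have mX : Meas X := fun N => measurable_wmom M (F := fun m s v => (rateL (absL b) M m (famL fun n => S n s) v - ofReal N) * ‖u m s v‖ₑ)
    (fun m => ((mR m).sub_const _).mul (hu2 m).1.enorm) (measurable_wt 1)
  have etot_fin : ∀ s ∈ Icc 0 T, etot (absL b) M (famL fun m => u m s) (famL fun m => S m s) (wt d 1) ≤ Z := fun s hs => by
    refine (etot_le 1 hb.absL_le M 1 (measurable_famL (hum s)) (measurable_famL (hSm s))).trans ?_
    simp only [Z]; gcongr
    · exact uρ s hs
    · exact (wmom_mono_wt).trans (Sρ s hs)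
  have cfin : Z ≠ ⊤ := by
    have hρ : (ρ : ℝ≥0∞) + ρ ≠ ⊤ := by simp
    exact mul_ne_top (crossMax_ne_top d M) (mul_ne_top (by simp) (mul_ne_top hρ hρ))
  have rate_mul : ∀ s, wmom M (fun m v => famL (fun n => u n s) m v * rateL (absL b) M m
      (famL fun n => S n s) v) (wt d 1) = 2 * etot (absL b) M (famL fun m => u m s) (famL fun m => S m s) (wt d 1) :=
    fun s => wmom_rateL hB M (measurable_famL (hum s)) (measurable_famL (hSm s)) (measurable_wt 1)
  have Xle : ∀ N, ∀ s ∈ Icc 0 T, X N s ≤ 2 * Z := fun N s hs => by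
    refine (wmom_mono M fun m _ => of_forall fun v => ?_).trans ((rate_mul s).le.trans (mul_le_mul' le_rfl (etot_fin s hs)))
    rw [mul_comm]; gcongr; exact tsub_le_self
  have Xlim : Tendsto (fun N : ℕ => ∫⁻ s in Ioc 0 t, X N s) atTop (𝓝 0) := by
    refine tendsto_lintegral_excess hB M (U := fun m s v => ‖u m s v‖ₑ) (S := fun m s v => ‖S m s v‖ₑ)
      (fun m => (hu2 m).1.enorm) (fun m => (hSmm m).enorm) (measurable_wt 1) (fun s hs m hm v => ?_) (K := (2 * Z).toNNReal) (fun s hs => ?_)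
    · refine ne_top_of_le_ne_top ?_ (rateL_le 1 hb.absL_le hm (measurable_famL (hSm s)) v)
      have : mom M S s (wt d 1) ≠ ⊤ := ne_top_of_le_ne_top (by simp) ((wmom_mono_wt).trans (Sρ s (h0t hs)))
      exact mul_ne_top (mul_ne_top (mul_ne_top (by simp) (crossMax_ne_top d M)) (mul_ne_top (by simp) this)) (wt_ne_top 1 v)
    · rw [coe_toNNReal (mul_ne_top (by simp) cfin)]
      exact (rate_mul s).le.trans (mul_le_mul' le_rfl (etot_fin s (h0t hs)))
  -- Four times the remaining collision rate, in which `S` has second moment at most `2ρ`.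
  set k : ℝ := (8 * crossMax d M * ρ).toReal
  have hk : ofReal k = 8 * crossMax d M * ρ := ofReal_toReal (mul_ne_top (mul_ne_top (by simp) (crossMax_ne_top d M)) coe_ne_top)
  have hk0 : 0 ≤ k := toReal_nonneg
  -- The difference is written in mild form with damping `N`; the source then contains `N u`, which
  -- pairs with the loss in the pointwise estimate.
  have ineq : ∀ N : ℕ, ∀ s ∈ Icc 0 T, (∀ᵐ q ∂volR (Ioc 0 T), P q) → P s →
      Y s ≤ ofReal (exp (-((N - C) * s))) * A + ∫⁻ q in Ioc 0 s, ofReal (exp (-((N - C) * (s - q)))) * (ofReal (N + k) * Y q + (E₁ q + 2 * X N q)) := by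
    intro N s hs hae hat
    set h : Fam d := fun m q v => src m q v + N * u m q v
    have hsrc : ∀ m ∈ Lev M, UL 0 T 1 (src m) := fun m hm =>
      (hQf m hm).sub ((hQg m hm).add (he m))
    have hhU : ∀ m ∈ Lev M, UL 0 T 0 (h m) := fun m hm =>
      ((hsrc m hm).add ((hu1 m).const_mul N)).mono_weight
    have hhm : UMeas h := fun m => by
      have q1 : ∀ {f : Fam d}, Unif T 2 f → Measurable (uncurry fun q => collB b M m fun n => f n q) := fun {f} hf =>
        measurable_collB_comp (f := fun n (p : ℝ × Vel d) => f n p.1) hb.meas M m (fun n => (hf n).1.comp measurable_time_vel) measurable_snd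
      exact ((q1 hf).sub ((q1 hg).add (he m).1)).add ((hu2 m).1.const_mul _)
    have hi₀ : ∀ m, Integrable fun v => f₀ m v - g₀ m v := fun m =>
      (integrable_of_wt_ne_top (hf₀ m) (hfi m)).sub (integrable_of_wt_ne_top (hg₀ m) (hgi m))
    have hmild : ∀ m ∈ Lev M, u m s =ᵐ[volume] mild (c m) (D m) (0 + N) 0 (fun v => f₀ m v - g₀ m v) (h m) s := by
      intro m hm
      refine mild_of_weak (T := T) (hc m hm) (hD m hm) ((hf₀ m).sub (hg₀ m)) (hi₀ m) (hu1 m) (hhU m hm) hs ?_ ?_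
      · filter_upwards [hae, ae_mem_Ioc] with q hq hqm
        exact (hq m hm).shift (hu0 m) (hsrc m hm).mono_weight ⟨hqm.1.le, hqm.2⟩ N
      · exact (hat m hm).shift (hu0 m) (hsrc m hm).mono_weight hs N
    have h1 : Y s ≤ wmom M (famL fun m => mild (c m) (D m) N 0 (fun v => f₀ m v - g₀ m v) (h m) s) (wt d 1) := by
      refine wmom_mono M fun m hm => ?_
      filter_upwards [hmild m hm] with v hv
      rw [zero_add] at hv
      exact (congrArg (‖·‖ₑ) hv).le
    refine (h1.trans (wmom_mild_le (measurable_wt 1) hgr N (fun m => (hf₀ m).sub (hg₀ m)) hhm hs)).trans ?_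
    refine add_le_add le_rfl ?_
    refine setLIntegral_mono' measurableSet_Ioc fun q hq => ?_
    have hqT : q ∈ Icc 0 T := Ioc_sub hs hq
    gcongr
    have hff : ∀ {f : Fam d}, Unif T 2 f → ∀ n ∈ Lev M, nrm 1 (f n q) ≠ ⊤ := fun {f} hf n _ => (hf n).nrm_ne_top hqT
    have key := wmom_collB_sub_le hb (M := M) (hfm q) (hgm q) (fun n v => hf0 n q v) (fun n v => hg0 n q v)
      (hff hf) (hff hg) (Nat.cast_nonneg N) (measurable_wt 1) (convexWeight_wt 1) (ne_top_of_le_ne_top cfin (etot_fin q hqT))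
    have hL : ∀ m, Measurable (famL (fun m v => (N : ℝ) * (f m q v - g m q v) +
        (collB b M m (fun n => f n q) v - collB b M m (fun n => g n q) v)) m) := fun m =>
      (((hum q m).const_mul _).add ((measurable_collB hb.meas M m (hfm q)).sub (measurable_collB hb.meas M m (hgm q)))).enorm
    calc mom M h q (wt d 1)
        ≤ wmom M (fun m v => famL (fun m v => (N : ℝ) * (f m q v - g m q v) +
            (collB b M m (fun n => f n q) v - collB b M m (fun n => g n q) v)) m v + famL (fun m => e m q) m v) (wt d 1) := by
          refine wmom_mono M fun m _ => of_forall fun v => ?_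
          change ‖h m q v‖ₑ ≤ _
          rw [show h m q v = ((N : ℝ) * (f m q v - g m q v) + (collB b M m (fun n => f n q) v -
            collB b M m (fun n => g n q) v)) - e m q v by simp only [h, u]; ring]
          exact enorm_sub_le
      _ = wmom M (famL fun m v => (N : ℝ) * (f m q v - g m q v) + (collB b M m (fun n => f n q) v - collB b M m (fun n => g n q) v)) (wt d 1) + E₁ q :=
          wmom_add M hL (measurable_wt 1)
      _ ≤ (ofReal N * Y q + 2 * X N q + 4 * etot (absL b) M (famL fun n => S n q) (famL fun n => u n q) (wt d 1)) + E₁ q := by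
          gcongr
      _ ≤ (ofReal N * Y q + 2 * X N q + 4 * (crossMax d M * (1 * ((ρ + ρ) * Y q)))) + E₁ q := by
          gcongr
          refine (etot_le 1 hb.absL_le M 1 (measurable_famL (hSm q)) (measurable_famL (hum q))).trans ?_
          gcongr
          exact Sρ q hqT
      _ = _ := by
          rw [ofReal_add (Nat.cast_nonneg N) hk0, hk]; ring
  have wsub : ∀ s ∈ Icc 0 T, (∀ m ∈ Lev M, SolAt b M c D f₀ f m s ∧
      LinWeakAt (c m) (D m) 0 0 (g₀ m) (g m) (fun s v => collB b M m (fun n => g n s) v + e m s v) s) →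
      P s :=
    fun s hs h m hm => (h m hm).1.sub (h m hm).2 (hf m).mono_weight (hQf m hm).mono_weight (hg m).mono_weight (((hQg m hm).add (he m)).mono_weight)
      (integrable_of_wt_ne_top (hf₀ m) (hfi m)) (integrable_of_wt_ne_top (hg₀ m) (hgi m)) hs
  have hae : ∀ᵐ q ∂volR (Ioc 0 T), P q := by
    filter_upwards [hw, ae_mem_Ioc] with q hq hqm
    exact wsub q ⟨hqm.1.le, hqm.2⟩ hq
  obtain ⟨ρe, hρe⟩ := exists_wmom_bound he M
  have hA : A ≠ ⊤ := by
    refine (sum_lt_top.2 fun m _ => mul_lt_top (by simp) ?_).ne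
    have hm : Measurable fun v => ‖f₀ m v‖ₑ * wt d 1 v := (hf₀ m).enorm.mul (measurable_wt 1)
    calc _ ≤ ∫⁻ v, (‖f₀ m v‖ₑ * wt d 1 v + ‖g₀ m v‖ₑ * wt d 1 v) := by
          refine lintegral_mono fun v => ?_
          rw [← add_mul]; unfold famL; gcongr; exact enorm_sub_le
      _ < ⊤ := by
          rw [lintegral_add_left hm]
          exact ENNReal.add_lt_top.2 ⟨(hfi m).lt_top, (hgi m).lt_top⟩
  have fin : ∀ N : ℕ, ∫⁻ s in Ioc 0 T, (E₁ s + 2 * X N s) ≠ ⊤ := fun N => by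
    refine ne_top_of_le_ne_top (b := ∫⁻ s in Ioc 0 T, (ρe + 2 * (2 * Z))) ?_ (setLIntegral_mono' measurableSet_Ioc fun s hs => ?_)
    · rw [lintegral_const]
      exact mul_ne_top (add_ne_top.2 ⟨coe_ne_top, mul_ne_top (by simp) (mul_ne_top (by simp) cfin)⟩) (by simp)
    · exact add_le_add (hρe s ⟨hs.1.le, hs.2⟩) (mul_le_mul' le_rfl (Xle N s ⟨hs.1.le, hs.2⟩))
  have bound : ∀ N : ℕ, Y t ≤ ofReal (exp ((C + k) * t)) * (A + ((∫⁻ s in Ioc 0 t, E₁ s) + 2 * ∫⁻ s in Ioc 0 t, X N s)) := by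
    intro N
    have mXN := mX N
    -- The rate `ν - μ = (N + k) - (N - C) = C + k` is free of `N`, so `N` may tend to infinity.
    have g := gronwall_lintegral (T := T) (μ := N - C) (ν := N + k) (by positivity) (by linarith) mY
      (E := fun s => E₁ s + 2 * X N s) (by fun_prop) (C := ρ + ρ) (fun s hs => by push_cast; exact (wmom_mono_wt).trans (uρ s hs)) hA (fin N) (by
        filter_upwards [hae, ae_mem_Ioc] with s hs hsm
        exact ineq N s ⟨hsm.1.le, hsm.2⟩ hae hs) ht (ineq N t ht hae (wsub t ht hwt))
    rw [show (N : ℝ) + k - (N - C) = C + k by ring, lintegral_add_left mE₁, lintegral_const_mul _ mXN] at g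
    exact g
  have lim : Tendsto (fun N : ℕ => ofReal (exp ((C + k) * t)) * (A + ((∫⁻ s in Ioc 0 t, E₁ s) + 2 * ∫⁻ s in Ioc 0 t, X N s))) atTop
      (𝓝 (ofReal (exp ((C + k) * t)) * (A + ((∫⁻ s in Ioc 0 t, E₁ s) + 2 * 0)))) := by
    refine ENNReal.Tendsto.const_mul ?_ (Or.inr ofReal_ne_top)
    exact tendsto_const_nhds.add (tendsto_const_nhds.add (ENNReal.Tendsto.const_mul Xlim (Or.inr (by simp))))
  simpa using ge_of_tendsto' lim bound

end Stability

/-! ### The system with a bounded kernel -/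

section Picard

variable {ρ : ℝ≥0} {D c : ℕ → ℝ}

lemma ou_zero (c D lam r : ℝ) (v : Vel d) : ou c D lam r (fun _ => 0) v = 0 := by simp [ou]

lemma ae_integrable_ou (c D r : ℝ) (hg : Measurable g) (hi : Integrable g) :
    ∀ᵐ v, Integrable (fun z => g (exp (c * r) • (v - ouSd c D r • z))) (gauss d) := by
  have h : ∫⁻ v, ouL c D r (fun w => ‖g w‖ₑ) v * 1 ≠ ⊤ := by
    rw [lintegral_ouL_mul c D r hg.enorm measurable_const]
    have := ouDualL_const (d := d) c D r 1
    simp only [this, mul_one]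
    exact hi.2.ne
  filter_upwards [ae_lt_top ((measurable_ouL hg.enorm).mul_const 1) h] with v hv
  refine ⟨Measurable.aestronglyMeasurable (by fun_prop), ?_⟩
  rw [mul_one, ouL] at hv
  by_contra hc
  rw [HasFiniteIntegral, not_lt, top_le_iff] at hc
  rw [hc, mul_top (by simp [exp_pos])] at hv
  exact lt_irrefl _ hv

/-- Linearity holds only almost everywhere, where both Gaussian averages converge absolutely. -/
lemma ou_sub_ae (c D lam r : ℝ) {k : Fn d} (hg : Measurable g) (hgi : Integrable g) (hk : Measurable k)
    (hki : Integrable k) : ∀ᵐ v, ou c D lam r g v - ou c D lam r k v = ou c D lam r (fun w => g w - k w) v := by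
  filter_upwards [ae_integrable_ou c D r hg hgi, ae_integrable_ou c D r hk hki] with v h1 h2
  unfold ou
  rw [integral_sub h1 h2, mul_sub]

lemma duhamel_sub_ae (c D lam : ℝ) {k : ℝ → Fn d} (hh : UL a T 0 h) (hk : UL a T 0 k) (ht : t ≤ T) :
    ∀ᵐ v, duhamel c D lam a h t v - duhamel c D lam a k t v = duhamel c D lam a (fun s w => h s w - k s w) t v := by
  have hm : ∀ {h : ℝ → Fn d}, Measurable (uncurry h) → Measurable fun p : ℝ × Vel d => ou c D lam (t - p.1) (h p.1) p.2 := fun {h} hh =>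
    measurable_ou_comp (H := fun p : ℝ × Vel d => h p.1) c D lam (hh.comp (measurable_time_vel)) (by fun_prop) (by fun_prop)
  have e1 : ∀ᵐ s ∂volR (Ioc a t), ∀ᵐ v, ou c D lam (t - s) (h s) v - ou c D lam (t - s) (k s) v = ou c D lam (t - s) (fun w => h s w - k s w) v := by
    filter_upwards [ae_mem_Ioc] with s hs
    have hsT : s ∈ Icc a T := ⟨hs.1.le, hs.2.trans ht⟩
    exact ou_sub_ae c D lam (t - s) (hh.measurable_apply s) (hh.integrable hsT) (hk.measurable_apply s) (hk.integrable hsT)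
  have e2 := (Measure.ae_ae_comm (p := fun s v => ou c D lam (t - s) (h s) v - ou c D lam (t - s) (k s) v =
      ou c D lam (t - s) (fun w => h s w - k s w) v) (measurableSet_eq_fun ((hm hh.1).sub (hm hk.1))
    (hm (h := fun s w => h s w - k s w) (hh.1.sub hk.1)))).1 e1
  filter_upwards [e2, (integrable_duhamel_prod (c := c) (D := D) (lam := lam) hh ht).prod_right_ae,
    (integrable_duhamel_prod (c := c) (D := D) (lam := lam) hk ht).prod_right_ae] with v h1 h2 h3
  unfold duhamel
  rw [← integral_sub h2 h3]
  exact integral_congr_ae h1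

/-- The nonnegative part of `lam f + Q(f)`. -/
def posSource (b : Fn d) (M : ℕ) (lam : ℝ) (f : ℕ → Fn d) (m : ℕ) (v : Vel d) : ℝ := max 0 (lam * f m v + collB b M m f v)

lemma absL_le_of_bounded (hb : IsKernel b) (hR : ∀ z, b z ≤ R) (x y : Vel d) : absL b (x - y) ≤ ofReal R * (wt d 0 x * wt d 0 y) := by
  simp only [wt_zero, mul_one]
  rw [absL, enorm_of_nonneg (hb.nonneg _)]
  exact ofReal_le_ofReal (hR _)

/-- If `lam` dominates the loss rate, the source is the gain plus `(lam - A) f`, already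
nonnegative. The positive part in the definition is then inactive, yet it makes every iterate
nonnegative without any check. -/
lemma posSource_eq (hb : IsKernel b) (hl : 0 ≤ lam) {f : ℕ → Fn d} (hf0 : Pos2 f) {v : Vel d} (hr : rateL (absL b) M m (famL f) v ≤ ofReal lam) :
    posSource b M lam f m v = lam * f m v + collB b M m f v := by
  refine max_eq_right ?_
  have h1 : rateR b M m f v ≤ lam := by
    have := (enorm_rateR_le b M m f v).trans hr
    rw [enorm_of_nonneg (rateR_nonneg hb M m hf0 v)] at this
    exact (ofReal_le_ofReal_iff hl).1 this
  have h2 := gainR_nonneg hb m hf0 v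
  have h3 := mul_nonneg (hf0 m v) (sub_nonneg.2 h1)
  unfold collB
  linarith

lemma measurable_posSource_comp (hb : Measurable b) (M m : ℕ) (lam : ℝ) {f : ℕ → X → Fn d} (hf : UMeas f) :
    Measurable (uncurry fun x => posSource b M lam (fun n => f n x) m) := by
  have := measurable_collB_comp (f := fun n (p : X × Vel d) => f n p.1) hb M m
    (fun n => (hf n).comp (by fun_prop : Measurable fun q : (X × Vel d) × Vel d => (q.1.1, q.2))) measurable_snd
  exact measurable_const.max (((hf m).const_mul lam).add this)

/-- The gain is dominated by the loss, so the collisions add nothing to the moment of `lam f`. -/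
lemma wmom_posSource_le (hb : IsKernel b) (hR : ∀ z, b z ≤ R) (hl : 0 ≤ lam) {f : ℕ → Fn d} (hf : Meas f) (hf0 : Pos2 f)
    (hff : ∀ n ∈ Lev M, nrm 1 (f n) ≠ ⊤) (hj : wmom M (famL f) (wt d j) ≠ ⊤) (hr : ∀ m ∈ Lev M, ∀ v, rateL (absL b) M m (famL f) v ≤ ofReal lam) :
    wmom M (famL (posSource b M lam f)) (wt d j) ≤ ofReal lam * wmom M (famL f) (wt d j) := by
  have hB := measurable_absL hb.meas
  have hF := measurable_famL hf
  have hS : ∀ m, Measurable (famL (posSource b M lam f) m) := fun m =>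
    (measurable_const.max (((hf m).const_mul lam).add (measurable_collB hb.meas M m hf))).enorm
  have fin : 2 * etot (absL b) M (famL f) (famL f) (wt d j) ≠ ⊤ := by
    refine mul_ne_top (by simp) (ne_top_of_le_ne_top ?_ (etot_le 0 (absL_le_of_bounded hb hR) M j hF hF))
    exact mul_ne_top (crossMax_ne_top d M) (mul_ne_top ofReal_ne_top (mul_ne_top hj (ne_top_of_le_ne_top hj (wmom_mono_wt (Nat.zero_le j)))))
  have pt : ∀ m ∈ Lev M, ∀ v, famL (posSource b M lam f) m v + famL f m v * rateL (absL b) M m (famL f) v ≤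
      ofReal lam * famL f m v + gainL (absL b) m (famL f) (famL f) v := by
    intro m hm v
    have hrm := hr m hm v
    rw [rateL_famL_eq hb hf hf0 hff] at hrm ⊢
    have h1 : rateR b M m f v ≤ lam := (ofReal_le_ofReal_iff hl).1 hrm
    have h0 := rateR_nonneg hb M m hf0 v
    have e : posSource b M lam f m v = gainR b m f v + f m v * (lam - rateR b M m f v) := by
      rw [posSource_eq hb hl hf0 (hr m hm v)]; unfold collB; ring
    unfold famL
    rw [e]
    calc _ ≤ (‖gainR b m f v‖ₑ + ‖f m v * (lam - rateR b M m f v)‖ₑ) + ‖f m v‖ₑ * ofReal (rateR b M m f v) := by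
          gcongr; exact enorm_add_le _ _
      _ = ofReal lam * ‖f m v‖ₑ + ‖gainR b m f v‖ₑ := by
          rw [enorm_mul, enorm_of_nonneg (sub_nonneg.2 h1), add_assoc, ← mul_add, ← ofReal_add (sub_nonneg.2 h1) h0, sub_add_cancel]
          ring
      _ ≤ _ := by gcongr; exact enorm_gainR_le b m f v
  have tot := wmom_mono M (Φ := wt d j) fun m hm => of_forall (pt m hm)
  rw [wmom_add M hS (measurable_wt j), wmom_rateL hB M hF hF (measurable_wt j),
    wmom_add M (F := fun m v => ofReal lam * famL f m v) (fun m => (hF m).const_mul _) (measurable_wt j),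
    wmom_const_mul M hF (measurable_wt j)] at tot
  refine (ENNReal.add_le_add_iff_right fin).1 (tot.trans (add_le_add le_rfl ?_))
  exact (wmom_gainL_le hB (absL_even hb.even) M hF hF (measurable_wt j) (convexWeight_wt j)).trans (two_mul _).ge

/-- Taking the positive part is 1-Lipschitz, and the excess term of `wmom_collB_sub_le` vanishes
because `lam` exceeds the loss rate of the mean. -/
lemma wmom_posSource_sub_le (hb : IsKernel b) (hR : ∀ z, b z ≤ R) (hl : 0 ≤ lam) {f g : ℕ → Fn d} (hf : Meas f) (hg : Meas g) (hf0 : Pos2 f)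
    (hg0 : Pos2 g) (hff : ∀ n ∈ Lev M, nrm 1 (f n) ≠ ⊤)
    (hgf : ∀ n ∈ Lev M, nrm 1 (g n) ≠ ⊤) (hfρ : wmom M (famL f) (wt d 0) ≤ ρ) (hgρ : wmom M (famL g) (wt d 0) ≤ ρ)
    (hlam : 2 * crossMax d M * (ofReal R * (ρ + ρ)) ≤ ofReal lam) :
    wmom M (famL fun m v => posSource b M lam f m v - posSource b M lam g m v) (wt d 0) ≤ (ofReal lam + 4 * (crossMax d M * (ofReal R * (ρ + ρ)))) *
        dmom M f g (wt d 0) := by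
  have hbl := absL_le_of_bounded hb hR
  have hfm := measurable_famL hf
  have sum2 : wmom M (fun m v => famL f m v + famL g m v) (wt d 0) ≤ ρ + ρ := by
    rw [wmom_add M hfm (measurable_wt 0)]; exact add_le_add hfρ hgρ
  have uρ : dmom M f g (wt d 0) ≤ ρ + ρ := (wmom_mono M fun m _ => of_forall fun v => enorm_sub_le).trans sum2
  have Sρ : wmom M avgL f g (wt d 0) ≤ ρ + ρ := (wmom_mono M fun m _ => of_forall fun v => enorm_half_le le_self_add le_add_self).trans sum2
  have hu : ∀ n, Measurable (diffL f g n) := fun n => ((hf n).sub (hg n)).enorm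
  have hS : ∀ n, Measurable (avgL f g n) := fun n =>
    (((hf n).add (hg n)).div_const 2).enorm
  have fin : etot (absL b) M diffL f g avgL f g (wt d 0) ≠ ⊤ := by
    have h2 : (ρ : ℝ≥0∞) + ρ ≠ ⊤ := by simp
    refine ne_top_of_le_ne_top ?_ (etot_le 0 hbl M 0 hu hS)
    exact mul_ne_top (crossMax_ne_top d M) (mul_ne_top ofReal_ne_top (mul_ne_top (ne_top_of_le_ne_top h2 uρ) (ne_top_of_le_ne_top h2 Sρ)))
  have key := wmom_collB_sub_le hb hf hg hf0 hg0 hff hgf hl (measurable_wt 0) (convexWeight_wt 0) fin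
  have ex : wmom M (fun m v => (rateL (absL b) M m avgL f g v - ofReal lam) * diffL f g m v) (wt d 0) = 0 := by
    refine Finset.sum_eq_zero fun m hm => ?_
    rw [mul_eq_zero]; right
    refine (lintegral_congr fun v => ?_).trans lintegral_zero
    have : rateL (absL b) M m avgL f g v - ofReal lam = 0 := tsub_eq_zero_of_le ?_
    · simp only [this, zero_mul]
    refine (rateL_le 0 hbl hm hS v).trans (le_trans ?_ hlam)
    rw [show wt d 0 v = 1 by simp [wt_zero], mul_one]
    gcongr
  rw [ex, mul_zero, add_zero] at key
  calc _ ≤ wmom M (famL fun m v => lam * (f m v - g m v) + (collB b M m f v - collB b M m g v)) (wt d 0) := by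
        refine wmom_mono M fun m _ => of_forall fun v => ?_
        unfold famL
        rw [enorm_eq_ofReal_abs, enorm_eq_ofReal_abs]
        refine ofReal_le_ofReal ?_
        refine (abs_max_sub_max_le_max _ _ _ _).trans (max_le (by simp) (le_of_eq ?_))
        congr 1; ring
    _ ≤ _ := key
    _ ≤ _ := by
        rw [add_mul]
        refine add_le_add le_rfl ?_
        rw [mul_assoc, mul_assoc, mul_assoc]
        refine mul_le_mul' le_rfl ((etot_le 0 hbl M 0 hS hu).trans ?_)
        gcongr

/-- One step of the Picard iteration for the system. -/
def picardStep (b : Fn d) (M : ℕ) (c D : ℕ → ℝ) (lam : ℝ) (f₀ : ℕ → Fn d) (f : Fam d) (m : ℕ) (t : ℝ) (v : Vel d) : ℝ := if m ∈ Lev M then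
    mild (c m) (D m) lam 0 (f₀ m) (fun s => posSource b M lam (fun n => f n s) m) t v else 0

lemma measurable_picardStep (hb : Measurable b) (M : ℕ) (c D : ℕ → ℝ) (lam : ℝ) (hf₀ : Meas f₀) (hf : UMeas f) (m : ℕ) :
    Measurable (uncurry (picardStep b M c D lam f₀ f m)) := by
  by_cases hm : m ∈ Lev M
  · have e : uncurry (picardStep b M c D lam f₀ f m) = uncurry (mild (c m) (D m) lam 0 (f₀ m) (fun s => posSource b M lam (fun n => f n s) m)) := by
      ext p; simp only [uncurry, picardStep, if_pos hm]
    rw [e]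
    exact measurable_mild (hf₀ m) (measurable_posSource_comp hb M m lam hf)
  · have e : uncurry (picardStep b M c D lam f₀ f m) = fun _ => 0 := by
      ext p; simp only [uncurry, picardStep, if_neg hm]
    rw [e]; exact measurable_const

lemma ou_nonneg (c D lam r : ℝ) (hg : ∀ v, 0 ≤ g v) (v : Vel d) : 0 ≤ ou c D lam r g v := mul_nonneg (exp_pos _).le (integral_nonneg fun _ => hg _)

lemma mild_nonneg (c D lam a : ℝ) (hu₀ : ∀ v, 0 ≤ u₀ v) (hh : Pos2 h) (t : ℝ) (v : Vel d) : 0 ≤ mild c D lam a u₀ h t v :=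
  add_nonneg (ou_nonneg c D lam _ hu₀ v) (integral_nonneg fun _ => ou_nonneg c D lam _ (hh _) v)

lemma picardStep_nonneg (b : Fn d) (M : ℕ) (c D : ℕ → ℝ) (lam : ℝ) (hf₀ : Pos2 f₀)
    (f : Fam d) (m : ℕ) (t : ℝ) (v : Vel d) : 0 ≤ picardStep b M c D lam f₀ f m t v := by
  unfold picardStep
  split_ifs
  · exact mild_nonneg _ _ _ _ (hf₀ m) (fun _ _ => le_max_left _ _) t v
  · exact le_rfl

/-- The profile `e^{Ct}` solves the scalar mild equation with damping `lam - C` and source `lam`, so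
moment bounds of this form are reproduced exactly by the Picard map. -/
lemma exp_add_lintegral_exp (lam C : ℝ) (hl : 0 ≤ lam) (ht : 0 ≤ t) :
    ofReal (exp (-((lam - C) * t))) + ∫⁻ s in Ioc 0 t, ofReal (exp (-((lam - C) * (t - s)))) *
      (ofReal lam * ofReal (exp (C * s))) = ofReal (exp (C * t)) := by
  have e : ∀ s, ofReal (exp (-((lam - C) * (t - s)))) * (ofReal lam * ofReal (exp (C * s))) =
      ofReal (lam * exp ((C - lam) * t + lam * s)) := fun s => by
    rw [mul_left_comm, ← ofReal_mul (exp_pos _).le, ← ofReal_mul hl, ← exp_add]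
    congr 3; ring
  simp only [e]
  have cont : Continuous fun s => lam * exp ((C - lam) * t + lam * s) := by fun_prop
  rw [← ofReal_integral_eq_lintegral_ofReal (cont.integrableOn_Ioc) (of_forall fun s => by positivity),
    ← ofReal_add (exp_pos _).le (integral_nonneg fun s => by positivity), ← integral_of_le ht]
  congr 1
  have h : ∀ s ∈ uIcc 0 t, HasDerivAt (fun s => exp ((C - lam) * t + lam * s)) (lam * exp ((C - lam) * t + lam * s)) s := fun s _ => by
    have := (((hasDerivAt_id s).const_mul lam).const_add ((C - lam) * t)).exp
    simpa [mul_comm] using this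
  rw [integral_eq_sub_of_hasDerivAt h (cont.intervalIntegrable _ _)]
  have e1 : (C - lam) * t + lam * t = C * t := by ring
  have e2 : (C - lam) * t + lam * 0 = -((lam - C) * t) := by ring
  rw [e1, e2]; ring

lemma wmom_picardStep_le (hb : IsKernel b) (hR : ∀ z, b z ≤ R) (hgr : Grow d M c D T C j) (hl : 0 ≤ lam)
    (hf₀ : Meas f₀) (hf : UMeas f) (hf0 : Pos3 f) {A : ℝ≥0∞} (hA : A ≠ ⊤) (h0 : wmom M (famL f₀) (wt d j) ≤ A)
    (hff : ∀ t ∈ Icc 0 T, ∀ n ∈ Lev M, nrm 1 (f n t) ≠ ⊤) (hfA : ∀ t ∈ Icc 0 T, mom M f t (wt d j) ≤ ofReal (exp (C * t)) * A)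
    (hr : ∀ t ∈ Icc 0 T, ∀ m ∈ Lev M, ∀ v, rateL (absL b) M m (famL fun n => f n t) v ≤ ofReal lam) (ht : t ∈ Icc 0 T) :
    wmom M (famL fun m => picardStep b M c D lam f₀ f m t) (wt d j) ≤ ofReal (exp (C * t)) * A := by
  calc _ ≤ wmom M (famL fun m => mild (c m) (D m) lam 0 (f₀ m) (fun s => posSource b M lam (fun n => f n s) m) t) (wt d j) := by
        refine wmom_mono M fun m hm => of_forall fun v => le_of_eq ?_
        simp only [famL, picardStep, if_pos hm]
    _ ≤ _ := wmom_mild_le (h := fun m s => posSource b M lam (fun n => f n s) m) (measurable_wt j) hgr lam hf₀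
        (fun m => measurable_posSource_comp hb.meas M m lam hf) ht
    _ ≤ ofReal (exp (-((lam - C) * t))) * A + ∫⁻ s in Ioc 0 t, (ofReal (exp (-((lam - C) * (t - s)))) * (ofReal lam * ofReal (exp (C * s)))) * A := by
        gcongr ?_ + ?_
        · gcongr
        · refine setLIntegral_mono' measurableSet_Ioc fun s hs => ?_
          have hsT : s ∈ Icc 0 T := Ioc_sub ht hs
          rw [mul_assoc, mul_assoc]
          gcongr
          refine (wmom_posSource_le hb hR hl (fun n => (hf n).comp measurable_prodMk_left) (fun n v => hf0 n s v)
            (hff s hsT) (ne_top_of_le_ne_top (mul_ne_top ofReal_ne_top hA) (hfA s hsT)) (hr s hsT)).trans ?_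
          gcongr
          exact hfA s hsT
    _ = _ := by
        rw [lintegral_mul_const _ (by fun_prop), ← add_mul, exp_add_lintegral_exp lam C hl ht.1]

/-- The initial terms cancel, leaving a Volterra-type Lipschitz estimate, which makes the iteration
converge on the whole time interval. -/
lemma wmom_picardStep_sub_le (hb : IsKernel b) (hR : ∀ z, b z ≤ R) (hC : 0 ≤ C) (hgr : Grow d M c D T C 0) (hl : 0 ≤ lam) {g : Fam d}
    (hf : Unif T 1 f) (hg : Unif T 1 g) (hf0 : Pos3 f) (hg0 : Pos3 g) (hfρ : ∀ t ∈ Icc 0 T, mom M f t (wt d 0) ≤ ρ)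
    (hgρ : ∀ t ∈ Icc 0 T, mom M g t (wt d 0) ≤ ρ) (hlam : 2 * crossMax d M * (ofReal R * (ρ + ρ)) ≤ ofReal lam) (ht : t ∈ Icc 0 T) :
    wmom M (famL fun m v => picardStep b M c D lam f₀ f m t v - picardStep b M c D lam f₀ g m t v) (wt d 0) ≤
      ofReal (exp (C * T)) * (ofReal lam + 4 * (crossMax d M * (ofReal R * (ρ + ρ)))) *
        ∫⁻ s in Ioc 0 t, wmom M (famL fun m v => f m s v - g m s v) (wt d 0) := by
  have hmS : ∀ {f : Fam d}, Unif T 1 f → ∀ m, Measurable (uncurry fun s => posSource b M lam (fun n => f n s) m) := fun hf m =>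
    measurable_posSource_comp hb.meas M m lam fun n => (hf n).1
  have hff : ∀ {f : Fam d}, Unif T 1 f → ∀ s ∈ Icc 0 T, ∀ n ∈ Lev M, nrm 1 (f n s) ≠ ⊤ := fun {f} hf s hs n _ => (hf n).nrm_ne_top hs
  have hmD : ∀ m, Measurable (uncurry fun s v => posSource b M lam (fun n => f n s) m v -
      posSource b M lam (fun n => g n s) m v) := fun m => (hmS hf m).sub (hmS hg m)
  have hS1 : ∀ {f : Fam d}, Unif T 1 f → ∀ m ∈ Lev M, UL 0 T 0 (fun s => posSource b M lam (fun n => f n s) m) := fun {f} hf m hm => by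
    obtain ⟨K, hK⟩ := ((((hf m).mono_weight (Nat.zero_le 1)).const_mul lam).add (unifL1_collB hb hf hm)).2
    refine ⟨hmS hf m, K, fun s hs => (lintegral_mono fun v => ?_).trans (hK s hs)⟩
    gcongr
    unfold posSource
    rw [enorm_eq_ofReal_abs, enorm_eq_ofReal_abs, abs_of_nonneg (le_max_left _ _)]
    exact ofReal_le_ofReal (max_le (abs_nonneg _) (le_abs_self _))
  calc _ ≤ wmom M (famL fun m => mild (c m) (D m) lam 0 (fun _ => 0) (fun s v => posSource b M lam (fun n => f n s) m v -
          posSource b M lam (fun n => g n s) m v) t) (wt d 0) := by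
        refine wmom_mono M fun m hm => ?_
        filter_upwards [duhamel_sub_ae (c m) (D m) lam (hS1 hf m hm) (hS1 hg m hm) ht.2] with v hv
        unfold famL
        refine le_of_eq (congrArg _ ?_)
        simp only [picardStep, if_pos hm, mild, ou_zero, zero_add]
        rw [← hv]; ring
    _ ≤ _ := wmom_mild_le (h := fun m s v => posSource b M lam (fun n => f n s) m v -
          posSource b M lam (fun n => g n s) m v) (measurable_wt 0) hgr lam (fun _ => measurable_const) hmD ht
    _ ≤ ∫⁻ s in Ioc 0 t, ofReal (exp (C * T)) * ((ofReal lam + 4 * (crossMax d M * (ofReal R * (ρ + ρ)))) *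
          wmom M (famL fun m v => f m s v - g m s v) (wt d 0)) := by
        have z : wmom M (famL fun _ (_ : Vel d) => (0 : ℝ)) (wt d 0) = 0 := by simp [wmom, famL]
        rw [z, mul_zero, zero_add]
        refine setLIntegral_mono' measurableSet_Ioc fun s hs => ?_
        have hsT : s ∈ Icc 0 T := Ioc_sub ht hs
        gcongr
        · have : 0 ≤ lam * (t - s) := mul_nonneg hl (by linarith [hs.2])
          have : C * (t - s) ≤ C * T := by gcongr; linarith [hs.1, ht.2]
          nlinarith
        · exact wmom_posSource_sub_le hb hR hl (fun n => (hf n).measurable_apply s) (fun n => (hg n).measurable_apply s)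
            (fun n v => hf0 n s v) (fun n v => hg0 n s v) (hff hf s hsT) (hff hg s hsT) (hfρ s hsT) (hgρ s hsT) hlam
    _ = _ := by
        have hmw : Measurable fun s => wmom M (famL fun m v => f m s v - g m s v) (wt d 0) :=
          measurable_wmom M (F := fun m s v => ‖f m s v - g m s v‖ₑ) (fun m => ((hf m).1.sub (hg m).1).enorm) (measurable_wt 0)
        rw [lintegral_const_mul _ (by fun_prop), lintegral_const_mul _ hmw, mul_assoc]

end Picard

/-! ### Solutions for bounded kernels as limits of the Picard iteration -/

section BoundedKernel

/-- Monotone convergence in the truncation of the weight. -/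
lemma wmom_le_of_truncated {M : ℕ} {F : ℕ → FnL d} (hF : Meas F) {Φ : FnL d}
    (hΦ : Measurable Φ) (hΦt : ∀ v, Φ v ≠ ⊤) {K : ℝ≥0∞} (h : ∀ N : ℕ, wmom M F (fun v => min (Φ v) N) ≤ K) :
    wmom M F Φ ≤ K := by
  have lim : Tendsto (fun N : ℕ => wmom M F (fun v => min (Φ v) N)) atTop (𝓝 (wmom M F Φ)) := by
    refine tendsto_finsetSum _ fun m _ => ENNReal.Tendsto.const_mul ?_ (Or.inr (by simp))
    refine lintegral_tendsto_of_tendsto_of_monotone (fun N => ((hF m).mul (hΦ.min measurable_const)).aemeasurable)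
      (of_forall fun v a b hab => ?_) (of_forall fun v => tendsto_const_nhds.congr' ?_)
    · simp only; gcongr
    · obtain ⟨N₀, hN₀⟩ := ENNReal.exists_nat_gt (hΦt v)
      filter_upwards [eventually_ge_atTop N₀] with N hN
      rw [min_eq_left (hN₀.le.trans (by exact_mod_cast hN))]
  exact le_of_tendsto' lim h

/-- Moment bounds pass to `L¹` limits. -/
lemma wmom_le_of_approx {w : ℕ → Fn d} {u : ℕ → ℕ → Fn d} (hw : Meas w) (hu : ∀ n m, Measurable (u n m)) (hε : Tendsto ε atTop (𝓝 0))
    (h : ∀ n, wmom M (famL fun m v => u n m v - w m v) (wt d 0) ≤ ε n) (hΦ : Measurable Φ)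
    (hΦt : ∀ v, Φ v ≠ ⊤) (hK : ∀ n, wmom M (famL (u n)) Φ ≤ K) : wmom M (famL w) Φ ≤ K := by
  -- Against the weight cut off at `N`, unweighted `L¹` convergence suffices; its error carries the
  -- factor `N`, harmless at fixed `N`.
  refine wmom_le_of_truncated (measurable_famL hw) hΦ hΦt fun N => ?_
  have lim : Tendsto (fun n => (N : ℝ≥0∞) * ε n + K) atTop (𝓝 ((N : ℝ≥0∞) * 0 + K)) :=
    (ENNReal.Tendsto.const_mul hε (Or.inr (by simp))).add tendsto_const_nhds
  rw [mul_zero, zero_add] at lim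
  refine ge_of_tendsto' lim fun n => ?_
  have hd : ∀ m, Measurable (famL (fun m v => u n m v - w m v) m) := fun m => ((hu n m).sub (hw m)).enorm
  calc wmom M (famL w) (fun v => min (Φ v) N)
      ≤ wmom M (fun m v => famL (fun m v => u n m v - w m v) m v + famL (u n) m v) (fun v => min (Φ v) N) := by
        refine wmom_mono M fun m _ => of_forall fun v => ?_
        unfold famL
        calc ‖w m v‖ₑ = ‖u n m v - (u n m v - w m v)‖ₑ := by rw [sub_sub_cancel]
          _ ≤ ‖u n m v‖ₑ + ‖u n m v - w m v‖ₑ := enorm_sub_le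
          _ = _ := add_comm _ _
    _ = wmom M (famL fun m v => u n m v - w m v) (fun v => min (Φ v) N) + wmom M (famL (u n)) (fun v => min (Φ v) N) :=
        wmom_add M hd (hΦ.min measurable_const)
    _ ≤ N * wmom M (famL fun m v => u n m v - w m v) (wt d 0) + wmom M (famL (u n)) Φ := by
        refine add_le_add ?_ ?_
        · rw [← wmom_const_mul M hd (measurable_wt 0)]
          refine sum_le_sum fun m _ => mul_le_mul' le_rfl (lintegral_mono fun v => ?_)
          simp only [wt_zero, mul_one]
          rw [mul_comm]
          exact mul_le_mul' (min_le_right _ _) le_rfl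
        · unfold wmom
          gcongr
          exact min_le_left _ _
    _ ≤ _ := by gcongr; exacts [h n, hK n]

lemma unifL1_of_wmom (hm : m ∈ Lev M) (hf : Measurable (uncurry (f m))) (hK : K ≠ ⊤) (h : ∀ s ∈ S, mom M f s (wt d j) ≤ K) : UnifL1 S j (f m) := by
  refine ⟨hf, K.toNNReal, fun s hs => ?_⟩
  rw [coe_toNNReal hK]
  exact (le_wmom hm (famL fun m => f m s) (wt d j)).trans (h s hs)

lemma unifL1_zero (S : Set ℝ) (j : ℕ) : UnifL1 S j (fun _ (_ : Vel d) => 0) := ⟨measurable_const, 0, fun s _ => by simp⟩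

lemma wmom_ne_top {f : ℕ → Fn d} (h : HMom j f) : wmom M (famL f) (wt d j) ≠ ⊤ := (sum_lt_top.2 fun m _ => mul_lt_top (by simp) (h m).lt_top).ne

lemma lintegral_wt_ne_top_mono (hij : i ≤ j) (h : nrm j g ≠ ⊤) : nrm i g ≠ ⊤ :=
  ne_top_of_le_ne_top h (lintegral_mono fun v => mul_le_mul' le_rfl (wt_mono hij v))

lemma lintegral_pow_div_factorial (L : ℝ) (hL : 0 ≤ L) (k : ℕ) (ht : 0 ≤ t) : ofReal L * ∫⁻ s in Ioc 0 t, ofReal ((L * s) ^ k / k.factorial) =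
      ofReal ((L * t) ^ (k + 1) / (k + 1).factorial) := by
  have cont : Continuous fun s : ℝ => (L * s) ^ k / k.factorial := by fun_prop
  rw [← ofReal_integral_eq_lintegral_ofReal cont.integrableOn_Ioc, ← ofReal_mul hL, ← integral_of_le ht]
  · congr 1
    simp only [mul_pow, mul_div_assoc]
    rw [intervalIntegral.integral_const_mul, intervalIntegral.integral_div, integral_pow, Nat.factorial_succ]
    push_cast
    field_simp
    ring
  · filter_upwards [ae_mem_Ioc] with s hs
    have := hs.1.le
    positivity

lemma wmom_famL_comm (M : ℕ) (f g : ℕ → Fn d) (Φ : FnL d) : dmom M f g Φ = dmom M g f Φ := by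
  unfold wmom famL
  simp only [← edist_eq_enorm_sub]
  simp only [edist_comm]

lemma wmom_sub_triangle (M : ℕ) {f g h : ℕ → Fn d} (hf : Meas f) (hg : Meas g) (hΦ : Measurable Φ) : dmom M f h Φ ≤ dmom M f g Φ + dmom M g h Φ := by
  have hm : ∀ m, Measurable (diffL f g m) := fun m => ((hf m).sub (hg m)).enorm
  rw [← wmom_add M hm hΦ]
  refine wmom_mono M fun m _ => of_forall fun v => ?_
  unfold famL
  simp only [← edist_eq_enorm_sub]
  exact edist_triangle _ _ _

/-- The limit is taken level by level and put to zero off the mass levels; `κ` only restores the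
mass factors in the sum. -/
lemma exists_family_limit {u : ℕ → Fam d} (hu : ∀ n, UMeas (u n)) (hu0 : ∀ n, Pos3 (u n)) (hε : Tendsto ε atTop (𝓝 0))
    (h : ∀ n k, n ≤ k → ∀ t ∈ S, wmom M (famL fun m v => u n m t v - u k m t v) (wt d j) ≤ ε n) :
    ∃ (w : Fam d) (κ : ℝ≥0∞), κ ≠ ⊤ ∧ UMeas w ∧ Pos3 w ∧ (∀ m ∉ Lev M, w m = fun _ _ => 0) ∧
      ∀ n, ∀ t ∈ S, wmom M (famL fun m v => u n m t v - w m t v) (wt d j) ≤ κ * ε n := by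
  choose! w₁ hw₁m hw₁0 hw₁ using fun m (hm : m ∈ Lev M) =>
    exists_uniform_limit volume (measurable_wt j) (wt_ne_zero j) (wt_ne_top j) (fun n => u n m) (fun n => hu n m) S ε hε fun n k hnk t ht =>
      (le_wmom hm (famL fun m v => u n m t v - u k m t v) (wt d j)).trans (h n k hnk t ht)
  refine ⟨fun m => if m ∈ Lev M then w₁ m else fun _ _ => 0, ∑ m ∈ Lev M, (m : ℝ≥0∞), (sum_lt_top.2 fun m _ => by simp).ne, fun m => ?_,
    fun m t v => ?_, fun m hm => if_neg hm, fun n t ht => ?_⟩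
  · by_cases hm : m ∈ Lev M
    · simp only [if_pos hm]; exact hw₁m m hm
    · simp only [if_neg hm]; exact measurable_const
  · by_cases hm : m ∈ Lev M
    · simp only [if_pos hm]; exact hw₁0 m hm (fun n => hu0 n m) t v
    · simp only [if_neg hm]; exact le_rfl
  · rw [sum_mul]
    refine sum_le_sum fun m hm => mul_le_mul' le_rfl ?_
    simpa only [famL, if_pos hm] using hw₁ m hm n t ht

/-- Existence for bounded kernels and data with four moments. -/
lemma exists_solution_of_bounded {c D : ℕ → ℝ} (hc : PosOn M c) (hD : PosOn M D) (hC : 0 ≤ C) (hgr : ∀ j ∈ ({0, 2, 4} : Set ℕ), Grow d M c D T C j)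
    (hb : IsKernel b) (hR : ∀ z, b z ≤ R) (hf₀ : Meas f₀) (hf₀0 : Pos2 f₀) (hf₀4 : HMom 4 f₀) :
    ∃ f : Fam d, Unif T 4 f ∧ Pos3 f ∧ (∀ j ∈ ({0, 2, 4} : Set ℕ), ∀ t ∈ Icc 0 T, mom M f t (wt d j) ≤
        ofReal (exp (C * t)) * wmom M (famL f₀) (wt d j)) ∧
      ∀ t ∈ Icc 0 T, ∀ m ∈ Lev M, SolAt b M c D f₀ f m t := by
  set A : ℕ → ℝ≥0∞ := fun j => wmom M (famL f₀) (wt d j)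
  have hle4 : ∀ j ∈ ({0, 2, 4} : Set ℕ), j ≤ 4 := by
    rintro j (rfl | rfl | rfl) <;> norm_num
  have hA : ∀ j ∈ ({0, 2, 4} : Set ℕ), A j ≠ ⊤ := fun j hj => wmom_ne_top fun m => lintegral_wt_ne_top_mono (hle4 j hj) (hf₀4 m)
  have hEA : ∀ j ∈ ({0, 2, 4} : Set ℕ), ofReal (exp (C * T)) * A j ≠ ⊤ := fun j hj =>
    mul_ne_top ofReal_ne_top (hA j hj)
  have m0 : (0 : ℕ) ∈ ({0, 2, 4} : Set ℕ) := by simp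
  have m4 : (4 : ℕ) ∈ ({0, 2, 4} : Set ℕ) := by simp
  set ρ : ℝ≥0 := (ofReal (exp (C * T)) * A 0).toNNReal
  have hρ : (ρ : ℝ≥0∞) = ofReal (exp (C * T)) * A 0 := coe_toNNReal (hEA 0 m0)
  -- Chosen above the loss rate of every iterate and of the mean of two iterates; `ρ + ρ` is a
  -- convenient bound for the mass of such a mean.
  set lam : ℝ := (2 * crossMax d M * (ofReal R * (ρ + ρ))).toReal
  have hl : 0 ≤ lam := toReal_nonneg
  have hρρ : (ρ : ℝ≥0∞) + ρ ≠ ⊤ := by simp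
  have hlam : 2 * crossMax d M * (ofReal R * (ρ + ρ)) = ofReal lam := (ofReal_toReal
    (mul_ne_top (mul_ne_top (by simp) (crossMax_ne_top d M)) (mul_ne_top ofReal_ne_top hρρ))).symm
  -- The invariant of the iteration. Vanishing off the mass levels makes the uniform bounds hold for
  -- every index.
  let Inv : Fam d → Prop := fun f => UMeas f ∧ Pos3 f ∧ (∀ m ∉ Lev M, f m = fun _ _ => 0) ∧
    ∀ j ∈ ({0, 2, 4} : Set ℕ), ∀ t ∈ Icc 0 T, mom M f t (wt d j) ≤ ofReal (exp (C * t)) * A j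
  have mono_t : ∀ {t : ℝ}, t ∈ Icc 0 T → ∀ a : ℝ≥0∞, ofReal (exp (C * t)) * a ≤ ofReal (exp (C * T)) * a := fun ht a => by
      gcongr
      exact ht.2
  have invU : ∀ {f}, Inv f → Unif T 4 f := by
    rintro f ⟨h1, -, h3, h4⟩ m
    by_cases hm : m ∈ Lev M
    · exact unifL1_of_wmom hm (h1 m) (hEA 4 m4) fun s hs => (h4 4 m4 s hs).trans (mono_t hs _)
    · rw [h3 m hm]; exact unifL1_zero _ _
  have invρ : ∀ {f}, Inv f → ∀ t ∈ Icc 0 T, mom M f t (wt d 0) ≤ ρ := fun hf t ht => by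
    rw [hρ]; exact (hf.2.2.2 0 m0 t ht).trans (mono_t ht _)
  have invR : ∀ {f}, Inv f → ∀ t ∈ Icc 0 T, ∀ m ∈ Lev M, ∀ v, rateL (absL b) M m (famL fun n => f n t) v ≤ ofReal lam := fun {f} hf t ht m hm v => by
    refine (rateL_le 0 (absL_le_of_bounded hb hR) hm (measurable_famL fun n => (hf.1 n).comp measurable_prodMk_left) v).trans ?_
    rw [← hlam, show wt d 0 v = 1 by simp [wt_zero], mul_one]
    gcongr
    exact (invρ hf t ht).trans le_self_add
  have inv1 : ∀ {f}, Inv f → ∀ t ∈ Icc 0 T, ∀ n ∈ Lev M, nrm 1 (f n t) ≠ ⊤ := fun hf t ht n _ => (invU hf n).nrm_ne_top ht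
  set step := picardStep b M c D lam f₀
  have invS : ∀ {f}, Inv f → Inv (step f) := fun {f} hf => by
    refine ⟨measurable_picardStep hb.meas M c D lam hf₀ hf.1, picardStep_nonneg b M c D lam hf₀0 f, fun m hm => ?_, ?_⟩
    · ext t v; simp only [step, picardStep, if_neg hm]
    · intro j hj t ht
      exact wmom_picardStep_le hb hR (hgr j hj) hl hf₀ hf.1 hf.2.1 (hA j hj) le_rfl (inv1 hf) (hf.2.2.2 j hj) (invR hf) ht
  set u : ℕ → Fam d := fun k => step^[k] fun _ _ _ => 0
  have hu0 : u 0 = fun _ _ _ => 0 := rfl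
  have husucc : ∀ k, u (k + 1) = step (u k) := fun k => Function.iterate_succ_apply' step k _
  have invu : ∀ k, Inv (u k) := fun k => by
    induction k with
    | zero =>
      rw [hu0]
      refine ⟨fun _ => measurable_const, fun _ _ _ => le_rfl, fun _ _ => rfl, fun j _ t _ => ?_⟩
      simp [wmom, famL]
    | succ k ih => rw [husucc]; exact invS ih
  set L₀ : ℝ≥0∞ := ofReal (exp (C * T)) * (ofReal lam + 4 * (crossMax d M * (ofReal R * (ρ + ρ))))
  have hL₀ : L₀ ≠ ⊤ := mul_ne_top ofReal_ne_top (add_ne_top.2 ⟨ofReal_ne_top,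
    mul_ne_top (by simp) (mul_ne_top (crossMax_ne_top d M) (mul_ne_top ofReal_ne_top hρρ))⟩)
  have lip : ∀ {f g}, Inv f → Inv g → ∀ t ∈ Icc 0 T, wmom M (famL fun m v => step f m t v - step g m t v) (wt d 0) ≤
      L₀ * ∫⁻ s in Ioc 0 t, wmom M (famL fun m v => f m s v - g m s v) (wt d 0) := fun hf hg t ht =>
    wmom_picardStep_sub_le hb hR hC (hgr 0 m0) hl (fun m => (invU hf m).mono_weight)
      (fun m => (invU hg m).mono_weight) hf.2.1 hg.2.1 (invρ hf) (invρ hg) hlam.le ht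
  set L : ℝ := L₀.toReal
  have hL : ofReal L = L₀ := ofReal_toReal hL₀
  have hL0 : 0 ≤ L := toReal_nonneg
  -- Iterating the Volterra estimate produces `(Lt)^k/k!`, summable without a smallness condition on
  -- `T`.
  have hdk : ∀ k, ∀ t ∈ Icc 0 T, wmom M (famL fun m v => u (k + 1) m t v - u k m t v) (wt d 0) ≤ ofReal ((L * t) ^ k / k.factorial) * ρ := fun k => by
    induction k with
    | zero =>
      intro t ht
      have := invρ (invu 1) t ht
      simpa [hu0, famL] using this
    | succ k ih =>
      intro t ht
      have := lip (invu (k + 1)) (invu k) t ht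
      rw [← husucc, ← husucc] at this
      refine this.trans ?_
      calc L₀ * _ ≤ L₀ * ∫⁻ s in Ioc 0 t, ofReal ((L * s) ^ k / k.factorial) * ρ := by
            gcongr 1
            exact setLIntegral_mono' measurableSet_Ioc fun s hs => ih s (Ioc_sub ht hs)
        _ = _ := by
            rw [lintegral_mul_const _ (by fun_prop), ← hL, ← mul_assoc, lintegral_pow_div_factorial L hL0 k ht.1]
  set a : ℕ → ℝ≥0∞ := fun i => ofReal ((L * T) ^ i / i.factorial) * ρ
  have ha : ∑' i, a i ≠ ⊤ := by
    rw [ENNReal.tsum_mul_right]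
    exact mul_ne_top (Real.summable_pow_div_factorial (L * T)).tsum_ofReal_ne_top coe_ne_top
  set ε : ℕ → ℝ≥0∞ := fun n => ∑' i, a (i + n)
  have hε : Tendsto ε atTop (𝓝 0) := ENNReal.tendsto_sum_nat_add a ha
  have hda : ∀ k, ∀ t ∈ Icc 0 T, wmom M (famL fun m v => u (k + 1) m t v - u k m t v) (wt d 0) ≤ a k := fun k t ht => by
    refine (hdk k t ht).trans ?_
    have h1 := ht.1
    simp only [a]
    gcongr
    exact ht.2
  have hum : ∀ k t m, Measurable (u k m t) := fun k t m => ((invu k).1 m).comp measurable_prodMk_left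
  have cauchy : ∀ n l, ∀ t ∈ Icc 0 T, wmom M (famL fun m v => u n m t v - u (n + l) m t v) (wt d 0) ≤
      ∑ i ∈ Finset.range l, a (i + n) := fun n l t ht => by
    induction l with
    | zero => simp [wmom, famL]
    | succ l ih =>
      refine (wmom_sub_triangle M (hum n t) (hum (n + l) t) (measurable_wt 0)).trans ?_
      rw [Finset.sum_range_succ]
      refine add_le_add ih ?_
      rw [wmom_famL_comm, add_comm l n]
      exact hda (n + l) t ht
  have cauchy' : ∀ n k, n ≤ k → ∀ t ∈ Icc 0 T, wmom M (famL fun m v => u n m t v - u k m t v) (wt d 0) ≤ ε n := by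
    intro n k hnk t ht
    obtain ⟨l, rfl⟩ := Nat.exists_eq_add_of_le hnk
    exact (cauchy n l t ht).trans (ENNReal.sum_le_tsum _)
  obtain ⟨w, κ, hκ, hwm, hw0, hwz, happ⟩ := exists_family_limit (j := 0) (fun n => (invu n).1) (fun n => (invu n).2.1) hε cauchy'
  have hwms : ∀ t m, Measurable (w m t) := fun t m => (hwm m).comp measurable_prodMk_left
  have hκε : Tendsto (fun n => κ * ε n) atTop (𝓝 0) := by
    simpa using ENNReal.Tendsto.const_mul hε (Or.inr hκ)
  have invw : Inv w := by
    refine ⟨hwm, hw0, hwz, fun j hj t ht => ?_⟩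
    exact wmom_le_of_approx (hwms t) (fun n => hum n t) hκε (fun n => happ n t ht) (measurable_wt j) (wt_ne_top j) (fun n => (invu n).2.2.2 j hj t ht)
  -- Compare with the next iterate: the Lipschitz estimate controls one half of the difference,
  -- convergence the other.
  have fixed : ∀ t ∈ Icc 0 T, wmom M (famL fun m v => step w m t v - w m t v) (wt d 0) = 0 := by
    intro t ht
    have hsm : ∀ m, Measurable (step w m t) := fun m => ((invS invw).1 m).comp measurable_prodMk_left
    have lim : Tendsto (fun n => L₀ * (κ * ε n * ofReal t) + κ * ε (n + 1)) atTop (𝓝 (L₀ * (0 * ofReal t) + 0)) :=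
      (ENNReal.Tendsto.const_mul (ENNReal.Tendsto.mul_const hκε (Or.inr ofReal_ne_top)) (Or.inr hL₀)).add (hκε.comp (tendsto_add_atTop_nat 1))
    rw [zero_mul, mul_zero, zero_add] at lim
    refine le_antisymm (ge_of_tendsto' lim fun n => ?_) zero_le
    refine (wmom_sub_triangle M hsm (hum (n + 1) t) (measurable_wt 0)).trans (add_le_add ?_ (happ (n + 1) t ht))
    rw [husucc]
    refine (lip invw (invu n) t ht).trans ?_
    gcongr
    calc _ ≤ ∫⁻ s in Ioc 0 t, κ * ε n := by
          refine setLIntegral_mono' measurableSet_Ioc fun s hs => ?_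
          rw [wmom_famL_comm]
          exact happ n s (Ioc_sub ht hs)
      _ = _ := by simp
  refine ⟨w, invU invw, hw0, invw.2.2.2, fun t ht m hm => ?_⟩
  have hmild : ∀ s ∈ Icc 0 T, w m s =ᵐ[volume] fun v => ou (c m) (D m) lam (s - 0) (f₀ m) v +
      duhamel (c m) (D m) lam 0 (fun s v => collB b M m (fun n => w n s) v + lam * w m s v) s v := by
    intro s hs
    have h1 : ∫⁻ v, ‖step w m s v - w m s v‖ₑ * wt d 0 v = 0 :=
      le_antisymm ((le_wmom hm (famL fun m v => step w m s v - w m s v) (wt d 0)).trans (fixed s hs).le) zero_le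
    have hsm : Measurable (step w m s) := ((invS invw).1 m).comp measurable_prodMk_left
    have hmm : Measurable fun v => ‖step w m s v - w m s v‖ₑ * wt d 0 v := (hsm.sub (hwms s m)).enorm.mul (measurable_wt 0)
    rw [lintegral_eq_zero_iff hmm] at h1
    filter_upwards [h1] with v hv
    have hv' : step w m s v = w m s v := by
      simpa [wt_zero, sub_eq_zero] using hv
    rw [← hv']
    simp only [step, picardStep, if_pos hm, mild]
    congr 1
    unfold duhamel
    refine setIntegral_congr_fun measurableSet_Ioc fun q hq => ?_
    simp only
    congr 1
    ext y
    rw [posSource_eq hb hl (fun n y => hw0 n q y) (invR invw q (Ioc_sub hs hq) m hm y), add_comm]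
  have hQ : UL 0 T 0 cB b M m w := unifL1_collB hb (fun n => (invU invw n).mono_weight) hm
  have hw0U : UL 0 T 0 (w m) := (invU invw m).mono_weight
  have weak := weak_of_mild (hc m hm) (hD m hm) (hf₀ m) (integrable_of_wt_ne_top (hf₀ m) (hf₀4 m)) hw0U (hQ.add (hw0U.const_mul lam)) ht hmild
  -- The damping was auxiliary; shifting by `-lam` removes it together with `lam w` from the source.
  have weak' := weak.shift hw0U (hQ.add (hw0U.const_mul lam)) ht (-lam)
  have e : (fun s v => collB b M m (fun n => w n s) v + lam * w m s v + -lam * w m s v) = fun s => collB b M m fun n => w n s := by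
    ext s v; ring
  rwa [add_neg_cancel, e] at weak'

end BoundedKernel

/-! ### Removal of the truncations: solutions for the relative speed -/

section Existence

variable {f : ℕ → Fn d}

lemma enorm_pair_le {g ψ : Fn d} {K : ℝ} (hK : ∀ v, |ψ v| ≤ K) : ‖pair g ψ‖ₑ ≤ ofReal K * nrm 0 g := by
  rw [← lintegral_const_mul' _ _ ofReal_ne_top]
  refine (enorm_integral_le_lintegral_enorm _).trans (lintegral_mono fun v => ?_)
  simp only [wt_zero, mul_one]
  rw [enorm_mul, mul_comm]
  gcongr
  rw [enorm_eq_ofReal_abs]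
  exact ofReal_le_ofReal (hK v)

/-- The linear weak formulation is stable under uniform `L¹` limits. -/
lemma LinWeakAt.of_approx {k : ℝ → Fn d} {u₀ : ℕ → Fn d} {u h : Fam d} (hwn : ∀ n, LinWeakAt c D lam a (u₀ n) (u n) (h n) t)
    (hu : ∀ n, UL a T 0 (u n)) (hh : ∀ n, UL a T 0 (h n)) (hw : UL a T 0 w)
    (hk : UL a T 0 k) (hi₀ : ∀ n, Integrable (u₀ n)) (hj₀ : Integrable w₀) (ht : t ∈ Icc a T)
    {ε₀ ε' : ℕ → ℝ≥0∞} (hε₀ : Tendsto ε₀ atTop (𝓝 0)) (hε : Tendsto ε atTop (𝓝 0)) (hε' : Tendsto ε' atTop (𝓝 0))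
    (h₀ : ∀ n, ∫⁻ v, ‖u₀ n v - w₀ v‖ₑ * wt d 0 v ≤ ε₀ n) (h₁ : ∀ n, ∀ s ∈ Icc a T, ∫⁻ v, ‖u n s v - w s v‖ₑ * wt d 0 v ≤ ε n)
    (h₂ : ∀ n, ∀ s ∈ Icc a T, ∫⁻ v, ‖h n s v - k s v‖ₑ * wt d 0 v ≤ ε' n) : LinWeakAt c D lam a w₀ w k t := by
  intro φ hφ
  have hG := hφ.genAdj c D lam
  have hsub : Ioc a t ⊆ Icc a T := Ioc_sub ht
  obtain ⟨K, hK⟩ := hφ.exists_bound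
  obtain ⟨L, hL⟩ := hG.exists_bound
  set X : ℝ := pair (w t) φ - (pair w₀ φ + ∫ s in a..t, (pair (w s) (genAdj c D lam φ) + pair (k s) φ)) with hX
  have key : ∀ n, X = -pair (fun v => u n t v - w t v) φ + pair (fun v => u₀ n v - w₀ v) φ +
      ∫ s in a..t, (pair (fun v => u n s v - w s v) (genAdj c D lam φ) + pair (fun v => h n s v - k s v) φ) := by
    intro n
    rw [integral_pair_sub (hu n) (hh n) hw hk ht hG hφ, pair_sub ((hu n).integrable_mul_test ht hφ) (hw.integrable_mul_test ht hφ),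
      pair_sub (hφ.integrable_mul (hi₀ n)) (hφ.integrable_mul hj₀), hwn n φ hφ, hX]
    ring
  have bd : ∀ n, ‖X‖ₑ ≤ ofReal K * ε n + ofReal K * ε₀ n + (ofReal L * ε n + ofReal K * ε' n) * ofReal (t - a) := by
    intro n
    rw [key n]
    refine (enorm_add_le _ _).trans (add_le_add ((enorm_add_le _ _).trans (add_le_add ?_ ?_)) ?_)
    · rw [enorm_neg]
      exact (enorm_pair_le hK).trans (mul_le_mul' le_rfl (h₁ n t ht))
    · exact (enorm_pair_le hK).trans (mul_le_mul' le_rfl (h₀ n))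
    · rw [integral_of_le ht.1]
      refine (enorm_integral_le_lintegral_enorm _).trans ?_
      calc _ ≤ ∫⁻ s in Ioc a t, (ofReal L * ε n + ofReal K * ε' n) := by
            refine setLIntegral_mono' measurableSet_Ioc fun s hs => (enorm_add_le _ _).trans (add_le_add ?_ ?_)
            · exact (enorm_pair_le hL).trans (mul_le_mul' le_rfl (h₁ n s (hsub hs)))
            · exact (enorm_pair_le hK).trans (mul_le_mul' le_rfl (h₂ n s (hsub hs)))
        _ = _ := by simp
  have cm : ∀ {c : ℝ} {f : ℕ → ℝ≥0∞}, Tendsto f atTop (𝓝 0) → Tendsto (fun n => ofReal c * f n) atTop (𝓝 0) :=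
    fun {c f} hf => by simpa using ENNReal.Tendsto.const_mul (a := ofReal c) hf (Or.inr ofReal_ne_top)
  have lim := ((cm (c := K) hε).add (cm (c := K) hε₀)).add
    (ENNReal.Tendsto.mul_const (b := ofReal (t - a)) ((cm (c := L) hε).add (cm (c := K) hε')) (Or.inr ofReal_ne_top))
  simp only [add_zero, zero_mul] at lim
  have : ‖X‖ₑ = 0 := le_antisymm (ge_of_tendsto' lim bd) zero_le
  rw [enorm_eq_zero, hX, sub_eq_zero] at this
  exact this

/-- Linearity in the kernel, almost everywhere in `v` because the gain integrals converge only
there. -/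
lemma collB_kernel_sub (hb : IsKernel b) (hb' : IsKernel b') (hf : Meas f) (hff : HMom 1 f) :
    ∀ᵐ v, collB b M m f v - collB b' M m f v = collB (fun z => b z - b' z) M m f v := by
  have h1 : ∀ {b : Fn d}, IsKernel b → ∀ᵐ v, ∀ n ∈ Finset.Ico 1 m,
      Integrable fun z => f n (v + mfr n m • z) * f (m - n) (v - (1 - mfr n m) • z) * b z :=
    fun hb => (Filter.eventually_all_finset _).2 fun n hn => ae_integrable_coll hb.meas (hf n) (hf (m - n)) one_ne_top 1
      hb.absL_le (hff n) (hff (m - n)) (theta_mem hn).1 (theta_mem hn).2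
  filter_upwards [h1 hb, h1 hb'] with v i1 i2
  have e1 : ∀ n ∈ Finset.Ico 1 m, coll (fun z => b z - b' z) mfr n m (f n) (f (m - n)) v =
      coll b mfr n m (f n) (f (m - n)) v - coll b' mfr n m (f n) (f (m - n)) v := fun n hn => by
    unfold coll
    rw [← integral_sub (i1 n hn) (i2 n hn)]
    simp only [mul_sub]
  have e2 : ∀ n, conv (fun z => b z - b' z) (f n) v = conv b (f n) v - conv b' (f n) v := fun n => by
    unfold conv
    rw [← integral_sub (integrable_conv hb.meas (hf n) one_ne_top 1 hb.absL_le (hff n) v)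
      (integrable_conv hb'.meas (hf n) one_ne_top 1 hb'.absL_le (hff n) v)]
    simp only [mul_sub]
  unfold collB gainR rateR
  simp only [e2, sum_congr rfl fun n hn => congrArg (crossSection d n (m - n) * ·) (e1 n hn), mul_sub, sum_sub_distrib]
  ring

/-- The difference of two kernels is itself an even kernel, of quadratic growth with a small
constant; smallness is bought with two moments on each partner. -/
lemma wmom_collB_kernel_sub_le (hb : IsKernel b) (hb' : IsKernel b') (hK : ∀ x y : Vel d, absL (fun z => b z - b' z) (x - y) ≤ K * (wt d 2 x * wt d 2 y)) (M j : ℕ)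
    (hf : Meas f) (hff : HMom 1 f) :
    wmom M (famL fun m v => collB b M m f v - collB b' M m f v) (wt d j) ≤
      4 * (crossMax d M * (K * (wmom M (famL f) (wt d (j + 2)) * wmom M (famL f) (wt d 2)))) := by
  have hm : Measurable fun z => b z - b' z := hb.meas.sub hb'.meas
  calc _ ≤ wmom M (famL fun m => collB (fun z => b z - b' z) M m f) (wt d j) := by
        refine wmom_mono M fun m _ => ?_
        filter_upwards [collB_kernel_sub hb hb' hf hff] with v hv
        exact (congrArg (‖·‖ₑ) hv).le
    _ ≤ _ := by
        refine (wmom_famL_collB_le hm (fun z => by rw [hb.even, hb'.even]) M hf j).trans ?_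
        gcongr
        exact etot_le 2 hK M j (measurable_famL hf) (measurable_famL hf)

/-- The stability estimate with `lam = 0`. Without cancellation the operator is Lipschitz from
`L¹_1` to `L¹` on bounded sets, enough to pass to the limit in the collision term. -/
lemma wmom_collB_sub_zero_le (hb : IsKernel b) {g : ℕ → Fn d} (hf : Meas f) (hg : Meas g) (hf0 : Pos2 f) (hg0 : Pos2 g)
    (hff : HMom 1 f) (hgf : HMom 1 g) :
    wmom M (famL fun m v => collB b M m f v - collB b M m g v) (wt d 0) ≤ 8 * (crossMax d M * (dmom M f g (wt d 1) *
        (wmom M (famL f) (wt d 1) + wmom M (famL g) (wt d 1)))) := by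
  set U : ℕ → FnL d := diffL f g
  set S : ℕ → FnL d := avgL f g
  have hU : Meas U := measurable_famL fun n => (hf n).sub (hg n)
  have hS : Meas S := measurable_famL fun n => ((hf n).add (hg n)).div_const 2
  have hSle : wmom M S (wt d 1) ≤ wmom M (famL f) (wt d 1) + wmom M (famL g) (wt d 1) := by
    rw [← wmom_add M (measurable_famL hf) (measurable_wt 1)]
    exact wmom_mono M fun m _ => of_forall fun v => enorm_half_le le_self_add le_add_self
  have hfg : wmom M (famL f) (wt d 1) + wmom M (famL g) (wt d 1) ≠ ⊤ := add_ne_top.2 ⟨wmom_ne_top hff, wmom_ne_top hgf⟩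
  have hUt : wmom M U (wt d 1) ≠ ⊤ := by
    refine ne_top_of_le_ne_top hfg ?_
    rw [← wmom_add M (measurable_famL hf) (measurable_wt 1)]
    exact wmom_mono M fun m _ => of_forall fun v => enorm_sub_le
  have e1 : etot (absL b) M U S (wt d 0) ≤ crossMax d M * (1 * (wmom M U (wt d 1) * wmom M S (wt d 1))) := etot_le 1 hb.absL_le M 0 hU hS
  have e2 : etot (absL b) M S U (wt d 0) ≤ crossMax d M * (1 * (wmom M S (wt d 1) * wmom M U (wt d 1))) := etot_le 1 hb.absL_le M 0 hS hU
  have hfin : etot (absL b) M U S (wt d 0) ≠ ⊤ := ne_top_of_le_ne_top (mul_ne_top (crossMax_ne_top d M)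
    (mul_ne_top one_ne_top (mul_ne_top hUt (ne_top_of_le_ne_top hfg hSle)))) e1
  have main := wmom_collB_sub_le hb hf hg hf0 hg0 (fun n _ => hff n) (fun n _ => hgf n) (M := M) le_rfl (measurable_wt 0) (convexWeight_wt 0) hfin
  have r : wmom M (fun m v => (rateL (absL b) M m S v - ofReal 0) * U m v) (wt d 0) = 2 * etot (absL b) M U S (wt d 0) := by
    rw [← wmom_rateL (measurable_absL hb.meas) M hU hS (measurable_wt 0)]
    simp only [ofReal_zero, tsub_zero, mul_comm]
  rw [r] at main
  simp only [zero_mul, zero_add, ofReal_zero] at main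
  refine main.trans ?_
  calc _ ≤ 2 * (2 * (crossMax d M * (1 * (wmom M U (wt d 1) * wmom M S (wt d 1))))) +
        4 * (crossMax d M * (1 * (wmom M S (wt d 1) * wmom M U (wt d 1)))) := by gcongr
    _ = 8 * (crossMax d M * (wmom M U (wt d 1) * wmom M S (wt d 1))) := by ring
    _ ≤ _ := by gcongr

/-- The two truncations differ only where `x > R`, and there by at most `x ≤ x²/R`. -/
lemma abs_min_sub_min_le {R' : ℝ} (hx : 0 ≤ x) (hR : 0 < R) (h : R ≤ R') : |min x R - min x R'| ≤ x ^ 2 / R := by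
  rw [le_div_iff₀ hR]
  rcases le_total x R with h1 | h1
  · rw [min_eq_left h1, min_eq_left (h1.trans h)]; simp; positivity
  · rw [min_eq_right h1, abs_sub_comm, abs_of_nonneg (sub_nonneg.2 (le_min h1 h))]
    nlinarith [min_le_left x R', min_le_right x R']

lemma abs_min_sub_self_le (hx : 0 ≤ x) (hR : 0 < R) : |min x R - x| ≤ x ^ 2 / R := by
  have := abs_min_sub_min_le hx hR (le_max_left R x)
  rwa [min_eq_left (le_max_right R x)] at this

lemma enorm_sq_le_wt (hR : 0 < R) (h : ∀ z, |b z| ≤ ‖z‖ ^ 2 / R) (x y : Vel d) : absL b (x - y) ≤ ofReal (1 / R) * (wt d 2 x * wt d 2 y) := by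
  unfold absL wt
  rw [enorm_eq_ofReal_abs, ← ofReal_mul (by have := bracket_pos x; positivity), ← ofReal_mul (by positivity)]
  refine ofReal_le_ofReal ((h _).trans ?_)
  rw [div_eq_inv_mul, one_div, ← mul_pow]
  gcongr
  exact norm_sub_le_bracket_mul x y

/-- Chebyshev's inequality: outside `⟨v⟩ ≤ N` one weight is worth a factor `1/N`. -/
lemma enorm_mul_wt_one_le_of_tail {f : Fn d} {N : ℝ} (hN : 0 < N) {v : Vel d} (h : |g v| ≤ |f v|)
    (h0 : bracket v ≤ N → g v = 0) : ‖g v‖ₑ * wt d 1 v ≤ ofReal (1 / N) * (‖f v‖ₑ * wt d 2 v) := by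
  by_cases hv : bracket v ≤ N
  · simp [h0 hv]
  · push Not at hv
    unfold wt
    rw [enorm_eq_ofReal_abs, enorm_eq_ofReal_abs, ← ofReal_mul (abs_nonneg _), ← ofReal_mul (abs_nonneg _), ← ofReal_mul (by positivity)]
    refine ofReal_le_ofReal ?_
    have hb := bracket_pos v
    calc |g v| * bracket v ^ 1 ≤ |f v| * (1 / N * bracket v ^ 2) := by
          gcongr
          rw [one_div, ← div_eq_inv_mul, le_div_iff₀ hN]
          nlinarith
      _ = _ := by ring

/-- Existence of nonnegative weak solutions for data with two moments. -/
lemma exists_solution {c D : ℕ → ℝ} (hc : PosOn M c) (hD : PosOn M D) (hC : 0 ≤ C) (hgr : ∀ j ∈ ({0, 1, 2, 4} : Set ℕ), Grow d M c D T C j)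
    (hf₀ : Meas f₀) (hf₀0 : Pos2 f₀) (hf₀2 : HMom 2 f₀) :
    ∃ f : Fam d, Unif T 2 f ∧ Pos3 f ∧ ∀ t ∈ Icc 0 T, ∀ m ∈ Lev M, SolAt norm M c D f₀ f m t := by
  set A : ℝ≥0∞ := wmom M (famL f₀) (wt d 2)
  have hA : A ≠ ⊤ := wmom_ne_top hf₀2
  set E : ℝ≥0∞ := ofReal (exp (C * T))
  have hEA : E * A ≠ ⊤ := mul_ne_top ofReal_ne_top hA
  set N : ℕ → ℝ := fun n => (n : ℝ) + 1
  have hN : ∀ n, 0 < N n := fun n => by positivity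
  have hN1 : ∀ n, 1 ≤ N n := fun n => by simp [N]
  have hNm : ∀ {n k : ℕ}, n ≤ k → N n ≤ N k := fun h => by simp only [N]; gcongr
  -- The exponent five beats the product of two fourth moments, each `O(N²)`, with one power of `N`
  -- to spare.
  set b : ℕ → Fn d := fun n z => min ‖z‖ (N n ^ 5)
  have hb : ∀ n, IsKernel (b n) := fun n => isKernel_min (pow_nonneg (hN n).le 5)
  set δ : ℕ → ℝ≥0∞ := fun n => ofReal (1 / N n)
  have hδ : Tendsto δ atTop (𝓝 0) := by
    rw [← ofReal_zero]
    exact ENNReal.tendsto_ofReal tendsto_one_div_add_atTop_nhds_zero_nat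
  have hRδ : ∀ n, ofReal (1 / N n ^ 5) ≤ δ n := fun n =>
    ofReal_le_ofReal (one_div_le_one_div_of_le (hN n) (by simpa using pow_le_pow_right₀ (hN1 n) (show 1 ≤ 5 by norm_num)))
  -- The cut-off creates a fourth moment, at most `N²` times the second.
  set B : ℕ → Set (Vel d) := fun n => {v | bracket v ≤ N n}
  have hBm : ∀ n, MeasurableSet (B n) := fun n => measurableSet_le measurable_bracket measurable_const
  set u₀ : ℕ → ℕ → Fn d := fun n m => (B n).indicator (f₀ m)
  have hu₀m : ∀ n m, Measurable (u₀ n m) := fun n m => (hf₀ m).indicator (hBm n)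
  have hu₀0 : Pos3 u₀ := fun n m v => indicator_nonneg (fun v _ => hf₀0 m v) v
  have hu₀le : ∀ n m v, u₀ n m v ≤ f₀ m v := fun n m v => indicator_le_self' (fun v _ => hf₀0 m v) v
  have hu₀e : ∀ n m v, ‖u₀ n m v‖ₑ ≤ ‖f₀ m v‖ₑ := fun n m v => enorm_indicator_le_enorm_self _ _
  have hu₀2 : ∀ n, wmom M (famL (u₀ n)) (wt d 2) ≤ A := fun n =>
    wmom_mono M fun m _ => of_forall fun v => hu₀e n m v
  have hpt4 : ∀ n m v, ‖u₀ n m v‖ₑ * wt d 4 v ≤ ofReal (N n ^ 2) * (‖f₀ m v‖ₑ * wt d 2 v) := fun n m v => by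
    by_cases hv : v ∈ B n
    · rw [← wt_mul 2 2 v, show u₀ n m v = f₀ m v from indicator_of_mem hv _]
      have : wt d 2 v ≤ ofReal (N n ^ 2) := ofReal_le_ofReal (pow_le_pow_left₀ (bracket_pos v).le hv 2)
      calc _ ≤ ‖f₀ m v‖ₑ * (ofReal (N n ^ 2) * wt d 2 v) := by gcongr
        _ = _ := by ring
    · rw [show u₀ n m v = 0 from indicator_of_notMem hv _]; simp
  have hu₀4 : ∀ n, wmom M (famL (u₀ n)) (wt d 4) ≤ ofReal (N n ^ 2) * A := fun n => by
    rw [← wmom_const_mul M (measurable_famL hf₀) (measurable_wt 2)]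
    refine sum_le_sum fun m _ => mul_le_mul' le_rfl (lintegral_mono fun v => ?_)
    simp only [mul_assoc]
    exact hpt4 n m v
  have hu₀f : ∀ n m, nrm 4 (u₀ n m) ≠ ⊤ := fun n m => by
    refine ne_top_of_le_ne_top (mul_ne_top (ofReal_ne_top (r := N n ^ 2)) (hf₀2 m)) ?_
    rw [← lintegral_const_mul' _ _ ofReal_ne_top]
    exact lintegral_mono fun v => hpt4 n m v
  have hu₀1 : ∀ n m, nrm 1 (u₀ n m) ≠ ⊤ := fun n m => lintegral_wt_ne_top_mono (by norm_num) (hu₀f n m)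
  have tail : ∀ n, ∀ g : ℕ → Fn d, (∀ m v, |g m v| ≤ |f₀ m v|) → (∀ m v, v ∈ B n → g m v = 0) →
      wmom M (famL g) (wt d 1) ≤ δ n * A := fun n g h1 h2 => by
    rw [← wmom_const_mul M (measurable_famL hf₀) (measurable_wt 2)]
    refine sum_le_sum fun m _ => mul_le_mul' le_rfl (lintegral_mono fun v => ?_)
    simp only [mul_assoc]
    exact enorm_mul_wt_one_le_of_tail (hN n) (h1 m v) (h2 m v)
  have gr3 : ∀ j ∈ ({0, 2, 4} : Set ℕ), Grow d M c D T C j := by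
    rintro j (rfl | rfl | rfl) <;> exact hgr _ (by simp)
  choose f hfU hf0 hfw hfweak using fun n => exists_solution_of_bounded hc hD hC gr3 (hb n) (fun z => min_le_right _ _) (hu₀m n) (hu₀0 n) (hu₀f n)
  have hE : ∀ t ∈ Icc 0 T, ofReal (exp (C * t)) ≤ E := fun t ht => by
    simp only [E]; gcongr; exact ht.2
  have hf2 : ∀ n, ∀ t ∈ Icc 0 T, wmom M (famL fun m => f n m t) (wt d 2) ≤ E * A := fun n t ht =>
    (hfw n 2 (by simp) t ht).trans (mul_le_mul' (hE t ht) (hu₀2 n))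
  have hf4 : ∀ n, ∀ t ∈ Icc 0 T, wmom M (famL fun m => f n m t) (wt d 4) ≤ E * (ofReal (N n ^ 2) * A) := fun n t ht =>
    (hfw n 4 (by simp) t ht).trans (mul_le_mul' (hE t ht) (hu₀4 n))
  have hfm : ∀ n t m, Measurable (f n m t) := fun n t m => (hfU n m).measurable_apply t
  have hf1 : ∀ n, ∀ t ∈ Icc 0 T, ∀ m, nrm 1 (f n m t) ≠ ⊤ := fun n t ht m => (hfU n m).nrm_ne_top ht
  set ρ : ℝ≥0 := (E * A).toNNReal
  set W : ℝ≥0∞ := 4 * (crossMax d M * (E * A) ^ 2)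
  have hρ : (ρ : ℝ≥0∞) = E * A := coe_toNNReal hEA
  set e : ℕ → ℕ → Fam d := fun n k m s v =>
    collB (b n) M m (fun l => f n l s) v - collB (b k) M m (fun l => f n l s) v
  have heU : ∀ n k m, m ∈ Lev M → UL 0 T 1 (e n k m) := fun n k m hm =>
    (unifL1_collB (hb n) (fun l => (hfU n l).mono_weight) hm).sub (unifL1_collB (hb k) (fun l => (hfU n l).mono_weight) hm)
  have hebd : ∀ n k, n ≤ k → ∀ s ∈ Icc 0 T, wmom M (famL fun m => e n k m s) (wt d 1) ≤ δ n * W := fun n k hnk s hs => by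
    have hRR : N n ^ 5 ≤ N k ^ 5 := pow_le_pow_left₀ (hN n).le (hNm hnk) 5
    have key := wmom_collB_kernel_sub_le (hb n) (hb k) (enorm_sq_le_wt (pow_pos (hN n) 5) fun z =>
      abs_min_sub_min_le (norm_nonneg z) (pow_pos (hN n) 5) hRR) M 1 (hfm n s) (hf1 n s hs)
    refine key.trans ?_
    -- The power count `1/N = N^{-5} · N² · N²`.
    have e4 : δ n = ofReal (1 / N n ^ 5) * ofReal (N n ^ 2) * ofReal (N n ^ 2) := by
      rw [← ofReal_mul (by have := hN n; positivity), ← ofReal_mul (by have := hN n; positivity)]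
      change ofReal (1 / N n) = _
      congr 1
      have := (hN n).ne'
      field_simp
    calc _ ≤ 4 * (crossMax d M * (ofReal (1 / N n ^ 5) *
          ((E * (ofReal (N n ^ 2) * A)) * (E * (ofReal (N n ^ 2) * A))))) := by
          gcongr
          · exact (wmom_mono_wt).trans (hf4 n s hs)
          · exact (wmom_mono_wt).trans (hf4 n s hs)
      _ = _ := by simp only [e4, W]; ring
  set Kc : ℝ≥0∞ := ofReal (exp ((C + (8 * crossMax d M * ρ).toReal) * T)) * (A + ofReal T * W)
  have hKc : Kc ≠ ⊤ := mul_ne_top ofReal_ne_top (add_ne_top.2 ⟨hA, mul_ne_top ofReal_ne_top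
    (mul_ne_top (by simp) (mul_ne_top (crossMax_ne_top d M) (ENNReal.pow_ne_top hEA)))⟩)
  have cauchy : ∀ n k, n ≤ k → ∀ t ∈ Icc 0 T, wmom M (famL fun m v => f n m t v - f k m t v) (wt d 1) ≤ Kc * δ n := by
    intro n k hnk t ht
    -- The approximation `f n` solves the equation of the kernel `b k` up to the error `e`. It is
    -- extended by zero off the levels because the stability estimate asks for bounds at all
    -- indices.
    set e' : Fam d := fun m => if m ∈ Lev M then e n k m else fun _ _ => 0
    have he' : ∀ m ∈ Lev M, e' m = e n k m := fun m hm => if_pos hm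
    have he'U : Unif T 1 e' := fun m => by
      by_cases hm : m ∈ Lev M
      · rw [he' m hm]; exact heU n k m hm
      · simp only [e', if_neg hm]; exact unifL1_zero _ _
    have weak : ∀ t ∈ Icc 0 T, ∀ m ∈ Lev M, LinWeakAt (c m) (D m) 0 0 (u₀ k m) (f k m) (fun s => collB (b k) M m fun l => f k l s) t ∧
        LinWeakAt (c m) (D m) 0 0 (u₀ n m) (f n m) (fun s v => collB (b k) M m (fun l => f n l s) v + e' m s v) t := by
      refine fun t ht m hm => ⟨hfweak k t ht m hm, ?_⟩
      have := hfweak n t ht m hm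
      rw [he' m hm]
      convert this using 3
      simp only [e]
      ring
    have key := wmom_sub_le hc hD hC (hgr 1 (by simp)) (hb k) (fun m => (hfU k m).mono_weight)
      (fun m => (hfU n m).mono_weight) he'U (hf0 k) (hf0 n) (ρ := ρ) (fun s hs => (hf2 k s hs).trans hρ.ge)
      (fun s hs => (hf2 n s hs).trans hρ.ge) (hu₀m k) (hu₀m n) (hu₀1 k) (hu₀1 n)
      ((ae_restrict_iff' measurableSet_Ioc).2 (of_forall fun t ht => weak t ⟨ht.1.le, ht.2⟩)) ht (weak t ht)
    rw [wmom_famL_comm]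
    refine key.trans ?_
    have i1 : wmom M (famL fun m v => u₀ k m v - u₀ n m v) (wt d 1) ≤ δ n * A := by
      refine tail n _ (fun m v => ?_) fun m v hv => ?_
      · rw [abs_of_nonneg (hf₀0 m v), abs_le]
        constructor <;> linarith [hu₀0 k m v, hu₀0 n m v, hu₀le k m v, hu₀le n m v]
      · have hv' : v ∈ B k := le_trans hv (hNm hnk)
        simp only [u₀, indicator_of_mem hv, indicator_of_mem hv', sub_self]
    have i2 : ∫⁻ s in Ioc 0 t, mom M e' s (wt d 1) ≤ δ n * (ofReal T * W) := by
      calc _ ≤ ∫⁻ s in Ioc 0 t, δ n * W := by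
            refine setLIntegral_mono' measurableSet_Ioc fun s hs => ?_
            refine (Eq.le ?_).trans (hebd n k hnk s (Ioc_sub ht hs))
            exact sum_congr rfl fun m hm => by simp only [famL, he' m hm]
        _ = (δ n * W) * ofReal t := by simp
        _ ≤ (δ n * W) * ofReal T := by gcongr; exact ht.2
        _ = _ := by ring
    calc _ ≤ ofReal (exp ((C + (8 * crossMax d M * ρ).toReal) * T)) *
          (δ n * A + δ n * (ofReal T * W)) := by
          gcongr
          exact ht.2
      _ = _ := by ring
  have hKδ : ∀ {K : ℝ≥0∞}, K ≠ ⊤ → Tendsto (fun n => K * δ n) atTop (𝓝 0) := fun hK => by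
    simpa using ENNReal.Tendsto.const_mul hδ (Or.inr hK)
  obtain ⟨w, κ, hκ, hwm, hw0, hwz, happ⟩ := exists_family_limit (j := 1) (fun n m => (hfU n m).1) hf0 (hKδ hKc) cauchy
  have hwms : ∀ t m, Measurable (w m t) := fun t m => (hwm m).comp measurable_prodMk_left
  have hκK : κ * Kc ≠ ⊤ := mul_ne_top hκ hKc
  simp only [← mul_assoc] at happ
  have happ0 : ∀ n, ∀ t ∈ Icc 0 T, wmom M (famL fun m v => f n m t v - w m t v) (wt d 0) ≤ κ * Kc * δ n := fun n t ht =>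
    (wmom_mono_wt).trans (happ n t ht)
  have hw2 : ∀ t ∈ Icc 0 T, mom M w t (wt d 2) ≤ E * A := fun t ht =>
    wmom_le_of_approx (hwms t) (fun n => hfm n t) (hKδ hκK) (fun n => happ0 n t ht) (measurable_wt 2) (wt_ne_top 2) (fun n => hf2 n t ht)
  have hwU : Unif T 2 w := fun m => by
    by_cases hm : m ∈ Lev M
    · exact unifL1_of_wmom hm (hwm m) hEA hw2
    · rw [hwz m hm]; exact unifL1_zero _ _
  have hw1 : ∀ t ∈ Icc 0 T, ∀ m, nrm 1 (w m t) ≠ ⊤ := fun t ht m => (hwU m).nrm_ne_top ht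
  -- The first summand comes from exchanging the kernel at a fixed density, the second from
  -- exchanging the density under the full kernel.
  set Kq : ℝ≥0∞ := 4 * (crossMax d M * (E * A * (E * A))) + 8 * (crossMax d M * (κ * Kc * (E * A + E * A)))
  have hKq : Kq ≠ ⊤ := add_ne_top.2 ⟨mul_ne_top (by simp) (mul_ne_top (crossMax_ne_top d M) (mul_ne_top hEA hEA)),
    mul_ne_top (by simp) (mul_ne_top (crossMax_ne_top d M) (mul_ne_top hκK (add_ne_top.2 ⟨hEA, hEA⟩)))⟩
  have hQ : ∀ n, ∀ s ∈ Icc 0 T, wmom M (famL fun m v => collB (b n) M m (fun l => f n l s) v - collB norm M m (fun l => w l s) v) (wt d 0) ≤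
      Kq * δ n := fun n s hs => by
    have cm : ∀ {b : Fn d}, IsKernel b → ∀ {f : ℕ → Fn d}, Meas f → ∀ m, Measurable (collB b M m f) := fun hb _ hf m => measurable_collB hb.meas M m hf
    refine (wmom_sub_triangle M (cm (hb n) (hfm n s)) (cm isKernel_norm (hfm n s)) (measurable_wt 0)).trans ?_
    rw [add_mul]
    refine add_le_add ?_ ?_
    · refine (wmom_collB_kernel_sub_le (hb n) isKernel_norm (enorm_sq_le_wt (pow_pos (hN n) 5) fun z =>
        abs_min_sub_self_le (norm_nonneg z) (pow_pos (hN n) 5)) M 0 (hfm n s) (hf1 n s hs)).trans ?_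
      calc _ ≤ 4 * (crossMax d M * (δ n * (E * A * (E * A)))) := by
            gcongr
            · exact hRδ n
            · exact hf2 n s hs
            · exact hf2 n s hs
        _ = _ := by ring
    · refine (wmom_collB_sub_zero_le isKernel_norm (hfm n s) (hwms s) (fun m => hf0 n m s) (fun m => hw0 m s) (hf1 n s hs) (hw1 s hs)).trans ?_
      calc _ ≤ 8 * (crossMax d M * (κ * Kc * δ n * (E * A + E * A))) := by
            gcongr
            · exact happ n s hs
            · exact (wmom_mono_wt).trans (hf2 n s hs)
            · exact (wmom_mono_wt).trans (hw2 s hs)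
        _ = _ := by ring
  refine ⟨w, hwU, hw0, fun t ht m hm => ?_⟩
  refine LinWeakAt.of_approx (fun n => hfweak n t ht m hm) (fun n => (hfU n m).mono_weight)
    (fun n => unifL1_collB (hb n) (fun l => (hfU n l).mono_weight) hm) ((hwU m).mono_weight)
    (unifL1_collB isKernel_norm (fun l => (hwU l).mono_weight) hm)
    (fun n => integrable_of_wt_ne_top (hu₀m n m) (hu₀1 n m)) (integrable_of_wt_ne_top (hf₀ m) (hf₀2 m)) ht
    (hKδ hA) (hKδ hκK) (hKδ hKq) (fun n => ?_) (fun n s hs => ?_) (fun n s hs => ?_)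
  · refine (le_wmom hm (famL fun m v => u₀ n m v - f₀ m v) (wt d 0)).trans ((wmom_mono_wt (j := 1)).trans ?_)
    rw [mul_comm]
    refine tail n _ (fun m v => ?_) fun m v hv => ?_
    · rw [abs_of_nonneg (hf₀0 m v), abs_le]
      constructor <;> linarith [hu₀0 n m v, hu₀le n m v, hf₀0 m v]
    · simp only [u₀, indicator_of_mem hv, sub_self]
  · exact (le_wmom hm (famL fun m v => f n m s v - w m s v) (wt d 0)).trans (happ0 n s hs)
  · exact (le_wmom hm (famL fun m v => collB (b n) M m (fun l => f n l s) v - collB norm M m (fun l => w l s) v) (wt d 0)).trans (hQ n s hs)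

end Existence

/-! ### Nonnegative solutions and moment creation -/

section Moments

variable {G : ℝ → Fn d}

/-- The Duhamel term for nonnegative sources. -/
def duhL (c D a : ℝ) (H : ℝ → FnL d) (t : ℝ) (v : Vel d) : ℝ≥0∞ := ∫⁻ s in Ioc a t, ouL c D (t - s) (H s) v

/-- Subtracting two weak identities makes an intermediate time the initial time. -/
lemma LinWeakAt.restart {b : ℝ} (hb : LinWeakAt c D lam a u₀ u h b) (ht : LinWeakAt c D lam a u₀ u h t)
    (hu : UL a T 0 u) (hh : UL a T 0 h) (hab : a ≤ b) (hbt : b ≤ t) (htT : t ≤ T) :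
    LinWeakAt c D lam b (u b) u h t := by
  intro φ hφ
  have i : ∀ {x y}, a ≤ x → x ≤ y → y ≤ T → IntervalIntegrable (fun s => pair (u s) (genAdj c D lam φ) + pair (h s) φ) volume x y := fun hx hxy hy =>
    (hu.intervalIntegrable_pair (hφ.genAdj c D lam) hxy fun s hs => ⟨hx.trans hs.1.le, hs.2.trans hy⟩).add
      (hh.intervalIntegrable_pair hφ hxy fun s hs => ⟨hx.trans hs.1.le, hs.2.trans hy⟩)
  rw [ht φ hφ, hb φ hφ, ← intervalIntegral.integral_add_adjacent_intervals (i le_rfl hab (hbt.trans htT)) (i hab hbt htT)]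
  ring

/-- For nonnegative densities the signed and extended averages agree wherever the average converges
absolutely. -/
lemma ofReal_ou_ae (c D r : ℝ) (hg : Measurable g) (hi : Integrable g) (h0 : ∀ v, 0 ≤ g v) :
    ∀ᵐ v, ofReal (ou c D 0 r g v) = ouL c D r (fun w => ofReal (g w)) v := by
  filter_upwards [ae_integrable_ou c D r hg hi] with v hv
  unfold ou ouL
  rw [ofReal_mul (exp_pos _).le, ofReal_integral_eq_lintegral_ofReal hv (of_forall fun z => h0 _), sub_zero]

lemma ofReal_duhamel_ae (c D : ℝ) (hh : UL a T 0 h) (ht : t ≤ T) (h0 : Pos2 h) :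
    ∀ᵐ v, ofReal (duhamel c D 0 a h t v) = duhL c D a (fun s w => ofReal (h s w)) t v := by
  have hm : Measurable fun p : ℝ × Vel d => ou c D 0 (t - p.1) (h p.1) p.2 := measurable_ou_comp (H := fun p : ℝ × Vel d => h p.1) c D 0
      (hh.1.comp (measurable_time_vel)) (by fun_prop) (by fun_prop)
  have hmL : Measurable fun p : ℝ × Vel d => ouL c D (t - p.1) (fun w => ofReal (h p.1 w)) p.2 :=
    measurable_ouL_comp (H := fun (p : ℝ × Vel d) w => ofReal (h p.1 w)) c D
      ((hh.1.comp (measurable_time_vel)).ennreal_ofReal) (by fun_prop) (by fun_prop)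
  have e1 : ∀ᵐ s ∂volR (Ioc a t), ∀ᵐ v, ofReal (ou c D 0 (t - s) (h s) v) = ouL c D (t - s) (fun w => ofReal (h s w)) v := by
    filter_upwards [ae_mem_Ioc] with s hs
    exact ofReal_ou_ae c D (t - s) (hh.measurable_apply s) (hh.integrable ⟨hs.1.le, hs.2.trans ht⟩) (h0 s)
  have e2 := (Measure.ae_ae_comm (p := fun s v => ofReal (ou c D 0 (t - s) (h s) v) =
      ouL c D (t - s) (fun w => ofReal (h s w)) v) (measurableSet_eq_fun hm.ennreal_ofReal hmL)).1 e1
  filter_upwards [e2, (integrable_duhamel_prod (c := c) (D := D) (lam := 0) hh ht).prod_right_ae] with v h1 h2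
  unfold duhamel duhL
  rw [ofReal_integral_eq_lintegral_ofReal h2 (of_forall fun s => ou_nonneg _ _ _ _ (h0 s) _)]
  exact lintegral_congr_ae h1

lemma lintegral_duhL_mul (c D a t : ℝ) {H : ℝ → FnL d} (hH : Measurable (uncurry H)) (hΦ : Measurable Φ) :
    ∫⁻ v, duhL c D a H t v * Φ v = ∫⁻ s in Ioc a t, ∫⁻ w, H s w * ouDualL c D (t - s) Φ w := by
  have hm : Measurable fun p : Vel d × ℝ => ouL c D (t - p.2) (H p.2) p.1 := measurable_ouL_comp (H := fun p : Vel d × ℝ => H p.2) c D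
      (hH.comp ((by fun_prop : Measurable fun q : (Vel d × ℝ) × Vel d => (q.1.2, q.2)))) (by fun_prop) (by fun_prop)
  have e : ∀ v, duhL c D a H t v * Φ v = ∫⁻ s in Ioc a t, ouL c D (t - s) (H s) v * Φ v := fun v => by
    have hv : Measurable fun s => ouL c D (t - s) (H s) v := hm.comp measurable_prodMk_left
    rw [lintegral_mul_const _ hv]; rfl
  simp only [e]
  rw [lintegral_lintegral_swap (hm.mul (hΦ.comp measurable_fst)).aemeasurable]
  exact lintegral_congr fun s => lintegral_ouL_mul c D (t - s) (hH.comp measurable_prodMk_left) hΦ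

/-- The mild formulation with the loss on the left, as an identity between nonnegative quantities. -/
lemma mildL_of_weak (hc : 0 < c) (hD : 0 < D) (hm₀ : Measurable u₀) (hi₀ : Integrable u₀) (h₀ : ∀ v, 0 ≤ u₀ v)
    (hu : UL a T 1 u) (hG : UL a T 0 G) (hL : UL a T 0 L) (hu0 : Pos2 u) (hG0 : Pos2 G) (hL0 : Pos2 L) (ht : t ∈ Icc a T)
    (hw : ∀ s ∈ Icc a T, LinWeakAt c D 0 a u₀ u (fun s v => G s v - L s v) s) :
    ∀ᵐ v, ofReal (u t v) + duhL c D a (fun s w => ofReal (L s w)) t v =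
      ouL c D (t - a) (fun w => ofReal (u₀ w)) v + duhL c D a (fun s w => ofReal (G s w)) t v := by
  have hmild := mild_of_weak hc hD hm₀ hi₀ hu (hG.sub hL) ht
    ((ae_restrict_iff' measurableSet_Ioc).2 (of_forall fun s hs => hw s ⟨hs.1.le, hs.2⟩)) (hw t ht)
  have nn : ∀ {h : ℝ → Fn d}, Pos2 h → ∀ v, 0 ≤ duhamel c D 0 a h t v := fun h0 v =>
    setIntegral_nonneg measurableSet_Ioc fun s _ => ou_nonneg _ _ _ _ (h0 s) _
  filter_upwards [hmild, duhamel_sub_ae c D 0 hG hL ht.2, ofReal_ou_ae c D (t - a) hm₀ hi₀ h₀, ofReal_duhamel_ae c D hG ht.2 hG0,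
    ofReal_duhamel_ae c D hL ht.2 hL0] with v e1 e2 e3 e4 e5
  rw [← e3, ← e4, ← e5, ← ofReal_add (hu0 t v) (nn hL0 v), ← ofReal_add (ou_nonneg _ _ _ _ h₀ _) (nn hG0 v), e1, ← e2]
  congr 1
  ring

lemma lintegral_gauss_neg {f : FnL d} (hf : Measurable f) : ∫⁻ z, f (-z) ∂gauss d = ∫⁻ z, f z ∂gauss d := by
  rw [lintegral_gauss hf, lintegral_gauss (f := fun z => f (-z)) (hf.comp measurable_neg),
    ← (Measure.measurePreserving_neg (volume : Measure (Vel d))).lintegral_comp_emb (MeasurableEquiv.neg (Vel d)).measurableEmbedding]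
  simp [gaussPdf]

/-- For each `z`, one of `z` and `-z` has nonnegative inner product with `x`, and moving `x` in that
direction does not shorten it. So half of the Gaussian mass keeps the weight, and the drift costs
only `e^{-cT}` per power. -/
lemma le_ouDualL_wt (hc : 0 < c) (j : ℕ) (hr : r ∈ Icc 0 T) (w : Vel d) : ofReal (exp (-(c * T)) ^ j) * wt d j w ≤ 2 * ouDualL c D r (wt d j) w := by
  set x : Vel d := exp (-(c * r)) • w
  set σ := ouSd c D r
  have hm : Measurable fun z : Vel d => wt d j (x + σ • z) := (measurable_wt j).comp (by fun_prop)
  have e : 2 * ouDualL c D r (wt d j) w = ∫⁻ z, (wt d j (x + σ • z) + wt d j (x + σ • -z)) ∂gauss d := by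
    rw [lintegral_add_left hm, lintegral_gauss_neg hm, two_mul]; rfl
  have hx : exp (-(c * T)) * bracket w ≤ bracket x := by
    have h1 : exp (-(c * T)) ≤ exp (-(c * r)) := by
      gcongr
      exact hr.2
    have h2 : exp (-(c * r)) ≤ 1 := exp_le_one_iff.2 (by have := mul_nonneg hc.le hr.1; linarith)
    refine (mul_le_mul_of_nonneg_right h1 (bracket_pos w).le).trans (le_of_sq_le_sq ?_ (bracket_pos x).le)
    rw [mul_pow, bracket_sq, bracket_sq, norm_smul, norm_of_nonneg (exp_pos _).le, mul_pow]
    nlinarith [pow_le_one₀ (exp_pos (-(c * r))).le h2 (n := 2)]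
  rw [e]
  calc ofReal (exp (-(c * T)) ^ j) * wt d j w ≤ wt d j x := by
        unfold wt
        rw [← ofReal_mul (by positivity), ← mul_pow]
        exact ofReal_le_ofReal (pow_le_pow_left₀ (mul_nonneg (exp_pos _).le (bracket_pos w).le) hx j)
    _ = ∫⁻ _, wt d j x ∂gauss d := by simp
    _ ≤ _ := by
        refine lintegral_mono fun z => ?_
        rcases le_total 0 (inner ℝ x z) with h | h
        · refine le_add_right (ofReal_le_ofReal (pow_le_pow_left₀ (bracket_pos x).le (bracket_mono ?_) j))
          refine le_of_sq_le_sq ?_ (norm_nonneg _)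
          rw [norm_add_sq_real, inner_smul_right]
          nlinarith [mul_nonneg (ouSd_nonneg c D r) h, sq_nonneg ‖σ • z‖]
        · refine le_add_left (ofReal_le_ofReal (pow_le_pow_left₀ (bracket_pos x).le (bracket_mono ?_) j))
          refine le_of_sq_le_sq ?_ (norm_nonneg _)
          rw [norm_add_sq_real, inner_smul_right, inner_neg_right]
          nlinarith [mul_nonneg (ouSd_nonneg c D r) (neg_nonneg.2 h), sq_nonneg ‖σ • -z‖]

/-- Propagation of a moment, and the gain of a moment of the loss. -/
lemma moment_step (hc : 0 < c) (hD : 0 < D) (ha : 0 ≤ a) (hu : UL a T 1 u) (hG : UL a T 0 G) (hL : UL a T 0 L) (hu0 : Pos2 u)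
    (hG0 : Pos2 G) (hL0 : Pos2 L) (haT : a ≤ T) (hw : ∀ s ∈ Icc a T, LinWeakAt c D 0 a (u a) u (fun s v => G s v - L s v) s) (j : ℕ)
    (hua : nrm j (u a) ≠ ⊤) (hGj : UL a T j G) :
    UL a T j u ∧ ∫⁻ s in Ioc a T, nrm j (L s) ≠ ⊤ := by
  obtain ⟨C, hC0, hC⟩ := exists_ouDualL_wt_le (d := d) hc hD T j
  obtain ⟨B, hB⟩ := hGj.2
  have hma : Measurable (u a) := hu.measurable_apply a
  have hLm : Measurable (uncurry fun s w => ofReal (L s w)) := hL.1.ennreal_ofReal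
  have hGm : Measurable (uncurry fun s w => ofReal (G s w)) := hG.1.ennreal_ofReal
  have en : ∀ {x : ℝ}, 0 ≤ x → ofReal x = ‖x‖ₑ := fun h => (enorm_of_nonneg h).symm
  set K : ℝ≥0∞ := ofReal C * nrm j (u a) + (ofReal C * B) * ofReal (T - a)
  have hK : K ≠ ⊤ := add_ne_top.2 ⟨mul_ne_top ofReal_ne_top hua, mul_ne_top (mul_ne_top ofReal_ne_top coe_ne_top) ofReal_ne_top⟩
  -- The mild identity keeps the loss on the left. Dropping it propagates the moment; dropping the
  -- density bounds the moment taken away by collisions.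
  have main : ∀ t ∈ Icc a T, nrm j (u t) + (∫⁻ s in Ioc a t, ∫⁻ w, ofReal (L s w) * ouDualL c D (t - s) (wt d j) w) ≤ K := by
    intro t ht
    have id := mildL_of_weak hc hD hma (hu.integrable ⟨le_rfl, haT⟩) (hu0 a) hu hG hL hu0 hG0 hL0 ht hw
    have hrt : ∀ s ∈ Icc a t, t - s ∈ Icc 0 T := fun s hs => ⟨by linarith [hs.2], by linarith [hs.1, ht.2]⟩
    have tm : ∀ H : FnL d, ∀ s ∈ Icc a t, ∫⁻ w, H w * ouDualL c D (t - s) (wt d j) w ≤ ofReal C * ∫⁻ w, H w * wt d j w := fun H s hs => by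
      rw [← lintegral_const_mul' _ _ ofReal_ne_top]
      refine lintegral_mono fun w => ?_
      calc _ ≤ H w * (ofReal C * wt d j w) := by gcongr; exact hC _ (hrt s hs) w
        _ = _ := by ring
    have hum : Measurable fun v => ofReal (u t v) * wt d j v := (hu.measurable_apply t).ennreal_ofReal.mul (measurable_wt j)
    have hom : Measurable fun v => ouL c D (t - a) (fun w => ofReal (u a w)) v * wt d j v := (measurable_ouL hma.ennreal_ofReal).mul (measurable_wt j)
    calc _ = ∫⁻ v, (ofReal (u t v) + duhL c D a (fun s w => ofReal (L s w)) t v) * wt d j v := by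
          rw [← lintegral_duhL_mul c D a t hLm (measurable_wt j)]
          simp only [add_mul]
          rw [lintegral_add_left hum]
          simp only [en (hu0 t _)]
      _ = ∫⁻ v, (ouL c D (t - a) (fun w => ofReal (u a w)) v + duhL c D a (fun s w => ofReal (G s w)) t v) * wt d j v :=
          lintegral_congr_ae (by filter_upwards [id] with v hv; rw [hv])
      _ = (∫⁻ w, ofReal (u a w) * ouDualL c D (t - a) (wt d j) w) + ∫⁻ s in Ioc a t, ∫⁻ w, ofReal (G s w) * ouDualL c D (t - s) (wt d j) w := by
          simp only [add_mul]
          rw [lintegral_add_left hom, lintegral_duhL_mul c D a t hGm (measurable_wt j),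
            lintegral_ouL_mul c D (t - a) hma.ennreal_ofReal (measurable_wt j)]
      _ ≤ ofReal C * nrm j (u a) + ∫⁻ s in Ioc a t, ofReal C * B := by
          refine add_le_add ?_ (setLIntegral_mono' measurableSet_Ioc fun s hs => (tm _ s ⟨hs.1.le, hs.2⟩).trans ?_)
          · refine (tm _ a ⟨le_rfl, ht.1⟩).trans (le_of_eq ?_)
            simp only [en (hu0 a _)]
          · simp only [en (hG0 s _)]
            gcongr
            exact hB s (Ioc_sub ht hs)
      _ ≤ K := by
          simp only [K, lintegral_const, Measure.restrict_apply MeasurableSet.univ, univ_inter, Real.volume_Ioc]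
          gcongr
          exact ht.2
  refine ⟨⟨hu.1, K.toNNReal, fun t ht => ?_⟩, ?_⟩
  · rw [coe_toNNReal hK]
    exact le_self_add.trans (main t ht)
  · set δ := ofReal (exp (-(c * T)) ^ j)
    have hδ : δ ≠ 0 := by simp only [δ, ne_eq, ENNReal.ofReal_eq_zero, not_le]; positivity
    -- Evaluated at the final time, the lower bound for the evolved weight removes the semigroup
    -- acting on the loss.
    have h1 : δ * ∫⁻ s in Ioc a T, nrm j (L s) ≤ 2 * K := by
      rw [← lintegral_const_mul' _ _ ofReal_ne_top]
      refine le_trans ?_ (mul_le_mul' le_rfl (le_add_self.trans (main T ⟨haT, le_rfl⟩)))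
      rw [← lintegral_const_mul' _ _ ofNat_ne_top]
      refine setLIntegral_mono' measurableSet_Ioc fun s hs => ?_
      rw [← lintegral_const_mul' _ _ ofReal_ne_top, ← lintegral_const_mul' _ _ ofNat_ne_top]
      refine lintegral_mono fun w => ?_
      have := le_ouDualL_wt (D := D) hc j (r := T - s) (T := T) ⟨by linarith [hs.2], by linarith [hs.1]⟩ w
      calc δ * (‖L s w‖ₑ * wt d j w) = ‖L s w‖ₑ * (δ * wt d j w) := by ring
        _ ≤ ‖L s w‖ₑ * (2 * ouDualL c D (T - s) (wt d j) w) := by gcongr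
        _ = _ := by rw [en (hL0 s w)]; ring
    intro htop
    rw [htop, mul_top hδ, top_le_iff] at h1
    exact mul_ne_top ofNat_ne_top hK h1

/-- A level gains from strictly smaller masses only, so bounds below `m` suffice; this makes
induction on the mass possible. -/
lemma unifL1_gainR (hfm : UMeas f) (hf : ∀ n ∈ Finset.Ico 1 m, UnifL1 S (j + 1) (f n)) : UnifL1 S j (fun s => gainR norm m fun n => f n s) := by
  have hn : ∀ n ∈ Finset.Ico 1 m, m - n ∈ Finset.Ico 1 m := fun n hn => by
    rw [Finset.mem_Ico] at hn ⊢; omega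
  choose! C hC using fun n hn => (hf n hn).2
  refine ⟨measurable_gainR_comp (f := fun n (x : ℝ × Vel d) => f n x.1) measurable_norm m (fun n => (hfm n).comp measurable_time_vel) measurable_snd,
    (∑ n ∈ Finset.Ico 1 m, crossSectionL d n (m - n) * (C n * C (m - n))).toNNReal, fun s hs => ?_⟩
  rw [coe_toNNReal (sum_lt_top.2 fun n _ => mul_lt_top (crossSectionL_ne_top d n _).lt_top (by simp [mul_lt_top])).ne]
  have hms : ∀ n, Measurable (f n s) := fun n => (hfm n).comp measurable_prodMk_left
  have hcm : ∀ n : ℕ, Measurable fun v => collL (absL norm) mfr n m (famL (fun n => f n s) n) (famL (fun n => f n s) (m - n)) v * wt d j v :=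
    fun n => (measurable_collL (measurable_absL measurable_norm) _ (measurable_famL hms n) (measurable_famL hms _)).mul (measurable_wt j)
  calc ∫⁻ v, ‖gainR norm m (fun n => f n s) v‖ₑ * wt d j v
      ≤ ∫⁻ v, ∑ n ∈ Finset.Ico 1 m, crossSectionL d n (m - n) *
          (collL (absL norm) mfr n m (famL (fun n => f n s) n) (famL (fun n => f n s) (m - n)) v * wt d j v) := by
        refine lintegral_mono fun v => (mul_le_mul' (enorm_gainR_le _ _ _ _) le_rfl).trans (le_of_eq ?_)
        unfold gainL
        rw [sum_mul]
        exact sum_congr rfl fun n _ => mul_assoc _ _ _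
    _ = ∑ n ∈ Finset.Ico 1 m, crossSectionL d n (m - n) *
          ∫⁻ v, collL (absL norm) mfr n m (famL (fun n => f n s) n) (famL (fun n => f n s) (m - n)) v * wt d j v := by
        rw [lintegral_finsetSum _ fun n _ => (hcm n).const_mul _]
        exact sum_congr rfl fun n _ => lintegral_const_mul _ (hcm n)
    _ ≤ _ := by
        refine sum_le_sum fun n hnm => mul_le_mul' le_rfl ?_
        refine (lintegral_collL_wt_le (measurable_absL measurable_norm) 1 isKernel_norm.absL_le (theta_mem hnm).1 (theta_mem hnm).2 j
          (measurable_famL hms n) (measurable_famL hms _)).trans ?_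
        rw [one_mul]
        exact mul_le_mul' (hC n hnm s hs) (hC _ (hn n hnm) s hs)

lemma unifL1_loss (hm : m ∈ Lev M) (hf : ∀ n, UnifL1 S 1 (f n))
    (hfj : UnifL1 S (j + 1) (f m)) : UnifL1 S j (fun s v => f m s v * rateR norm M m (fun n => f n s) v) := by
  obtain ⟨ρ, hρ⟩ := exists_wmom_bound hf M
  obtain ⟨K, hK⟩ := hfj.2
  refine ⟨hfj.1.mul (measurable_rateR_comp (f := fun n (x : ℝ × Vel d) => f n x.1) measurable_norm M m
    (fun n => (hf n).1.comp measurable_time_vel) measurable_snd), (2 * crossMax d M * (1 * ρ) * K).toNNReal, fun s hs => ?_⟩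
  have ht : 2 * crossMax d M * (1 * ρ) ≠ ⊤ := mul_ne_top (mul_ne_top (by simp) (crossMax_ne_top d M)) (by simp)
  rw [coe_toNNReal (mul_ne_top ht coe_ne_top)]
  calc _ ≤ ∫⁻ v, 2 * crossMax d M * (1 * ρ) * (‖f m s v‖ₑ * wt d (j + 1) v) := by
        refine lintegral_mono fun v => ?_
        rw [enorm_mul, ← wt_mul j 1 v]
        have := (enorm_rateR_le norm M m (fun n => f n s) v).trans
          (rateL_le 1 isKernel_norm.absL_le hm (measurable_famL fun n => (hf n).measurable_apply s) v)
        calc _ ≤ ‖f m s v‖ₑ * (2 * crossMax d M * (1 * ρ) * wt d 1 v) * wt d j v := by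
              gcongr
              refine this.trans ?_
              gcongr
              exact hρ s hs
          _ = _ := by ring
    _ ≤ _ := by
        rw [lintegral_const_mul' _ _ ht]
        gcongr
        exact hK s hs

/-- Creation of moments. -/
lemma unifL1_of_rate_lower {c D : ℕ → ℝ} (hc : PosOn M c) (hD : PosOn M D) (hf : Unif T 2 f) (hf0 : Pos3 f)
    (hw : ∀ t ∈ Icc 0 T, ∀ m ∈ Lev M, SolAt norm M c D f₀ f m t)
    (hr : ∀ m ∈ Lev M, ∃ α β : ℝ, 0 < α ∧ ∀ t ∈ Icc 0 T, ∀ v, α * bracket v ≤ rateR norm M m (fun n => f n t) v + β)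
    (hm : m ∈ Lev M) (j : ℕ) (ha : 0 < a) : UL a T j (f m) := by
  -- Outer induction on the mass: the gain at level `m` then has all moments on every positive time
  -- interval. The inner induction raises the order of the moment.
  induction m using Nat.strong_induction_on generalizing j a with
  | _ m ihm =>
  obtain ⟨α, β, hα, hr⟩ := hr m hm
  set G : ℝ → Fn d := fun s => gainR norm m fun n => f n s
  set L : ℝ → Fn d := fun s v => f m s v * rateR norm M m (fun n => f n s) v
  have sub : ∀ {a : ℝ}, 0 < a → Icc a T ⊆ Icc 0 T := fun ha s hs => ⟨ha.le.trans hs.1, hs.2⟩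
  have hGj : ∀ j (a : ℝ), 0 < a → UL a T j G := fun j a ha => unifL1_gainR (fun n => (hf n).1) fun n hn => by
    have := Finset.mem_Ico.1 hn
    exact ihm n this.2 (mem_Icc_of_Ico hm hn).1 (j + 1) ha
  have hf1 : Unif T 1 f := fun n => (hf n).mono_weight
  have hL : UL 0 T 0 L := unifL1_loss hm hf1 (hf1 m)
  have hG0 : Pos2 G := fun s v => gainR_nonneg isKernel_norm m (fun n v => hf0 n s v) v
  have hL0 : Pos2 L := fun s v => mul_nonneg (hf0 m s v) (rateR_nonneg isKernel_norm M m (fun n v => hf0 n s v) v)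
  have hQ : UL 0 T 0 cB norm M m f := unifL1_collB isKernel_norm hf1 hm
  have weak : ∀ a, 0 < a → a ≤ T → ∀ t ∈ Icc a T, LinWeakAt (c m) (D m) 0 a (f m a) (f m) (fun s v => G s v - L s v) t :=
    fun a ha haT t ht => (hw a ⟨ha.le, haT⟩ m hm).restart (hw t ⟨ha.le.trans ht.1, ht.2⟩ m hm) ((hf m).mono_weight) hQ ha.le ht.1 ht.2
  have step : ∀ j (a : ℝ), 0 < a → a ≤ T → nrm j (f m a) ≠ ⊤ → UL a T j (f m) ∧ ∫⁻ s in Ioc a T, nrm j (L s) ≠ ⊤ := fun j a ha haT hfin =>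
    moment_step (hc m hm) (hD m hm) ha.le ((hf1 m).mono_set (sub ha)) (hGj 0 a ha) (hL.mono_set (sub ha)) (hf0 m) hG0 hL0 haT
      (weak a ha haT) j hfin (hGj j a ha)
  induction j generalizing a with
  | zero => exact ((hf m).mono_weight).mono_set (sub ha)
  | succ j ihj =>
    rcases lt_or_ge T a with hTa | haT
    · exact ⟨(hf m).1, 0, fun s hs => absurd (hs.1.trans hs.2) (not_le.2 hTa)⟩
    have ha2 : 0 < a / 2 := by positivity
    have ha2T : a / 2 ≤ T := by linarith
    have hj := ihj ha2
    obtain ⟨K, hK⟩ := hj.2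
    have hLj := (step j (a / 2) ha2 ha2T ((hK _ ⟨le_rfl, ha2T⟩).trans_lt coe_lt_top).ne).2
    have hmf : Measurable fun s => nrm (j + 1) (f m s) :=
      Measurable.lintegral_prod_right ((hf m).1.enorm.mul ((measurable_wt (j + 1)).comp measurable_snd))
    have hmL : Measurable fun s => nrm j (L s) := Measurable.lintegral_prod_right (hL.1.enorm.mul ((measurable_wt j).comp measurable_snd))
    -- The lower bound on the rate gives `α ⟨v⟩^{j+1} f ≤ ⟨v⟩^j (L + β f)`: the lost moment of order
    -- `j` controls the moment of order `j + 1`, integrated in time.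
    have hfin : ofReal α * ∫⁻ s in Ioc (a / 2) T, nrm (j + 1) (f m s) ≠ ⊤ := by
      refine ne_top_of_le_ne_top (b := (∫⁻ s in Ioc (a / 2) T, nrm j (L s)) + (ofReal β * K) * ofReal (T - a / 2)) (add_ne_top.2 ⟨hLj, mul_ne_top
          (mul_ne_top ofReal_ne_top coe_ne_top) ofReal_ne_top⟩) ?_
      have e : (ofReal β * K) * ofReal (T - a / 2) = ∫⁻ s in Ioc (a / 2) T, ofReal β * K := by simp
      rw [e, ← lintegral_add_left hmL, ← lintegral_const_mul _ hmf]
      refine setLIntegral_mono' measurableSet_Ioc fun s hs => ?_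
      have hs' : s ∈ Icc (a / 2) T := ⟨hs.1.le, hs.2⟩
      have hmLs : Measurable fun v => ‖L s v‖ₑ * wt d j v := (hL.measurable_apply s).enorm.mul (measurable_wt j)
      calc ofReal α * nrm (j + 1) (f m s)
          ≤ ∫⁻ v, (‖L s v‖ₑ * wt d j v + ofReal β * (‖f m s v‖ₑ * wt d j v)) := by
            rw [← lintegral_const_mul' _ _ ofReal_ne_top]
            refine lintegral_mono fun v => ?_
            have h1 := hr s (sub ha2 hs') v
            have hR := rateR_nonneg isKernel_norm M m (fun n v => hf0 n s v) v
            have h2 : ofReal α * wt d 1 v ≤ ‖rateR norm M m (fun n => f n s) v‖ₑ + ofReal β := by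
              unfold wt
              rw [← ofReal_mul hα.le, pow_one, enorm_of_nonneg hR]
              exact (ofReal_le_ofReal h1).trans ENNReal.ofReal_add_le
            rw [← wt_mul j 1 v]
            simp only [L, enorm_mul]
            calc _ = ‖f m s v‖ₑ * wt d j v * (ofReal α * wt d 1 v) := by ring
              _ ≤ ‖f m s v‖ₑ * wt d j v * (‖rateR norm M m (fun n => f n s) v‖ₑ + ofReal β) := by gcongr
              _ = _ := by ring
        _ ≤ _ := by
            rw [lintegral_add_left hmLs, lintegral_const_mul' _ _ ofReal_ne_top]
            gcongr
            exact hK s hs'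
    have hfin' : ∫⁻ s in Ioc (a / 2) T, nrm (j + 1) (f m s) ≠ ⊤ := fun h => by
      rw [h, mul_top (by simpa using hα)] at hfin
      exact hfin rfl
    have hae := ae_lt_top hmf hfin'
    have hpos : volume (Ioc (a / 2) a) ≠ 0 := by
      rw [Real.volume_Ioc]
      simpa using ha
    have hae' : ∀ᵐ s ∂volR (Ioc (a / 2) a), nrm (j + 1) (f m s) < ⊤ := ae_mono (Measure.restrict_mono (Ioc_subset_Ioc_right haT) le_rfl) hae
    have : (ae (volume.restrict (Ioc (a / 2) a))).NeBot := by
      rw [ae_neBot]; simpa using hpos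
    -- Some time before `a` has a finite moment of order `j + 1`; propagation from there covers all
    -- later times.
    obtain ⟨a', ha'fin, ha'⟩ := (hae'.and ae_mem_Ioc).exists
    exact (step (j + 1) a' (ha2.trans ha'.1) (ha'.2.trans haT) ha'fin.ne).1.mono_set (Icc_subset_Icc_left ha'.2)

end Moments

/-! ### Uniqueness and a lower bound for the collision rate -/

section RateLower

variable {D c : ℕ → ℝ}

/-- Solutions with two moments, satisfying the weak formulation at all times. -/
structure IsSolution (M : ℕ) (c D : ℕ → ℝ) (T : ℝ) (f₀ : ℕ → Fn d) (f : Fam d) : Prop where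
  unif : Unif T 2 f
  nonneg : Pos3 f
  weak : ∀ t ∈ Icc 0 T, ∀ m ∈ Lev M, SolAt norm M c D f₀ f m t

/-- The stability estimate with zero error and equal data. -/
lemma ae_eq_of_weak (hc : PosOn M c) (hD : PosOn M D) (hC : 0 ≤ C) (hgr : Grow d M c D T C 1) {g : Fam d} (hf : Unif T 2 f)
    (hg : Unif T 2 g) (hf0 : Pos3 f) (hg0 : Pos3 g) {g₀ : ℕ → Fn d} (hf₀ : Meas f₀) (hg₀ : Meas g₀) (hfi : HMom 1 f₀) (hgi : HMom 1 g₀)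
    (h₀ : ∀ m ∈ Lev M, f₀ m =ᵐ[volume] g₀ m) (hw : ∀ᵐ t ∂volR (Ioc 0 T), ∀ m ∈ Lev M, SolAt norm M c D f₀ f m t ∧ SolAt norm M c D g₀ g m t)
    (ht : t ∈ Icc 0 T) (hwt : ∀ m ∈ Lev M, SolAt norm M c D f₀ f m t ∧ SolAt norm M c D g₀ g m t) (hm : m ∈ Lev M) : f m t =ᵐ[volume] g m t := by
  obtain ⟨ρ, hρ⟩ := exists_wmom_bound hf M
  obtain ⟨ρ', hρ'⟩ := exists_wmom_bound hg M
  have key := wmom_sub_le hc hD hC hgr isKernel_norm hf hg (e := fun _ _ _ => 0) (fun _ => unifL1_zero _ _) hf0 hg0 (ρ := ρ + ρ')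
    (fun s hs => (hρ s hs).trans (by exact_mod_cast le_self_add)) (fun s hs => (hρ' s hs).trans (by exact_mod_cast le_add_self))
    hf₀ hg₀ hfi hgi (by simpa only [add_zero] using hw) ht (by simpa only [add_zero] using hwt)
  have z : dmom M f₀ g₀ (wt d 1) = 0 := by
    refine Finset.sum_eq_zero fun m hm => ?_
    rw [lintegral_eq_zero_of_ae_eq_zero, mul_zero]
    filter_upwards [h₀ m hm] with v hv
    simp [famL, hv]
  rw [z] at key
  simp only [famL, wmom, enorm_zero, zero_mul, lintegral_zero, mul_zero, Finset.sum_const_zero, add_zero, nonpos_iff_eq_zero] at key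
  have hz := (le_wmom hm (famL fun m v => f m t v - g m t v) (wt d 1)).trans key.le
  have hmm : Measurable fun v => famL (fun m v => f m t v - g m t v) m v * wt d 1 v :=
    (((hf m).measurable_apply t).sub ((hg m).measurable_apply t)).enorm.mul (measurable_wt 1)
  rw [nonpos_iff_eq_zero, lintegral_eq_zero_iff hmm] at hz
  filter_upwards [hz] with v hv
  simpa [famL, wt_ne_zero, sub_eq_zero] using hv

lemma contDiff_gaussPdf : ContDiff ℝ ∞ (gaussPdf : Fn d) := by
  unfold gaussPdf
  exact contDiff_const.mul (Real.contDiff_exp.comp (contDiff_const.mul (contDiff_norm_sq ℝ)))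

lemma fderiv_gaussPdf_apply (v e : Vel d) : fderiv ℝ gaussPdf v e = -gaussPdf v * inner ℝ v e := by
  rw [(hasFDerivAt_gaussPdf v).fderiv]
  simp

lemma laplacian_gaussPdf (v : Vel d) : laplacian gaussPdf v = gaussPdf v * (‖v‖ ^ 2 - d) := by
  rw [laplacian_eq_sum (contDiff_gaussPdf.of_le two_le_infty)]
  have h : ∀ i : Fin d, fderiv ℝ (fun x => fderiv ℝ gaussPdf x (single i 1)) v (single i 1) = gaussPdf v * (v i ^ 2 - 1) := fun i => by
    have e : (fun x : Vel d => fderiv ℝ gaussPdf x (single i 1)) = fun x => -(gaussPdf x * x i) := by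
      ext x
      rw [fderiv_gaussPdf_apply]
      simp [inner_single_right]
    have h1 : HasFDerivAt (fun x : Vel d => x i) (proj i : Vel d →L[ℝ] ℝ) v := (proj i : Vel d →L[ℝ] ℝ).hasFDerivAt
    have h2 : HasFDerivAt (fun x : Vel d => -(gaussPdf x * x i)) _ v := ((hasFDerivAt_gaussPdf v).mul h1).neg
    rw [e, h2.fderiv]
    simp [inner_single_right]
    ring
  simp only [h, ← mul_sum, sum_sub_distrib]
  rw [EuclideanSpace.norm_sq_eq]
  simp

lemma exists_rateR_le (hf : ∀ n, UnifL1 S 1 (f n)) :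
    ∃ R : ℝ, 0 ≤ R ∧ ∀ m ∈ Lev M, ∀ s ∈ S, ∀ v, |rateR norm M m (fun n => f n s) v| ≤ R * bracket v := by
  obtain ⟨ρ, hρ⟩ := exists_wmom_bound hf M
  have ht : 2 * crossMax d M * (1 * ρ) ≠ ⊤ := mul_ne_top (mul_ne_top (by simp) (crossMax_ne_top d M)) (by simp)
  refine ⟨(2 * crossMax d M * (1 * ρ)).toReal, toReal_nonneg, fun m hm s hs v => ?_⟩
  have h := (enorm_rateR_le norm M m (fun n => f n s) v).trans
    (rateL_le 1 isKernel_norm.absL_le hm (measurable_famL fun n => (hf n).measurable_apply s) v)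
  have h2 : ‖rateR norm M m (fun n => f n s) v‖ₑ ≤ 2 * crossMax d M * (1 * ρ) * wt d 1 v := by
    refine h.trans ?_
    gcongr
    exact hρ s hs
  rw [← ofReal_toReal ht, wt, pow_one, ← ofReal_mul toReal_nonneg, enorm_eq_ofReal_abs,
    ofReal_le_ofReal_iff (mul_nonneg toReal_nonneg (bracket_pos v).le)] at h2
  exact h2

/-- Gronwall from below: `e^{Kt} g` is nondecreasing when `g' ≥ -K g`. -/
lemma le_exp_mul_of_primitive {K : ℝ} {g k : ℝ → ℝ} (hk : IntegrableOn k (Ioc 0 T))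
    (hg : ∀ t ∈ Icc 0 T, g t = g₀ + ∫ s in (0)..t, k s) (hkg : ∀ t ∈ Icc 0 T, -(K * g t) ≤ k t) (ht : t ∈ Icc 0 T) :
    g₀ ≤ exp (K * t) * g t := by
  have hη : ∀ s, HasDerivAt (fun s => exp (K * s)) (K * exp (K * s)) s := fun s => by
    simpa [mul_comm] using ((hasDerivAt_id s).const_mul K).exp
  have sub : Ioc 0 t ⊆ Ioc 0 T := Ioc_subset_Ioc_right ht.2
  have h := integral_mul_primitive ht.1 hη (by fun_prop) (hk.mono_set sub)
    ((ae_restrict_iff' measurableSet_Ioc).2 (of_forall fun s hs => hg s (Ioc_sub ht hs))) (hg t ht)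
  rw [h]
  simp only [mul_zero, Real.exp_zero, one_mul, le_add_iff_nonneg_right]
  refine intervalIntegral.integral_nonneg ht.1 fun s hs => ?_
  have := hkg s ⟨hs.1, hs.2.trans ht.2⟩
  nlinarith [exp_pos (K * s)]

/-- The mass of a component with nonzero initial value stays bounded below. -/
lemma exists_mass_lower (h : IsSolution M c D T f₀ f) (hn : n ∈ Lev M) (hcn : 0 < c n) (hDn : 0 < D n)
    (hi₀ : Integrable (f₀ n)) (hf₀0 : ∀ v, 0 ≤ f₀ n v) (hne : ¬ f₀ n =ᵐ[volume] 0) :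
    ∃ μ : ℝ, 0 < μ ∧ ∀ t ∈ Icc 0 T, μ ≤ ∫ v, f n t v := by
  have hf1 : Unif T 1 f := fun n => (h.unif n).mono_weight
  have hf0 : UL 0 T 0 (f n) := (hf1 n).mono_weight
  have hQ : UL 0 T 0 (fun s => collB norm M n fun k => f k s) := unifL1_collB isKernel_norm hf1 hn
  obtain ⟨R, hR0, hR⟩ := exists_rateR_le (M := M) hf1
  obtain ⟨C, hC0, hC⟩ := exists_gaussPdf_mul_bracket_pow_le (d := d) 2
  -- Testing with the Gaussian: Laplacian and drift produce `+ψ|v|²`, which compensates the linearly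
  -- growing loss rate, a control that a constant test function would not give.
  set ψ : Fn d := gaussPdf
  have hψ0 : ∀ v, 0 < ψ v := gaussPdf_pos
  have hψ1 : ∀ v, ψ v ≤ C := fun v => le_trans (le_mul_of_one_le_right (hψ0 v).le (one_le_pow₀ (one_le_bracket v))) (hC v)
  have hψb : ∀ v, ψ v * ‖v‖ ^ 2 ≤ C := fun v => le_trans (by rw [bracket_sq]; nlinarith [hψ0 v]) (hC v)
  set B : ℝ := C * (1 + d) + C
  have hdn : (0 : ℝ) ≤ d := by positivity
  have hψm : Measurable ψ := measurable_gaussPdf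
  have b0 : ∀ v, |ψ v| ≤ B := fun v => by
    rw [abs_of_pos (hψ0 v)]
    nlinarith [hψ1 v]
  have b1 : ∀ v, ‖fderiv ℝ ψ v‖ ≤ B := fun v => by
    rw [(hasFDerivAt_gaussPdf v).fderiv, norm_smul, norm_neg, innerSL_apply_norm, norm_of_nonneg (hψ0 v).le]
    have : ψ v * ‖v‖ ≤ C := le_trans (by
      gcongr
      · exact (hψ0 v).le
      · exact (norm_le_bracket v).trans (le_self_pow₀ (one_le_bracket v) two_ne_zero)) (hC v)
    nlinarith
  have b2 : ∀ v, |laplacian ψ v| ≤ B := fun v => by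
    rw [laplacian_gaussPdf, abs_le]
    constructor <;> nlinarith [hψ1 v, hψb v, hψ0 v, sq_nonneg ‖v‖, mul_nonneg (hψ0 v).le (sq_nonneg ‖v‖), mul_nonneg hC0 hdn,
      mul_le_mul_of_nonneg_right (hψ1 v) hdn, mul_nonneg (hψ0 v).le hdn]
  set L : Fn d := genAdj (c n) (D n) 0 ψ
  have hL : ∀ v, L v = ψ v * ((D n + c n) * ‖v‖ ^ 2 - D n * d) := fun v => by
    simp only [L, genAdj, ψ]
    rw [laplacian_gaussPdf, fderiv_gaussPdf_apply, real_inner_self_eq_norm_sq]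
    ring
  have hLm : Measurable L := by
    have : L = fun v => ψ v * ((D n + c n) * ‖v‖ ^ 2 - D n * d) := funext hL
    rw [this]; fun_prop
  have hLb : ∀ v, |L v| ≤ C * (D n + c n) + C * (D n * d) := fun v => by
    rw [hL]
    have p1 := mul_le_mul_of_nonneg_right (hψb v) (add_pos hDn hcn).le
    have p2 := mul_le_mul_of_nonneg_right (hψ1 v) (mul_nonneg hDn.le hdn)
    have p3 : 0 ≤ ψ v * ‖v‖ ^ 2 * (D n + c n) := by have := hψ0 v; positivity
    have p4 : 0 ≤ ψ v * (D n * d) := by have := hψ0 v; positivity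
    rw [abs_le]
    constructor <;> nlinarith
  set g : ℝ → ℝ := fun s => pair (f n s) ψ
  set k : ℝ → ℝ := fun s => pair (f n s) L + pair (fun v => collB norm M n (fun k => f k s) v) ψ
  have hg : ∀ t ∈ Icc 0 T, g t = pair (f₀ n) ψ + ∫ s in (0)..t, k s := fun t ht =>
    (h.weak t ht n hn).extend (hf1 n) hQ hi₀ ht contDiff_gaussPdf b0 b1 b2
  have hk : IntegrableOn k (Ioc 0 T) := by
    obtain ⟨C1, -, hC1⟩ := hf0.exists_pair_bound
    obtain ⟨C2, -, hC2⟩ := hQ.exists_pair_bound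
    refine Measure.integrableOn_of_bounded (M := C1 * (C * (D n + c n) + C * (D n * d)) + C2 * B) (by simp) ?_ ?_
    · exact ((measurable_pair_comp (ψ := fun _ => L) hf0.1 measurable_id (hLm.comp measurable_snd)).add
        (measurable_pair_comp (ψ := fun _ => ψ) hQ.1 measurable_id (hψm.comp measurable_snd))).aestronglyMeasurable
    · filter_upwards [ae_mem_Ioc] with s hs
      have hs' : s ∈ Icc 0 T := ⟨hs.1.le, hs.2⟩
      exact (norm_add_le _ _).trans (add_le_add (hC1 s hs' L _ fun v => by simpa using hLb v) (hC2 s hs' ψ _ fun v => by simpa using b0 v))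
  -- Collects `D d` from the Laplacian and the remainder of `R⟨v⟩ ≤ D⟨v⟩² + R²/(4D)`, where `⟨v⟩² =
  -- 1 + |v|²`.
  set K : ℝ := D n * d + D n + R ^ 2 / (4 * D n)
  have hkg : ∀ t ∈ Icc 0 T, -(K * g t) ≤ k t := fun t ht => by
    have i1 : Integrable fun v => f n t v * ψ v := (hf0.integrable ht).mul_bdd hψm.aestronglyMeasurable (of_forall b0)
    have i2 : Integrable fun v => f n t v * L v := (hf0.integrable ht).mul_bdd hLm.aestronglyMeasurable (of_forall hLb)
    have i3 : Integrable fun v => collB norm M n (fun k => f k t) v * ψ v := (hQ.integrable ht).mul_bdd hψm.aestronglyMeasurable (of_forall b0)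
    simp only [g, k, pair]
    rw [← integral_add i2 i3, ← integral_const_mul, ← integral_neg]
    refine integral_mono (i1.const_mul K).neg (i2.add i3) fun v => ?_
    have hG := gainR_nonneg isKernel_norm n (fun k v => h.nonneg k t v) v
    have hA := (abs_le.1 (hR n hn t ht v)).2
    have hfv := h.nonneg n t v
    have hψv := hψ0 v
    have hbr := bracket_sq v
    have quad : -K ≤ ((D n + c n) * ‖v‖ ^ 2 - D n * d) - R * bracket v := by
      have q : R * bracket v ≤ D n * bracket v ^ 2 + R ^ 2 / (4 * D n) := by
        have h4 : D n * bracket v ^ 2 + R ^ 2 / (4 * D n) - R * bracket v = (2 * D n * bracket v - R) ^ 2 / (4 * D n) := by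
          field_simp
          ring
        have : 0 ≤ (2 * D n * bracket v - R) ^ 2 / (4 * D n) := by positivity
        linarith
      rw [hbr] at q
      nlinarith [mul_nonneg hcn.le (sq_nonneg ‖v‖)]
    simp only [hL, collB]
    have m1 := mul_le_mul_of_nonneg_left quad (mul_nonneg hfv hψv.le)
    have m2 := mul_le_mul_of_nonneg_left hA (mul_nonneg hfv hψv.le)
    have m3 := mul_nonneg hG hψv.le
    nlinarith
  have hg0 : 0 < pair (f₀ n) ψ := by
    have i0 : Integrable fun v => f₀ n v * ψ v := hi₀.mul_bdd hψm.aestronglyMeasurable (of_forall b0)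
    refine lt_of_le_of_ne (integral_nonneg fun v => mul_nonneg (hf₀0 v) (hψ0 v).le) fun h0 => hne ?_
    have := (integral_eq_zero_iff_of_nonneg (fun v => mul_nonneg (hf₀0 v) (hψ0 v).le) i0).1 h0.symm
    filter_upwards [this] with v hv
    simpa [(hψ0 v).ne'] using hv
  have hCpos : 0 < C := (hψ0 0).trans_le (hψ1 0)
  refine ⟨exp (-(K * T)) * pair (f₀ n) ψ / C, by positivity, fun t ht => ?_⟩
  have hK0 : 0 ≤ K := by positivity
  have key := le_exp_mul_of_primitive hk hg hkg ht
  rw [div_le_iff₀ hCpos]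
  have hgt : 0 ≤ g t := integral_nonneg fun v => mul_nonneg (h.nonneg n t v) (hψ0 v).le
  calc exp (-(K * T)) * pair (f₀ n) ψ ≤ exp (-(K * T)) * (exp (K * T) * g t) := by
        gcongr
        refine key.trans ?_
        gcongr
        exact ht.2
    _ = g t := by rw [← mul_assoc, ← exp_add]; simp
    _ ≤ ∫ v, f n t v * C := by
        refine integral_mono ((hf0.integrable ht).mul_bdd hψm.aestronglyMeasurable (of_forall b0)) ((hf0.integrable ht).mul_const C) fun v => ?_
        exact mul_le_mul_of_nonneg_left (hψ1 v) (h.nonneg n t v)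
    _ = _ := integral_mul_const _ _

/-- From `|v - w| ≥ |v| - |w|`, the lower mass bound and the upper first-moment bound of one
component. Its positive cross sections make it act on every level `m`. -/
lemma exists_rate_lower (h : IsSolution M c D T f₀ f) (hn : n ∈ Lev M) (hμ : 0 < μ) (hmass : ∀ t ∈ Icc 0 T, μ ≤ ∫ v, f n t v) (m : ℕ) :
    ∃ α β : ℝ, 0 < α ∧ ∀ t ∈ Icc 0 T, ∀ v, α * bracket v ≤ rateR norm M m (fun n => f n t) v + β := by
  have hf1 : UL 0 T 1 (f n) := (h.unif n).mono_weight
  obtain ⟨C, hC0, hC⟩ := hf1.exists_pair_bound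
  set s := crossSection d n m
  have hs : 0 < s := crossSection_pos d (Finset.mem_Icc.1 hn).1
  refine ⟨2 * s * μ, 2 * s * (μ + C), by positivity, fun t ht v => ?_⟩
  have i1 := hf1.integrable ht
  have i2 : Integrable fun w => f n t w * ‖w‖ := by
    refine (hf1.integrable_mul ht).mono' ((hf1.measurable_apply t).mul measurable_norm).aestronglyMeasurable (of_forall fun w => ?_)
    rw [pow_one, norm_mul, norm_of_nonneg (h.nonneg n t w), norm_norm]
    exact mul_le_mul_of_nonneg_left (norm_le_bracket w) (h.nonneg n t w)
  have hn2 : ∫ w, f n t w * ‖w‖ ≤ C := by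
    have := hC t ht norm 1 fun w => by simpa using norm_le_bracket w
    rw [mul_one] at this
    exact (le_abs_self _).trans this
  have hfin : nrm 1 (f n t) ≠ ⊤ := hf1.nrm_ne_top ht
  have hconv : ‖v‖ * μ - C ≤ conv norm (f n t) v := by
    calc ‖v‖ * μ - C ≤ ‖v‖ * (∫ w, f n t w) - ∫ w, f n t w * ‖w‖ := by
          gcongr
          exact hmass t ht
      _ = ∫ w, (‖v‖ * f n t w - f n t w * ‖w‖) := by
          rw [integral_sub (i1.const_mul _) i2, integral_const_mul]
      _ ≤ _ := by
          refine integral_mono ((i1.const_mul _).sub i2) (integrable_conv measurable_norm (hf1.measurable_apply t) one_ne_top 1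
            isKernel_norm.absL_le hfin v) fun w => ?_
          have := mul_le_mul_of_nonneg_left (norm_sub_norm_le v w) (h.nonneg n t w)
          simp only
          nlinarith
  have hsum : s * conv norm (f n t) v ≤ ∑ k ∈ Lev M, crossSection d k m * conv norm (f k t) v :=
    single_le_sum (f := fun k => crossSection d k m * conv norm (f k t) v)
      (fun k _ => mul_nonneg (crossSection_nonneg _ _ _) (integral_nonneg fun w => mul_nonneg (h.nonneg k t w) (norm_nonneg _))) hn
  have hb := bracket_le v
  have h3 := mul_le_mul_of_nonneg_left hconv hs.le
  have h4 := mul_le_mul_of_nonneg_left hb (mul_nonneg hs.le hμ.le)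
  unfold rateR
  nlinarith

/-- Creation of all moments. -/
lemma IsSolution.unifL1 (hc : PosOn M c) (hD : PosOn M D) (h : IsSolution M c D T f₀ f) (hC : 0 ≤ C) (hgr : Grow d M c D T C 1) (hf₀ : Meas f₀)
    (hf₀0 : Pos2 f₀) (hf₀1 : HMom 1 f₀) (hm : m ∈ Lev M) (j : ℕ) (ha : 0 < a) : UL a T j (f m) := by
  -- If all data vanish there is no lower bound for the rate, but uniqueness forces the zero
  -- solution.
  by_cases hz : ∀ n ∈ Lev M, f₀ n =ᵐ[volume] 0
  · refine ⟨(h.unif m).1, 0, fun t ht => ?_⟩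
    have ht' : t ∈ Icc 0 T := ⟨ha.le.trans ht.1, ht.2⟩
    have weak : ∀ t ∈ Icc 0 T, ∀ m ∈ Lev M, SolAt norm M c D f₀ f m t ∧
        LinWeakAt (c m) (D m) 0 0 (fun _ : Vel d => (0 : ℝ)) (fun _ _ => 0) (fun _ => collB norm M m fun _ _ => 0) t :=
      fun t ht m hm => ⟨h.weak t ht m hm, fun φ _ => by simp [pair, collB, gainR, coll]⟩
    have := ae_eq_of_weak (g₀ := fun _ _ => 0) (g := fun _ _ _ => 0) hc hD hC hgr h.unif (fun _ => unifL1_zero _ _) h.nonneg (fun _ _ _ => le_rfl) hf₀ (fun _ => measurable_const)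
      hf₀1 (fun _ => by simp only [enorm_zero, zero_mul, lintegral_zero]; simp) hz ((ae_restrict_iff' measurableSet_Ioc).2 (of_forall fun t ht => weak t ⟨ht.1.le, ht.2⟩))
      ht' (weak t ht') hm
    rw [lintegral_eq_zero_of_ae_eq_zero]
    · simp
    · filter_upwards [this] with v hv
      simp [hv]
  · push Not at hz
    obtain ⟨n, hn, hne⟩ := hz
    obtain ⟨μ, hμ, hmass⟩ := exists_mass_lower h hn (hc n hn) (hD n hn) (integrable_of_wt_ne_top (hf₀ n) (hf₀1 n)) (hf₀0 n) hne
    exact unifL1_of_rate_lower hc hD h.unif h.nonneg h.weak (fun m _ => exists_rate_lower h hn hμ hmass m) hm j ha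

end RateLower

/-! ### Rapid decay for positive times -/

section SupBounds

lemma bracket_sub_le (x y : Vel d) : bracket (x - y) ≤ 2 * (bracket x * bracket y) := by
  rw [sub_eq_add_neg, ← bracket_neg y]
  exact bracket_add_le x (-y)

lemma integrable_inv_bracket_pow : Integrable fun z : Vel d => (bracket z ^ (d + 1))⁻¹ := by
  have h := integrable_rpow_neg_one_add_norm_sq (E := Vel d) (μ := volume) (r := ((d + 1 : ℕ) : ℝ)) (by simp)
  refine h.congr (of_forall fun z => ?_)
  have h0 : (0 : ℝ) ≤ 1 + ‖z‖ ^ 2 := by positivity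
  simp only [bracket]
  rw [Real.sqrt_eq_rpow, ← Real.rpow_natCast ((1 + ‖z‖ ^ 2) ^ (1 / 2 : ℝ)), ← Real.rpow_mul h0, ← Real.rpow_neg h0]
  congr 1
  ring

/-- The outgoing `v` lies on the segment between the partners `x` and `y`, and `z = x - y`; all
three factors are bounded by powers of `⟨x⟩⟨y⟩`. -/
lemma weight_coll_le (h0 : 0 ≤ θ) (h1 : θ ≤ 1) (j p : ℕ) (v z : Vel d) : bracket v ^ j * ‖z‖ * bracket z ^ p ≤
      2 ^ (p + 1) * (bracket (v + θ • z) ^ (j + p + 1) * bracket (v - (1 - θ) • z) ^ (j + p + 1)) := by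
  set x := v + θ • z
  set y := v - (1 - θ) • z
  have hv : v = (1 - θ) • x + θ • y := by simp only [x, y]; module
  have hz : z = x - y := by simp only [x, y]; module
  have e1 : bracket v ≤ bracket x * bracket y := by
    conv_lhs => rw [hv]
    exact bracket_segment_le h0 h1 x y
  have e2 : bracket z ≤ 2 * (bracket x * bracket y) := by
    conv_lhs => rw [hz]
    exact bracket_sub_le x y
  have p0 := bracket_pos v
  have p1 := bracket_pos z
  calc bracket v ^ j * ‖z‖ * bracket z ^ p ≤ (bracket x * bracket y) ^ j * (2 * (bracket x * bracket y)) * (2 * (bracket x * bracket y)) ^ p := by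
        have := bracket_pos x
        have := bracket_pos y
        gcongr
        exact (norm_le_bracket z).trans e2
    _ = _ := by ring

lemma abs_coll_integrand_le (h0 : 0 ≤ θ) (h1 : θ ≤ 1) (j p : ℕ) {v z : Vel d} {b B : ℝ}
    (ha : |a| * bracket (v + θ • z) ^ (j + p + 1) ≤ A) (hb : |b| * bracket (v - (1 - θ) • z) ^ (j + p + 1) ≤ B) :
    |a * b * ‖z‖| * bracket v ^ j ≤ 2 ^ (p + 1) * (A * B) * (bracket z ^ p)⁻¹ := by
  have hz := pow_pos (bracket_pos z) p
  rw [← div_eq_mul_inv, le_div_iff₀ hz, abs_mul, abs_mul, abs_norm]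
  have hx := bracket_pos (v + θ • z)
  have hy := bracket_pos (v - (1 - θ) • z)
  have hA : 0 ≤ A := le_trans (by positivity) ha
  calc |a| * |b| * ‖z‖ * bracket v ^ j * bracket z ^ p = |a| * |b| * (bracket v ^ j * ‖z‖ * bracket z ^ p) := by ring
    _ ≤ |a| * |b| * (2 ^ (p + 1) * (bracket (v + θ • z) ^ (j + p + 1) * bracket (v - (1 - θ) • z) ^ (j + p + 1))) := by
        exact mul_le_mul_of_nonneg_left (weight_coll_le h0 h1 j p v z) (by positivity)
    _ = 2 ^ (p + 1) * ((|a| * bracket (v + θ • z) ^ (j + p + 1)) * (|b| * bracket (v - (1 - θ) • z) ^ (j + p + 1))) := by ring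
    _ ≤ _ := by gcongr

/-- Of the extra weights on the partners, `d + 1` buy the integrable factor `⟨z⟩^{-(d+1)}` and one
pays for the relative speed. The constant does not depend on `θ`. -/
lemma exists_abs_coll_le (d j : ℕ) : ∃ C, 0 ≤ C ∧ ∀ θ : ℝ, 0 ≤ θ → θ ≤ 1 → ∀ (g h : Fn d) (A B : ℝ), ∀ v,
    (∀ᵐ z, |g (v + θ • z)| * bracket (v + θ • z) ^ (j + (d + 1) + 1) ≤ A) →
    (∀ᵐ z, |h (v - (1 - θ) • z)| * bracket (v - (1 - θ) • z) ^ (j + (d + 1) + 1) ≤ B) →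
    |coll norm θ g h v| * bracket v ^ j ≤ C * (A * B) := by
  refine ⟨2 ^ (d + 1 + 1) * ∫ z : Vel d, (bracket z ^ (d + 1))⁻¹,
    mul_nonneg (by positivity) (integral_nonneg fun z => inv_nonneg.2 (pow_pos (bracket_pos z) _).le), fun θ h0 h1 g h A B v hg hh => ?_⟩
  have hv := pow_pos (bracket_pos v) j
  rw [← abs_of_pos hv, ← abs_mul, coll, ← integral_mul_const, ← norm_eq_abs]
  refine (norm_integral_le_of_norm_le (integrable_inv_bracket_pow.const_mul (2 ^ (d + 1 + 1) * (A * B))) ?_).trans (le_of_eq ?_)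
  · filter_upwards [hg, hh] with z h2 h3
    rw [norm_mul, norm_eq_abs, norm_of_nonneg hv.le]
    exact abs_coll_integrand_le h0 h1 j (d + 1) h2 h3
  · rw [integral_const_mul]; ring

lemma ae_comp_add_smul {p : Vel d → Prop} (hp : ∀ᵐ x, p x) (v : Vel d) (hθ : θ ≠ 0) : ∀ᵐ z, p (v + θ • z) := by
  have h1 : Measure.QuasiMeasurePreserving (fun z : Vel d => v + z) volume volume := (measurePreserving_add_left volume v).quasiMeasurePreserving
  have h2 : Measure.QuasiMeasurePreserving (fun z : Vel d => θ • z) volume volume := by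
    refine ⟨measurable_const_smul θ, ?_⟩
    rw [Measure.map_addHaar_smul _ hθ]
    exact Measure.smul_absolutelyContinuous
  exact (h1.comp h2).ae hp

lemma bracket_le_ou (hc : 0 ≤ c) (hσ : 0 ≤ σ) (hr : 0 ≤ r) (v z : Vel d) : bracket v ≤ 2 * (1 + σ) * (bracket ouI c r σ v z * bracket z) := by
  set x := exp (c * r) • (v - σ • z)
  have hx : bracket (v - σ • z) ≤ bracket x := by
    refine bracket_mono ?_
    rw [norm_smul, norm_of_nonneg (exp_pos _).le]
    exact le_mul_of_one_le_left (norm_nonneg _) (Real.one_le_exp (mul_nonneg hc hr))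
  have hv : v = (v - σ • z) + σ • z := by module
  have := bracket_add_smul_le hσ (v - σ • z) z
  rw [← hv] at this
  refine this.trans ?_
  rw [mul_assoc]
  have h1 := bracket_pos z
  gcongr

lemma wt_le_ou (hc : 0 ≤ c) (hσ : 0 ≤ σ) (hr : 0 ≤ r) (j : ℕ) (v z : Vel d) :
    wt d j v ≤ ofReal ((2 * (1 + σ)) ^ j) * (wt d j ouI c r σ v z * wt d j z) := by
  unfold wt
  rw [← ofReal_mul (pow_pos (bracket_pos _) j).le, ← ofReal_mul (by positivity), ← mul_pow, ← mul_pow]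
  exact ofReal_le_ofReal (pow_le_pow_left₀ (bracket_pos v).le (bracket_le_ou hc hσ hr v z) j)

/-- For times bounded away from zero the transition kernel is bounded, with Gaussian decay absorbing
the shift of the weight: weighted `L¹` becomes weighted `L^∞`. -/
lemma exists_ouL_le_of_integral (hc : 0 < c) (hD : 0 < D) {ε : ℝ} (hε : 0 < ε) (T : ℝ) (j : ℕ) :
    ∃ C : ℝ≥0, ∀ r ∈ Icc ε T, ∀ H : FnL d, Measurable H → ∀ v, ouL c D r H v * wt d j v ≤ C * ∫⁻ w, H w * wt d j w := by
  obtain ⟨C, hC0, hC⟩ := exists_gaussPdf_mul_bracket_pow_le (d := d) j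
  set σT := ouSd c D T
  set K : ℝ≥0∞ := ofReal (exp (c * d * T)) * (ofReal ((2 * (1 + σT)) ^ j * C) * ofReal ((ouSd c D ε ^ d)⁻¹))
  have hK : K ≠ ⊤ := mul_ne_top ofReal_ne_top (mul_ne_top ofReal_ne_top ofReal_ne_top)
  refine ⟨K.toNNReal, fun r hr H hH v => ?_⟩
  rw [coe_toNNReal hK]
  have hr0 : 0 < r := hε.trans_le hr.1
  set σ := ouSd c D r
  have hσ : 0 < σ := ouSd_pos hc hD hr0
  have hσT : σ ≤ σT := ouSd_mono hc hD hr.2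
  have hσε : ouSd c D ε ≤ σ := ouSd_mono hc hD hr.1
  set Y : FnL d := fun x => H x * wt d j x
  have hY : Measurable Y := hH.mul (measurable_wt j)
  have hHm : Measurable fun z : Vel d => H ouI c r σ v z := hH.comp (by fun_prop)
  have key : ∀ z, ofReal (gaussPdf z) * H ouI c r σ v z * wt d j v ≤ ofReal ((2 * (1 + σT)) ^ j * C) * Y ouI c r σ v z := fun z => by
    have h1 : ofReal (gaussPdf z) * wt d j z ≤ ofReal C := by
      unfold wt
      rw [← ofReal_mul (gaussPdf_pos z).le]
      exact ofReal_le_ofReal (hC z)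
    rw [ofReal_mul (by have := ouSd_nonneg c D T; positivity)]
    set X := H ouI c r σ v z with hX
    set W := wt d j ouI c r σ v z with hW
    calc ofReal (gaussPdf z) * X * wt d j v
        ≤ ofReal (gaussPdf z) * X * (ofReal ((2 * (1 + σ)) ^ j) * (W * wt d j z)) := by
          gcongr
          exact wt_le_ou hc.le hσ.le hr0.le j v z
      _ = ofReal ((2 * (1 + σ)) ^ j) * (ofReal (gaussPdf z) * wt d j z) * (X * W) := by ring
      _ ≤ ofReal ((2 * (1 + σT)) ^ j) * ofReal C * (X * W) := by gcongr
      _ = _ := rfl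
  have cv : ∫⁻ z, Y ouI c r σ v z = ofReal (((exp (c * r) * σ) ^ d)⁻¹) * ∫⁻ y, Y y := by
    have e : ∀ z, Y ouI c r σ v z = (fun y => Y (exp (c * r) • v - y)) ((exp (c * r) * σ) • z) := fun z => by
      simp only [smul_sub, smul_smul]
    simp only [e]
    rw [lintegral_comp_smul_vel (F := fun y => Y (exp (c * r) • v - y)) (by positivity) (hY.comp (by fun_prop)), lintegral_sub_left_eq_self]
  unfold ouL
  rw [lintegral_gauss hHm]
  calc _ = ofReal (exp (c * d * r)) *
        ∫⁻ z, ofReal (gaussPdf z) * H ouI c r σ v z * wt d j v := by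
        rw [lintegral_mul_const' _ _ (wt_ne_top j v), mul_assoc]
    _ ≤ ofReal (exp (c * d * T)) * ∫⁻ z, ofReal ((2 * (1 + σT)) ^ j * C) * Y ouI c r σ v z := by
        refine mul_le_mul' (ofReal_le_ofReal (Real.exp_le_exp.2 ?_)) (lintegral_mono key)
        exact mul_le_mul_of_nonneg_left hr.2 (by positivity)
    _ = ofReal (exp (c * d * T)) * (ofReal ((2 * (1 + σT)) ^ j * C) * (ofReal (((exp (c * r) * σ) ^ d)⁻¹) * ∫⁻ y, Y y)) := by
        rw [lintegral_const_mul' _ _ ofReal_ne_top, cv]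
    _ ≤ ofReal (exp (c * d * T)) * (ofReal ((2 * (1 + σT)) ^ j * C) * (ofReal ((ouSd c D ε ^ d)⁻¹) * ∫⁻ y, Y y)) := by
        gcongr
        · exact pow_pos (ouSd_pos hc hD hε) d
        · exact ouSd_nonneg c D ε
        · exact hσε.trans (le_mul_of_one_le_left hσ.le (Real.one_le_exp (mul_nonneg hc.le hr0.le)))
    _ = _ := by simp only [K, Y]; ring

lemma lintegral_gauss_wt_ne_top (j : ℕ) : ∫⁻ z, wt d j z ∂gauss d ≠ ⊤ := by
  have := (integrable_gauss_bracket_pow (d := d) j).lintegral_lt_top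
  exact this.ne

/-- Averaging preserves weighted supremum bounds down to time zero, as the Duhamel term requires. -/
lemma exists_ouL_le_of_sup (hc : 0 < c) (hD : 0 < D) (T : ℝ) (j : ℕ) :
    ∃ C : ℝ≥0, ∀ r ∈ Icc 0 T, ∀ (H : FnL d) (K : ℝ≥0∞), (∀ w, H w * wt d j w ≤ K) → ∀ v, ouL c D r H v * wt d j v ≤ C * K := by
  set σT := ouSd c D T
  set L : ℝ≥0∞ := ofReal (exp (c * d * T)) * (ofReal ((2 * (1 + σT)) ^ j) * ∫⁻ z, wt d j z ∂gauss d)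
  have hL : L ≠ ⊤ := mul_ne_top ofReal_ne_top (mul_ne_top ofReal_ne_top (lintegral_gauss_wt_ne_top j))
  refine ⟨L.toNNReal, fun r hr H K hK v => ?_⟩
  rw [coe_toNNReal hL]
  set σ := ouSd c D r
  have hσ : 0 ≤ σ := ouSd_nonneg c D r
  have hσT : σ ≤ σT := ouSd_mono hc hD hr.2
  unfold ouL
  calc _ = ofReal (exp (c * d * r)) * ∫⁻ z, H ouI c r σ v z * wt d j v ∂gauss d := by
        rw [lintegral_mul_const' _ _ (wt_ne_top j v), mul_assoc]
    _ ≤ ofReal (exp (c * d * T)) * ∫⁻ z, ofReal ((2 * (1 + σT)) ^ j) * K * wt d j z ∂gauss d := by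
        refine mul_le_mul' (ofReal_le_ofReal (Real.exp_le_exp.2 ?_)) (lintegral_mono fun z => ?_)
        · exact mul_le_mul_of_nonneg_left hr.2 (by positivity)
        · set X := H ouI c r σ v z
          set W := wt d j ouI c r σ v z
          have hXW : X * W ≤ K := hK _
          calc X * wt d j v ≤ X * (ofReal ((2 * (1 + σ)) ^ j) * (W * wt d j z)) := by
                gcongr
                exact wt_le_ou hc.le hσ hr.1 j v z
            _ = ofReal ((2 * (1 + σ)) ^ j) * (X * W) * wt d j z := by ring
            _ ≤ _ := by gcongr
    _ = _ := by
        rw [lintegral_const_mul _ (measurable_wt j)]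
        simp only [L]
        ring

/-- Rapid decay, for almost every velocity. -/
lemma theta_ne (hn : n ∈ Finset.Ico 1 m) : mfr n m ≠ 0 ∧ -(1 - mfr n m) ≠ 0 := by
  have hnm := Finset.mem_Ico.1 hn
  have hm0 : (0 : ℝ) < m := by exact_mod_cast (by omega : 0 < m)
  have hn0 : (1 : ℝ) ≤ n := by exact_mod_cast hnm.1
  have hnm' : (n : ℝ) < m := by exact_mod_cast hnm.2
  have : mfr n m < 1 := by rw [div_lt_one hm0]; linarith
  exact ⟨(div_pos (by linarith) hm0).ne', neg_ne_zero.2 (by linarith)⟩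

/-- Dropping the loss from the mild identity started at `a/2` bounds `f_m` by the evolved density
and the Duhamel term of the gain. The first is controlled by moments, the second by the induction on
the mass; only levels below `m` enter the gain, with higher weights. -/
lemma IsSolution.ae_le {c D : ℕ → ℝ} (hc : PosOn M c) (hD : PosOn M D) (h : IsSolution M c D T f₀ f)
    (hmom : ∀ m ∈ Lev M, ∀ j : ℕ, ∀ a : ℝ, 0 < a → UL a T j (f m)) (hm : m ∈ Lev M) (j : ℕ) (ha : 0 < a) :
    ∃ C : ℝ, 0 ≤ C ∧ ∀ t ∈ Icc a T, ∀ᵐ v, |f m t v| * bracket v ^ j ≤ C := by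
  induction m using Nat.strong_induction_on generalizing j a with
  | _ m ihm =>
  have ha2 : 0 < a / 2 := by positivity
  set G : ℝ → Fn d := fun s => gainR norm m fun n => f n s
  set L : ℝ → Fn d := fun s v => f m s v * rateR norm M m (fun n => f n s) v
  have sub : Icc (a / 2) T ⊆ Icc 0 T := fun s hs => ⟨ha2.le.trans hs.1, hs.2⟩
  have hf1 : Unif T 1 f := fun n => (h.unif n).mono_weight
  have hG : UnifL1 (Icc (a / 2) T) 0 G := unifL1_gainR (fun n => (h.unif n).1) fun n hn => hmom n (mem_Icc_of_Ico hm hn).1 _ _ ha2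
  have hL : UL 0 T 0 L := unifL1_loss hm hf1 (hf1 m)
  have hG0 : Pos2 G := fun s v => gainR_nonneg isKernel_norm m (fun n v => h.nonneg n s v) v
  have hL0 : Pos2 L := fun s v => mul_nonneg (h.nonneg m s v) (rateR_nonneg isKernel_norm M m (fun n v => h.nonneg n s v) v)
  have hQ : UL 0 T 0 cB norm M m f := unifL1_collB isKernel_norm hf1 hm
  obtain ⟨Cc, hCc0, hCc⟩ := exists_abs_coll_le d j
  have ih : ∀ n ∈ Finset.Ico 1 m, ∃ B : ℝ, 0 ≤ B ∧ ∀ t ∈ Icc (a / 2) T, ∀ᵐ v, |f n t v| * bracket v ^ (j + (d + 1) + 1) ≤ B := fun n hn =>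
    ihm n (Finset.mem_Ico.1 hn).2 (mem_Icc_of_Ico hm hn).1 _ ha2
  choose! B hB0 hB using ih
  set KG : ℝ := ∑ n ∈ Finset.Ico 1 m, crossSection d n (m - n) * (Cc * (B n * B (m - n)))
  -- The bound for the gain holds at every `v`, since its integrals ignore null sets of the relative
  -- velocity.
  have hGb : ∀ s ∈ Icc (a / 2) T, ∀ v, |G s v| * bracket v ^ j ≤ KG := fun s hs v => by
    have hb := pow_pos (bracket_pos v) j
    rw [← abs_of_pos hb, ← abs_mul]
    simp only [G, gainR]
    rw [sum_mul]
    refine (Finset.abs_sum_le_sum_abs _ _).trans (sum_le_sum fun n hn => ?_)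
    rw [abs_mul, abs_mul, abs_of_nonneg (crossSection_nonneg _ _ _), abs_of_pos hb, mul_assoc]
    have hn' : m - n ∈ Finset.Ico 1 m := by rw [Finset.mem_Ico] at hn ⊢; omega
    refine mul_le_mul_of_nonneg_left ?_ (crossSection_nonneg _ _ _)
    refine hCc _ (theta_mem hn).1 (theta_mem hn).2 _ _ _ _ v (ae_comp_add_smul (hB n hn s hs) v (theta_ne hn).1) ?_
    filter_upwards [ae_comp_add_smul (hB (m - n) hn' s hs) v (theta_ne hn).2] with z hz
    rwa [neg_smul, ← sub_eq_add_neg] at hz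
  rcases lt_or_ge T a with hTa | haT
  · exact ⟨0, le_rfl, fun t ht => absurd (ht.1.trans ht.2) (not_le.2 hTa)⟩
  have ha2T : a / 2 ≤ T := by linarith
  obtain ⟨C1, hC1⟩ := exists_ouL_le_of_integral (d := d) (hc m hm) (hD m hm) ha2 T j
  obtain ⟨C2, hC2⟩ := exists_ouL_le_of_sup (d := d) (hc m hm) (hD m hm) T j
  obtain ⟨Kf, hKf⟩ := (hmom m hm j (a / 2) ha2).2
  have en : ∀ {x : ℝ}, 0 ≤ x → ofReal x = ‖x‖ₑ := fun h => (enorm_of_nonneg h).symm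
  set K : ℝ≥0∞ := C1 * Kf + C2 * ofReal KG * ofReal T
  have hK : K ≠ ⊤ := add_ne_top.2 ⟨by simp [ENNReal.mul_eq_top], mul_ne_top (mul_ne_top coe_ne_top ofReal_ne_top) ofReal_ne_top⟩
  refine ⟨K.toReal, toReal_nonneg, fun t ht => ?_⟩
  have ht2 : t ∈ Icc (a / 2) T := ⟨by linarith [ht.1], ht.2⟩
  have hmild := mildL_of_weak (hc m hm) (hD m hm) ((hf1 m).measurable_apply (a / 2)) ((hf1 m).integrable (sub ⟨le_rfl, ha2T⟩)) (h.nonneg m _)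
    ((hf1 m).mono_set sub) hG (hL.mono_set sub) (h.nonneg m) hG0 hL0 ht2 fun s hs =>
      (h.weak _ (sub ⟨le_rfl, ha2T⟩) m hm).restart (h.weak s (sub hs) m hm) ((hf1 m).mono_weight) hQ ha2.le hs.1 hs.2
  filter_upwards [hmild] with v hv
  have h1 : ofReal (f m t v) * wt d j v ≤ K := by
    calc ofReal (f m t v) * wt d j v
        ≤ (ouL (c m) (D m) (t - a / 2) (fun w => ofReal (f m (a / 2) w)) v + duhL (c m) (D m) (a / 2) (fun s w => ofReal (G s w)) t v) * wt d j v := by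
          gcongr
          rw [← hv]
          exact le_self_add
      _ ≤ C1 * Kf + ∫⁻ s in Ioc (a / 2) t, C2 * ofReal KG := by
          rw [add_mul]
          refine add_le_add ?_ ?_
          · refine (hC1 (t - a / 2) ⟨by linarith [ht.1], by linarith [ht.2]⟩ _ ((hf1 m).measurable_apply _).ennreal_ofReal v).trans ?_
            gcongr
            simp only [en (h.nonneg m _ _)]
            exact hKf _ ⟨le_rfl, ha2T⟩
          · unfold duhL
            rw [← lintegral_mul_const' _ _ (wt_ne_top j v)]
            refine setLIntegral_mono' measurableSet_Ioc fun s hs => ?_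
            refine hC2 (t - s) ⟨by linarith [hs.2], by linarith [hs.1, ht.2]⟩ _ _ (fun w => ?_) v
            rw [wt, ← ofReal_mul (hG0 s w), ← abs_of_nonneg (hG0 s w)]
            exact ofReal_le_ofReal (hGb s ⟨hs.1.le, hs.2.trans ht.2⟩ w)
      _ ≤ K := by
          simp only [K, lintegral_const, Measure.restrict_apply MeasurableSet.univ, univ_inter, Real.volume_Ioc]
          gcongr
          linarith [ht.2]
  rw [wt, ← ofReal_mul (h.nonneg m t v), ← abs_of_nonneg (h.nonneg m t v)] at h1
  exact (ENNReal.ofReal_le_iff_le_toReal hK).1 h1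

end SupBounds

/-! ### Smooth rapidly decaying families -/

section Regular

variable {G : ℝ → Fn d}

/-- The linear form with the given components. -/
def gradCLM (g : Fin d → ℝ) : Vel d →L[ℝ] ℝ := ∑ i, g i • (proj i : Vel d →L[ℝ] ℝ)

lemma gradCLM_apply (g : Fin d → ℝ) (e : Vel d) : gradCLM g e = ∑ i, g i * e i := by
  simp [gradCLM]

lemma norm_proj_le (i : Fin d) : ‖(proj i : Vel d →L[ℝ] ℝ)‖ ≤ 1 := opNorm_le_bound _ zero_le_one fun v => by
    simpa using PiLp.norm_apply_le v i

lemma norm_gradCLM_le (g : Fin d → ℝ) : ‖gradCLM g‖ ≤ ∑ i, |g i| := by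
  refine (norm_sum_le _ _).trans (sum_le_sum fun i _ => ?_)
  rw [norm_smul]
  exact (mul_le_mul_of_nonneg_left (norm_proj_le i) (norm_nonneg _)).trans (by simp)

lemma gradCLM_add (g h : Fin d → ℝ) : gradCLM g + gradCLM h = gradCLM fun i => g i + h i := by
  simp [gradCLM, add_smul, sum_add_distrib]

lemma smul_gradCLM (a : ℝ) (g : Fin d → ℝ) : a • gradCLM g = gradCLM fun i => a * g i := by
  simp [gradCLM, Finset.smul_sum, smul_smul]

lemma gradCLM_zero : (gradCLM fun _ : Fin d => (0 : ℝ)) = 0 := by simp [gradCLM]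

/-- Differentiation under the integral sign, in components. -/
lemma hasFDerivAt_integral_grad {α : Type*} [MeasurableSpace α] {μ : Measure α} {F : Vel d → α → ℝ} {G : Fin d → Vel d → α → ℝ}
    {v₀ : Vel d} {s : Set (Vel d)} (hs : s ∈ 𝓝 v₀) {b : α → ℝ} (hF : ∀ v, AEStronglyMeasurable (F v) μ) (hFi : Integrable (F v₀) μ)
    (hG : ∀ i, AEStronglyMeasurable (G i v₀) μ) (hb : Integrable b μ) (hGb : ∀ i, ∀ᵐ x ∂μ, ∀ v ∈ s, |G i v x| ≤ b x)
    (hd : ∀ᵐ x ∂μ, ∀ v ∈ s, HasFDerivAt (fun v => F v x) (gradCLM fun i => G i v x) v) :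
    HasFDerivAt (fun v => ∫ x, F v x ∂μ) (gradCLM fun i => ∫ x, G i v₀ x ∂μ) v₀ := by
  have hGi : ∀ i, Integrable (G i v₀) μ := fun i => hb.mono' (hG i) (by
    filter_upwards [hGb i] with x hx using hx v₀ (mem_of_mem_nhds hs))
  have key := hasFDerivAt_integral_of_dominated_of_fderiv_le (μ := μ) (F := F) (F' := fun v x => gradCLM fun i => G i v x)
    (bound := fun x => ∑ _i : Fin d, b x) hs (of_forall hF) hFi (by
      unfold gradCLM
      exact Finset.aestronglyMeasurable_fun_sum _ fun i _ => (hG i).smul_const _)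
    (by
      filter_upwards [ae_all_iff.2 hGb] with x hx v hv
      exact (norm_gradCLM_le _).trans (sum_le_sum fun i _ => hx i v hv))
    (integrable_finsetSum _ fun _ _ => hb) hd
  refine key.congr_fderiv ?_
  unfold gradCLM
  rw [integral_finsetSum _ fun i _ => (hGi i).smul_const _]
  exact sum_congr rfl fun i _ => integral_smul_const _ _

/-- Measurable families decaying faster than every power, uniformly for times in `I`. -/
def Rapid (I : Set ℝ) (F : ℝ → Fn d) : Prop := Measurable (uncurry F) ∧ ∀ j : ℕ, ∃ C, 0 ≤ C ∧ ∀ t ∈ I, ∀ v, |F t v| * bracket v ^ j ≤ C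

/-- Families with `k` derivatives, all of them rapidly decaying. -/
def Reg (I : Set ℝ) : ℕ → (ℝ → Fn d) → Prop
  | 0, F => Rapid I F
  | k + 1, F => Rapid I F ∧ ∃ G : Fin d → ℝ → Fn d, (∀ i, Reg I k (G i)) ∧
      ∀ t ∈ I, ∀ v, HasFDerivAt (F t) (gradCLM fun i => G i t v) v

lemma Reg.rapid (h : Reg I k F) : Rapid I F := by
  cases k with
  | zero => exact h
  | succ k => exact h.1

lemma Reg.pred (h : Reg I (k + 1) F) : Reg I k F := by
  induction k generalizing F with
  | zero => exact h.1
  | succ k ih => exact ⟨h.1, h.2.imp fun G hG => ⟨fun i => ih (hG.1 i), hG.2⟩⟩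

lemma Reg.mono_set {J : Set ℝ} (hJ : J ⊆ I) (h : Reg I k F) : Reg J k F := by
  have r : ∀ {F : ℝ → Fn d}, Rapid I F → Rapid J F := fun h =>
    ⟨h.1, fun j => (h.2 j).imp fun C hC => ⟨hC.1, fun t ht => hC.2 t (hJ ht)⟩⟩
  induction k generalizing F with
  | zero => exact r h
  | succ k ih => exact ⟨r h.1, h.2.imp fun G hG => ⟨fun i => ih (hG.1 i), fun t ht => hG.2 t (hJ ht)⟩⟩

lemma Rapid.add (hF : Rapid I F) (hG : Rapid I G) : Rapid I fun t v => F t v + G t v := by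
  refine ⟨hF.1.add hG.1, fun j => ?_⟩
  obtain ⟨A, hA0, hA⟩ := hF.2 j
  obtain ⟨B, hB0, hB⟩ := hG.2 j
  refine ⟨A + B, by positivity, fun t ht v => ?_⟩
  have hv := pow_pos (bracket_pos v) j
  calc |F t v + G t v| * bracket v ^ j ≤ (|F t v| + |G t v|) * bracket v ^ j := by
        gcongr
        exact abs_add_le _ _
    _ ≤ A + B := by rw [add_mul]; exact add_le_add (hA t ht v) (hB t ht v)

lemma Reg.add (hF : Reg I k F) (hG : Reg I k G) : Reg I k fun t v => F t v + G t v := by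
  induction k generalizing F G with
  | zero => exact Rapid.add hF hG
  | succ k ih =>
    obtain ⟨hF0, F', hF', hFd⟩ := hF
    obtain ⟨hG0, G', hG', hGd⟩ := hG
    refine ⟨hF0.add hG0, fun i t v => F' i t v + G' i t v, fun i => ih (hF' i) (hG' i), fun t ht v => ?_⟩
    rw [← gradCLM_add]
    exact (hFd t ht v).add (hGd t ht v)

lemma reg_zero (I : Set ℝ) (k : ℕ) : Reg (d := d) I k fun _ _ => 0 := by
  have r : Rapid (d := d) I fun _ _ => 0 := ⟨measurable_const, fun j => ⟨0, le_rfl, fun t _ v => by simp⟩⟩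
  induction k with
  | zero => exact r
  | succ k ih =>
    refine ⟨r, fun _ _ _ => 0, fun _ => ih, fun t _ v => ?_⟩
    rw [gradCLM_zero]
    exact hasFDerivAt_const _ _

lemma Reg.time_mul (hF : Reg I k F) (hη : Measurable η) {K : ℝ} (hK : ∀ t ∈ I, |η t| ≤ K) : Reg I k fun t v => η t * F t v := by
  have r : ∀ {F : ℝ → Fn d}, Rapid I F → Rapid I fun t v => η t * F t v := fun {F} h => by
    refine ⟨(hη.comp measurable_fst).mul h.1, fun j => ?_⟩
    obtain ⟨A, hA0, hA⟩ := h.2 j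
    refine ⟨|K| * A, by positivity, fun t ht v => ?_⟩
    rw [abs_mul, mul_assoc]
    exact mul_le_mul ((hK t ht).trans (le_abs_self K)) (hA t ht v) (mul_nonneg (abs_nonneg _) (pow_pos (bracket_pos v) j).le) (abs_nonneg _)
  induction k generalizing F with
  | zero => exact r hF
  | succ k ih =>
    obtain ⟨hF0, F', hF', hFd⟩ := hF
    refine ⟨r hF0, fun i t v => η t * F' i t v, fun i => ih (hF' i), fun t ht v => ?_⟩
    rw [← smul_gradCLM]
    exact (hFd t ht v).const_mul (η t)

lemma Reg.const_mul (hF : Reg I k F) (a : ℝ) : Reg I k fun t v => a * F t v := hF.time_mul (η := fun _ => a) measurable_const fun _ _ => le_rfl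

lemma Reg.sum {ι : Type*} (s : Finset ι) {F : ι → ℝ → Fn d} (hF : ∀ i ∈ s, Reg I k (F i)) : Reg I k fun t v => ∑ i ∈ s, F i t v := by
  classical
  induction s using Finset.induction_on with
  | empty => simpa using reg_zero I k
  | insert i s his ih =>
    simp only [Finset.sum_insert his]
    exact (hF i (Finset.mem_insert_self i s)).add (ih fun j hj => hF j (Finset.mem_insert_of_mem hj))

lemma Rapid.coll (hF : Rapid I F) (hG : Rapid I G) (h0 : 0 ≤ θ) (h1 : θ ≤ 1) : Rapid I fun t v => coll norm θ (F t) (G t) v := by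
  have m : ∀ {F : ℝ → Fn d}, Measurable (uncurry F) → Measurable (uncurry fun (x : ℝ × Vel d) => F x.1) := fun h => h.comp measurable_time_vel
  refine ⟨measurable_coll_comp (g := fun x : ℝ × Vel d => F x.1) (h := fun x : ℝ × Vel d => G x.1) measurable_norm θ
    (m hF.1) (m hG.1) measurable_snd, fun j => ?_⟩
  obtain ⟨C, hC0, hC⟩ := exists_abs_coll_le d j
  obtain ⟨A, hA0, hA⟩ := hF.2 (j + (d + 1) + 1)
  obtain ⟨B, hB0, hB⟩ := hG.2 (j + (d + 1) + 1)
  exact ⟨C * (A * B), by positivity, fun t ht v => hC θ h0 h1 _ _ A B v (of_forall fun z => hA t ht _) (of_forall fun z => hB t ht _)⟩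

/-- In the relative variable the kernel `|z|` is independent of `v`, so the Leibniz rule applies
under the integral and its nonsmoothness at zero is harmless. -/
lemma Reg.coll (hF : Reg I k F) (hG : Reg I k G) (h0 : 0 ≤ θ) (h1 : θ ≤ 1) : Reg I k fun t v => coll norm θ (F t) (G t) v := by
  induction k generalizing F G with
  | zero => exact Rapid.coll hF hG h0 h1
  | succ k ih =>
    have hFk := hF.pred
    have hGk := hG.pred
    obtain ⟨hF0, F', hF', hFd⟩ := hF
    obtain ⟨hG0, G', hG', hGd⟩ := hG
    refine ⟨hF0.coll hG0 h0 h1, fun i t v => KineticSmoluchowski.coll norm θ (F' i t) (G t) v + KineticSmoluchowski.coll norm θ (F t) (G' i t) v,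
      fun i => (ih (hF' i) hGk).add (ih hFk (hG' i)), fun t ht v => ?_⟩
    have hms : ∀ {H : ℝ → Fn d}, Rapid I H → Measurable (H t) := fun h => h.1.comp measurable_prodMk_left
    have bd : ∀ {H : ℝ → Fn d}, Rapid I H → ∃ A, 0 ≤ A ∧ ∀ v, |H t v| * bracket v ^ (0 + (d + 1) + 1) ≤ A := fun h =>
      (h.2 _).imp fun A hA => ⟨hA.1, hA.2 t ht⟩
    obtain ⟨A, hA0, hA⟩ := bd hF0
    obtain ⟨B, hB0, hB⟩ := bd hG0
    choose A' hA'0 hA' using fun i => bd (hF' i).rapid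
    choose B' hB'0 hB' using fun i => bd (hG' i).rapid
    have pw : ∀ {f g : Fn d} {A B : ℝ}, (∀ v, |f v| * bracket v ^ (0 + (d + 1) + 1) ≤ A) → (∀ v, |g v| * bracket v ^ (0 + (d + 1) + 1) ≤ B) →
        ∀ v z, |f (v + θ • z) * g (v - (1 - θ) • z) * ‖z‖| ≤ 2 ^ (d + 1 + 1) * (A * B) * (bracket z ^ (d + 1))⁻¹ := fun hf hg v z => by
      have := abs_coll_integrand_le h0 h1 0 (d + 1) (v := v) (z := z) (hf _) (hg _)
      simpa only [pow_zero, mul_one] using this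
    have me : ∀ {f g : Fn d}, Measurable f → Measurable g → ∀ v, Measurable fun z : Vel d => f (v + θ • z) * g (v - (1 - θ) • z) * ‖z‖ :=
      fun hf hg v => ((hf.comp (by fun_prop)).mul (hg.comp (by fun_prop))).mul measurable_norm
    have int : ∀ {f g : Fn d} {A B : ℝ}, Measurable f → Measurable g → (∀ v, |f v| * bracket v ^ (0 + (d + 1) + 1) ≤ A) →
        (∀ v, |g v| * bracket v ^ (0 + (d + 1) + 1) ≤ B) → ∀ v, Integrable fun z : Vel d => f (v + θ • z) * g (v - (1 - θ) • z) * ‖z‖ :=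
      fun mf mg hf hg v => (integrable_inv_bracket_pow.const_mul _).mono' (me mf mg v).aestronglyMeasurable (of_forall fun z => pw hf hg v z)
    have key := hasFDerivAt_integral_grad (μ := (volume : Measure (Vel d))) (v₀ := v) (s := univ)
      (F := fun v z => F t (v + θ • z) * G t (v - (1 - θ) • z) * ‖z‖)
      (G := fun i v z => F' i t (v + θ • z) * G t (v - (1 - θ) • z) * ‖z‖ + F t (v + θ • z) * G' i t (v - (1 - θ) • z) * ‖z‖)
      (b := fun z => (∑ i, 2 ^ (d + 1 + 1) * (A' i * B + A * B' i)) * (bracket z ^ (d + 1))⁻¹) univ_mem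
      (fun v => (me (hms hF0) (hms hG0) v).aestronglyMeasurable) (int (hms hF0) (hms hG0) hA hB v)
      (fun i => ((me (hms (hF' i).rapid) (hms hG0) v).add (me (hms hF0) (hms (hG' i).rapid) v)).aestronglyMeasurable)
      (integrable_inv_bracket_pow.const_mul _) (fun i => of_forall fun z v _ => by
        refine (abs_add_le _ _).trans ((add_le_add (pw (hA' i) hB v z) (pw hA (hB' i) v z)).trans ?_)
        rw [← add_mul, ← mul_add]
        have hz := (inv_pos.2 (pow_pos (bracket_pos z) (d + 1))).le
        refine mul_le_mul_of_nonneg_right ?_ hz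
        exact single_le_sum (f := fun i => 2 ^ (d + 1 + 1) * (A' i * B + A * B' i))
          (fun i _ => by have := hA'0 i; have := hB'0 i; positivity) (Finset.mem_univ i))
      (of_forall fun z v _ => by
        have e1 : HasFDerivAt (fun v : Vel d => v + θ • z) (ContinuousLinearMap.id ℝ (Vel d)) v := (hasFDerivAt_id v).add_const _
        have e2 : HasFDerivAt (fun v : Vel d => v - (1 - θ) • z) (ContinuousLinearMap.id ℝ (Vel d)) v := (hasFDerivAt_id v).sub_const _
        have e3 := (((hFd t ht _).comp v e1).mul ((hGd t ht _).comp v e2)).mul_const ‖z‖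
        refine e3.congr_fderiv ?_
        simp only [ContinuousLinearMap.comp_id, smul_gradCLM, gradCLM_add, Function.comp]
        congr 1
        ext i
        ring)
    simp only [KineticSmoluchowski.coll]
    convert key using 2
    funext i
    exact (integral_add (int (hms (hF' i).rapid) (hms hG0) (hA' i) hB v) (int (hms hF0) (hms (hG' i).rapid) hA (hB' i) v)).symm

/-- The loss is a collision density with `θ = 0`, so one regularity lemma covers gain and loss. -/
lemma mul_conv_eq_coll (b g h : Fn d) (v : Vel d) : g v * conv b h v = coll b 0 g h v := by
  unfold conv coll
  rw [← integral_const_mul, ← integral_sub_left_eq_self _ volume v]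
  refine integral_ext fun z => ?_
  simp only [zero_smul, add_zero, sub_zero, one_smul, sub_sub_cancel]
  ring

lemma Reg.collB (hm : m ∈ Lev M) (hf : ∀ n ∈ Lev M, Reg I k (f n)) : Reg I k fun t => collB norm M m fun n => f n t := by
  have e : (fun t => KineticSmoluchowski.collB norm M m fun n => f n t) = fun t v =>
      (∑ n ∈ Finset.Ico 1 m, crossSection d n (m - n) * KineticSmoluchowski.coll norm mfr n m (f n t) (f (m - n) t) v) +
        (-2) * ∑ n ∈ Lev M, crossSection d n m * KineticSmoluchowski.coll norm 0 (f m t) (f n t) v := by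
    ext t v
    simp only [KineticSmoluchowski.collB, gainR, rateR, ← mul_conv_eq_coll, mul_sum]
    rw [sub_eq_add_neg, ← Finset.sum_neg_distrib]
    congr 1
    exact sum_congr rfl fun n _ => by ring
  rw [e]
  refine (Reg.sum _ fun n hn => ?_).add (Reg.const_mul (Reg.sum _ fun n hn => ?_) _)
  · have := mem_Icc_of_Ico hm hn
    exact ((hf _ this.1).coll (hf _ this.2) (theta_mem hn).1 (theta_mem hn).2).const_mul _
  · exact ((hf m hm).coll (hf n hn) le_rfl zero_le_one).const_mul _

/-- The top derivatives in `Reg` are only measurable and rapidly decaying; one further order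
supplies the missing continuity. -/
lemma Reg.contDiff (h : Reg I (k + 1) F) (ht : t ∈ I) : ContDiff ℝ k (F t) ∧ ∀ n ≤ k, ∃ C : ℝ, ∀ v, ‖iteratedFDeriv ℝ n (F t) v‖ ≤ C := by
  have zero : ∀ {F : ℝ → Fn d}, Rapid I F → ∃ C : ℝ, ∀ v, ‖iteratedFDeriv ℝ 0 (F t) v‖ ≤ C := fun h => by
    obtain ⟨C, -, hC⟩ := h.2 0
    exact ⟨C, fun v => by simpa using hC t ht v⟩
  induction k generalizing F with
  | zero =>
    obtain ⟨h0, G, -, hd⟩ := h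
    refine ⟨?_, fun n hn => ?_⟩
    · rw [Nat.cast_zero, contDiff_zero]
      exact continuous_iff_continuousAt.2 fun v => (hd t ht v).continuousAt
    · obtain rfl : n = 0 := by omega
      exact zero h0
  | succ k ih =>
    obtain ⟨h0, G, hG, hd⟩ := h
    have hf : fderiv ℝ (F t) = fun v => ∑ i, G i t v • (proj i : Vel d →L[ℝ] ℝ) := funext fun v => (hd t ht v).fderiv
    have hsm : ∀ i, ContDiff ℝ k fun v => G i t v • (proj i : Vel d →L[ℝ] ℝ) := fun i => (ih (hG i)).1.smul contDiff_const
    refine ⟨?_, fun n hn => ?_⟩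
    · rw [Nat.cast_succ, contDiff_succ_iff_fderiv]
      refine ⟨fun v => (hd t ht v).differentiableAt, fun h => by simp at h, ?_⟩
      rw [hf]
      exact ContDiff.sum fun i _ => hsm i
    · cases n with
      | zero => exact zero h0
      | succ n =>
        have hn' : n ≤ k := by omega
        choose C hC using fun i => (ih (hG i)).2 n hn'
        refine ⟨∑ i, C i, fun v => ?_⟩
        rw [← norm_iteratedFDeriv_fderiv, hf, iteratedFDeriv_fun_sum_apply fun i _ => ((hsm i).of_le (by exact_mod_cast hn')).contDiffAt]
        refine (norm_sum_le _ _).trans (sum_le_sum fun i _ => ?_)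
        set L : ℝ →L[ℝ] (Vel d →L[ℝ] ℝ) := ContinuousLinearMap.toSpanSingleton ℝ (proj i : Vel d →L[ℝ] ℝ)
        have hL : ‖L‖ ≤ 1 := by
          simp only [L, ContinuousLinearMap.norm_toSpanSingleton]
          exact norm_proj_le i
        have := L.norm_iteratedFDeriv_comp_left (f := G i t) (x := v) (N := k) (n := n) (ih (hG i)).1.contDiffAt (by exact_mod_cast hn')
        have e : (fun v => G i t v • (proj i : Vel d →L[ℝ] ℝ)) = L ∘ G i t := by
          ext v; simp [L]
        rw [e]
        refine this.trans ((mul_le_mul hL (hC i v) (norm_nonneg _) zero_le_one).trans (by simp))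

end Regular

/-! ### The Duhamel operator gains a derivative -/

section KernelOperator

variable {B : ℝ}

/-- The integrand of the Duhamel-type operator with weight `ρ`. -/
def kopIntgd (c D a : ℝ) (ρ : ℝ → Fn d) (h : ℝ → Fn d) (t : ℝ) (v : Vel d) (p : ℝ × Vel d) : ℝ := if a < p.1 ∧ p.1 < t then
    ρ (t - p.1) p.2 * h p.1 (exp (c * (t - p.1)) • (v - ouSd c D (t - p.1) • p.2)) else 0

/-- The Duhamel-type operator with weight `ρ`. -/
def kop (c D a : ℝ) (ρ : ℝ → Fn d) (h : ℝ → Fn d) (t : ℝ) (v : Vel d) : ℝ := ∫ p, kopIntgd c D a ρ h t v p ∂((volume : Measure ℝ).prod (gauss d))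

/-- Admissible weights: an integrable singularity in time and linear growth in velocity. -/
def KernelWeight (L : ℝ) (ρ : ℝ → Fn d) : Prop :=
  Measurable (uncurry ρ) ∧ ∃ C, 0 ≤ C ∧ ∀ r ∈ Ioc 0 L, ∀ z, |ρ r z| ≤ C * (r ^ (-(1 / 2) : ℝ) * bracket z)

/-- The time singularity. -/
def timeSing (a t s : ℝ) : ℝ := if a < s ∧ s < t then (t - s) ^ (-(1 / 2) : ℝ) else 0

lemma timeSing_eq (a t : ℝ) : timeSing a t = (Ioo a t).indicator fun s => (t - s) ^ (-(1 / 2) : ℝ) := by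
  ext s
  simp [timeSing, indicator, mem_Ioo]

lemma timeSing_nonneg (a t s : ℝ) : 0 ≤ timeSing a t s := by
  unfold timeSing
  split_ifs with h
  · exact Real.rpow_nonneg (by linarith [h.2]) _
  · exact le_rfl

lemma integrable_timeSing (hat : a ≤ t) : Integrable (timeSing a t) := by
  rw [timeSing_eq, integrable_indicator_iff measurableSet_Ioo, ← integrableOn_Ioc_iff_integrableOn_Ioo,
    ← intervalIntegrable_iff_integrableOn_Ioc_of_le hat]
  have h := (intervalIntegral.intervalIntegrable_rpow' (a := 0) (b := t - a) (r := (-(1 / 2) : ℝ)) (by norm_num)).comp_sub_left t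
  simpa using h.symm

lemma integral_timeSing_le (hat : a ≤ t) (htT : t ≤ T) : ∫ s, timeSing a t s ≤ 2 * (T - a) ^ (1 / 2 : ℝ) := by
  rw [timeSing_eq, integral_indicator measurableSet_Ioo, ← integral_Ioc_eq_integral_Ioo, ← integral_of_le hat,
    integral_comp_sub_left fun s => s ^ (-(1 / 2) : ℝ), sub_self, integral_rpow (Or.inl (by norm_num))]
  have h : (-(1 / 2) : ℝ) + 1 = 1 / 2 := by norm_num
  rw [h, Real.zero_rpow (by norm_num), sub_zero, div_eq_mul_inv, mul_comm]
  norm_num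
  gcongr

lemma measurable_kopIntgd (c D a : ℝ) (hρ : Measurable (uncurry ρ)) (hh : Measurable (uncurry h)) :
    Measurable fun x : (ℝ × Vel d) × (ℝ × Vel d) => kopIntgd c D a ρ h x.1.1 x.1.2 x.2 := by
  unfold kopIntgd
  have hσ := (continuous_ouSd c D).measurable
  refine Measurable.ite ?_ ?_ measurable_const
  · exact (measurableSet_lt measurable_const (measurable_fst.comp measurable_snd)).inter
      (measurableSet_lt (measurable_fst.comp measurable_snd) (measurable_fst.comp measurable_fst))
  · exact (hρ.comp (by fun_prop : Measurable fun x : (ℝ × Vel d) × (ℝ × Vel d) => (x.1.1 - x.2.1, x.2.2))).mul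
      (hh.comp (by fun_prop : Measurable fun x : (ℝ × Vel d) × (ℝ × Vel d) =>
        (x.2.1, exp (c * (x.1.1 - x.2.1)) • (x.1.2 - ouSd c D (x.1.1 - x.2.1) • x.2.2))))

lemma measurable_kopIntgd_apply (c D a : ℝ) (hρ : Measurable (uncurry ρ)) (hh : Measurable (uncurry h)) (t : ℝ) (v : Vel d) : Measurable (kopIntgd c D a ρ h t v) :=
  (measurable_kopIntgd c D a hρ hh).comp (measurable_prodMk_left (x := (t, v)))

lemma measurable_kop (c D a : ℝ) (hρ : Measurable (uncurry ρ)) (hh : Measurable (uncurry h)) : Measurable (uncurry (kop c D a ρ h)) :=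
  ((measurable_kopIntgd c D a hρ hh).stronglyMeasurable.integral_prod_right').measurable

lemma KernelWeight.mul_time {L : ℝ} (hρ : KernelWeight L ρ) (hη : Continuous η) : KernelWeight L fun r z => η r * ρ r z := by
  obtain ⟨hm, C, hC0, hC⟩ := hρ
  obtain ⟨K, hK⟩ := isCompact_Icc.exists_bound_of_continuousOn (s := Icc 0 L) hη.continuousOn
  refine ⟨(hη.measurable.comp measurable_fst).mul hm, |K| * C, by positivity, fun r hr z => ?_⟩
  rw [abs_mul, mul_assoc]
  exact mul_le_mul ((hK r ⟨hr.1.le, hr.2⟩).trans (le_abs_self K)) (hC r hr z) (abs_nonneg _) (abs_nonneg _)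

/-- The pointwise bound for the integrand. -/
lemma exists_kopIntgd_le (hc : 0 < c) (hD : 0 < D) (hρ : KernelWeight (T - a) ρ) (j : ℕ) :
    ∃ C, 0 ≤ C ∧ ∀ (h : ℝ → Fn d) (A : ℝ), 0 ≤ A → (∀ s ∈ Icc a T, ∀ v, |h s v| * bracket v ^ j ≤ A) → ∀ t ∈ Icc a T, ∀ v p,
      |kopIntgd c D a ρ h t v p| * bracket v ^ j ≤ C * A * (timeSing a t p.1 * bracket p.2 ^ (j + 1)) := by
  obtain ⟨-, C, hC0, hC⟩ := hρ
  set σT := ouSd c D (T - a)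
  have hσT0 : 0 ≤ σT := ouSd_nonneg _ _ _
  refine ⟨C * (2 * (1 + σT)) ^ j, by positivity, fun h A hA0 hA t ht v p => ?_⟩
  unfold kopIntgd timeSing
  split_ifs with hp
  · set r := t - p.1
    have hr : r ∈ Ioc 0 (T - a) := ⟨by simp only [r]; linarith [hp.2], by simp only [r]; linarith [hp.1, ht.2]⟩
    set x := exp (c * r) • (v - ouSd c D r • p.2)
    have hσ : ouSd c D r ≤ σT := ouSd_mono hc hD hr.2
    have hb : bracket v ≤ 2 * (1 + σT) * (bracket x * bracket p.2) := by
      refine (bracket_le_ou hc.le (ouSd_nonneg c D r) hr.1.le v p.2).trans ?_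
      have h1 := bracket_pos x
      have h2 := bracket_pos p.2
      gcongr
    have hx := bracket_pos x
    have hz := bracket_pos p.2
    have hrr : 0 ≤ r ^ (-(1 / 2) : ℝ) := Real.rpow_nonneg hr.1.le _
    calc |ρ r p.2 * h p.1 x| * bracket v ^ j ≤ (C * (r ^ (-(1 / 2) : ℝ) * bracket p.2)) * |h p.1 x| * (2 * (1 + σT) * (bracket x * bracket p.2)) ^ j := by
          rw [abs_mul]
          exact mul_le_mul (mul_le_mul_of_nonneg_right (hC r hr p.2) (abs_nonneg _)) (pow_le_pow_left₀ (bracket_pos v).le hb j)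
            (pow_pos (bracket_pos v) j).le (by positivity)
      _ = C * (2 * (1 + σT)) ^ j * (|h p.1 x| * bracket x ^ j) * (r ^ (-(1 / 2) : ℝ) * bracket p.2 ^ (j + 1)) := by
          rw [mul_pow, mul_pow, pow_succ]; ring
      _ ≤ _ := by
          gcongr
          exact hA p.1 ⟨hp.1.le, hp.2.le.trans ht.2⟩ x
  · simp

lemma integrable_timeSing_prod (hat : a ≤ t) (j : ℕ) :
    Integrable (fun p : ℝ × Vel d => timeSing a t p.1 * bracket p.2 ^ j) ((volume : Measure ℝ).prod (gauss d)) :=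
  (integrable_timeSing hat).mul_prod (integrable_gauss_bracket_pow j)

lemma integrable_kopIntgd (hc : 0 < c) (hD : 0 < D) (hρ : KernelWeight (T - a) ρ) (hh : Rapid (Icc a T) h) (ht : t ∈ Icc a T) (v : Vel d) :
    Integrable (kopIntgd c D a ρ h t v) ((volume : Measure ℝ).prod (gauss d)) := by
  obtain ⟨C, hC0, hC⟩ := exists_kopIntgd_le hc hD hρ 0
  obtain ⟨A, hA0, hA⟩ := hh.2 0
  refine ((integrable_timeSing_prod ht.1 (0 + 1)).const_mul (C * A)).mono' (measurable_kopIntgd_apply c D a hρ.1 hh.1 t v).aestronglyMeasurable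
    (of_forall fun p => ?_)
  simpa using hC h A hA0 hA t ht v p

lemma Rapid.kop (hc : 0 < c) (hD : 0 < D) (hρ : KernelWeight (T - a) ρ) (hh : Rapid (Icc a T) h) : Rapid (Icc a T) (kop c D a ρ h) := by
  refine ⟨measurable_kop c D a hρ.1 hh.1, fun j => ?_⟩
  obtain ⟨C, hC0, hC⟩ := exists_kopIntgd_le hc hD hρ j
  obtain ⟨A, hA0, hA⟩ := hh.2 j
  have hg0 : 0 ≤ ∫ z, bracket z ^ (j + 1) ∂gauss d := integral_nonneg fun z => (pow_pos (bracket_pos z) _).le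
  refine ⟨C * A * (2 * |T - a| ^ (1 / 2 : ℝ) * ∫ z, bracket z ^ (j + 1) ∂gauss d), by positivity, fun t ht v => ?_⟩
  have hTa : 0 ≤ T - a := by linarith [ht.1, ht.2]
  have hv := pow_pos (bracket_pos v) j
  have h1 : ‖∫ p, kopIntgd c D a ρ h t v p * bracket v ^ j ∂((volume : Measure ℝ).prod (gauss d))‖ ≤
      ∫ p, C * A * (timeSing a t p.1 * bracket p.2 ^ (j + 1)) ∂((volume : Measure ℝ).prod (gauss d)) := by
    refine norm_integral_le_of_norm_le ((integrable_timeSing_prod ht.1 (j + 1)).const_mul (C * A)) (of_forall fun p => ?_)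
    rw [norm_mul, norm_eq_abs, norm_of_nonneg hv.le]
    exact hC h A hA0 hA t ht v p
  rw [integral_mul_const, norm_mul, norm_eq_abs, norm_of_nonneg hv.le, integral_const_mul,
    integral_prod_mul (fun s => timeSing a t s) fun z : Vel d => bracket z ^ (j + 1)] at h1
  refine h1.trans ?_
  rw [abs_of_nonneg hTa]
  exact mul_le_mul_of_nonneg_left (mul_le_mul_of_nonneg_right (integral_timeSing_le ht.1 ht.2) hg0) (by positivity)

/-- A velocity derivative passes to `h` and produces `e^{cr}`, absorbed in the weight; hence the
induction varies the weight as well. -/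
lemma Reg.kop (hc : 0 < c) (hD : 0 < D) (hρ : KernelWeight (T - a) ρ) (hh : Reg (Icc a T) k h) : Reg (Icc a T) k (kop c D a ρ h) := by
  induction k generalizing h ρ with
  | zero => exact Rapid.kop hc hD hρ hh
  | succ k ih =>
    obtain ⟨h0, G, hG, hd⟩ := hh
    set ρ' : ℝ → Fn d := fun r z => exp (c * r) * ρ r z
    have hρ' : KernelWeight (T - a) ρ' := hρ.mul_time (by fun_prop)
    refine ⟨h0.kop hc hD hρ, fun i => KineticSmoluchowski.kop c D a ρ' (G i), fun i => ih hρ' (hG i), fun t ht v => ?_⟩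
    obtain ⟨C, hC0, hC⟩ := exists_kopIntgd_le hc hD hρ' 0
    choose A hA0 hA using fun i => (hG i).rapid.2 0
    refine hasFDerivAt_integral_grad (s := univ) (F := fun v p => kopIntgd c D a ρ h t v p) (G := fun i v p => kopIntgd c D a ρ' (G i) t v p)
      (b := fun p => C * (∑ i, A i) * (timeSing a t p.1 * bracket p.2 ^ (0 + 1))) univ_mem
      (fun v => (measurable_kopIntgd_apply c D a hρ.1 h0.1 t v).aestronglyMeasurable) (integrable_kopIntgd hc hD hρ h0 ht v)
      (fun i => (measurable_kopIntgd_apply c D a hρ'.1 (hG i).rapid.1 t v).aestronglyMeasurable) ((integrable_timeSing_prod ht.1 _).const_mul _)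
      (fun i => of_forall fun p v _ => ?_) (of_forall fun p v _ => ?_)
    · have := hC (G i) (A i) (hA0 i) (hA i) t ht v p
      rw [pow_zero, mul_one] at this
      refine this.trans ?_
      have h1 := timeSing_nonneg a t p.1
      have h2 := bracket_pos p.2
      gcongr
      exact single_le_sum (f := A) (fun i _ => hA0 i) (Finset.mem_univ i)
    · unfold kopIntgd
      by_cases hp : a < p.1 ∧ p.1 < t
      · simp only [if_pos hp, ρ']
        set e := exp (c * (t - p.1))
        have e1 : HasFDerivAt (fun v : Vel d => e • (v - ouSd c D (t - p.1) • p.2)) (e • ContinuousLinearMap.id ℝ (Vel d)) v :=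
          ((hasFDerivAt_id v).sub_const _).const_smul e
        have e2 := ((hd p.1 ⟨hp.1.le, hp.2.le.trans ht.2⟩ _).comp v e1).const_mul (ρ (t - p.1) p.2)
        refine e2.congr_fderiv ?_
        rw [ContinuousLinearMap.comp_smul, ContinuousLinearMap.comp_id, smul_gradCLM, smul_gradCLM]
        congr 1
        ext i
        ring
      · simp only [if_neg hp, gradCLM_zero]
        exact hasFDerivAt_const _ _

/-- The change of variables turning the Gaussian average into a convolution. -/
lemma integral_gaussian_average (Ψ : Fn d) (g : Fn d) (hσ : 0 < σ) (e : ℝ) (v : Vel d) :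
    ∫ z, Ψ z * g (e • (v - σ • z)) = (σ ^ d)⁻¹ * ∫ y, Ψ (σ⁻¹ • (v - y)) * g (e • y) := by
  have h1 : ∀ y, Ψ (σ⁻¹ • (v - y)) * g (e • y) = (fun x => Ψ (σ⁻¹ • x) * g (e • (v - x))) (v - y) := fun y => by
    simp only [sub_sub_cancel]
  simp only [h1]
  rw [integral_sub_left_eq_self (fun x => Ψ (σ⁻¹ • x) * g (e • (v - x))) volume v]
  have h2 := Measure.integral_comp_smul (volume : Measure (Vel d)) (fun x => Ψ (σ⁻¹ • x) * g (e • (v - x))) σ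
  simp only [smul_smul, inv_mul_cancel₀ hσ.ne', one_smul, finrank_euclideanSpace_fin, smul_eq_mul] at h2
  rw [h2, abs_of_pos (by positivity)]

/-- A dominating function that tolerates unit displacements: `⟨u₀⟩ ≤ 4⟨u⟩` there, and the Gaussian
absorbs all powers. -/
lemma exists_gauss_tail (d : ℕ) : ∃ C, 0 ≤ C ∧ ∀ u u₀ : Vel d, ‖u₀ - u‖ ≤ 1 → gaussPdf u * bracket u ≤ C * (bracket u₀ ^ (d + 1))⁻¹ := by
  obtain ⟨C, hC0, hC⟩ := exists_gaussPdf_mul_bracket_pow_le (d := d) (d + 2)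
  refine ⟨C * 4 ^ (d + 1), by positivity, fun u u₀ hu => ?_⟩
  have h0 := bracket_pos u₀
  have hb : bracket u₀ ≤ 4 * bracket u := by
    have h1 := bracket_add_le u (u₀ - u)
    rw [add_sub_cancel] at h1
    have h2 : bracket (u₀ - u) ≤ 2 := (bracket_le _).trans (by linarith)
    nlinarith [bracket_pos u]
  rw [← div_eq_mul_inv, le_div_iff₀ (by positivity)]
  calc gaussPdf u * bracket u * bracket u₀ ^ (d + 1) ≤ gaussPdf u * bracket u * (4 * bracket u) ^ (d + 1) := by
        have := (gaussPdf_pos u).le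
        have := bracket_pos u
        gcongr
    _ = gaussPdf u * bracket u ^ (d + 2) * 4 ^ (d + 1) := by ring
    _ ≤ _ := by gcongr; exact hC u

/-- The density is merely bounded, so the derivative must fall on the Gaussian. -/
lemma hasFDerivAt_gauss_convolution (hg : Measurable g) (hB : ∀ v, |g v| ≤ B) (hσ : 0 < σ) (v : Vel d) :
    HasFDerivAt (fun v => ∫ y, gaussPdf (σ⁻¹ • (v - y)) * g y)
      (gradCLM fun i => ∫ y, -(σ⁻¹ * (gaussPdf (σ⁻¹ • (v - y)) * (σ⁻¹ • (v - y)) i)) * g y) v := by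
  obtain ⟨C, hC0, hC⟩ := exists_gauss_tail d
  have hB0 : 0 ≤ B := (abs_nonneg _).trans (hB 0)
  have hbi : Integrable fun y : Vel d => (σ⁻¹ + 1) * (C * B) * (bracket (σ⁻¹ • (v - y)) ^ (d + 1))⁻¹ := by
    have h1 : Integrable fun x : Vel d => (bracket (σ⁻¹ • x) ^ (d + 1))⁻¹ := integrable_inv_bracket_pow.comp_smul (inv_ne_zero hσ.ne')
    exact (h1.comp_sub_left v).const_mul _
  have hco : ∀ v : Vel d, Measurable fun y : Vel d => gaussPdf (σ⁻¹ • (v - y)) := fun v => measurable_gaussPdf.comp (by fun_prop)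
  -- The radius `σ` becomes a unit displacement after rescaling.
  have near : ∀ v' ∈ Metric.ball v σ, ∀ y : Vel d, gaussPdf (σ⁻¹ • (v' - y)) * bracket (σ⁻¹ • (v' - y)) ≤ C * (bracket (σ⁻¹ • (v - y)) ^ (d + 1))⁻¹ :=
    fun v' hv' y => hC _ _ (by
      rw [← smul_sub, sub_sub_sub_cancel_right, norm_smul, norm_inv, norm_of_nonneg hσ.le, inv_mul_le_one₀ hσ]
      rw [Metric.mem_ball, dist_comm, dist_eq_norm] at hv'
      exact hv'.le)
  have hinv : ∀ x : Vel d, 0 ≤ (bracket x ^ (d + 1))⁻¹ := fun x => (inv_pos.2 (pow_pos (bracket_pos x) _)).le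
  set b : Fn d := fun y => (σ⁻¹ + 1) * (C * B) * (bracket (σ⁻¹ • (v - y)) ^ (d + 1))⁻¹
  set G : Fin d → Vel d → Fn d := fun i v y => -(σ⁻¹ * (gaussPdf (σ⁻¹ • (v - y)) * (σ⁻¹ • (v - y)) i)) * g y
  have k1 : Integrable fun y => gaussPdf (σ⁻¹ • (v - y)) * g y := by
    refine hbi.mono' ((hco v).mul hg).aestronglyMeasurable (of_forall fun y => ?_)
    have h1 := near v (Metric.mem_ball_self hσ) y
    have h2 := gaussPdf_pos (σ⁻¹ • (v - y))
    rw [norm_mul, norm_of_nonneg h2.le]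
    calc gaussPdf (σ⁻¹ • (v - y)) * ‖g y‖ ≤ (gaussPdf (σ⁻¹ • (v - y)) * bracket (σ⁻¹ • (v - y))) * B := by
          exact mul_le_mul (le_mul_of_one_le_right h2.le (one_le_bracket _)) (hB y) (norm_nonneg _) (mul_nonneg h2.le (bracket_pos _).le)
      _ ≤ (C * (bracket (σ⁻¹ • (v - y)) ^ (d + 1))⁻¹) * B := by gcongr
      _ ≤ (σ⁻¹ + 1) * (C * (bracket (σ⁻¹ • (v - y)) ^ (d + 1))⁻¹ * B) :=
          le_mul_of_one_le_left (mul_nonneg (mul_nonneg hC0 (hinv _)) hB0) (by have := inv_pos.2 hσ; linarith)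
      _ = _ := by ring
  have k2 : ∀ i, AEStronglyMeasurable (G i v) volume := fun i => by
    refine Measurable.aestronglyMeasurable ((Measurable.neg (measurable_const.mul ((hco v).mul ?_))).mul hg)
    exact (proj i : Vel d →L[ℝ] ℝ).continuous.measurable.comp (by fun_prop : Measurable fun y : Vel d => σ⁻¹ • (v - y))
  have k3 : ∀ i, ∀ y, ∀ v' ∈ Metric.ball v σ, |G i v' y| ≤ b y := fun i y v' hv' => by
    simp only [G, b]
    have h1 := near v' hv' y
    set u := σ⁻¹ • (v' - y)
    have h2 := gaussPdf_pos u
    have h3 : |u i| ≤ bracket u := (PiLp.norm_apply_le u i).trans (norm_le_bracket u)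
    have hi := inv_pos.2 hσ
    rw [abs_mul, abs_neg, abs_mul, abs_mul, abs_of_pos hi, abs_of_pos h2]
    calc σ⁻¹ * (gaussPdf u * |u i|) * |g y| ≤ σ⁻¹ * (gaussPdf u * bracket u) * B := by
          exact mul_le_mul (by gcongr) (hB y) (abs_nonneg _) (mul_nonneg hi.le (mul_nonneg h2.le (bracket_pos _).le))
      _ ≤ (σ⁻¹ + 1) * (C * (bracket (σ⁻¹ • (v - y)) ^ (d + 1))⁻¹) * B := by
          have := bracket_pos u
          gcongr
          linarith
      _ = _ := by ring
  have k4 : ∀ y, ∀ v', HasFDerivAt (fun v => gaussPdf (σ⁻¹ • (v - y)) * g y) (gradCLM fun i => G i v' y) v' := fun y v' => by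
    have e3 : HasFDerivAt (fun v : Vel d => σ⁻¹ • (v - y)) (σ⁻¹ • ContinuousLinearMap.id ℝ (Vel d)) v' :=
      HasFDerivAt.const_smul (f := fun v : Vel d => v - y) ((hasFDerivAt_id v').sub_const y) σ⁻¹
    have e4 := ((hasFDerivAt_gaussPdf (σ⁻¹ • (v' - y))).comp v' e3).mul_const (g y)
    refine e4.congr_fderiv ?_
    ext w
    rw [gradCLM_apply]
    simp only [G]
    simp only [smul_apply, ContinuousLinearMap.comp_apply, ContinuousLinearMap.id_apply, innerSL_apply_apply, smul_eq_mul,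
      PiLp.inner_apply, PiLp.smul_apply, RCLike.inner_apply, conj_trivial, mul_sum]
    refine sum_congr rfl fun i _ => ?_
    ring
  exact hasFDerivAt_integral_grad (G := G) (Metric.ball_mem_nhds v hσ) (fun v => ((hco v).mul hg).aestronglyMeasurable) k1 k2 hbi
    (fun i => of_forall (k3 i)) (of_forall fun y v' _ => k4 y v')

/-- Gaussian averages of bounded functions are differentiable. -/
lemma hasFDerivAt_gaussian_average (hg : Measurable g) (hB : ∀ v, |g v| ≤ B) (hσ : 0 < σ) (e : ℝ) (v : Vel d) :
    HasFDerivAt (fun v => ∫ z, g (e • (v - σ • z)) ∂gauss d) (gradCLM fun i => ∫ z, -(σ⁻¹ * z i) * g (e • (v - σ • z)) ∂gauss d) v := by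
  have e1 : (fun v => ∫ z, g (e • (v - σ • z)) ∂gauss d) = fun v => (σ ^ d)⁻¹ * ∫ y, gaussPdf (σ⁻¹ • (v - y)) * g (e • y) := by
    ext v
    rw [integral_gauss, integral_gaussian_average gaussPdf g hσ e v]
  have e2 : (gradCLM fun i => ∫ z, -(σ⁻¹ * z i) * g (e • (v - σ • z)) ∂gauss d) =
      (σ ^ d)⁻¹ • gradCLM fun i => ∫ y, -(σ⁻¹ * (gaussPdf (σ⁻¹ • (v - y)) * (σ⁻¹ • (v - y)) i)) * g (e • y) := by
    rw [smul_gradCLM]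
    congr 1
    ext i
    rw [integral_gauss, ← integral_gaussian_average (fun z => -(σ⁻¹ * (gaussPdf z * z i))) g hσ e v]
    refine integral_ext fun z => ?_
    ring
  rw [e1, e2]
  exact (hasFDerivAt_gauss_convolution (g := fun y => g (e • y)) (hg.comp (by fun_prop)) (fun v => hB _) hσ v).const_mul _

end KernelOperator

/-! ### Regularization by the Duhamel operator -/

section Smoothing

lemma rpow_neg_half {r : ℝ} (hr : 0 ≤ r) : r ^ (-(1 / 2) : ℝ) = (sqrt r)⁻¹ := by rw [Real.rpow_neg hr, Real.sqrt_eq_rpow]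

lemma kernelWeight_one (L : ℝ) : KernelWeight (d := d) L fun _ _ => 1 := by
  refine ⟨measurable_const, sqrt L, Real.sqrt_nonneg L, fun r hr z => ?_⟩
  have h0 := Real.sqrt_pos.2 hr.1
  have h1 := one_le_bracket z
  rw [rpow_neg_half hr.1.le, abs_one, ← mul_assoc, ← div_eq_mul_inv]
  exact one_le_mul_of_one_le_of_one_le ((one_le_div h0).2 (sqrt_le_sqrt hr.2)) h1

/-- The weight left by one differentiation of the Gaussian; `le_ouVar` bounds `1/σ` by a multiple of
`r^{-1/2}`. -/
lemma kernelWeight_grad (hc : 0 < c) (hD : 0 < D) (L : ℝ) (i : Fin d) : KernelWeight (d := d) L fun r z => -((ouSd c D r)⁻¹ * z i) := by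
  have hσ := (continuous_ouSd c D).measurable
  refine ⟨?_, (sqrt (2 * D * exp (-(2 * c * L))))⁻¹, by positivity, fun r hr z => ?_⟩
  · unfold uncurry
    fun_prop
  · rw [rpow_neg_half hr.1.le, abs_neg, abs_mul, ← mul_assoc, ← mul_inv, ← Real.sqrt_mul (by positivity), abs_of_nonneg (inv_nonneg.2 (ouSd_nonneg c D r))]
    have hp : 0 < 2 * D * exp (-(2 * c * L)) * r := mul_pos (by positivity) hr.1
    exact mul_le_mul (inv_anti₀ (Real.sqrt_pos.2 hp) (sqrt_le_sqrt (le_ouVar hc hD hr.1.le hr.2)))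
      ((PiLp.norm_apply_le z i).trans (norm_le_bracket z)) (abs_nonneg _) (by positivity)

lemma kop_eq_integral (hc : 0 < c) (hD : 0 < D) (hρ : KernelWeight (T - a) ρ) (hh : Rapid (Icc a T) h) (ht : t ∈ Icc a T) (v : Vel d) :
    kop c D a ρ h t v = ∫ s, ∫ z, kopIntgd c D a ρ h t v (s, z) ∂gauss d :=
  integral_prod _ (integrable_kopIntgd hc hD hρ hh ht v)

lemma duhamel_eq_kop (hc : 0 < c) (hD : 0 < D) (hh : Rapid (Icc a T) h) (ht : t ∈ Icc a T) (v : Vel d) : duhamel c D 0 a h t v = kop c D a (fun r _ => exp (c * d * r) * 1) h t v := by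
  rw [kop_eq_integral hc hD ((kernelWeight_one _).mul_time (by fun_prop)) hh ht, duhamel, integral_Ioc_eq_integral_Ioo,
    ← integral_indicator measurableSet_Ioo]
  refine integral_ext fun s => ?_
  by_cases hs : a < s ∧ s < t
  · simp only [indicator_of_mem (show s ∈ Ioo a t from hs), kopIntgd, if_pos hs, ou, sub_zero, mul_one, integral_const_mul]
  · simp only [indicator_of_notMem (show s ∉ Ioo a t from hs), kopIntgd, if_neg hs, integral_zero]

/-- At each earlier time the Gaussian average of the bounded source is differentiable; the
integrable singularity `(t-s)^{-1/2}` dominates and permits differentiation under the time integral.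
-/
lemma hasFDerivAt_duhamel (hc : 0 < c) (hD : 0 < D) (hh : Rapid (Icc a T) h) (ht : t ∈ Icc a T) (v : Vel d) : HasFDerivAt (duhamel c D 0 a h t)
      (gradCLM fun i => kop c D a (fun r z => exp (c * d * r) * -((ouSd c D r)⁻¹ * z i)) h t v) v := by
  have hρ : ∀ i : Fin d, KernelWeight (T - a) fun r (z : Vel d) => exp (c * d * r) * -((ouSd c D r)⁻¹ * z i) := fun i =>
    (kernelWeight_grad hc hD _ i).mul_time (by fun_prop)
  have hρ1 : KernelWeight (T - a) fun r (_ : Vel d) => exp (c * d * r) * 1 := (kernelWeight_one _).mul_time (by fun_prop)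
  choose C hC0 hC using fun i => exists_kopIntgd_le hc hD (hρ i) 0
  obtain ⟨A, hA0, hA⟩ := hh.2 0
  have hA' : ∀ s ∈ Icc a T, ∀ v, |h s v| ≤ A := fun s hs v => by simpa using hA s hs v
  have e1 : duhamel c D 0 a h t = fun v => ∫ s, ∫ z, kopIntgd c D a (fun r _ => exp (c * d * r) * 1) h t v (s, z) ∂gauss d :=
    funext fun v => by rw [duhamel_eq_kop hc hD hh ht, kop_eq_integral hc hD hρ1 hh ht]
  rw [e1]
  simp only [fun i => kop_eq_integral hc hD (hρ i) hh ht v]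
  have me : ∀ {ρ : ℝ → Fn d}, Measurable (uncurry ρ) → ∀ v,
      AEStronglyMeasurable (fun s => ∫ z, kopIntgd c D a ρ h t v (s, z) ∂gauss d) volume := fun hm v =>
    ((measurable_kopIntgd_apply c D a hm hh.1 t v).stronglyMeasurable.integral_prod_right').aestronglyMeasurable
  have hb : Integrable fun s => ∑ i, C i * A * (timeSing a t s * ∫ z, bracket z ^ (0 + 1) ∂gauss d) :=
    integrable_finsetSum _ fun i _ => (((integrable_timeSing ht.1).mul_const _).const_mul _)
  refine hasFDerivAt_integral_grad (s := univ) univ_mem (me hρ1.1) (integrable_kopIntgd hc hD hρ1 hh ht v).integral_prod_left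
    (G := fun i v s => ∫ z, kopIntgd c D a (fun r z => exp (c * d * r) * -((ouSd c D r)⁻¹ * z i)) h t v (s, z) ∂gauss d)
    (fun i => me (hρ i).1 v) hb (fun i => of_forall fun s v _ => ?_) (of_forall fun s v _ => ?_)
  · have hΓ : 0 ≤ ∫ z : Vel d, bracket z ^ (0 + 1) ∂gauss d := integral_nonneg fun z => (pow_pos (bracket_pos z) _).le
    refine le_trans ?_ (single_le_sum (f := fun i => C i * A * (timeSing a t s * ∫ z, bracket z ^ (0 + 1) ∂gauss d))
      (fun i _ => mul_nonneg (mul_nonneg (hC0 i) hA0) (mul_nonneg (timeSing_nonneg a t s) hΓ)) (Finset.mem_univ i))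
    rw [← integral_const_mul, ← integral_const_mul, ← norm_eq_abs]
    refine norm_integral_le_of_norm_le (((integrable_gauss_bracket_pow _).const_mul _).const_mul _) (of_forall fun z => ?_)
    simpa using hC i h A hA0 hA t ht v (s, z)
  · by_cases hs : a < s ∧ s < t
    · simp only [kopIntgd, if_pos hs, mul_one, mul_assoc, integral_const_mul]
      rw [← smul_gradCLM]
      have hm : Measurable (h s) := hh.1.comp measurable_prodMk_left
      have := hasFDerivAt_gaussian_average hm (hA' s ⟨hs.1.le, hs.2.le.trans ht.2⟩) (ouSd_pos hc hD (sub_pos.2 hs.2)) (exp (c * (t - s))) v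
      simpa only [mul_assoc, neg_mul] using this.const_mul (exp (c * (d * (t - s))))
    · simp only [kopIntgd, if_neg hs, integral_zero, gradCLM_zero]
      exact hasFDerivAt_const _ _

lemma Reg.congr {G : ℝ → Fn d} (hF : Reg I k F) (hG : Measurable (uncurry G)) (h : ∀ t ∈ I, G t = F t) : Reg I k G := by
  have r : Rapid I F → Rapid I G := fun hF => ⟨hG, fun j => (hF.2 j).imp fun C hC => ⟨hC.1, fun t ht v => by rw [h t ht]; exact hC.2 t ht v⟩⟩
  cases k with
  | zero => exact r hF
  | succ k => exact ⟨r hF.1, hF.2.imp fun G' hG' => ⟨hG'.1, fun t ht => by rw [h t ht]; exact hG'.2 t ht⟩⟩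

/-- One derivative is placed on the Gaussian and the remaining `k` on the source, which gains
exactly one order. -/
lemma Reg.duhamel (hc : 0 < c) (hD : 0 < D) (hh : Reg (Icc a T) k h) : Reg (Icc a T) (k + 1) (duhamel c D 0 a h) := by
  have hr : Rapid (Icc a T) (KineticSmoluchowski.duhamel c D 0 a h) := Reg.congr (k := 0)
    (Rapid.kop hc hD ((kernelWeight_one _).mul_time (by fun_prop)) hh.rapid) (measurable_duhamel c D 0 a hh.rapid.1)
    fun t ht => funext fun v => duhamel_eq_kop hc hD hh.rapid ht v
  exact ⟨hr, _, fun i => Reg.kop hc hD ((kernelWeight_grad hc hD _ i).mul_time (by fun_prop)) hh, fun t ht v => hasFDerivAt_duhamel hc hD hh.rapid ht v⟩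

/-- For positive time the average is against a density, so null sets do not matter and the equality
holds at every velocity. -/
lemma ou_congr_ae (hc : 0 < c) (hD : 0 < D) (lam : ℝ) (hr : 0 < r) {h : Fn d} (hgh : g =ᵐ[volume] h) : ou c D lam r g = ou c D lam r h := by
  ext v
  unfold ou
  congr 1
  refine integral_congr_ae ((withDensity_absolutelyContinuous volume _).ae_le ?_)
  filter_upwards [ae_comp_add_smul hgh (exp (c * r) • v) (neg_ne_zero.2 (mul_pos (exp_pos (c * r)) (ouSd_pos hc hD hr)).ne')] with z hz
  rwa [neg_smul, ← sub_eq_add_neg, mul_smul, ← smul_sub] at hz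

lemma duhamel_congr_ae (hc : 0 < c) (hD : 0 < D) (lam : ℝ) {g : ℝ → Fn d}
    (hgh : ∀ s ∈ Ioo a t, g s =ᵐ[volume] h s) : duhamel c D lam a g t = duhamel c D lam a h t := by
  ext v
  simp only [duhamel, integral_Ioc_eq_integral_Ioo]
  exact setIntegral_congr_fun measurableSet_Ioo fun s hs => by
    simp only [ou_congr_ae hc hD lam (sub_pos.2 hs.2) (hgh s hs)]

lemma collB_congr_ae (hm : m ∈ Lev M) {f g : ℕ → Fn d} (hfg : ∀ n ∈ Lev M, f n =ᵐ[volume] g n) : collB norm M m f =ᵐ[volume] collB norm M m g := by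
  filter_upwards [hfg m hm] with v hv
  have e1 : gainR norm m f v = gainR norm m g v := sum_congr rfl fun n hn => by
    have hn' := mem_Icc_of_Ico hm hn
    congr 1
    refine integral_congr_ae ?_
    filter_upwards [ae_comp_add_smul (hfg _ hn'.1) v (theta_ne hn).1, ae_comp_add_smul (hfg _ hn'.2) v (theta_ne hn).2] with z h1 h2
    rw [neg_smul, ← sub_eq_add_neg] at h2
    simp only [h1, h2]
  have e2 : rateR norm M m f v = rateR norm M m g v := by
    unfold rateR
    refine congrArg (2 * ·) (sum_congr rfl fun n hn => congrArg (crossSection d n m * ·) (integral_congr_ae ?_))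
    filter_upwards [hfg n hn] with w hw
    rw [hw]
  simp only [collB, e1, e2, hv]

end Smoothing

/-! ### Smoothness of solutions -/

section SmoothRep

variable {F : Fam d} {c D : ℕ → ℝ}

/-- The product rule with `s - a`: the unknown initial value is removed at the price of the
additional source `u`. -/
lemma LinWeakAt.mul_time {c D lam a t T : ℝ} {u₀ : Fn d} {u h : ℝ → Fn d} (hu : UL a T 0 u) (hh : UL a T 0 h)
    (ht : t ∈ Icc a T) (hw : ∀ s ∈ Icc a T, LinWeakAt c D lam a u₀ u h s) :
    LinWeakAt c D lam a (fun _ => 0) (fun s v => (s - a) * u s v) (fun s v => (s - a) * h s v + u s v) t := fun φ hφ => by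
  have hk := (hu.intervalIntegrable_pair (hφ.genAdj c D lam) ht.1 (Ioc_sub ht)).add (hh.intervalIntegrable_pair hφ ht.1 (Ioc_sub ht))
  have key := integral_mul_primitive ht.1 (η := fun s => s - a) (η' := fun _ => 1) (fun s => (hasDerivAt_id s).sub_const a) continuous_const
    ((intervalIntegrable_iff_integrableOn_Ioc_of_le ht.1).1 hk) (g := fun s => pair (u s) φ)
    (ae_mem_Ioc.mono fun s hs => hw s (Ioc_sub ht hs) φ hφ) (hw t ht φ hφ)
  have pm : ∀ (k : ℝ) (g ψ : Fn d), pair (fun v => k * g v) ψ = k * pair g ψ := fun k g ψ => by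
    simp only [pair, mul_assoc, integral_const_mul]
  have p0 : pair (fun _ : Vel d => 0) φ = 0 := by simp [pair]
  rw [pm, key, p0, sub_self, zero_mul]
  congr 1
  refine integral_congr fun s hs => ?_
  rw [uIcc_of_le ht.1] at hs
  have hs' : s ∈ Icc a T := ⟨hs.1, hs.2.trans ht.2⟩
  have e : pair (fun v => (s - a) * h s v + u s v) φ = (s - a) * pair (h s) φ + pair (u s) φ := by
    rw [← pm, pair, pair, pair, ← integral_add ((hh.time_mul (η := fun s => s - a) (by fun_prop) (K := T - a) fun s hs => by
      rw [abs_of_nonneg (by linarith [hs.1])]; linarith [hs.2]).integrable_mul_test hs' hφ) (hu.integrable_mul_test hs' hφ)]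
    exact integral_ext fun v => add_mul _ _ _
  simp only [pm, e]
  ring

/-- The source of the equation for `(s - a) f_m(s)`. -/
def timeSource (M m : ℕ) (f : Fam d) (a s : ℝ) (v : Vel d) : ℝ := (s - a) * collB norm M m (fun n => f n s) v + f m s v

/-- With zero initial value the mild formula is a pure Duhamel term, and regularity can be read off
from the source alone. -/
lemma IsSolution.ae_eq_duhamel (hc : PosOn M c) (hD : PosOn M D) (h : IsSolution M c D T f₀ f)
    (hm : m ∈ Lev M) (ha : 0 ≤ a) (hat : a < t) (htT : t ≤ T) :
    f m t =ᵐ[volume] fun v => (t - a)⁻¹ * duhamel (c m) (D m) 0 a (timeSource M m f a) t v := by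
  have sub : Icc a T ⊆ Icc 0 T := Icc_subset_Icc_left ha
  have hf := (h.unif m).mono_set sub
  have hQ : UL 0 T 0 cB norm M m f := unifL1_collB isKernel_norm (fun n => (h.unif n).mono_weight) hm
  have bd : ∀ s ∈ Icc a T, |s - a| ≤ T - a := fun s hs => by rw [abs_of_nonneg (by linarith [hs.1])]; linarith [hs.2]
  have hw : ∀ s ∈ Icc a T, LinWeakAt (c m) (D m) 0 a (f m a) (f m) cB norm M m f s := fun s hs =>
    (h.weak a (sub ⟨le_rfl, hat.le.trans htT⟩) m hm).restart (h.weak s (sub hs) m hm) ((h.unif m).mono_weight) hQ ha hs.1 hs.2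
  have hw' : ∀ s ∈ Icc a T, _ := fun s hs => LinWeakAt.mul_time (hf.mono_weight) (hQ.mono_set sub) hs hw
  have key := mild_of_weak (hc m hm) (hD m hm) (u₀ := fun _ => 0) measurable_const (integrable_zero _ _ _)
    ((hf.mono_weight).time_mul (η := fun s => s - a) (by fun_prop) bd)
    (((hQ.mono_set sub).time_mul (η := fun s => s - a) (by fun_prop) bd).add (hf.mono_weight)) ⟨hat.le, htT⟩
    (ae_mem_Ioc.mono fun s hs => hw' s ⟨hs.1.le, hs.2⟩) (hw' t ⟨hat.le, htT⟩)
  filter_upwards [key] with v hv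
  rw [ou_zero, zero_add] at hv
  rw [eq_inv_mul_iff_mul_eq₀ (sub_pos.2 hat).ne', hv]
  rfl

lemma reg_timeSource {b : ℝ} (hm : m ∈ Lev M) (hF : ∀ n ∈ Lev M, Reg (Icc a b) k (F n)) : Reg (Icc a b) k (timeSource M m F a) :=
  ((Reg.collB hm hF).time_mul (η := fun s => s - a) (by fun_prop) (K := b - a) fun s hs => by
    rw [abs_of_nonneg (by linarith [hs.1])]; linarith [hs.2]).add (hF m hm)

lemma duhamel_timeSource_congr (hc : PosOn M c) (hD : PosOn M D) (hm : m ∈ Lev M) (hF : ∀ n ∈ Lev M, ∀ s ∈ Ioo a t, F n s =ᵐ[volume] f n s) :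
    duhamel (c m) (D m) 0 a (timeSource M m f a) t = duhamel (c m) (D m) 0 a (timeSource M m F a) t :=
  duhamel_congr_ae (hc m hm) (hD m hm) 0 fun s hs => by
    filter_upwards [hF m hm s hs, collB_congr_ae hm fun n hn => hF n hn s hs] with v h1 h2
    simp only [timeSource, h1, h2]

/-- Bootstrap: the collision source keeps the order `k`, the Duhamel operator adds one. Each step
moves the starting time from `a/2` to `a`, which keeps `(t - a/2)⁻¹` bounded. -/
lemma IsSolution.exists_reg (hc : PosOn M c) (hD : PosOn M D) (h : IsSolution M c D T f₀ f)
    (hmom : ∀ m ∈ Lev M, ∀ j : ℕ, ∀ a : ℝ, 0 < a → UL a T j (f m)) (k : ℕ) (ha : 0 < a) :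
    ∃ F : Fam d, (∀ n ∈ Lev M, Reg (Icc a T) k (F n)) ∧ ∀ n ∈ Lev M, ∀ t ∈ Icc a T, F n t =ᵐ[volume] f n t := by
  induction k generalizing a with
  | zero =>
    have key : ∀ n ∈ Lev M, ∀ j : ℕ, _ := fun n hn j => h.ae_le hc hD hmom hn j ha
    choose! C hC0 hC using key
    classical
    -- Zero is substituted where one of the countably many decay bounds fails; at each time this
    -- changes a null set only.
    refine ⟨fun n t v => if ∀ j, |f n t v| * bracket v ^ j ≤ C n j then f n t v else 0, fun n hn => ⟨?_, fun j => ⟨C n j, hC0 n hn j, fun t _ v => ?_⟩⟩,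
      fun n hn t ht => ?_⟩
    · have hm := (h.unif n).1
      refine Measurable.ite ?_ hm measurable_const
      simp only [Set.ofPred_forall]
      exact MeasurableSet.iInter fun j => measurableSet_le (hm.norm.mul ((measurable_bracket.comp measurable_snd).pow_const j)) measurable_const
    · dsimp only
      split_ifs with hj
      · exact hj j
      · simpa using hC0 n hn j
    · filter_upwards [ae_all_iff.2 fun j => hC n hn j t ht] with v hv
      exact if_pos hv
  | succ k ih =>
    obtain ⟨F, hF, hFf⟩ := ih (half_pos ha)
    have hle : Icc a T ⊆ Icc (a / 2) T := Icc_subset_Icc_left (by linarith)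
    refine ⟨fun n t v => (t - a / 2)⁻¹ * duhamel (c n) (D n) 0 (a / 2) (timeSource M n F (a / 2)) t v, fun n hn => ?_, fun n hn t ht => ?_⟩
    · refine ((reg_timeSource hn hF).duhamel (hc n hn) (hD n hn)).mono_set hle |>.time_mul (η := fun t => (t - a / 2)⁻¹) (by fun_prop)
        (K := (a / 2)⁻¹) fun t ht => ?_
      have : a / 2 ≤ t - a / 2 := by linarith [ht.1]
      rw [abs_of_nonneg (inv_nonneg.2 (by linarith))]
      exact inv_anti₀ (half_pos ha) this
    · have key := h.ae_eq_duhamel hc hD hn (half_pos ha).le (by linarith [ht.1] : a / 2 < t) ht.2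
      rw [duhamel_timeSource_congr hc hD hn fun n hn s hs => hFf n hn s ⟨hs.1.le, hs.2.le.trans ht.2⟩] at key
      exact key.symm

/-- A representative that is smooth in velocity at positive times. -/
def smoothRep (M : ℕ) (c D : ℕ → ℝ) (f : Fam d) (m : ℕ) (t : ℝ) (v : Vel d) : ℝ :=
  if 0 < t then (t - t / 2)⁻¹ * duhamel (c m) (D m) 0 (t / 2) (timeSource M m f (t / 2)) t v else f m t v

/-- Starting time and source both depend on `t`, so the time integral is written as an indicator
integral with `t` as a parameter. -/
lemma measurable_smoothRep (hf : UMeas f) (m : ℕ) : Measurable (uncurry (smoothRep M c D f m)) := by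
  have hH : Measurable (uncurry fun x : (ℝ × Vel d) × ℝ => timeSource M m f (x.1.1 / 2) x.2) := by
    have h1 := measurable_collB_comp (X := ((ℝ × Vel d) × ℝ) × Vel d) (b := norm) measurable_norm M m (f := fun n x => f n x.1.2)
      (fun n => (hf n).comp (by fun_prop : Measurable fun q : (((ℝ × Vel d) × ℝ) × Vel d) × Vel d => (q.1.1.2, q.2))) measurable_snd
    have h2 := (hf m).comp (by fun_prop : Measurable fun q : ((ℝ × Vel d) × ℝ) × Vel d => (q.1.2, q.2))
    exact (Measurable.mul (by fun_prop : Measurable fun q : ((ℝ × Vel d) × ℝ) × Vel d => q.1.2 - q.1.1.1 / 2) h1).add h2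
  have h3 := measurable_ou_comp (c m) (D m) 0 hH (r := fun x => x.1.1 - x.2) (by fun_prop) (v := fun x => x.1.2) (by fun_prop)
  have hS : MeasurableSet {x : (ℝ × Vel d) × ℝ | x.1.1 / 2 < x.2 ∧ x.2 ≤ x.1.1} :=
    MeasurableSet.inter (measurableSet_lt (f := fun x : (ℝ × Vel d) × ℝ => x.1.1 / 2) (g := fun x => x.2) (by fun_prop) (by fun_prop))
      (measurableSet_le (f := fun x : (ℝ × Vel d) × ℝ => x.2) (g := fun x => x.1.1) (by fun_prop) (by fun_prop))
  have h4 := ((h3.indicator hS).stronglyMeasurable.integral_prod_right' (ν := volume)).measurable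
  have e : ∀ x : ℝ × Vel d, duhamel (c m) (D m) 0 (x.1 / 2) (timeSource M m f (x.1 / 2)) x.1 x.2 =
      ∫ s, {x : (ℝ × Vel d) × ℝ | x.1.1 / 2 < x.2 ∧ x.2 ≤ x.1.1}.indicator
        (fun x => ou (c m) (D m) 0 (x.1.1 - x.2) (timeSource M m f (x.1.1 / 2) x.2) x.1.2) (x, s) := fun x => by
    rw [duhamel, ← integral_indicator measurableSet_Ioc]
    rfl
  refine Measurable.ite (measurableSet_lt measurable_const measurable_fst) ?_ (hf m)
  simp only [e]
  exact Measurable.mul (by fun_prop) h4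

lemma IsSolution.smoothRep_ae_eq (hc : PosOn M c) (hD : PosOn M D) (h : IsSolution M c D T f₀ f)
    (hm : m ∈ Lev M) (htT : t ≤ T) : smoothRep M c D f m t =ᵐ[volume] f m t := by
  by_cases ht : 0 < t
  · filter_upwards [h.ae_eq_duhamel hc hD hm (half_pos ht).le (half_lt_self ht) htT] with v hv
    rw [smoothRep, if_pos ht, hv]
  · exact of_forall fun v => if_neg ht

/-- The representative does not involve `k`. For each `k` its source may be replaced by a regular
version, equal almost everywhere, without changing the Duhamel integral at any velocity. -/
lemma IsSolution.isCbInfty_smoothRep (hc : PosOn M c) (hD : PosOn M D) (h : IsSolution M c D T f₀ f)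
    (hmom : ∀ m ∈ Lev M, ∀ j : ℕ, ∀ a : ℝ, 0 < a → UL a T j (f m)) (hm : m ∈ Lev M) (ht : t ∈ Ioc 0 T) :
    IsCbInfty (smoothRep M c D f m t) := by
  have key : ∀ k : ℕ, ContDiff ℝ k (smoothRep M c D f m t) ∧ ∀ n ≤ k, ∃ C : ℝ, ∀ v, ‖iteratedFDeriv ℝ n (smoothRep M c D f m t) v‖ ≤ C := fun k => by
    obtain ⟨F, hF, hFf⟩ := h.exists_reg hc hD hmom k (half_pos ht.1)
    have h1 := (((reg_timeSource hm hF).duhamel (hc m hm) (hD m hm)).const_mul (t - t / 2)⁻¹).contDiff (t := t) ⟨by linarith [ht.1], ht.2⟩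
    have e : smoothRep M c D f m t = fun v => (t - t / 2)⁻¹ * duhamel (c m) (D m) 0 (t / 2) (timeSource M m F (t / 2)) t v := by
      ext v
      rw [smoothRep, if_pos ht.1, duhamel_timeSource_congr hc hD hm fun n hn s hs => hFf n hn s ⟨hs.1.le, hs.2.le.trans ht.2⟩]
    rwa [e]
  exact ⟨contDiff_infty.2 fun k => (key k).1, fun n => (key n).2 n le_rfl⟩

end SmoothRep

/-! ### Weak solutions in the sense of the statement -/

section Main

lemma enorm_mul_bracket_pow (x : ℝ) (j : ℕ) (v : Vel d) : ‖x * bracket v ^ j‖ₑ = ‖x‖ₑ * wt d j v := by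
  rw [enorm_mul, enorm_of_nonneg (pow_pos (bracket_pos v) j).le, wt]

lemma massCoeff_pos (hα : 0 < α) (hm : m ∈ Lev M) : 0 < massCoeff d α m :=
  mul_pos hα (Real.rpow_pos_of_pos (by exact_mod_cast (Finset.mem_Icc.1 hm).1) _)

lemma exists_uniform_ouGrowth {c D : ℕ → ℝ} (hc : PosOn M c) (hD : PosOn M D) (T : ℝ) :
    ∃ C, 0 ≤ C ∧ ∀ j ∈ ({0, 1, 2, 4} : Set ℕ), ∀ m ∈ Lev M, OUGrowth (c m) (D m) T C (wt d j) := by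
  have key : ∀ j ∈ ({0, 1, 2, 4} : Finset ℕ), ∃ C, 0 ≤ C ∧ ∀ m ∈ Lev M, OUGrowth (c m) (D m) T C (wt d j) := fun j hj => by
    have h : ∀ m ∈ Lev M, _ := fun m hm => exists_ouGrowth (d := d) (hc m hm) (hD m hm) T (j := j) (by simpa using hj)
    choose! C hC0 hC using h
    exact ⟨∑ m ∈ Lev M, C m, sum_nonneg hC0, fun m hm => (hC m hm).mono (single_le_sum hC0 hm)⟩
  choose! C hC0 hC using key
  refine ⟨∑ j ∈ {0, 1, 2, 4}, C j, sum_nonneg hC0, fun j hj m hm => ?_⟩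
  have hj' : j ∈ ({0, 1, 2, 4} : Finset ℕ) := by simpa using hj
  exact (hC j hj' m hm).mono (single_le_sum hC0 hj')

lemma MemWeightedLp.exists_measurable (hg : MemWeightedLp 1 2 g) (h0 : ∀ᵐ v, 0 ≤ g v) :
    ∃ G : Fn d, Measurable G ∧ (∀ v, 0 ≤ G v) ∧ nrm 2 G ≠ ⊤ ∧ G =ᵐ[volume] g := by
  have hm : AEMeasurable g volume := by
    refine (hg.1.aemeasurable.mul ((measurable_bracket.pow_const 2).inv.aemeasurable)).congr (of_forall fun v => ?_)
    exact mul_inv_cancel_right₀ (pow_pos (bracket_pos v) 2).ne' _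
  have e : (fun v => max 0 (hm.mk g v)) =ᵐ[volume] g := by
    filter_upwards [hm.ae_eq_mk, h0] with v hv h0
    rw [← hv, max_eq_right h0]
  refine ⟨_, measurable_const.max hm.measurable_mk, fun v => le_max_left _ _, ?_, e⟩
  have := hg.2
  rw [eLpNorm_one_eq_lintegral_enorm] at this
  simp only [enorm_mul_bracket_pow] at this
  rw [lintegral_congr_ae (g := fun v => ‖g v‖ₑ * wt d 2 v) (by filter_upwards [e] with v hv; rw [hv])]
  exact this.ne

/-- The essential bound in time becomes a bound at every time by setting the function to zero at the
exceptional times; the positive part secures the sign everywhere. -/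
lemma MemLinftyL1.exists_unifL1 {g : ℝ → Fn d} (hg : MemLinftyL1 T 2 g) (h0 : ∀ᵐ t ∂volR (Icc 0 T), ∀ᵐ v, 0 ≤ g t v) :
    ∃ G : ℝ → Fn d, UL 0 T 2 G ∧ Pos2 G ∧ ∀ᵐ t ∂volR (Icc 0 T), G t =ᵐ[volume] g t := by
  obtain ⟨hm, C, hC⟩ := hg
  set g' := hm.mk _
  have hg' : Measurable g' := hm.stronglyMeasurable_mk.measurable
  have hN : Measurable fun t => ∫⁻ v, ‖g' (t, v)‖ₑ * wt d 2 v := (hg'.enorm.mul ((measurable_wt 2).comp measurable_snd)).lintegral_prod_right'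
  classical
  refine ⟨fun t v => if ∫⁻ v, ‖g' (t, v)‖ₑ * wt d 2 v ≤ C then max 0 (g' (t, v)) else 0, ⟨?_, C, fun t _ => ?_⟩, fun t v => ?_, ?_⟩
  · exact Measurable.ite ((measurableSet_le hN measurable_const).preimage measurable_fst) (measurable_const.max hg') measurable_const
  · by_cases h : ∫⁻ v, ‖g' (t, v)‖ₑ * wt d 2 v ≤ C
    · simp only [if_pos h]
      refine (lintegral_mono fun v => mul_le_mul' ?_ le_rfl).trans h
      rw [enorm_eq_ofReal_abs, enorm_eq_ofReal_abs]
      refine ofReal_le_ofReal ?_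
      rw [abs_of_nonneg (le_max_left _ _)]
      exact max_le (abs_nonneg _) (le_abs_self _)
    · simp [if_neg h]
  · dsimp only
    split_ifs
    exacts [le_max_left _ _, le_rfl]
  · filter_upwards [Measure.ae_ae_of_ae_prod hm.ae_eq_mk, hC, h0] with t h1 h2 h3
    replace h1 : ∀ᵐ v, g t v = g' (t, v) := h1
    have hb : ∫⁻ v, ‖g' (t, v)‖ₑ * wt d 2 v ≤ C := by
      rw [eLpNorm_one_eq_lintegral_enorm] at h2
      simp only [enorm_mul_bracket_pow] at h2
      refine (lintegral_congr_ae ?_).trans_le h2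
      filter_upwards [h1] with v hv
      rw [hv]
    filter_upwards [h1, h3] with v h1 h3
    rw [if_pos hb, ← h1, max_eq_right h3]

lemma UnifL1.memLinftyL1 (hu : UL 0 T j u) (hw : Measurable (uncurry w)) (h : ∀ t ∈ Icc 0 T, w t =ᵐ[volume] u t) : MemLinftyL1 T j w := by
  obtain ⟨-, C, hC⟩ := hu
  refine ⟨hw.aestronglyMeasurable, C, (ae_restrict_mem measurableSet_Icc).mono fun t ht => ?_⟩
  rw [eLpNorm_one_eq_lintegral_enorm]
  simp only [enorm_mul_bracket_pow]
  refine (lintegral_congr_ae ?_).trans_le (hC t ht)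
  filter_upwards [h t ht] with v hv
  rw [hv]

/-- The weak form sees the family only through integrals, so versions may be exchanged; the equality
at the time `t` itself is needed separately. -/
lemma weakFormAt_iff {F₀ : ℕ → Fn d} {F : Fam d} (hF : Unif T 2 F)
    (ht : t ∈ Icc 0 T) (h₀ : ∀ m ∈ Lev M, F₀ m =ᵐ[volume] f₀ m) (hFt : ∀ m ∈ Lev M, F m t =ᵐ[volume] f m t)
    (hFs : ∀ᵐ s ∂volR (Icc 0 T), ∀ m ∈ Lev M, F m s =ᵐ[volume] f m s) :
    WeakFormAt M α κ f₀ f t ↔ ∀ m ∈ Lev M, LinWeakAt (massCoeff d α m) (κ * massCoeff d α m ^ 2) 0 0 (F₀ m) (F m) cB norm M m F t := by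
  refine forall₂_congr fun m hm => forall₂_congr fun φ hφ => ?_
  have hu := (hF m).mono_weight (i := 0) (by norm_num)
  have hQ : UL 0 T 0 cB norm M m F := unifL1_collB isKernel_norm (fun n => (hF n).mono_weight) hm
  have hsub : Ioc 0 t ⊆ Icc 0 T := Ioc_sub ht
  have pc : ∀ {g g' ψ : Fn d}, g =ᵐ[volume] g' → pair g ψ = ∫ v, g' v * ψ v := fun h =>
    integral_congr_ae (h.mono fun v hv => by simp only [hv])
  have ic : ∀ {A B : ℝ → ℝ}, (∀ s, (∀ m ∈ Lev M, F m s =ᵐ[volume] f m s) → A s = B s) → ∫ s in (0)..t, A s = ∫ s in (0)..t, B s := fun h => by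
    rw [integral_of_le ht.1, integral_of_le ht.1]
    exact integral_congr_ae ((ae_restrict_of_ae_restrict_of_subset hsub hFs).mono h)
  have i1 := hu.intervalIntegrable_pair hφ.laplacian ht.1 hsub
  have i2 := hu.intervalIntegrable_pair hφ.fderiv_apply_self ht.1 hsub
  have i3 := hQ.intervalIntegrable_pair hφ ht.1 hsub
  have e1 : ∫ s in (0)..t, (pair (F m s) (genAdj (massCoeff d α m) (κ * massCoeff d α m ^ 2) 0 φ) + pair (collB norm M m fun n => F n s) φ) =
      κ * massCoeff d α m ^ 2 * (∫ s in (0)..t, pair (F m s) (laplacian φ)) -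
        massCoeff d α m * (∫ s in (0)..t, pair (F m s) fun v => fderiv ℝ φ v v) + ∫ s in (0)..t, pair (collB norm M m fun n => F n s) φ := by
    rw [← intervalIntegral.integral_const_mul, ← intervalIntegral.integral_const_mul, ← intervalIntegral.integral_sub (i1.const_mul _) (i2.const_mul _),
      ← intervalIntegral.integral_add ((i1.const_mul _).sub (i2.const_mul _)) i3]
    refine integral_congr fun s hs => ?_
    rw [uIcc_of_le ht.1] at hs
    have hs' : s ∈ Icc 0 T := ⟨hs.1, hs.2.trans ht.2⟩
    have j1 := (hu.integrable_mul_test hs' hφ.laplacian).const_mul (κ * massCoeff d α m ^ 2)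
    have j2 := (hu.integrable_mul_test hs' hφ.fderiv_apply_self).const_mul (massCoeff d α m)
    refine congrArg (· + _) ?_
    simp only [pair]
    rw [← integral_const_mul, ← integral_const_mul, ← integral_sub j1 j2]
    refine integral_ext fun v => ?_
    simp only [genAdj]
    ring
  rw [e1, pc (h₀ m hm), pc (hFt m hm), sub_eq_iff_eq_add', ic (B := fun s => ∫ v, f m s v * laplacian φ v) fun s hs => pc (hs m hm),
    ic (A := fun s => pair (F m s) fun v => fderiv ℝ φ v v) (B := fun s => ∫ v, f m s v * fderiv ℝ φ v v) fun s hs => pc (hs m hm),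
    ic (A := fun s => pair (collB norm M m fun n => F n s) φ) (B := fun s => ∫ v, collision M m (fun n => f n s) v * φ v) fun s hs => by
      simp only [collision_eq]
      exact pc (collB_congr_ae hm hs)]

/-- Everywhere-measurable, everywhere-nonnegative versions of the data feed the construction; the
smooth representative agrees with the solution at every time up to a null set and thus inherits its
properties. -/
theorem exists_smooth_weak_solution (hα : 0 < α) (hκ : 0 < κ) (hf₀ : ∀ m ∈ Lev M, ∀ᵐ v, 0 ≤ f₀ m v) (hf₀2 : ∀ m ∈ Lev M, MemWeightedLp 1 2 (f₀ m)) :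
    ∃ f : Fam d, IsWeakSolution M α κ T f₀ f ∧ IsNonneg M T f ∧ (∀ g : Fam d, IsWeakSolution M α κ T f₀ g → IsNonneg M T g →
        ∀ m ∈ Lev M, ∀ᵐ t ∂volR (Icc 0 T), ∀ᵐ v, g m t v = f m t v) ∧
      (∀ t ∈ Icc 0 T, WeakFormAt M α κ f₀ f t) ∧ ∀ m ∈ Lev M, ∀ t ∈ Ioc 0 T, IsCbInfty (f m t) := by
  set c : ℕ → ℝ := massCoeff d α
  set D : ℕ → ℝ := fun m => κ * massCoeff d α m ^ 2
  have hc : ∀ m ∈ Lev M, 0 < c m := fun m hm => massCoeff_pos hα hm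
  have hD : ∀ m ∈ Lev M, 0 < D m := fun m hm => mul_pos hκ (pow_pos (hc m hm) 2)
  obtain ⟨C, hC, hgr⟩ := exists_uniform_ouGrowth (d := d) hc hD T
  have hdata : ∀ m, ∃ G : Fn d, Measurable G ∧ (∀ v, 0 ≤ G v) ∧ nrm 2 G ≠ ⊤ ∧ (m ∈ Lev M → G =ᵐ[volume] f₀ m) := fun m => by
    by_cases hm : m ∈ Lev M
    · obtain ⟨G, h1, h2, h3, h4⟩ := (hf₀2 m hm).exists_measurable (hf₀ m hm)
      exact ⟨G, h1, h2, h3, fun _ => h4⟩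
    · exact ⟨fun _ => 0, measurable_const, fun _ => le_rfl, by simp, fun h => absurd h hm⟩
  choose F₀ hF₀m hF₀0 hF₀2 hF₀ using hdata
  have hF₀1 : HMom 1 F₀ := fun m =>
    ne_top_of_le_ne_top (hF₀2 m) (lintegral_mono fun v => mul_le_mul' le_rfl (wt_mono (by norm_num) v))
  obtain ⟨F, hF, hF0, hFw⟩ := exists_solution hc hD hC hgr hF₀m hF₀0 hF₀2
  have hs : IsSolution M c D T F₀ F := ⟨hF, hF0, hFw⟩
  have hmom : ∀ m ∈ Lev M, ∀ j : ℕ, ∀ a : ℝ, 0 < a → UL a T j (F m) := fun m hm j a ha =>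
    hs.unifL1 hc hD hC (hgr 1 (by simp)) hF₀m hF₀0 hF₀1 hm j ha
  have hrep : ∀ t ∈ Icc 0 T, ∀ m ∈ Lev M, smoothRep M c D F m t =ᵐ[volume] F m t := fun t ht m hm => hs.smoothRep_ae_eq hc hD hm ht.2
  have hmeas : ∀ m, Measurable (uncurry (smoothRep M c D F m)) := measurable_smoothRep fun m => (hF m).1
  have hweak : ∀ t ∈ Icc 0 T, WeakFormAt M α κ f₀ (smoothRep M c D F) t := fun t ht =>
    (weakFormAt_iff hF ht hF₀ (fun m hm => (hrep t ht m hm).symm)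
      ((ae_restrict_mem measurableSet_Icc).mono fun s hs m hm => (hrep s hs m hm).symm)).2 (hFw t ht)
  refine ⟨smoothRep M c D F, ⟨fun m hm => (hF m).memLinftyL1 (hmeas m) fun t ht => hrep t ht m hm, fun m hm => ?_,
    (ae_restrict_mem measurableSet_Icc).mono hweak⟩, fun m hm => (ae_restrict_mem measurableSet_Icc).mono fun t ht => ?_, fun g hg hg0 => ?_, hweak,
    fun m hm t ht => hs.isCbInfty_smoothRep hc hD hmom hm ht⟩
  · have hQ : UL 0 T 0 cB norm M m F := unifL1_collB isKernel_norm (fun n => (hF n).mono_weight) hm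
    have e : (fun t => collision M m fun n => smoothRep M c D F n t) = fun t => collB norm M m fun n => smoothRep M c D F n t :=
      funext fun t => funext fun v => collision_eq M m _ v
    rw [e]
    refine hQ.memLinftyL1 ?_ fun t ht => collB_congr_ae hm (hrep t ht)
    exact measurable_collB_comp (X := ℝ × Vel d) (b := norm) measurable_norm M m (f := fun n x => smoothRep M c D F n x.1)
      (fun n => (hmeas n).comp measurable_time_vel) measurable_snd
  · filter_upwards [hrep t ht m hm] with v hv
    rw [hv]
    exact hF0 m t v
  · have hex : ∀ m, ∃ G : ℝ → Fn d, UL 0 T 2 G ∧ Pos2 G ∧ (m ∈ Lev M → ∀ᵐ t ∂volR (Icc 0 T), G t =ᵐ[volume] g m t) := fun m => by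
      by_cases hm : m ∈ Lev M
      · obtain ⟨G, h1, h2, h3⟩ := (hg.mem_class m hm).exists_unifL1 (hg0 m hm)
        exact ⟨G, h1, h2, fun _ => h3⟩
      · exact ⟨fun _ _ => 0, unifL1_zero _ _, fun _ _ => le_rfl, fun h => absurd h hm⟩
    choose G hG hG0 hGg using hex
    have hGall : ∀ᵐ t ∂volR (Icc 0 T), ∀ m ∈ Lev M, G m t =ᵐ[volume] g m t := (Filter.eventually_all_finset _).2 hGg
    -- A competitor satisfies the weak form at almost every time only, which is all the stability
    -- estimate requires.
    have hGw : ∀ᵐ t ∂volR (Icc 0 T), ∀ m ∈ Lev M, SolAt norm M c D F₀ F m t ∧ SolAt norm M c D F₀ G m t := by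
      filter_upwards [hg.weak_form, hGall, ae_restrict_mem measurableSet_Icc] with t h1 h2 ht m hm
      exact ⟨hFw t ht m hm, (weakFormAt_iff hG ht hF₀ h2 hGall).1 h1 m hm⟩
    intro m hm
    filter_upwards [hGw, hGall, ae_restrict_mem measurableSet_Icc] with t h1 h2 ht
    have key := ae_eq_of_weak hc hD hC (hgr 1 (by simp)) hF hG hF0 hG0 hF₀m hF₀m hF₀1 hF₀1 (fun _ _ => ae_eq_refl _)
      (ae_restrict_of_ae_restrict_of_subset Ioc_subset_Icc_self hGw) ht h1 hm
    filter_upwards [key, h2 m hm, hrep t ht m hm] with v e1 e2 e3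
    rw [← e2, ← e1, e3]

end Main


end KineticSmoluchowski

end

/-! ### The two assertions of the theorem -/

theorem mainTheorem1 (d M : ℕ) (hd : 1 ≤ d) (α κ T : ℝ) (hα : 0 < α) (hκ : 0 < κ) (hT : 0 < T)
    (f₀ : ℕ → KineticSmoluchowski.Vel d → ℝ)
    (hf₀ : ∀ m ∈ Finset.Icc 1 M, ∀ᵐ v, 0 ≤ f₀ m v) :
    ((∀ m ∈ Finset.Icc 1 M, MeasureTheory.MemLp (f₀ m) 2 MeasureTheory.volume ∧
        KineticSmoluchowski.MemWeightedLp 1 2 (f₀ m)) →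
      ∃ f : ℕ → ℝ → KineticSmoluchowski.Vel d → ℝ,
        KineticSmoluchowski.IsWeakSolution M α κ T f₀ f ∧ KineticSmoluchowski.IsNonneg M T f) ∧
    ((∀ m ∈ Finset.Icc 1 M, KineticSmoluchowski.MemWeightedSobolev 1 1 (f₀ m) ∧
        KineticSmoluchowski.MemWeightedLp 1 2 (f₀ m)) →
      ∃ f : ℕ → ℝ → KineticSmoluchowski.Vel d → ℝ,
        KineticSmoluchowski.IsWeakSolution M α κ T f₀ f ∧ KineticSmoluchowski.IsNonneg M T f ∧
        (∀ g : ℕ → ℝ → KineticSmoluchowski.Vel d → ℝ,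
          KineticSmoluchowski.IsWeakSolution M α κ T f₀ g → KineticSmoluchowski.IsNonneg M T g →
          ∀ m ∈ Finset.Icc 1 M, ∀ᵐ t ∂(MeasureTheory.volume.restrict (Set.Icc 0 T)),
            ∀ᵐ v, g m t v = f m t v) ∧
        (∀ t ∈ Set.Icc 0 T, KineticSmoluchowski.WeakFormAt M α κ f₀ f t) ∧
        (∀ m ∈ Finset.Icc 1 M, ∀ t ∈ Set.Ioc 0 T, KineticSmoluchowski.IsCbInfty (f m t))) := by
  refine ⟨fun h => ?_, fun h => KineticSmoluchowski.exists_smooth_weak_solution hα hκ hf₀ fun m hm => (h m hm).2⟩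
  obtain ⟨f, h1, h2, -⟩ := KineticSmoluchowski.exists_smooth_weak_solution (T := T) hα hκ hf₀ fun m hm => (h m hm).2
  exact ⟨f, h1, h2⟩
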